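/- Let $M$ be a connected smooth manifold (Hausdorff, second countable, finite dimensional) and let $\eta:A\to M$ be a special affine bundle, i.e. a smooth affine bundle of finite rank together with a nowhere vanishing smooth section $v_A$ of its model vector bundle $\mathcal V(A)$. Let $E=\widehat A\to M$ be the vector hull of $A$; its fibre $E_m$ is the vector space generated by symbols $x_a$, $a\in A_m$, subject to the relations $x_{ta+(1-t)b}=t\,x_a+(1-t)\,x_b$. Regard $A$ and $\mathcal V(A)$ as subsets of $E$, and let $\alpha_A$ be the section of $E^*$ with $\alpha_A=1$ on $A$ (so $\alpha_A(v_A)=0$). Put $\underline E=E/\langle v_A\rangle$ and $\underline{E^*}=E^*/\langle\alpha_A\rangle$. Let $\mathbb R\times\mathbb R$ act on $T^*E$ by letting $(s,t)$ map a covector $\omega$ at $w\in E_m$ to the covector $(\varphi_{-s})^*\omega+t\,d\alpha_A$ at $\varphi_s(w)$, where $\varphi_s(w)=w+s\,v_A(m)$. Let $A^\#$ be the special affine dual of $A$ (its fibre over $m$ consists of the affine functions on $A_m$ whose linear part takes the value $1$ at $v_A(m)$), let $\underline A=A/\langle v_A\rangle$ with projection $\zeta:A\to\underline A$, and let $\underline{A^\#}$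 be the quotient of $A^\#$ by the constant functions. For smooth sections $\sigma,\sigma'$ of $\zeta$ write $\sigma-\sigma'$ for the function $h$ with $\sigma=\sigma'-h\,v_A$. The affine phase bundle $PA$ is the set of affine differentials $d_y\sigma$, i.e. of classes of pairs $(y,\sigma)$ with $y\in\underline A$ and $\sigma$ a smooth section of $\zeta$, where $(y,\sigma)\sim(y,\sigma')$ iff $d_y(\sigma-\sigma')=0$. Let $f_\sigma:A\to\mathbb R$ be defined by $f_\sigma(a)\,v_A=a-\sigma(\zeta(a))$; for a function $g$ on $M$ let $\sigma+g$ denote the section $\sigma-g\,v_A$. Then: 1. The orbit space $T^*E/\mathbb R\times\mathbb R$ carries a smooth double vector bundle structure over $\underline E$ and $\underline{E^*}$ inherited from $(T^*E;E,E^*;M)$: the orbit projection is a smooth submersion and a morphism of double vector bundles over the quotient maps $E\to\underline E$ and $E^*\to\underline{E^*}$. 2. $PA$ is a smooth double affine bundle $(PA;\underline A,\underline{A^\#};M)$. The projections are $d_y\sigma\mapsto y$ and, for $\sigma$ fibrewise affine and $y$ over $m$, $d_y\sigma\mapsto[f_\sigma|_{A_m}]$. The affine combinations over $\underline A$ are those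 of sections. The affine combinations over $\underline{A^\#}$ are given by $t\,d_{y}(\sigma+g)+(1-t)\,d_{y'}(\sigma+g')=d_{ty+(1-t)y'}(\sigma+tg+(1-t)g')$ for $\sigma$ fibrewise affine and $g,g'\in C^\infty(M)$. If $(x,k,r)$ are local coordinates of $A$, affine in the fibres, with $v_A=\partial_r$, so that $f_\sigma=r+\psi(x,k)$ for a local function $\psi$, then the local coordinates of $d_y\sigma$ are $(x,k,\partial\psi/\partial k,\partial\psi/\partial x)$. 3. The double vector hull of $PA$ is a smooth double vector bundle over the vector hulls of $\underline A$ and $\underline{A^\#}$. It is obtained by first taking the vector hull of $PA\to\underline A$, which is an affine bundle over the vector hull of $\underline{A^\#}$, and then the vector hull of this affine bundle; its charts are the linear extensions of the charts of $PA$. 4. There is exactly one isomorphism $\Phi$ of double vector bundles over $\mathrm{id}_M$ from $T^*E/\mathbb R\times\mathbb R$ to the double vector hull of $PA$ such that: on $\underline E$ it sends $[a]$ to $[a]\in\underline A$ for all $a\in A$; on $\underline{E^*}$ it sends the class of the linear extension of $f$ to $[f]\in\underline{A^\#}$ for all $f\in A^\#$; and it sends the orbit of $\omega\in T^*_aE$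 to $d_{\zeta(a)}\sigma\in PA$ whenever $a\in A\subset E$ and $\omega|_{T_aA}=d_af_\sigma$. -/

import Mathlib

open Bundle Set
open scoped Manifold ContDiff Topology

noncomputable section
namespace DoubleAffine

/-! ### Vector hulls of affine spaces -/

section Hull
variable {P : Type*}

/-- The span of the vectors `x_c - t x_a - (1 - t) x_b`, where `c` is the affine combination of `a`
and `b` with weights `t` and `1 - t`. -/
def VectorHull.relations (comb : P → P → ℝ → P → Prop) : Submodule ℝ (P →₀ ℝ) :=
  Submodule.span ℝ {x | ∃ a b t c, comb a b t c ∧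
    x = Finsupp.single c 1 - (t • Finsupp.single a 1 + (1 - t) • Finsupp.single b 1)}

/-- The vector hull of a set `P` with affine combinations, given by the relation `comb a b t c`
(`c` is the affine combination of `a` and `b` with weights `t` and `1 - t`): the free vector space
on `P` modulo the relations `x_c = t x_a + (1 - t) x_b`. -/
def VectorHull (comb : P → P → ℝ → P → Prop) : Type _ :=
  (P →₀ ℝ) ⧸ VectorHull.relations comb

variable (comb : P → P → ℝ → P → Prop)

instance : AddCommGroup (VectorHull comb) :=
  inferInstanceAs (AddCommGroup ((P →₀ ℝ) ⧸ VectorHull.relations comb))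
instance : Module ℝ (VectorHull comb) :=
  inferInstanceAs (Module ℝ ((P →₀ ℝ) ⧸ VectorHull.relations comb))

namespace VectorHull

/-- The canonical map from `P` to its vector hull. -/
def of (a : P) : VectorHull comb := (relations comb).mkQ (Finsupp.single a 1)

variable {comb}

theorem of_comb {a b c : P} {t : ℝ} (h : comb a b t c) :
    of comb c = t • of comb a + (1 - t) • of comb b := by
  have : Finsupp.single c (1:ℝ) - (t • Finsupp.single a 1 + (1 - t) • Finsupp.single b 1)
      ∈ relations comb := Submodule.subset_span ⟨a, b, t, c, h, rfl⟩
  have h2 := (Submodule.Quotient.mk_eq_zero _).2 this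
  have h3 : (relations comb).mkQ (Finsupp.single c (1:ℝ)
      - (t • Finsupp.single a 1 + (1 - t) • Finsupp.single b 1)) = 0 := h2
  rw [map_sub, map_add, map_smul, map_smul, sub_eq_zero] at h3
  exact h3

/-- The linear extension of an affine map. -/
def lift {W : Type*} [AddCommGroup W] [Module ℝ W] (f : P → W)
    (hf : ∀ a b t c, comb a b t c → f c = t • f a + (1 - t) • f b) :
    VectorHull comb →ₗ[ℝ] W :=
  (relations comb).liftQ (Finsupp.linearCombination ℝ f) (by
    rw [relations, Submodule.span_le]
    rintro x ⟨a, b, t, c, h, rfl⟩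
    simp only [SetLike.mem_coe, LinearMap.mem_ker, map_sub, map_add, map_smul,
      Finsupp.linearCombination_single, one_smul, hf a b t c h]
    module)

@[simp] theorem lift_of {W : Type*} [AddCommGroup W] [Module ℝ W] (f : P → W)
    (hf : ∀ a b t c, comb a b t c → f c = t • f a + (1 - t) • f b) (a : P) :
    lift f hf (of comb a) = f a := by
  change (relations comb).liftQ _ _ ((relations comb).mkQ _) = _
  rw [Submodule.mkQ_apply, Submodule.liftQ_apply]
  simp

theorem hom_ext {W : Type*} [AddCommGroup W] [Module ℝ W] {f g : VectorHull comb →ₗ[ℝ] W}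
    (h : ∀ a, f (of comb a) = g (of comb a)) : f = g := by
  apply Submodule.linearMap_qext
  apply Finsupp.lhom_ext'
  intro a
  apply LinearMap.ext_ring
  exact h a

/-- The linear map of hulls induced by an affine map. -/
def map {P' : Type*} {comb' : P' → P' → ℝ → P' → Prop} (f : P → P')
    (hf : ∀ a b t c, comb a b t c → comb' (f a) (f b) t (f c)) :
    VectorHull comb →ₗ[ℝ] VectorHull comb' :=
  lift (fun a => of comb' (f a)) fun a b t c h => of_comb (hf a b t c h)

end VectorHull

variable {V : Type*} [AddCommGroup V] [Module ℝ V] {A : Type*} [AddTorsor V A]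

/-- Affine combinations in an affine space: `c = b + t (a - b)`. -/
def affComb (V : Type*) [AddCommGroup V] [Module ℝ V] {A : Type*} [AddTorsor V A]
    (a b : A) (t : ℝ) (c : A) : Prop :=
  c = AffineMap.lineMap (k := ℝ) (V1 := V) b a t

theorem affComb_map {W : Type*} [AddCommGroup W] [Module ℝ W] (φ : A →ᵃ[ℝ] W) (a b : A) (t : ℝ)
    (c : A) (h : affComb V a b t c) : φ c = t • φ a + (1 - t) • φ b := by
  rw [h, AffineMap.apply_lineMap, AffineMap.lineMap_apply_module]; abel

theorem hullEquiv_aux {W : Type*} [AddCommGroup W] [Module ℝ W] (φ : A ≃ᵃ[ℝ] W) (a b : A) (t : ℝ)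
    (c : A) (h : affComb V a b t c) :
    (φ c, (1 : ℝ)) = t • (φ a, (1 : ℝ)) + (1 - t) • (φ b, (1 : ℝ)) := by
  ext
  · exact affComb_map (φ : A →ᵃ[ℝ] W) a b t c h
  · simp

/-- An affine isomorphism `A ≃ W` induces a linear isomorphism from the hull of `A` to `W × ℝ`. -/
def hullEquiv {W : Type*} [AddCommGroup W] [Module ℝ W] (φ : A ≃ᵃ[ℝ] W) :
    VectorHull (affComb V (A := A)) ≃ₗ[ℝ] W × ℝ := by
  let F : VectorHull (affComb V (A := A)) →ₗ[ℝ] W × ℝ :=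
    VectorHull.lift (fun a => (φ a, (1 : ℝ))) (hullEquiv_aux φ)
  have key : ∀ (y z : W) (t : ℝ), VectorHull.of (affComb V (A := A)) (φ.symm (t • y + (1 - t) • z))
      = t • VectorHull.of (affComb V (A := A)) (φ.symm y)
        + (1 - t) • VectorHull.of (affComb V (A := A)) (φ.symm z) := by
    intro y z t
    apply VectorHull.of_comb
    rw [affComb, show t • y + (1 - t) • z = AffineMap.lineMap z y t by
      rw [AffineMap.lineMap_apply_module]; abel]
    exact AffineMap.apply_lineMap (φ.symm : W →ᵃ[ℝ] A) _ _ _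
  let h : W → VectorHull (affComb V (A := A)) := fun y =>
    VectorHull.of _ (φ.symm y) - VectorHull.of _ (φ.symm 0)
  have hs : ∀ (t : ℝ) y, h (t • y) = t • h y := by
    intro t y
    have := key y 0 t
    simp only [smul_zero, add_zero] at this
    simp only [h, this]
    module
  have ha : ∀ y z, h (y + z) = h y + h z := by
    intro y z
    have h1 := key y z (1/2)
    have h2 : h ((1/2 : ℝ) • (y + z)) = (1/2 : ℝ) • h (y + z) := hs _ _
    have h3 : (1/2 : ℝ) • (y + z) = (1/2 : ℝ) • y + (1 - 1/2 : ℝ) • z := by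
      rw [smul_add]; norm_num
    have h4 : h ((1/2 : ℝ) • (y + z)) = (1/2 : ℝ) • h y + (1/2 : ℝ) • h z := by
      rw [h3]; simp only [h, h1]; module
    rw [h2, ← smul_add] at h4
    have := congrArg (fun x => (2:ℝ) • x) h4
    simpa [smul_smul] using this
  let G : W × ℝ →ₗ[ℝ] VectorHull (affComb V (A := A)) :=
    { toFun := fun p => h p.1 + p.2 • VectorHull.of _ (φ.symm 0)
      map_add' := fun p q => by simp only [Prod.fst_add, Prod.snd_add, ha]; module
      map_smul' := fun t p => by
        simp only [Prod.smul_fst, Prod.smul_snd, hs, RingHom.id_apply, smul_eq_mul]; module }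
  refine LinearEquiv.ofLinearMap F G ?_ ?_
  · apply LinearMap.ext
    rintro ⟨y, s⟩
    simp [F, G, h]
  · apply VectorHull.hom_ext
    intro a
    simp [F, G, h]

@[simp] theorem hullEquiv_of {W : Type*} [AddCommGroup W] [Module ℝ W] (φ : A ≃ᵃ[ℝ] W) (a : A) :
    hullEquiv (V := V) φ (VectorHull.of _ a) = (φ a, 1) := by
  unfold hullEquiv
  exact VectorHull.lift_of _ (hullEquiv_aux φ) a

end Hull

/-! ### Smooth affine bundles and their vector hulls -/

section Bundle

variable (F : Type*) [NormedAddCommGroup F] [NormedSpace ℝ F] {M : Type*} [TopologicalSpace M]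
  (V : M → Type*) [∀ m, AddCommGroup (V m)] [∀ m, Module ℝ (V m)]
  (A : M → Type*) [∀ m, AddTorsor (V m) (A m)]
  [∀ m, TopologicalSpace (A m)] [TopologicalSpace (TotalSpace F A)] [FiberBundle F A]

/-- The fibre bundle `A → M`, whose fibres are affine spaces modelled on the vector spaces `V m`,
is an affine bundle: the trivializations are affine on the fibres. -/
class AffineBundle : Prop where
  exists_affineMap : ∀ (e : Trivialization F (π F A)) [MemTrivializationAtlas e], ∀ m ∈ e.baseSet,
    ∃ φ : A m →ᵃ[ℝ] F, ∀ a, (e ⟨m, a⟩).2 = φ a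

/-- A smooth affine bundle: an affine bundle over a manifold `M` (modelled on `B`) with smooth
changes of trivializations. -/
class SmoothAffineBundle (B : Type*) [NormedAddCommGroup B] [NormedSpace ℝ B]
    [ChartedSpace B M] : Prop extends AffineBundle F V A where
  contMDiffOn_coordChange : ∀ (e e' : Trivialization F (π F A)) [MemTrivializationAtlas e]
    [MemTrivializationAtlas e'], ContMDiffOn (𝓘(ℝ, B).prod 𝓘(ℝ, F)) 𝓘(ℝ, F) ∞
      (fun x : M × F => e.coordChange e' x.1 x.2) ((e.baseSet ∩ e'.baseSet) ×ˢ univ)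

/-- The vector hull `E` of the bundle `A` (its fibre over `m`). -/
def Hull (m : M) : Type _ := VectorHull (affComb (V m) (A := A m))
instance (m : M) : AddCommGroup (Hull V A m) :=
  inferInstanceAs (AddCommGroup (VectorHull (affComb (V m) (A := A m))))
instance (m : M) : Module ℝ (Hull V A m) :=
  inferInstanceAs (Module ℝ (VectorHull (affComb (V m) (A := A m))))
instance (m : M) : TopologicalSpace (Hull V A m) := moduleTopology ℝ _


section Triv
variable [AffineBundle F V A]

/-- the affine isomorphism `A m ≃ F` -/
def fiberEquiv (e : Trivialization F (π F A)) [MemTrivializationAtlas e] {m : M}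
    (hm : m ∈ e.baseSet) : A m ≃ᵃ[ℝ] F :=
  AffineEquiv.ofBijective (φ := (AffineBundle.exists_affineMap (V := V) e m hm).choose) (by
    have h := (AffineBundle.exists_affineMap (V := V) e m hm).choose_spec
    set φ := (AffineBundle.exists_affineMap (V := V) e m hm).choose
    constructor
    · intro a b hab
      rw [← h, ← h] at hab
      have h1 : (⟨m, a⟩ : TotalSpace F A) = ⟨m, b⟩ := by
        apply e.injOn (e.mem_source.2 hm) (e.mem_source.2 hm)
        refine Prod.ext ?_ hab
        exact (e.coe_fst' (x := ⟨m, a⟩) hm).trans (e.coe_fst' (x := ⟨m, b⟩) hm).symm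
      simpa using h1
    · intro y
      refine ⟨e.symm m y, ?_⟩
      rw [← h, e.mk_symm hm, e.apply_symm_apply' hm])

theorem fiberEquiv_apply (e : Trivialization F (π F A)) [MemTrivializationAtlas e] {m : M}
    (hm : m ∈ e.baseSet) (a : A m) : fiberEquiv F V A e hm a = (e ⟨m, a⟩).2 :=
  ((AffineBundle.exists_affineMap (V := V) e m hm).choose_spec a).symm

/-- The linear isomorphism `Hull (A m) ≃ F × ℝ` induced by a trivialization of `A`. -/
def hullFiberEquiv (e : Trivialization F (π F A)) [MemTrivializationAtlas e] {m : M}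
    (hm : m ∈ e.baseSet) : Hull V A m ≃ₗ[ℝ] F × ℝ := hullEquiv (fiberEquiv F V A e hm)

open Classical in
/-- The (pre)trivialization of the hull induced by a trivialization of `A`. -/
def hullPretrivialization (e : Trivialization F (π F A)) [MemTrivializationAtlas e] :
    Pretrivialization (F × ℝ) (π (F × ℝ) (Hull V A)) where
  toFun x := (x.1, if h : x.1 ∈ e.baseSet then hullFiberEquiv F V A e h x.2 else 0)
  invFun p := ⟨p.1, if h : p.1 ∈ e.baseSet then (hullFiberEquiv F V A e h).symm p.2 else 0⟩
  source := π (F × ℝ) (Hull V A) ⁻¹' e.baseSet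
  target := e.baseSet ×ˢ univ
  map_source' x hx := ⟨hx, mem_univ _⟩
  map_target' p hp := hp.1
  left_inv' x hx := by
    have hx : x.1 ∈ e.baseSet := hx
    simp [dif_pos hx]
  right_inv' p hp := by
    simp [dif_pos hp.1]
  open_target := e.open_baseSet.prod isOpen_univ
  baseSet := e.baseSet
  open_baseSet := e.open_baseSet
  source_eq := rfl
  target_eq := rfl
  proj_toFun _ _ := rfl

theorem hullPretrivialization_apply (e : Trivialization F (π F A)) [MemTrivializationAtlas e]
    {m : M} (hm : m ∈ e.baseSet) (w : Hull V A m) :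
    hullPretrivialization F V A e ⟨m, w⟩ = (m, hullFiberEquiv F V A e hm w) := by
  change (m, _) = _
  simp only [dif_pos hm]

theorem hullPretrivialization_symm (e : Trivialization F (π F A)) [MemTrivializationAtlas e]
    {m : M} (hm : m ∈ e.baseSet) (p : F × ℝ) :
    (hullPretrivialization F V A e).symm m p = (hullFiberEquiv F V A e hm).symm p := by
  apply (hullFiberEquiv F V A e hm).injective
  have h2 := (hullPretrivialization F V A e).apply_mk_symm (b := m) hm p
  rw [hullPretrivialization_apply F V A e hm] at h2
  rw [LinearEquiv.apply_symm_apply]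
  exact (Prod.ext_iff.1 h2).2

theorem hullFiberEquiv_change (e e' : Trivialization F (π F A)) [MemTrivializationAtlas e]
    [MemTrivializationAtlas e'] {m : M} (hm : m ∈ e.baseSet ∩ e'.baseSet) (y : F) (s : ℝ) :
    hullFiberEquiv F V A e' hm.2 ((hullFiberEquiv F V A e hm.1).symm (y, s)) =
    (e.coordChange e' m y - e.coordChange e' m 0 + s • e.coordChange e' m 0, s) := by
  have h1 : ∀ z : F, hullEquiv (fiberEquiv F V A e' hm.2)
      ((hullEquiv (fiberEquiv F V A e hm.1)).symm (z, 1)) = (e.coordChange e' m z, 1) := by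
    intro z
    have : (hullEquiv (fiberEquiv F V A e hm.1)).symm (z, 1) =
        VectorHull.of _ ((fiberEquiv F V A e hm.1).symm z) := by
      rw [LinearEquiv.symm_apply_eq, hullEquiv_of, AffineEquiv.apply_symm_apply]
    rw [this, hullEquiv_of, fiberEquiv_apply]
    have h2 : (fiberEquiv F V A e hm.1).symm z = e.symm m z := by
      rw [← (fiberEquiv F V A e hm.1).injective.eq_iff, AffineEquiv.apply_symm_apply,
        fiberEquiv_apply, e.apply_mk_symm hm.1]
    rw [h2, Trivialization.coordChange, e.mk_symm hm.1]
  have h2 : ((y, s) : F × ℝ) = (y, 1) - (0, 1) + s • (0, 1) := by ext <;> simp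
  change (hullEquiv (fiberEquiv F V A e' hm.2))
      ((hullEquiv (fiberEquiv F V A e hm.1)).symm (y, s)) = _
  rw [h2, map_add, map_add, map_sub, map_sub, map_smul, map_smul, h1, h1]
  ext <;> simp

variable [FiniteDimensional ℝ F]

open Classical in
/-- The change of fibre coordinates of the hull. -/
def hullChange (e e' : Trivialization F (π F A)) [MemTrivializationAtlas e]
    [MemTrivializationAtlas e'] (m : M) : F × ℝ →L[ℝ] F × ℝ :=
  if hm : m ∈ e.baseSet ∩ e'.baseSet then LinearMap.toContinuousLinearMap
    ((hullFiberEquiv F V A e hm.1).symm.trans (hullFiberEquiv F V A e' hm.2)).toLinearMap else 0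

theorem hullChange_eq (e e' : Trivialization F (π F A)) [MemTrivializationAtlas e]
    [MemTrivializationAtlas e'] {m : M} (hm : m ∈ e.baseSet ∩ e'.baseSet) (p : F × ℝ) :
    hullChange F V A e e' m p =
      hullFiberEquiv F V A e' hm.2 ((hullFiberEquiv F V A e hm.1).symm p) := by
  rw [hullChange, dif_pos hm]; rfl

theorem hullChange_apply (e e' : Trivialization F (π F A)) [MemTrivializationAtlas e]
    [MemTrivializationAtlas e'] {m : M} (hm : m ∈ e.baseSet ∩ e'.baseSet) (p : F × ℝ) :
    hullChange F V A e e' m p =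
    (e.coordChange e' m p.1 - e.coordChange e' m 0 + p.2 • e.coordChange e' m 0, p.2) := by
  rw [hullChange_eq F V A e e' hm, hullFiberEquiv_change F V A e e' hm]

theorem hullChange_pretrivialization (e e' : Trivialization F (π F A)) [MemTrivializationAtlas e]
    [MemTrivializationAtlas e'] {m : M} (hm : m ∈ e.baseSet ∩ e'.baseSet) (p : F × ℝ) :
    hullChange F V A e e' m p =
    (hullPretrivialization F V A e' ⟨m, (hullPretrivialization F V A e).symm m p⟩).2 := by
  rw [hullPretrivialization_symm F V A e hm.1, hullPretrivialization_apply F V A e' hm.2,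
    hullChange_eq F V A e e' hm]

/-- The vector bundle structure of the hull, given by the trivializations induced from those
of `A`. -/
def hullPrebundle : VectorPrebundle ℝ (F × ℝ) (Hull V A) where
  pretrivializationAtlas := {E | ∃ (e : Trivialization F (π F A)) (_ : MemTrivializationAtlas e),
    E = hullPretrivialization F V A e}
  pretrivialization_linear' := by
    rintro _ ⟨e, he, rfl⟩
    refine ⟨fun m hm => ⟨fun x y => ?_, fun c x => ?_⟩⟩ <;>
    simp only [hullPretrivialization_apply F V A e hm, map_add, map_smul]
  pretrivializationAt m := hullPretrivialization F V A (trivializationAt F A m)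
  mem_base_pretrivializationAt m := mem_baseSet_trivializationAt F A m
  pretrivialization_mem_atlas m := ⟨_, inferInstance, rfl⟩
  exists_coordChange := by
    rintro _ ⟨e, he, rfl⟩ _ ⟨e', he', rfl⟩
    refine ⟨hullChange F V A e e', ?_, fun m hm p => hullChange_pretrivialization F V A e e' hm p⟩
    rw [continuousOn_clm_apply]
    intro p
    have hc : ∀ y : F, ContinuousOn (fun m => e.coordChange e' m y) (e.baseSet ∩ e'.baseSet) := by
      intro y
      have h1 : ContinuousOn (fun m : M => e.toPartialEquiv.symm (m, y)) (e.baseSet ∩ e'.baseSet) :=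
        e.continuousOn_invFun.comp (f := fun m : M => (m, y)) (by fun_prop)
          (fun m hm => e.mem_target.2 hm.1)
      exact continuous_snd.comp_continuousOn (e'.continuousOn.comp h1 fun m hm =>
        e'.mem_source.2 (by
          rw [e.proj_symm_apply (e.mem_target.2 hm.1)]; exact hm.2))
    refine ContinuousOn.congr (f := fun m =>
      (e.coordChange e' m p.1 - e.coordChange e' m 0 + p.2 • e.coordChange e' m 0, p.2)) ?_
      (fun m hm => hullChange_apply F V A e e' hm p)
    exact ((((hc _).sub (hc _)).add ((hc _).const_smul _)).prodMk continuousOn_const)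
  totalSpaceMk_isInducing m := by
    have hm := mem_baseSet_trivializationAt F A m
    have : IsModuleTopology ℝ (F × ℝ) := isModuleTopologyOfFiniteDimensional
    have : ContinuousAdd (Hull V A m) := ModuleTopology.continuousAdd ℝ _
    have : ContinuousSMul ℝ (Hull V A m) := ModuleTopology.continuousSMul ℝ _
    have : IsModuleTopology ℝ (Hull V A m) := ⟨rfl⟩
    let L := hullFiberEquiv F V A (trivializationAt F A m) hm
    let H : Hull V A m ≃ₜ F × ℝ :=
      { L.toEquiv with
        continuous_toFun := IsModuleTopology.continuous_of_linearMap L.toLinearMap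
        continuous_invFun := IsModuleTopology.continuous_of_linearMap L.symm.toLinearMap }
    have h2 : (hullPretrivialization F V A (trivializationAt F A m)) ∘ TotalSpace.mk m
        = Prod.mk m ∘ H := by
      funext w
      exact hullPretrivialization_apply F V A _ hm w
    rw [h2]
    exact (isInducing_prodMkRight m).comp H.isInducing

instance : TopologicalSpace (TotalSpace (F × ℝ) (Hull V A)) :=
  (hullPrebundle F V A).totalSpaceTopology
instance : FiberBundle (F × ℝ) (Hull V A) := (hullPrebundle F V A).toFiberBundle
instance : VectorBundle ℝ (F × ℝ) (Hull V A) := (hullPrebundle F V A).toVectorBundle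

end Triv

section Smooth
variable [FiniteDimensional ℝ F]
variable (B : Type*) [NormedAddCommGroup B] [NormedSpace ℝ B]
  [ChartedSpace B M] [SmoothAffineBundle F V A B]

instance : ContMDiffVectorBundle ∞ (F × ℝ) (Hull V A) 𝓘(ℝ, B) := by
  have : (hullPrebundle F V A).IsContMDiff 𝓘(ℝ, B) ∞ := by
    constructor
    rintro _ ⟨e, he, rfl⟩ _ ⟨e', he', rfl⟩
    refine ⟨hullChange F V A e e', ?_, fun m hm p => hullChange_pretrivialization F V A e e' hm p⟩
    let ε : ((F × ℝ) →L[ℝ] (F × ℝ)) ≃L[ℝ] (Fin (Module.finrank ℝ (F × ℝ)) → F × ℝ) :=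
      ((ContinuousLinearEquiv.ofFinrankEq (Module.finrank_fin_fun ℝ).symm).arrowCongr
        (1 : (F × ℝ) ≃L[ℝ] (F × ℝ))).trans (ContinuousLinearEquiv.piRing _)
    have hc : ∀ y : F, ContMDiffOn 𝓘(ℝ, B) 𝓘(ℝ, F) ∞ (fun m => e.coordChange e' m y)
        (e.baseSet ∩ e'.baseSet) := by
      intro y
      exact (SmoothAffineBundle.contMDiffOn_coordChange (V := V) (B := B) e e').comp
        (g := fun x : M × F => e.coordChange e' x.1 x.2)
        (f := fun m : M => (m, y)) (contMDiff_id.prodMk contMDiff_const).contMDiffOn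
        (fun m hm => ⟨hm, mem_univ _⟩)
    have h1 : ∀ p : F × ℝ, ContMDiffOn 𝓘(ℝ, B) 𝓘(ℝ, F × ℝ) ∞ (fun m => hullChange F V A e e' m p)
        (e.baseSet ∩ e'.baseSet) := by
      intro p
      refine ContMDiffOn.congr (f := fun m =>
        (e.coordChange e' m p.1 - e.coordChange e' m 0 + p.2 • e.coordChange e' m 0, p.2)) ?_
        (fun m hm => hullChange_apply F V A e e' hm p)
      exact (((hc _).sub (hc _)).add ((contDiff_const_smul p.2).contMDiff.comp_contMDiffOn (hc 0))).prodMk_space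
        contMDiffOn_const
    have h2 : ContMDiffOn 𝓘(ℝ, B) 𝓘(ℝ, Fin (Module.finrank ℝ (F × ℝ)) → F × ℝ) ∞
        (fun m => ε (hullChange F V A e e' m)) (e.baseSet ∩ e'.baseSet) :=
      contMDiffOn_pi_space.2 fun i => h1 _
    have h3 := ε.symm.contDiff.contMDiff.comp_contMDiffOn (n := ∞) h2
    refine h3.congr fun m hm => ?_
    simp
  exact (hullPrebundle F V A).contMDiffVectorBundle 𝓘(ℝ, B)
variable [FiniteDimensional ℝ B] [IsManifold 𝓘(ℝ, B) ∞ M]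
end Smooth
end Bundle

/-! ### The cotangent bundle of the hull and the action of `ℝ × ℝ` -/

section Cotangent

variable (F : Type*) [NormedAddCommGroup F] [NormedSpace ℝ F] [FiniteDimensional ℝ F]
  {M : Type*} [TopologicalSpace M]
  (V : M → Type*) [∀ m, AddCommGroup (V m)] [∀ m, Module ℝ (V m)]
  (A : M → Type*) [∀ m, AddTorsor (V m) (A m)]
  [∀ m, TopologicalSpace (A m)] [TopologicalSpace (TotalSpace F A)] [FiberBundle F A]
  (B : Type*) [NormedAddCommGroup B] [NormedSpace ℝ B]
  [ChartedSpace B M] [IsManifold 𝓘(ℝ, B) ∞ M] [SmoothAffineBundle F V A B]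

namespace Hull
variable {A} {m : M}

/-- The inclusion `A → E`. -/
def of (a : A m) : Hull V A m := VectorHull.of _ a

variable {V}
/-- The inclusion `V(A) → E`, `w ↦ (a + w) - a`. -/
def ofVec (w : V m) : Hull V A m :=
  of V (w +ᵥ (Classical.arbitrary (A m))) - of V (Classical.arbitrary (A m))

/-- The linear extension to `E` of an affine function on `A`. -/
def extend (f : A m →ᵃ[ℝ] ℝ) : Module.Dual ℝ (Hull V A m) :=
  VectorHull.lift f fun a b t c h => affComb_map f a b t c h

variable (V A m)
/-- The distinguished section `α_A` of `E*`, equal to `1` on `A`. -/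
def alpha : Module.Dual ℝ (Hull V A m) := extend (AffineMap.const ℝ (A m) 1)
end Hull

/-- The total space of `E`. -/
abbrev HullTotal : Type _ := TotalSpace (F × ℝ) (Hull V A)
/-- The model of the manifold `E`. -/
abbrev hullModel : ModelWithCorners ℝ (B × (F × ℝ)) (ModelProd B (F × ℝ)) :=
  𝓘(ℝ, B).prod 𝓘(ℝ, F × ℝ)
/-- The tangent space of `E` at a point `w` of the fibre over `m`. -/
abbrev HullTangent (m : M) (w : Hull V A m) : Type _ :=
  TangentSpace (hullModel F B) (⟨m, w⟩ : HullTotal F V A)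

/-- The cotangent bundle `T*E` of the manifold `E`. -/
abbrev CotangentBundle : Type _ :=
  TotalSpace ((B × (F × ℝ)) →L[ℝ] ℝ) (fun x : HullTotal F V A =>
    TangentSpace (hullModel F B) x →L[ℝ] Bundle.Trivial (HullTotal F V A) ℝ x)
/-- The model of the manifold `T*E`. -/
abbrev cotangentModel : ModelWithCorners ℝ ((B × (F × ℝ)) × ((B × (F × ℝ)) →L[ℝ] ℝ))
   (ModelProd (ModelProd B (F × ℝ)) ((B × (F × ℝ)) →L[ℝ] ℝ)) :=
  (hullModel F B).prod 𝓘(ℝ, (B × (F × ℝ)) →L[ℝ] ℝ)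

/-- The part of `T*E` over a point `m` of `M`. -/
def CotangentFiber (m : M) : Type _ := Σ w : Hull V A m, HullTangent F V A B m w →L[ℝ] ℝ

variable {V}
/-- The translation of `E` by `s v_A`. -/
def translate (v : ∀ m, V m) (s : ℝ) (x : HullTotal F V A) : HullTotal F V A :=
  ⟨x.1, x.2 + s • Hull.ofVec (v x.1)⟩

/-- The differential `d α_A` at the point `w` of `E`. -/
def dalpha (m : M) (w : Hull V A m) : HullTangent F V A B m w →L[ℝ] ℝ :=
  mfderiv (hullModel F B) 𝓘(ℝ, ℝ) (fun y : HullTotal F V A => Hull.alpha V A y.1 y.2) ⟨m, w⟩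

/-- The action of `(s, t) ∈ ℝ × ℝ` on `T*E`: pull-back along the translation by `-s v_A`, followed
by addition of `t d α_A`. -/
def orbitAction (v : ∀ m, V m) (m : M) (s t : ℝ) (x : CotangentFiber F V A B m) :
    CotangentFiber F V A B m :=
  ⟨x.1 + s • Hull.ofVec (v m),
    x.2.comp (mfderiv (hullModel F B) (hullModel F B) (translate F A v (-s))
      ⟨m, x.1 + s • Hull.ofVec (v m)⟩) + t • dalpha F A B m (x.1 + s • Hull.ofVec (v m))⟩

/-- The part over `m` of the orbit space of the action of `ℝ × ℝ` on `T*E`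
(the action covers the identity of `M`). -/
def OrbitSpace (v : ∀ m, V m) (m : M) : Type _ :=
  Quot fun x y : CotangentFiber F V A B m => ∃ s t : ℝ, y = orbitAction F A B v m s t x

/-- The orbit of a covector. -/
def orbit (v : ∀ m, V m) (m : M) (w : Hull V A m) (η : HullTangent F V A B m w →L[ℝ] ℝ) :
    OrbitSpace F A B v m := Quot.mk _ ⟨w, η⟩

variable (V)

/-- The vertical lift `E_m → T_w E`, `u ↦ d/dt (w + t u)` at `t = 0`. -/
def vlift (m : M) (w : Hull V A m) : Hull V A m →ₗ[ℝ] HullTangent F V A B m w :=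
  (mfderiv 𝓘(ℝ, F × ℝ) (hullModel F B) (fun k : F × ℝ => (⟨m, w +
    (trivializationAt (F × ℝ) (Hull V A) m).symm m k⟩ : HullTotal F V A)) 0).toLinearMap ∘ₗ
   (trivializationAt (F × ℝ) (Hull V A) m).linearMapAt ℝ m

/-- The lift `T_m M → T_w E` tangent to the local section of `E` through `w` that is constant in
the preferred trivialization of `E` around `m`. -/
def hlift (m : M) (w : Hull V A m) : TangentSpace 𝓘(ℝ, B) m →L[ℝ] HullTangent F V A B m w :=
  mfderiv 𝓘(ℝ, B) (hullModel F B) (fun x : M => (⟨x,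
    (trivializationAt (F × ℝ) (Hull V A) m).symm x
      (trivializationAt (F × ℝ) (Hull V A) m ⟨m, w⟩).2⟩ : HullTotal F V A)) m

variable {A} in
/-- The projection `T*E → E*`: a covector at `w ∈ E_m` is restricted to the vertical vectors. -/
def vert (m : M) (w : Hull V A m) (η : HullTangent F V A B m w →L[ℝ] ℝ) :
    Module.Dual ℝ (Hull V A m) := η.toLinearMap ∘ₗ vlift F V A B m w

variable {A} in
/-- The components `p` of a covector along the base, in the preferred trivialization. -/
def horiz (m : M) (w : Hull V A m) (η : HullTangent F V A B m w →L[ℝ] ℝ) :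
    TangentSpace 𝓘(ℝ, B) m →L[ℝ] ℝ := η.comp (hlift F V A B m w)

variable {A} in
/-- The covector at `w` with components `p` along the base (in the preferred trivialization)
and `ξ` along the fibre. -/
def covec (m : M) (w : Hull V A m) (p : TangentSpace 𝓘(ℝ, B) m →L[ℝ] ℝ)
    (ξ : Module.Dual ℝ (Hull V A m)) : HullTangent F V A B m w →L[ℝ] ℝ :=
  p.comp (mfderiv (hullModel F B) 𝓘(ℝ, B) (fun x : HullTotal F V A => x.1) ⟨m, w⟩) +
  (LinearMap.toContinuousLinearMap
    (ξ ∘ₗ (trivializationAt (F × ℝ) (Hull V A) m).symmₗ ℝ m)).comp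
      (mfderiv (hullModel F B) 𝓘(ℝ, F × ℝ)
        (fun x : HullTotal F V A => (trivializationAt (F × ℝ) (Hull V A) m x).2) ⟨m, w⟩)

variable {A} in
/-- Addition in `T*E → E*`. In coordinates `(x, y, p, π)` adapted to a vector bundle chart of `E`:
`(x, y, p, π) + (x, y', p', π) = (x, y + y', p + p', π)`. Used only if `vert η = vert η'`. -/
def cotAdd (m : M) (w w' : Hull V A m) (η : HullTangent F V A B m w →L[ℝ] ℝ)
    (η' : HullTangent F V A B m w' →L[ℝ] ℝ) : HullTangent F V A B m (w + w') →L[ℝ] ℝ :=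
  covec F V B m (w + w') (horiz F V B m w η + horiz F V B m w' η') (vert F V B m w η)

variable {A} in
/-- Multiplication by scalars in `T*E → E*`: `t (x, y, p, π) = (x, t y, t p, π)`. -/
def cotSmul (m : M) (t : ℝ) (w : Hull V A m) (η : HullTangent F V A B m w →L[ℝ] ℝ) :
    HullTangent F V A B m (t • w) →L[ℝ] ℝ :=
  covec F V B m (t • w) (t • horiz F V B m w η) (vert F V B m w η)

/-- `E / ⟨v_A⟩`. -/
abbrev HullQuot (v : ∀ m, V m) (m : M) : Type _ :=
  Hull V A m ⧸ Submodule.span ℝ {Hull.ofVec (A := A) (v m)}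

/-- `E* / ⟨α_A⟩`. -/
abbrev DualQuot (m : M) : Type _ :=
  Module.Dual ℝ (Hull V A m) ⧸ Submodule.span ℝ {Hull.alpha V A m}

end Cotangent

/-! ### Double affine and double vector bundles -/

section Double

variable {M : Type*} [TopologicalSpace M] (B : Type*) [NormedAddCommGroup B] [NormedSpace ℝ B]
  [ChartedSpace B M]

/-- A double bundle chart over an open set `dom` of `M`: fibre coordinates on the side bundles and
the remaining coordinates on the total space. Only the values over `dom` are relevant. -/
structure DoubleChart (K₁ K₂ K : Type*) (D D₁ D₂ : M → Type*) where
  dom : TopologicalSpace.Opens M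
  fst : ∀ m, D₁ m → K₁
  snd : ∀ m, D₂ m → K₂
  core : ∀ m, D m → K

/-- All fibre coordinates of a double bundle chart together. -/
def DoubleChart.coord {K₁ K₂ K : Type*} {D D₁ D₂ : M → Type*}
    (χ : DoubleChart K₁ K₂ K D D₁ D₂) (pr₁ : ∀ m, D m → D₁ m) (pr₂ : ∀ m, D m → D₂ m)
    (m : M) (d : D m) : K₁ × K₂ × K :=
  (χ.fst m (pr₁ m d), χ.snd m (pr₂ m d), χ.core m d)

/-- Over `U`, the fibre coordinates `g` are smooth functions of `m` and of the coordinates `f`. -/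
def SmoothInTerms {X : M → Type*} {K K' : Type*} [NormedAddCommGroup K] [NormedSpace ℝ K]
    [NormedAddCommGroup K'] [NormedSpace ℝ K'] (U : Set M)
    (f : ∀ m, X m → K) (g : ∀ m, X m → K') : Prop :=
  ∃ τ : M × K → K', ContMDiffOn (𝓘(ℝ, B).prod 𝓘(ℝ, K)) 𝓘(ℝ, K') ∞ τ (U ×ˢ univ) ∧
    ∀ m ∈ U, ∀ x, g m x = τ (m, f m x)

variable (K₁ K₂ K : Type*) [NormedAddCommGroup K₁] [NormedSpace ℝ K₁] [NormedAddCommGroup K₂]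
  [NormedSpace ℝ K₂] [NormedAddCommGroup K] [NormedSpace ℝ K]

/-- A (smooth) double affine bundle `(D; D₁, D₂; M)`, presented by local trivializations: affine
combinations `aff a b t = t a + (1 - t) b` on the side bundles, two partially defined affine
combinations on `D` (`aff₁` in the fibres of `pr₁ : D → D₁` and `aff₂` in the fibres of
`pr₂ : D → D₂`; other values are irrelevant), and an atlas of charts identifying `D` over open
sets `U` of `M` with the trivial double affine bundle `U × K₁ × K₂ × K`, with smooth transition
maps. -/
structure DoubleAffineBundle (D D₁ D₂ : M → Type*) where
  pr₁ : ∀ m, D m → D₁ m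
  pr₂ : ∀ m, D m → D₂ m
  affSide₁ : ∀ m, D₁ m → D₁ m → ℝ → D₁ m
  affSide₂ : ∀ m, D₂ m → D₂ m → ℝ → D₂ m
  aff₁ : ∀ m, D m → D m → ℝ → D m
  aff₂ : ∀ m, D m → D m → ℝ → D m
  pr₁_aff₁ : ∀ m d d' t, pr₁ m d = pr₁ m d' → pr₁ m (aff₁ m d d' t) = pr₁ m d
  pr₂_aff₁ : ∀ m d d' t, pr₁ m d = pr₁ m d' →
    pr₂ m (aff₁ m d d' t) = affSide₂ m (pr₂ m d) (pr₂ m d') t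
  pr₂_aff₂ : ∀ m d d' t, pr₂ m d = pr₂ m d' → pr₂ m (aff₂ m d d' t) = pr₂ m d
  pr₁_aff₂ : ∀ m d d' t, pr₂ m d = pr₂ m d' →
    pr₁ m (aff₂ m d d' t) = affSide₁ m (pr₁ m d) (pr₁ m d') t
  charts : Set (DoubleChart K₁ K₂ K D D₁ D₂)
  cover : ∀ m, ∃ χ ∈ charts, m ∈ χ.dom
  fst_bijective : ∀ χ ∈ charts, ∀ m ∈ χ.dom, Function.Bijective (χ.fst m)
  snd_bijective : ∀ χ ∈ charts, ∀ m ∈ χ.dom, Function.Bijective (χ.snd m)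
  coord_bijective : ∀ χ ∈ charts, ∀ m ∈ χ.dom, Function.Bijective (χ.coord pr₁ pr₂ m)
  fst_aff : ∀ χ ∈ charts, ∀ m ∈ χ.dom, ∀ a b t,
    χ.fst m (affSide₁ m a b t) = t • χ.fst m a + (1 - t) • χ.fst m b
  snd_aff : ∀ χ ∈ charts, ∀ m ∈ χ.dom, ∀ a b t,
    χ.snd m (affSide₂ m a b t) = t • χ.snd m a + (1 - t) • χ.snd m b
  core_aff₁ : ∀ χ ∈ charts, ∀ m ∈ χ.dom, ∀ d d' t, pr₁ m d = pr₁ m d' →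
    χ.core m (aff₁ m d d' t) = t • χ.core m d + (1 - t) • χ.core m d'
  core_aff₂ : ∀ χ ∈ charts, ∀ m ∈ χ.dom, ∀ d d' t, pr₂ m d = pr₂ m d' →
    χ.core m (aff₂ m d d' t) = t • χ.core m d + (1 - t) • χ.core m d'
  smooth : ∀ χ ∈ charts, ∀ χ' ∈ charts,
    SmoothInTerms B (χ.dom ∩ χ'.dom : Set M) (χ.coord pr₁ pr₂) (χ'.coord pr₁ pr₂)

/-- A (smooth) double vector bundle `(D; D₁, D₂; M)`, presented by local trivializations: vector
space structures on the fibres of the side bundles, two partially defined linear structures on `D`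
(`add₁`, `smul₁` in the fibres of `pr₁ : D → D₁` and `add₂`, `smul₂` in the fibres of
`pr₂ : D → D₂`; other values of the additions are irrelevant), and an atlas of charts identifying
`D` over open sets `U` of `M` with the trivial double vector bundle `U × K₁ × K₂ × K`, with smooth
transition maps. -/
structure DoubleVectorBundle (D D₁ D₂ : M → Type*) [∀ m, AddCommGroup (D₁ m)]
    [∀ m, Module ℝ (D₁ m)] [∀ m, AddCommGroup (D₂ m)] [∀ m, Module ℝ (D₂ m)] where
  pr₁ : ∀ m, D m → D₁ m
  pr₂ : ∀ m, D m → D₂ m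
  add₁ : ∀ m, D m → D m → D m
  smul₁ : ∀ m, ℝ → D m → D m
  add₂ : ∀ m, D m → D m → D m
  smul₂ : ∀ m, ℝ → D m → D m
  pr₁_add₁ : ∀ m d d', pr₁ m d = pr₁ m d' → pr₁ m (add₁ m d d') = pr₁ m d
  pr₂_add₁ : ∀ m d d', pr₁ m d = pr₁ m d' → pr₂ m (add₁ m d d') = pr₂ m d + pr₂ m d'
  pr₁_smul₁ : ∀ m t d, pr₁ m (smul₁ m t d) = pr₁ m d
  pr₂_smul₁ : ∀ m t d, pr₂ m (smul₁ m t d) = t • pr₂ m d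
  pr₂_add₂ : ∀ m d d', pr₂ m d = pr₂ m d' → pr₂ m (add₂ m d d') = pr₂ m d
  pr₁_add₂ : ∀ m d d', pr₂ m d = pr₂ m d' → pr₁ m (add₂ m d d') = pr₁ m d + pr₁ m d'
  pr₂_smul₂ : ∀ m t d, pr₂ m (smul₂ m t d) = pr₂ m d
  pr₁_smul₂ : ∀ m t d, pr₁ m (smul₂ m t d) = t • pr₁ m d
  charts : Set (DoubleChart K₁ K₂ K D D₁ D₂)
  cover : ∀ m, ∃ χ ∈ charts, m ∈ χ.dom
  fst_bijective : ∀ χ ∈ charts, ∀ m ∈ χ.dom, Function.Bijective (χ.fst m)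
  snd_bijective : ∀ χ ∈ charts, ∀ m ∈ χ.dom, Function.Bijective (χ.snd m)
  coord_bijective : ∀ χ ∈ charts, ∀ m ∈ χ.dom, Function.Bijective (χ.coord pr₁ pr₂ m)
  fst_linear : ∀ χ ∈ charts, ∀ m ∈ χ.dom, IsLinearMap ℝ (χ.fst m)
  snd_linear : ∀ χ ∈ charts, ∀ m ∈ χ.dom, IsLinearMap ℝ (χ.snd m)
  core_add₁ : ∀ χ ∈ charts, ∀ m ∈ χ.dom, ∀ d d', pr₁ m d = pr₁ m d' →
    χ.core m (add₁ m d d') = χ.core m d + χ.core m d'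
  core_smul₁ : ∀ χ ∈ charts, ∀ m ∈ χ.dom, ∀ t d, χ.core m (smul₁ m t d) = t • χ.core m d
  core_add₂ : ∀ χ ∈ charts, ∀ m ∈ χ.dom, ∀ d d', pr₂ m d = pr₂ m d' →
    χ.core m (add₂ m d d') = χ.core m d + χ.core m d'
  core_smul₂ : ∀ χ ∈ charts, ∀ m ∈ χ.dom, ∀ t d, χ.core m (smul₂ m t d) = t • χ.core m d
  smooth : ∀ χ ∈ charts, ∀ χ' ∈ charts,
    SmoothInTerms B (χ.dom ∩ χ'.dom : Set M) (χ.coord pr₁ pr₂) (χ'.coord pr₁ pr₂)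

variable {B K₁ K₂ K}

/-- An isomorphism of double vector bundles over the identity of `M`. -/
structure DoubleVectorBundle.Iso {K₁' K₂' K' : Type*} [NormedAddCommGroup K₁'] [NormedSpace ℝ K₁']
    [NormedAddCommGroup K₂'] [NormedSpace ℝ K₂'] [NormedAddCommGroup K'] [NormedSpace ℝ K']
    {D D₁ D₂ D' D₁' D₂' : M → Type*}
    [∀ m, AddCommGroup (D₁ m)] [∀ m, Module ℝ (D₁ m)]
    [∀ m, AddCommGroup (D₂ m)] [∀ m, Module ℝ (D₂ m)]
    [∀ m, AddCommGroup (D₁' m)] [∀ m, Module ℝ (D₁' m)]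
    [∀ m, AddCommGroup (D₂' m)] [∀ m, Module ℝ (D₂' m)]
    (𝒟 : DoubleVectorBundle B K₁ K₂ K D D₁ D₂)
    (𝒟' : DoubleVectorBundle B K₁' K₂' K' D' D₁' D₂') where
  total : ∀ m, D m ≃ D' m
  side₁ : ∀ m, D₁ m ≃ₗ[ℝ] D₁' m
  side₂ : ∀ m, D₂ m ≃ₗ[ℝ] D₂' m
  pr₁_total : ∀ m d, 𝒟'.pr₁ m (total m d) = side₁ m (𝒟.pr₁ m d)
  pr₂_total : ∀ m d, 𝒟'.pr₂ m (total m d) = side₂ m (𝒟.pr₂ m d)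
  total_add₁ : ∀ m d d', 𝒟.pr₁ m d = 𝒟.pr₁ m d' →
    total m (𝒟.add₁ m d d') = 𝒟'.add₁ m (total m d) (total m d')
  total_smul₁ : ∀ m t d, total m (𝒟.smul₁ m t d) = 𝒟'.smul₁ m t (total m d)
  total_add₂ : ∀ m d d', 𝒟.pr₂ m d = 𝒟.pr₂ m d' →
    total m (𝒟.add₂ m d d') = 𝒟'.add₂ m (total m d) (total m d')
  total_smul₂ : ∀ m t d, total m (𝒟.smul₂ m t d) = 𝒟'.smul₂ m t (total m d)
  smooth : ∀ χ ∈ 𝒟.charts, ∀ χ' ∈ 𝒟'.charts, SmoothInTerms B (χ.dom ∩ χ'.dom : Set M)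
    (χ.coord 𝒟.pr₁ 𝒟.pr₂) fun m d => χ'.coord 𝒟'.pr₁ 𝒟'.pr₂ m (total m d)
  smooth_symm : ∀ χ ∈ 𝒟.charts, ∀ χ' ∈ 𝒟'.charts, SmoothInTerms B (χ.dom ∩ χ'.dom : Set M)
    (χ'.coord 𝒟'.pr₁ 𝒟'.pr₂) fun m d => χ.coord 𝒟.pr₁ 𝒟.pr₂ m ((total m).symm d)

/-! ### The vector hull of a double affine bundle -/

namespace DoubleAffineBundle

variable {D D₁ D₂ : M → Type*} (𝒜 : DoubleAffineBundle B K₁ K₂ K D D₁ D₂) (m : M)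

/-- The vector hull of the side bundle `D₁ → M`. -/
abbrev Hull₁ : Type _ := VectorHull fun (a b : D₁ m) t c => c = 𝒜.affSide₁ m a b t

/-- The vector hull of the side bundle `D₂ → M`. -/
abbrev Hull₂ : Type _ := VectorHull fun (a b : D₂ m) t c => c = 𝒜.affSide₂ m a b t

/-- The vector hull of the fibre of `pr₁ : D → D₁` over `a`. -/
abbrev VertFiber (a : D₁ m) : Type _ :=
  VectorHull fun (p q : {d : D m // 𝒜.pr₁ m d = a}) t r => r.1 = 𝒜.aff₁ m p.1 q.1 t

/-- The vector hull of `pr₁ : D → D₁`. -/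
abbrev VertHull : Type _ := Σ a : D₁ m, 𝒜.VertFiber m a

/-- The map from the vector hull of `pr₁ : D → D₁` to the vector hull of `D₂ → M` induced by
`pr₂`. -/
def vertProj (X : 𝒜.VertHull m) : 𝒜.Hull₂ m :=
  VectorHull.map (fun p : {d : D m // 𝒜.pr₁ m d = X.1} => 𝒜.pr₂ m p.1)
    (fun p q t r h => by
      rw [h, 𝒜.pr₂_aff₁ m _ _ _ (p.2.trans q.2.symm)]) X.2

/-- Affine combinations in the fibres of the induced affine bundle `vertProj`:
`Z = t X + (1 - t) Y`. If `X` and `Y` are written as linear combinations, with the same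
coefficients, of points `p i` and `q i` of `D` with `pr₂ (p i) = pr₂ (q i)`, then `Z` is the linear
combination of the points `t (p i) + (1 - t) (q i)`, formed in the fibres of `pr₂`. -/
def VertAff (X Y : 𝒜.VertHull m) (t : ℝ) (Z : 𝒜.VertHull m) : Prop :=
  Z.1 = 𝒜.affSide₁ m X.1 Y.1 t ∧
  ∃ (n : ℕ) (s : Fin n → ℝ) (p : Fin n → {d : D m // 𝒜.pr₁ m d = X.1})
    (q : Fin n → {d : D m // 𝒜.pr₁ m d = Y.1}) (r : Fin n → {d : D m // 𝒜.pr₁ m d = Z.1}),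
    (∀ i, 𝒜.pr₂ m (p i).1 = 𝒜.pr₂ m (q i).1 ∧ (r i).1 = 𝒜.aff₂ m (p i).1 (q i).1 t) ∧
    X.2 = ∑ i, s i • VectorHull.of _ (p i) ∧
    Y.2 = ∑ i, s i • VectorHull.of _ (q i) ∧
    Z.2 = ∑ i, s i • VectorHull.of _ (r i)

/-- The vector hull of the fibre of `vertProj` over `b`. -/
abbrev DoubleHullFiber (b : 𝒜.Hull₂ m) : Type _ :=
  VectorHull fun (X Y : {X : 𝒜.VertHull m // 𝒜.vertProj m X = b}) t Z =>
    𝒜.VertAff m X.1 Y.1 t Z.1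

/-- The total space (over `m`) of the double vector hull: the vector hull of `vertProj`. -/
abbrev DoubleHull : Type _ := Σ b : 𝒜.Hull₂ m, 𝒜.DoubleHullFiber m b

/-- The projection of the double vector hull to the vector hull of `D₁ → M`, induced by
the projection of the vector hull of `pr₁` to `D₁`. -/
def doubleHullProj (Ξ : 𝒜.DoubleHull m) : 𝒜.Hull₁ m :=
  VectorHull.map (fun X : {X : 𝒜.VertHull m // 𝒜.vertProj m X = Ξ.1} => X.1.1)
    (fun _ _ _ _ h => h.1) Ξ.2

/-- The inclusion of the vector hull of `pr₁` in the double vector hull. -/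
def ofVert (X : 𝒜.VertHull m) : 𝒜.DoubleHull m :=
  ⟨𝒜.vertProj m X, VectorHull.of _ ⟨X, rfl⟩⟩

/-- The inclusion of `D` in its double vector hull. -/
def ofPoint (d : D m) : 𝒜.DoubleHull m := 𝒜.ofVert m ⟨𝒜.pr₁ m d, VectorHull.of _ ⟨d, rfl⟩⟩

/-- `ℋ` is the double vector bundle structure of the double vector hull of `𝒜`: the linear
structure over the hull of `D₂` is the one of a vector hull, the linear structure over the hull of
`D₁` extends the one of the vector hull of `pr₁ : D → D₁`, and the charts are the linear extensions
of the charts of `𝒜`. -/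
structure IsDoubleHull
    (ℋ : DoubleVectorBundle B (K₁ × ℝ) (K₂ × ℝ) K 𝒜.DoubleHull 𝒜.Hull₁ 𝒜.Hull₂) : Prop where
  pr₁_eq : ∀ m Ξ, ℋ.pr₁ m Ξ = 𝒜.doubleHullProj m Ξ
  pr₂_eq : ∀ m Ξ, ℋ.pr₂ m Ξ = Ξ.1
  add₂_eq : ∀ m (b : 𝒜.Hull₂ m) (x y : 𝒜.DoubleHullFiber m b),
    ℋ.add₂ m ⟨b, x⟩ ⟨b, y⟩ = ⟨b, x + y⟩
  smul₂_eq : ∀ m t (b : 𝒜.Hull₂ m) (x : 𝒜.DoubleHullFiber m b),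
    ℋ.smul₂ m t ⟨b, x⟩ = ⟨b, t • x⟩
  add₁_eq : ∀ m (a : D₁ m) (x y : 𝒜.VertFiber m a),
    ℋ.add₁ m (𝒜.ofVert m ⟨a, x⟩) (𝒜.ofVert m ⟨a, y⟩) = 𝒜.ofVert m ⟨a, x + y⟩
  smul₁_eq : ∀ m t (a : D₁ m) (x : 𝒜.VertFiber m a),
    ℋ.smul₁ m t (𝒜.ofVert m ⟨a, x⟩) = 𝒜.ofVert m ⟨a, t • x⟩
  chart : ∀ ψ ∈ ℋ.charts, ∃ χ ∈ 𝒜.charts, ψ.dom = χ.dom ∧ ∀ m ∈ χ.dom,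
    (∀ a, ψ.fst m (VectorHull.of _ a) = (χ.fst m a, 1)) ∧
    (∀ a, ψ.snd m (VectorHull.of _ a) = (χ.snd m a, 1)) ∧
    ∀ d, ψ.core m (𝒜.ofPoint m d) = χ.core m d

end DoubleAffineBundle

end Double

/-! ### The affine phase bundle -/

section Phase

variable (F : Type*) [NormedAddCommGroup F] [NormedSpace ℝ F] {M : Type*} [TopologicalSpace M]
  {V : M → Type*} [∀ m, AddCommGroup (V m)] [∀ m, Module ℝ (V m)]
  (A : M → Type*) [∀ m, AddTorsor (V m) (A m)]
  [∀ m, TopologicalSpace (A m)] [TopologicalSpace (TotalSpace F A)] [FiberBundle F A]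
  (B : Type*) [NormedAddCommGroup B] [NormedSpace ℝ B] [ChartedSpace B M]

/-- `v` is a nowhere vanishing smooth section of the model bundle `V(A)`; smoothness is expressed by
smoothness of the translation `a ↦ a + v`. A special affine bundle is a smooth affine bundle with
such a section. -/
structure IsSpecialSection (v : ∀ m, V m) : Prop where
  ne_zero : ∀ m, v m ≠ 0
  smooth : ContMDiff (𝓘(ℝ, B).prod 𝓘(ℝ, F)) (𝓘(ℝ, B).prod 𝓘(ℝ, F)) ∞
    fun x : TotalSpace F A => (⟨x.1, v x.1 +ᵥ x.2⟩ : TotalSpace F A)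

variable (v : ∀ m, V m)

/-- `A / ⟨v_A⟩`. -/
def AffQuot (m : M) : Type _ := Quot fun a b : A m => ∃ t : ℝ, b = t • v m +ᵥ a

variable {A} in
/-- The projection `ζ : A → A / ⟨v_A⟩`. -/
def AffQuot.mk {m : M} (a : A m) : AffQuot A v m := Quot.mk _ a

/-- Special affine functions on `A m`: the fibre of the special affine dual of `A`. -/
abbrev SpecialDual (m : M) : Type _ := {f : A m →ᵃ[ℝ] ℝ // f.linear (v m) = 1}

/-- The quotient of the special affine dual by the constant functions. -/
def SpecialDualQuot (m : M) : Type _ :=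
  Quot fun f g : SpecialDual A v m => ∃ c : ℝ, ∀ a, g.1 a = f.1 a + c

variable {A v} in
/-- The class of a special affine function modulo constants. -/
def SpecialDualQuot.mk {m : M} (f : SpecialDual A v m) : SpecialDualQuot A v m := Quot.mk _ f

/-- Smooth sections of `ζ : A → A / ⟨v_A⟩`; a map on `A / ⟨v_A⟩` is smooth if its composition with
the submersion `ζ` is. -/
structure AVSection where
  toFun : ∀ m, AffQuot A v m → A m
  mk_toFun : ∀ m y, AffQuot.mk v (toFun m y) = y
  smooth : ContMDiff (𝓘(ℝ, B).prod 𝓘(ℝ, F)) (𝓘(ℝ, B).prod 𝓘(ℝ, F)) ∞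
    fun x : TotalSpace F A => (⟨x.1, toFun x.1 (AffQuot.mk v x.2)⟩ : TotalSpace F A)

/-- The number `t` such that `u = t w` (where `w ≠ 0`). -/
def ratio {W : Type*} [AddCommGroup W] [Module ℝ W] (u w : W) : ℝ :=
  Classical.epsilon fun t : ℝ => u = t • w

variable {F A B v}

namespace AVSection

/-- The function `f_σ` on `A` with `f_σ(a) v_A = a - σ(ζ(a))`. -/
def fn (σ : AVSection F A B v) (x : TotalSpace F A) : ℝ :=
  ratio (x.2 -ᵥ σ.toFun x.1 (AffQuot.mk v x.2)) (v x.1)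

/-- The difference of two sections as a function on `A / ⟨v_A⟩` (pulled back to `A`); the
distinguished section of the rank one affine bundle `ζ` is `-v_A`. -/
def diff (σ σ' : AVSection F A B v) (x : TotalSpace F A) : ℝ :=
  ratio (σ.toFun x.1 (AffQuot.mk v x.2) -ᵥ σ'.toFun x.1 (AffQuot.mk v x.2)) (-v x.1)

/-- The section is affine on the fibres over `M`. -/
def IsAffine (σ : AVSection F A B v) : Prop :=
  ∀ m (a b : A m) (t : ℝ), σ.toFun m (AffQuot.mk v (AffineMap.lineMap b a t)) =
    AffineMap.lineMap (σ.toFun m (AffQuot.mk v b)) (σ.toFun m (AffQuot.mk v a)) t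

/-- `σ' = σ + g` for a function `g` on `M` (recall that `-v_A` is the distinguished section). -/
def IsAdd (σ : AVSection F A B v) (g : M → ℝ) (σ' : AVSection F A B v) : Prop :=
  ∀ m y, σ'.toFun m y = g m • (-v m) +ᵥ σ.toFun m y

end AVSection

variable (F A B v) in
/-- The affine phase bundle (its part over `m`): pairs of a point `y` of `A / ⟨v_A⟩` and a class of
sections of `ζ`, where two sections are equivalent if the differential of their difference vanishes
at `y`. (As `ζ` is a submersion, the differential is computed after pull-back to `A`.) -/
def Phase (m : M) : Type _ :=
  Σ y : AffQuot A v m, Quot fun σ σ' : AVSection F A B v => ∀ a : A m, AffQuot.mk v a = y →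
    mfderiv (𝓘(ℝ, B).prod 𝓘(ℝ, F)) 𝓘(ℝ, ℝ) (σ.diff σ') ⟨m, a⟩ = 0

/-- The affine differential of `σ` at `y`. -/
def AVSection.affDiff (σ : AVSection F A B v) (m : M) (y : AffQuot A v m) : Phase F A B v m :=
  ⟨y, Quot.mk _ σ⟩

variable (F A B v) in
/-- Adapted local coordinates for a special affine bundle: a chart of `M` and a smooth affine
trivialization `A m ≃ K × ℝ` over an open set, in which `v_A` is the constant `(0, 1)`. (All fibres
of `A` are isomorphic; only the values of `triv` over `dom` are relevant.) -/
structure AdaptedChart (K : Type*) [NormedAddCommGroup K] [NormedSpace ℝ K] where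
  dom : TopologicalSpace.Opens M
  base : OpenPartialHomeomorph M B
  base_mem : base ∈ IsManifold.maximalAtlas 𝓘(ℝ, B) ∞ M
  dom_subset : (dom : Set M) ⊆ base.source
  triv : ∀ m, A m ≃ᵃ[ℝ] K × ℝ
  triv_special : ∀ m ∈ dom, (triv m).linear (v m) = (0, 1)
  smooth : ContMDiffOn (𝓘(ℝ, B).prod 𝓘(ℝ, F)) 𝓘(ℝ, K × ℝ) ∞
    (fun x : TotalSpace F A => triv x.1 x.2) {x | x.1 ∈ dom}
  smooth_symm : ContMDiffOn (𝓘(ℝ, B).prod 𝓘(ℝ, K × ℝ)) (𝓘(ℝ, B).prod 𝓘(ℝ, F)) ∞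
    (fun x : M × (K × ℝ) => (⟨x.1, (triv x.1).symm x.2⟩ : TotalSpace F A)) ((dom : Set M) ×ˢ univ)

variable {K : Type*} [NormedAddCommGroup K] [NormedSpace ℝ K]

/-- In adapted coordinates `(x, k, r)` one has `f_σ = r + g(x, k)`; this is the function `g`. -/
def AdaptedChart.localRep (κ : AdaptedChart F A B v K) (σ : AVSection F A B v) (p : B × K) : ℝ :=
  σ.fn ⟨κ.base.symm p.1, (κ.triv (κ.base.symm p.1)).symm (p.2, 0)⟩

/-- `χ` is the chart of the affine phase bundle induced by the adapted coordinates `κ`: if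
`f_σ = r + g(x, k)`, then the affine differential of `σ` at `(x, k)` has the coordinates `k`
(on `A / ⟨v_A⟩`), `∂g/∂k` (on the quotient of the special affine dual) and `∂g/∂x`. -/
def AdaptedChart.Induces (κ : AdaptedChart F A B v K)
    (χ : DoubleChart K (K →L[ℝ] ℝ) (B →L[ℝ] ℝ) (Phase F A B v) (AffQuot A v)
      (SpecialDualQuot A v)) : Prop :=
  χ.dom = κ.dom ∧ ∀ m ∈ κ.dom,
    (∀ a : A m, χ.fst m (AffQuot.mk v a) = (κ.triv m a).1) ∧
    (∀ (f : SpecialDual A v m) (k : K), χ.snd m (SpecialDualQuot.mk f) k =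
      f.1 ((κ.triv m).symm (k, 0)) - f.1 ((κ.triv m).symm (0, 0))) ∧
    ∀ (σ : AVSection F A B v) (a : A m), χ.core m (σ.affDiff m (AffQuot.mk v a)) =
      (fderiv ℝ (κ.localRep σ) (κ.base m, (κ.triv m a).1)).comp (ContinuousLinearMap.inl ℝ B K)

variable (F) in
/-- The model of the fibres of `A / ⟨v_A⟩`. -/
abbrev QuotModel : Type := EuclideanSpace ℝ (Fin (Module.finrank ℝ F - 1))

/-- `𝔓` is the canonical double affine bundle structure of the affine phase bundle. -/
structure IsPhaseBundle (𝔓 : DoubleAffineBundle B K (K →L[ℝ] ℝ) (B →L[ℝ] ℝ) (Phase F A B v)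
    (AffQuot A v) (SpecialDualQuot A v)) : Prop where
  affSide₁_eq : ∀ m (a b : A m) t, 𝔓.affSide₁ m (AffQuot.mk v a) (AffQuot.mk v b) t =
    AffQuot.mk v (AffineMap.lineMap b a t)
  affSide₂_eq : ∀ m (f g h : SpecialDual A v m) (t : ℝ),
    (∀ a, h.1 a = t * f.1 a + (1 - t) * g.1 a) →
    𝔓.affSide₂ m (SpecialDualQuot.mk f) (SpecialDualQuot.mk g) t = SpecialDualQuot.mk h
  pr₁_eq : ∀ m (η : Phase F A B v m), 𝔓.pr₁ m η = η.1
  /-- an affine differential of an affine section `σ` is projected to the class of `f_σ` -/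
  pr₂_eq : ∀ m (σ : AVSection F A B v) (y : AffQuot A v m) (f : SpecialDual A v m), σ.IsAffine →
    (∀ a, f.1 a = σ.fn ⟨m, a⟩) → 𝔓.pr₂ m (σ.affDiff m y) = SpecialDualQuot.mk f
  aff₁_eq : ∀ m (y : AffQuot A v m) (σ σ' σ'' : AVSection F A B v) (t : ℝ),
    (∀ x z, σ''.toFun x z = AffineMap.lineMap (σ'.toFun x z) (σ.toFun x z) t) →
    𝔓.aff₁ m (σ.affDiff m y) (σ'.affDiff m y) t = σ''.affDiff m y
  /-- if `σ` is affine and `g`, `g'` are functions on `M`, then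
  `aff₂ (d_y (σ + g)) (d_y' (σ + g')) t = d_y'' (σ + t g + (1 - t) g')`, where
  `y'' = t y + (1 - t) y'` -/
  aff₂_eq : ∀ m (y y' : AffQuot A v m) (σ σ₁ σ₂ σ₃ : AVSection F A B v) (g g' : M → ℝ) (t : ℝ),
    σ.IsAffine → ContMDiff 𝓘(ℝ, B) 𝓘(ℝ, ℝ) ∞ g → ContMDiff 𝓘(ℝ, B) 𝓘(ℝ, ℝ) ∞ g' →
    σ.IsAdd g σ₁ → σ.IsAdd g' σ₂ → σ.IsAdd (fun x => t * g x + (1 - t) * g' x) σ₃ →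
    𝔓.aff₂ m (σ₁.affDiff m y) (σ₂.affDiff m y') t = σ₃.affDiff m (𝔓.affSide₁ m y y' t)
  charts_eq : 𝔓.charts = {χ | ∃ κ : AdaptedChart F A B v K, κ.Induces χ}

end Phase

/-! ### The reduced double vector bundle and the canonical isomorphism -/

section Reduction

variable {F : Type*} [NormedAddCommGroup F] [NormedSpace ℝ F] [FiniteDimensional ℝ F]
  {M : Type*} [TopologicalSpace M]
  {V : M → Type*} [∀ m, AddCommGroup (V m)] [∀ m, Module ℝ (V m)]
  {A : M → Type*} [∀ m, AddTorsor (V m) (A m)]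
  [∀ m, TopologicalSpace (A m)] [TopologicalSpace (TotalSpace F A)] [FiberBundle F A]
  {B : Type*} [NormedAddCommGroup B] [NormedSpace ℝ B]
  [ChartedSpace B M] [IsManifold 𝓘(ℝ, B) ∞ M] [SmoothAffineBundle F V A B] {v : ∀ m, V m}
  {K₁ K₂ K : Type*} [NormedAddCommGroup K₁] [NormedSpace ℝ K₁] [NormedAddCommGroup K₂]
  [NormedSpace ℝ K₂] [NormedAddCommGroup K] [NormedSpace ℝ K]

/-- The double vector bundle structure `𝒬` on the orbit space is inherited from
`(T*E; E, E*; M)`: the orbit projection is a smooth submersion and a morphism of double vector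
bundles over the projections `E → E / ⟨v_A⟩` and `E* → E* / ⟨α_A⟩`. -/
structure IsInherited (𝒬 : DoubleVectorBundle B K₁ K₂ K (OrbitSpace F A B v) (HullQuot V A v)
    (DualQuot V A)) : Prop where
  pr₁_orbit : ∀ m w η, 𝒬.pr₁ m (orbit F A B v m w η) = Submodule.Quotient.mk w
  pr₂_orbit : ∀ m w η, 𝒬.pr₂ m (orbit F A B v m w η) = Submodule.Quotient.mk (vert F V B m w η)
  add₁_orbit : ∀ m w η η', 𝒬.add₁ m (orbit F A B v m w η) (orbit F A B v m w η') =
    orbit F A B v m w (η + η')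
  smul₁_orbit : ∀ m t w η, 𝒬.smul₁ m t (orbit F A B v m w η) = orbit F A B v m w (t • η)
  add₂_orbit : ∀ m w w' η η', vert F V B m w η = vert F V B m w' η' →
    𝒬.add₂ m (orbit F A B v m w η) (orbit F A B v m w' η') =
      orbit F A B v m (w + w') (cotAdd F V B m w w' η η')
  smul₂_orbit : ∀ m t w η, 𝒬.smul₂ m t (orbit F A B v m w η) =
    orbit F A B v m (t • w) (cotSmul F V B m t w η)
  smooth : ∀ χ ∈ 𝒬.charts, ContMDiffOn (cotangentModel F B) 𝓘(ℝ, K₁ × K₂ × K) ∞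
    (fun x : CotangentBundle F V A B =>
      χ.coord 𝒬.pr₁ 𝒬.pr₂ x.1.1 (orbit F A B v x.1.1 x.1.2 x.2)) {x | x.1.1 ∈ χ.dom}
  submersion : ∀ χ ∈ 𝒬.charts, ∀ x : CotangentBundle F V A B, x.1.1 ∈ χ.dom →
    Function.Surjective (mfderiv (cotangentModel F B) (𝓘(ℝ, B).prod 𝓘(ℝ, K₁ × K₂ × K))
      (fun x : CotangentBundle F V A B =>
        (x.1.1, χ.coord 𝒬.pr₁ 𝒬.pr₂ x.1.1 (orbit F A B v x.1.1 x.1.2 x.2))) x)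

/-- The isomorphism `Φ` from the orbit space to the double vector hull of the affine phase bundle is
the canonical one: on the side bundles it is induced by the inclusions of `A` in `E` and of the
special affine dual of `A` in `E*`, and a covector `η` of `E` at a point `a ∈ A`
whose restriction to `A` is `d_a f_σ` is sent to the affine differential of `σ`. -/
structure IsCanonical {𝒬 : DoubleVectorBundle B K₁ K₂ K (OrbitSpace F A B v) (HullQuot V A v)
      (DualQuot V A)} {L₁ L₂ L : Type*} [NormedAddCommGroup L₁] [NormedSpace ℝ L₁]
    [NormedAddCommGroup L₂] [NormedSpace ℝ L₂] [NormedAddCommGroup L] [NormedSpace ℝ L]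
    {𝔓 : DoubleAffineBundle B L₁ L₂ L (Phase F A B v) (AffQuot A v) (SpecialDualQuot A v)}
    {ℋ : DoubleVectorBundle B (L₁ × ℝ) (L₂ × ℝ) L 𝔓.DoubleHull 𝔓.Hull₁ 𝔓.Hull₂}
    (Φ : DoubleVectorBundle.Iso 𝒬 ℋ) : Prop where
  side₁_of : ∀ m (a : A m), Φ.side₁ m (Submodule.Quotient.mk (Hull.of V a)) =
    VectorHull.of _ (AffQuot.mk v a)
  side₂_extend : ∀ m (f : SpecialDual A v m), Φ.side₂ m (Submodule.Quotient.mk (Hull.extend f.1)) =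
    VectorHull.of _ (SpecialDualQuot.mk f)
  total_orbit : ∀ m (a : A m) (η : HullTangent F V A B m (Hull.of V a) →L[ℝ] ℝ)
    (σ : AVSection F A B v),
    η.comp (mfderiv (𝓘(ℝ, B).prod 𝓘(ℝ, F)) (hullModel F B)
      (fun x : TotalSpace F A => (⟨x.1, Hull.of V x.2⟩ : HullTotal F V A)) ⟨m, a⟩) =
      mfderiv (𝓘(ℝ, B).prod 𝓘(ℝ, F)) 𝓘(ℝ, ℝ) σ.fn ⟨m, a⟩ →
    Φ.total m (orbit F A B v m (Hull.of V a) η) =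
      𝔓.ofPoint m (σ.affDiff m (AffQuot.mk v a))

end Reduction

end DoubleAffine

end

open DoubleAffine

noncomputable section

namespace DoubleAffine

/-! ### Vector hulls in linear coordinates -/

section HullOfBijective

variable {P W : Type*} [AddCommGroup W] [Module ℝ W] {comb : P → P → ℝ → P → Prop}

/-! Over an adapted chart the hull E has fibre coordinates (k, r, s): k and r extend the coordinates
of A linearly, s is α_A, and v_A is the unit vector of r. Let (p, π_k, π_r, π_s) be the dual
components of a covector. The action of two real parameters adds the first one to r and the second
one to π_s, and fixes everything else (`hullCoord_orbitAction`, `covCoord_orbitAction`). An orbit is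
therefore the same thing as a triple ((k, s), (π_k, π_r), p), where (k, s) are coordinates on E /
⟨v_A⟩, (π_k, π_r) are coordinates on E* / ⟨α_A⟩, and p is the core coordinate (`orbit_ext`,
`orbitMk_coord`).

Inside E the bundle A is the hyperplane s = 1. If f_σ = r + ψ(x, k), a covector at a point of A that
restricts to d f_σ has π_r = 1, π_k = ∂ψ/∂k and p = ∂ψ/∂x; the component π_s is arbitrary and is
forgotten by the orbit (`orbit_of_restrict`). So the orbits with s = π_r = 1 are the points of PA,
with the same coordinates. The double vector hull contains PA in the same way, over weight one on
both sides.

The passage from this slice to everything is algebraic: a map h(a, b, c) that is linear in (a, c)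
and linear in (b, c) is determined by its values for a and b in affine hyperplanes off the origin
(`IsDoubleLinear.eq_of_slice`). Applied to the changes of the core coordinate of the orbit space and
of the double hull, this shows that they coincide (`orbitCore_orbitMk_eq`); hence the identity in
coordinates does not depend on the chart, and it is Φ. Applied to two canonical isomorphisms it
gives uniqueness (`eq_canonicalIso`).

Three constructions support this. The phase bundle PA has transition maps J ↦ (J + dr) ∘ DT, with T
the change of adapted coordinates along r' = 0 (`jet_trans`); since T is affine in k, the two affine
structures are independent of the chart, and a partition of unity realises every jet by a global
section (`exists_section_with_jet`). The double hull gets coordinates by computing two successive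
hulls as products with ℝ (`vertEquiv`, `dblEquiv`), and its transition maps are explicit expressions
in those of PA (`slice_expand`), hence smooth. Finally the structure of the orbit space is
transported from the double hull; it agrees with the operations on covectors because these are
componentwise in adapted coordinates (`covCoord_cotAdd`), and the orbit projection is a submersion
because it has smooth local right inverses through every covector (`orbitSection_reducedCoord`). -/

theorem affine_prodMk_one {φ : P → W}
    (h : ∀ a b t c, comb a b t c ↔ φ c = t • φ a + (1 - t) • φ b) (a b : P) (t : ℝ) (c : P)
    (hc : comb a b t c) : (φ c, (1 : ℝ)) = t • (φ a, (1 : ℝ)) + (1 - t) • (φ b, (1 : ℝ)) := by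
  ext
  · exact (h a b t c).1 hc
  · simp

/-- A bijection `P → W` that turns the affine combinations of `P` into those of a vector space `W`
induces a linear isomorphism from the hull of `P` to `W × ℝ`. -/
def hullEquivOfBijective (φ : P → W) (hφ : Function.Bijective φ)
    (h : ∀ a b t c, comb a b t c ↔ φ c = t • φ a + (1 - t) • φ b) :
    VectorHull comb ≃ₗ[ℝ] W × ℝ :=
  let F : VectorHull comb →ₗ[ℝ] W × ℝ :=
    VectorHull.lift (fun a => (φ a, (1 : ℝ))) (affine_prodMk_one h)
  -- The inverse bijection induces a map from the hull of `W`, regarded as an affine space over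
  -- itself; that hull is already identified with `W × ℝ` by `hullEquiv`.
  let G : VectorHull (affComb W (A := W)) →ₗ[ℝ] VectorHull comb :=
    VectorHull.map (Equiv.ofBijective φ hφ).symm (by
      intro a b t c hc
      rw [h]
      have e := fun x => (Equiv.ofBijective φ hφ).apply_symm_apply x
      simp only [Equiv.ofBijective_apply] at e
      rw [e, e, e, hc, AffineMap.lineMap_apply_module]
      abel)
  LinearEquiv.ofLinearMap F (G ∘ₗ (hullEquiv (V := W) (AffineEquiv.refl ℝ W)).symm.toLinearMap)
    (by
      have : F ∘ₗ G = (hullEquiv (V := W) (AffineEquiv.refl ℝ W)).toLinearMap := by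
        apply VectorHull.hom_ext
        intro a
        have e := (Equiv.ofBijective φ hφ).apply_symm_apply a
        simp only [Equiv.ofBijective_apply] at e
        simp [F, G, VectorHull.map, e]
      rw [← LinearMap.comp_assoc, this]
      ext x <;> simp)
    (by
      apply VectorHull.hom_ext
      intro a
      have h1 : (hullEquiv (V := W) (AffineEquiv.refl ℝ W)).symm (φ a, 1) =
          VectorHull.of _ (φ a) := by
        rw [LinearEquiv.symm_apply_eq, hullEquiv_of]; rfl
      have e := (Equiv.ofBijective φ hφ).symm_apply_apply a
      simp only [Equiv.ofBijective_apply] at e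
      simp [F, G, h1, VectorHull.map, e])

@[simp] theorem hullEquivOfBijective_of (φ : P → W) (hφ : Function.Bijective φ)
    (h : ∀ a b t c, comb a b t c ↔ φ c = t • φ a + (1 - t) • φ b) (a : P) :
    hullEquivOfBijective φ hφ h (VectorHull.of _ a) = (φ a, 1) :=
  VectorHull.lift_of _ (affine_prodMk_one h) a

@[simp] theorem VectorHull.map_of {P' : Type*} {comb' : P' → P' → ℝ → P' → Prop} (f : P → P')
    (hf : ∀ a b t c, comb a b t c → comb' (f a) (f b) t (f c)) (a : P) :
    VectorHull.map f hf (VectorHull.of comb a) = VectorHull.of comb' (f a) :=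
  VectorHull.lift_of _ _ a

end HullOfBijective

/-! ### The double vector hull of a double affine bundle -/

namespace DoubleAffineBundle

section Algebra

variable {M : Type*} [TopologicalSpace M] {B : Type*} [NormedAddCommGroup B] [NormedSpace ℝ B]
  [ChartedSpace B M]
  {K₁ K₂ K : Type*} [NormedAddCommGroup K₁] [NormedSpace ℝ K₁] [NormedAddCommGroup K₂]
  [NormedSpace ℝ K₂] [NormedAddCommGroup K] [NormedSpace ℝ K]
  {D D₁ D₂ : M → Type*} (𝒜 : DoubleAffineBundle B K₁ K₂ K D D₁ D₂)

theorem coord_inj {χ : DoubleChart K₁ K₂ K D D₁ D₂} (hχ : χ ∈ 𝒜.charts) {m : M}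
    (hm : m ∈ χ.dom) {d d' : D m} (h₁ : 𝒜.pr₁ m d = 𝒜.pr₁ m d') (h₂ : 𝒜.pr₂ m d = 𝒜.pr₂ m d')
    (h₃ : χ.core m d = χ.core m d') : d = d' := by
  apply (𝒜.coord_bijective χ hχ m hm).1
  simp [DoubleChart.coord, h₁, h₂, h₃]

theorem exists_point {χ : DoubleChart K₁ K₂ K D D₁ D₂} (hχ : χ ∈ 𝒜.charts) {m : M}
    (hm : m ∈ χ.dom) (a : D₁ m) (b : D₂ m) (c : K) :
    ∃ d, 𝒜.pr₁ m d = a ∧ 𝒜.pr₂ m d = b ∧ χ.core m d = c := by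
  obtain ⟨d, hd⟩ := (𝒜.coord_bijective χ hχ m hm).2 (χ.fst m a, χ.snd m b, c)
  simp only [DoubleChart.coord, Prod.mk.injEq] at hd
  exact ⟨d, (𝒜.fst_bijective χ hχ m hm).1 hd.1, (𝒜.snd_bijective χ hχ m hm).1 hd.2.1, hd.2.2⟩

/-- The linear extension of the first side coordinate. -/
def hullFst {χ : DoubleChart K₁ K₂ K D D₁ D₂} (hχ : χ ∈ 𝒜.charts) {m : M} (hm : m ∈ χ.dom) :
    𝒜.Hull₁ m ≃ₗ[ℝ] K₁ × ℝ :=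
  hullEquivOfBijective (χ.fst m) (𝒜.fst_bijective χ hχ m hm) (fun a b t c => by
    rw [← 𝒜.fst_aff χ hχ m hm]; exact (𝒜.fst_bijective χ hχ m hm).1.eq_iff.symm)

/-- The linear extension of the second side coordinate. -/
def hullSnd {χ : DoubleChart K₁ K₂ K D D₁ D₂} (hχ : χ ∈ 𝒜.charts) {m : M} (hm : m ∈ χ.dom) :
    𝒜.Hull₂ m ≃ₗ[ℝ] K₂ × ℝ :=
  hullEquivOfBijective (χ.snd m) (𝒜.snd_bijective χ hχ m hm) (fun a b t c => by
    rw [← 𝒜.snd_aff χ hχ m hm]; exact (𝒜.snd_bijective χ hχ m hm).1.eq_iff.symm)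

/-- The coordinates of the vector hull of a fibre of `pr₁`. -/
def vertEquiv {χ : DoubleChart K₁ K₂ K D D₁ D₂} (hχ : χ ∈ 𝒜.charts) {m : M} (hm : m ∈ χ.dom)
    (a : D₁ m) : 𝒜.VertFiber m a ≃ₗ[ℝ] (K₂ × K) × ℝ :=
  hullEquivOfBijective (fun p => (χ.snd m (𝒜.pr₂ m p.1), χ.core m p.1))
    (by
      constructor
      · intro p q h
        simp only [Prod.mk.injEq] at h
        exact Subtype.ext (𝒜.coord_inj hχ hm (p.2.trans q.2.symm)
          ((𝒜.snd_bijective χ hχ m hm).1 h.1) h.2)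
      · rintro ⟨k, c⟩
        obtain ⟨b, rfl⟩ := (𝒜.snd_bijective χ hχ m hm).2 k
        obtain ⟨d, h₁, h₂, h₃⟩ := 𝒜.exists_point hχ hm a b c
        exact ⟨⟨d, h₁⟩, by simp [h₂, h₃]⟩)
    (fun p q t r => by
      have hpq := p.2.trans q.2.symm
      have e : t • (χ.snd m (𝒜.pr₂ m p.1), χ.core m p.1) +
          (1 - t) • (χ.snd m (𝒜.pr₂ m q.1), χ.core m q.1) =
          (χ.snd m (𝒜.pr₂ m (𝒜.aff₁ m p.1 q.1 t)), χ.core m (𝒜.aff₁ m p.1 q.1 t)) := by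
        rw [𝒜.pr₂_aff₁ m _ _ _ hpq, 𝒜.snd_aff χ hχ m hm, 𝒜.core_aff₁ χ hχ m hm _ _ _ hpq]; rfl
      rw [e]
      constructor
      · intro h; rw [h]
      · intro h
        simp only [Prod.mk.injEq] at h
        exact 𝒜.coord_inj hχ hm ((r.2.trans p.2.symm).trans (𝒜.pr₁_aff₁ m _ _ _ hpq).symm)
          ((𝒜.snd_bijective χ hχ m hm).1 h.1) h.2)

variable {χ : DoubleChart K₁ K₂ K D D₁ D₂} (hχ : χ ∈ 𝒜.charts) {m : M} (hm : m ∈ χ.dom)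

@[simp] theorem hullFst_of (a : D₁ m) :
    𝒜.hullFst hχ hm (VectorHull.of _ a) = (χ.fst m a, 1) := hullEquivOfBijective_of _ _ _ a

@[simp] theorem hullSnd_of (a : D₂ m) :
    𝒜.hullSnd hχ hm (VectorHull.of _ a) = (χ.snd m a, 1) := hullEquivOfBijective_of _ _ _ a

@[simp] theorem vertEquiv_of (a : D₁ m) (p : {d : D m // 𝒜.pr₁ m d = a}) :
    𝒜.vertEquiv hχ hm a (VectorHull.of _ p) = ((χ.snd m (𝒜.pr₂ m p.1), χ.core m p.1), 1) :=
  hullEquivOfBijective_of _ _ _ p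

/-- `vertProj` restricted to a fibre, as a linear map -/
def vertProjLin (a : D₁ m) : 𝒜.VertFiber m a →ₗ[ℝ] 𝒜.Hull₂ m :=
  VectorHull.map (fun p : {d : D m // 𝒜.pr₁ m d = a} => 𝒜.pr₂ m p.1)
    (fun p q t r h => by rw [h, 𝒜.pr₂_aff₁ m _ _ _ (p.2.trans q.2.symm)])

/-- Both sides are linear in the fibre component, so it is enough to compare them on points of `D`,
which have weight 1. -/
theorem hullSnd_vertProj (X : 𝒜.VertHull m) : 𝒜.hullSnd hχ hm (𝒜.vertProj m X) =
    ((𝒜.vertEquiv hχ hm X.1 X.2).1.1, (𝒜.vertEquiv hχ hm X.1 X.2).2) := by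
  obtain ⟨a, x⟩ := X
  let L : (K₂ × K) × ℝ →ₗ[ℝ] K₂ × ℝ := (LinearMap.fst ℝ K₂ K).prodMap LinearMap.id
  have : (𝒜.hullSnd hχ hm).toLinearMap ∘ₗ 𝒜.vertProjLin a =
      L ∘ₗ (𝒜.vertEquiv hχ hm a).toLinearMap := by
    apply VectorHull.hom_ext
    intro p
    simp [vertProjLin, L]
  exact LinearMap.congr_fun this x

/-- The core coordinate on the vector hull of `pr₁`. -/
def vertCore (X : 𝒜.VertHull m) : K := (𝒜.vertEquiv hχ hm X.1 X.2).1.2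

theorem vertEquiv_eq (X : 𝒜.VertHull m) : 𝒜.vertEquiv hχ hm X.1 X.2 =
    (((𝒜.hullSnd hχ hm (𝒜.vertProj m X)).1, 𝒜.vertCore hχ hm X),
      (𝒜.hullSnd hχ hm (𝒜.vertProj m X)).2) := by
  rw [hullSnd_vertProj]; rfl

theorem vertHull_ext {X Y : 𝒜.VertHull m} (h₁ : X.1 = Y.1)
    (h₂ : 𝒜.vertProj m X = 𝒜.vertProj m Y) (h₃ : 𝒜.vertCore hχ hm X = 𝒜.vertCore hχ hm Y) :
    X = Y := by
  have := 𝒜.vertEquiv_eq hχ hm X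
  rw [h₂, h₃, ← 𝒜.vertEquiv_eq hχ hm Y] at this
  obtain ⟨a, x⟩ := X
  obtain ⟨b, y⟩ := Y
  obtain rfl : a = b := h₁
  exact congrArg (Sigma.mk a) ((𝒜.vertEquiv hχ hm a).injective this)

theorem exists_vertHull (a : D₁ m) (b : 𝒜.Hull₂ m) (c : K) :
    ∃ X : 𝒜.VertHull m, X.1 = a ∧ 𝒜.vertProj m X = b ∧ 𝒜.vertCore hχ hm X = c := by
  refine ⟨⟨a, (𝒜.vertEquiv hχ hm a).symm
    (((𝒜.hullSnd hχ hm b).1, c), (𝒜.hullSnd hχ hm b).2)⟩, rfl, ?_, ?_⟩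
  · apply (𝒜.hullSnd hχ hm).injective
    rw [hullSnd_vertProj]
    simp
  · simp [vertCore]

/-- `VertAff` only asks for some simultaneous presentation of X, Y and Z; this turns it into a
condition on coordinates and so makes Z unique. In one direction the linear core coordinate is
applied to the presentation. In the other, two terms suffice, because an element of the hull of an
affine space is a point plus a multiple of another point. -/
theorem vertAff_iff (X Y Z : 𝒜.VertHull m) (t : ℝ) (hXY : 𝒜.vertProj m X = 𝒜.vertProj m Y)
    (hXZ : 𝒜.vertProj m X = 𝒜.vertProj m Z) :
    𝒜.VertAff m X Y t Z ↔ Z.1 = 𝒜.affSide₁ m X.1 Y.1 t ∧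
      𝒜.vertCore hχ hm Z = t • 𝒜.vertCore hχ hm X + (1 - t) • 𝒜.vertCore hχ hm Y := by
  constructor
  · rintro ⟨h, n, s, p, q, r, hpq, hX, hY, hZ⟩
    refine ⟨h, ?_⟩
    simp only [vertCore, hX, hY, hZ, map_sum, map_smul, vertEquiv_of, Prod.fst_sum, Prod.snd_sum,
      Prod.smul_fst, Prod.smul_snd, Finset.smul_sum, ← Finset.sum_add_distrib]
    refine Finset.sum_congr rfl fun i _ => ?_
    rw [(hpq i).2, 𝒜.core_aff₂ χ hχ m hm _ _ _ (hpq i).1]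
    module
  · rintro ⟨h, hc⟩
    refine ⟨h, ?_⟩
    set β := 𝒜.hullSnd hχ hm (𝒜.vertProj m X) with hβ
    obtain ⟨b, hb⟩ := (𝒜.snd_bijective χ hχ m hm).2 β.1
    obtain ⟨b₀, hb₀⟩ := (𝒜.snd_bijective χ hχ m hm).2 0
    -- The weights 1 and `β.2 - 1` add up to the weight `β.2` of the common projection. The first
    -- point carries the coordinate `β.1` and the whole core; the second lies over the origin `b₀`
    -- of the chart with core 0 and only corrects the weight.
    have key : ∀ W : 𝒜.VertHull m, 𝒜.vertProj m W = 𝒜.vertProj m X →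
        ∃ p : Fin 2 → {d : D m // 𝒜.pr₁ m d = W.1}, 𝒜.pr₂ m (p 0).1 = b ∧ 𝒜.pr₂ m (p 1).1 = b₀ ∧
          χ.core m (p 0).1 = 𝒜.vertCore hχ hm W ∧ χ.core m (p 1).1 = 0 ∧
          W.2 = ∑ i, (![1, β.2 - 1] : Fin 2 → ℝ) i • VectorHull.of _ (p i) := by
      intro W hW
      obtain ⟨d, h₁, h₂, h₃⟩ := 𝒜.exists_point hχ hm W.1 b (𝒜.vertCore hχ hm W)
      obtain ⟨d', h₁', h₂', h₃'⟩ := 𝒜.exists_point hχ hm W.1 b₀ 0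
      refine ⟨![⟨d, h₁⟩, ⟨d', h₁'⟩], h₂, h₂', h₃, h₃', ?_⟩
      apply (𝒜.vertEquiv hχ hm W.1).injective
      rw [𝒜.vertEquiv_eq hχ hm W, hW, ← hβ]
      simp [Fin.sum_univ_two, h₂, h₂', h₃, h₃', hb, hb₀]
    obtain ⟨p, p₁, p₂, p₃, p₄, p₅⟩ := key X rfl
    obtain ⟨q, q₁, q₂, q₃, q₄, q₅⟩ := key Y hXY.symm
    obtain ⟨r, r₁, r₂, r₃, r₄, r₅⟩ := key Z hXZ.symm
    refine ⟨2, _, p, q, r, ?_, p₅, q₅, r₅⟩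
    have e : ∀ i, 𝒜.pr₂ m (p i).1 = 𝒜.pr₂ m (q i).1 ∧ 𝒜.pr₂ m (p i).1 = 𝒜.pr₂ m (r i).1 ∧
        χ.core m (r i).1 = t • χ.core m (p i).1 + (1 - t) • χ.core m (q i).1 := by
      intro i
      fin_cases i
      · simp [p₁, q₁, r₁, p₃, q₃, r₃, hc]
      · simp [p₂, q₂, r₂, p₄, q₄, r₄]
    intro i
    obtain ⟨e₁, e₂, e₃⟩ := e i
    refine ⟨e₁, 𝒜.coord_inj hχ hm ?_ ?_ ?_⟩
    · rw [𝒜.pr₁_aff₂ m _ _ _ e₁, (r i).2, (p i).2, (q i).2, h]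
    · rw [𝒜.pr₂_aff₂ m _ _ _ e₁, e₂]
    · rw [e₃, 𝒜.core_aff₂ χ hχ m hm _ _ _ e₁]

/-- The coordinates of a fibre of the double vector hull over the hull of `D₂`. -/
def dblEquiv (b : 𝒜.Hull₂ m) : 𝒜.DoubleHullFiber m b ≃ₗ[ℝ] (K₁ × K) × ℝ :=
  hullEquivOfBijective (fun X => (χ.fst m X.1.1, 𝒜.vertCore hχ hm X.1))
    (by
      constructor
      · intro X Y h
        simp only [Prod.mk.injEq] at h
        exact Subtype.ext (𝒜.vertHull_ext hχ hm ((𝒜.fst_bijective χ hχ m hm).1 h.1)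
          (X.2.trans Y.2.symm) h.2)
      · rintro ⟨k, c⟩
        obtain ⟨a, rfl⟩ := (𝒜.fst_bijective χ hχ m hm).2 k
        obtain ⟨X, h₁, h₂, h₃⟩ := 𝒜.exists_vertHull hχ hm a b c
        exact ⟨⟨X, h₂⟩, by simp [h₁, h₃]⟩)
    (fun X Y t Z => by
      rw [𝒜.vertAff_iff hχ hm _ _ _ _ (X.2.trans Y.2.symm) (X.2.trans Z.2.symm),
        ← (𝒜.fst_bijective χ hχ m hm).1.eq_iff, 𝒜.fst_aff χ hχ m hm, Prod.ext_iff]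
      rfl)

@[simp] theorem dblEquiv_of (b : 𝒜.Hull₂ m) (X : {X : 𝒜.VertHull m // 𝒜.vertProj m X = b}) :
    𝒜.dblEquiv hχ hm b (VectorHull.of _ X) = ((χ.fst m X.1.1, 𝒜.vertCore hχ hm X.1), 1) :=
  hullEquivOfBijective_of _ _ _ X

/-- `doubleHullProj` restricted to a fibre, as a linear map -/
def doubleHullProjLin (b : 𝒜.Hull₂ m) : 𝒜.DoubleHullFiber m b →ₗ[ℝ] 𝒜.Hull₁ m :=
  VectorHull.map (fun X : {X : 𝒜.VertHull m // 𝒜.vertProj m X = b} => X.1.1)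
    (fun _ _ _ _ h => h.1)

theorem hullFst_doubleHullProj (Ξ : 𝒜.DoubleHull m) : 𝒜.hullFst hχ hm (𝒜.doubleHullProj m Ξ) =
    ((𝒜.dblEquiv hχ hm Ξ.1 Ξ.2).1.1, (𝒜.dblEquiv hχ hm Ξ.1 Ξ.2).2) := by
  obtain ⟨b, x⟩ := Ξ
  let L : (K₁ × K) × ℝ →ₗ[ℝ] K₁ × ℝ := (LinearMap.fst ℝ K₁ K).prodMap LinearMap.id
  have : (𝒜.hullFst hχ hm).toLinearMap ∘ₗ 𝒜.doubleHullProjLin b =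
      L ∘ₗ (𝒜.dblEquiv hχ hm b).toLinearMap := by
    apply VectorHull.hom_ext
    intro p
    simp [doubleHullProjLin, L]
  exact LinearMap.congr_fun this x

/-- The core coordinate on the double vector hull. -/
def dblCore (Ξ : 𝒜.DoubleHull m) : K := (𝒜.dblEquiv hχ hm Ξ.1 Ξ.2).1.2

theorem dblEquiv_eq (Ξ : 𝒜.DoubleHull m) : 𝒜.dblEquiv hχ hm Ξ.1 Ξ.2 =
    (((𝒜.hullFst hχ hm (𝒜.doubleHullProj m Ξ)).1, 𝒜.dblCore hχ hm Ξ),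
      (𝒜.hullFst hχ hm (𝒜.doubleHullProj m Ξ)).2) := by
  rw [hullFst_doubleHullProj]; rfl

theorem doubleHull_ext {X Y : 𝒜.DoubleHull m} (h₁ : 𝒜.doubleHullProj m X = 𝒜.doubleHullProj m Y)
    (h₂ : X.1 = Y.1) (h₃ : 𝒜.dblCore hχ hm X = 𝒜.dblCore hχ hm Y) : X = Y := by
  have := 𝒜.dblEquiv_eq hχ hm X
  rw [h₁, h₃, ← 𝒜.dblEquiv_eq hχ hm Y] at this
  obtain ⟨a, x⟩ := X
  obtain ⟨b, y⟩ := Y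
  obtain rfl : a = b := h₂
  exact congrArg (Sigma.mk a) ((𝒜.dblEquiv hχ hm a).injective this)

theorem doubleHullProj_ofVert (X : 𝒜.VertHull m) :
    𝒜.doubleHullProj m (𝒜.ofVert m X) = VectorHull.of _ X.1 := VectorHull.map_of _ _ _

theorem dblCore_ofVert (X : 𝒜.VertHull m) :
    𝒜.dblCore hχ hm (𝒜.ofVert m X) = 𝒜.vertCore hχ hm X :=
  congrArg (fun p => p.1.2) (𝒜.dblEquiv_of hχ hm _ ⟨X, rfl⟩)

theorem doubleHullProj_ofPoint (d : D m) :
    𝒜.doubleHullProj m (𝒜.ofPoint m d) = VectorHull.of _ (𝒜.pr₁ m d) :=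
  𝒜.doubleHullProj_ofVert _

theorem ofPoint_fst (d : D m) : (𝒜.ofPoint m d).1 = VectorHull.of _ (𝒜.pr₂ m d) :=
  VectorHull.map_of _ _ _

theorem dblCore_ofPoint (d : D m) : 𝒜.dblCore hχ hm (𝒜.ofPoint m d) = χ.core m d := by
  rw [ofPoint, dblCore_ofVert]
  simp [vertCore]

end Algebra

end DoubleAffineBundle

/-! ### Maps that are linear in two directions, and affine hyperplanes -/

section Slice

variable {X₁ X₂ Y Z : Type*} [AddCommGroup X₁] [Module ℝ X₁]
  [AddCommGroup Y] [Module ℝ Y] [AddCommGroup Z] [Module ℝ Z]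

/-- The variables x₁ and y are linear only jointly; all of y is put in the first summand, so the
correction term carries 0. -/
theorem expand_left {h : X₁ → X₂ → Y → Z} {x₂ : X₂}
    (hl : IsLinearMap ℝ fun p : X₁ × Y => h p.1 x₂ p.2) (x e : X₁) (t : ℝ) (y : Y) :
    h (x + t • e) x₂ y = h x x₂ y + t • h e x₂ 0 := by
  have h₁ := hl.map_add (x, y) (t • (e, 0))
  have h₂ := hl.map_smul t (e, (0 : Y))
  simp only [Prod.fst_add, Prod.snd_add, Prod.smul_fst, Prod.smul_snd, smul_zero, add_zero]
    at h₁ h₂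
  rw [h₁, h₂]

theorem expand_right {X₁ X₂ : Type*} [AddCommGroup X₂] [Module ℝ X₂] {h : X₁ → X₂ → Y → Z} {x₁ : X₁}
    (hr : IsLinearMap ℝ fun p : X₂ × Y => h x₁ p.1 p.2) (x e : X₂) (t : ℝ) (y : Y) :
    h x₁ (x + t • e) y = h x₁ x y + t • h x₁ e 0 :=
  expand_left (h := fun a b c => h b a c) hr x e t y

variable [AddCommGroup X₂] [Module ℝ X₂]

/-- A map that is linear in `(x₁, y)` and in `(x₂, y)`. -/
structure IsDoubleLinear (h : X₁ → X₂ → Y → Z) : Prop where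
  left : ∀ x₂, IsLinearMap ℝ fun p : X₁ × Y => h p.1 x₂ p.2
  right : ∀ x₁, IsLinearMap ℝ fun p : X₂ × Y => h x₁ p.1 p.2

/-- Every vector x is a combination of two vectors of the hyperplane l = 1, namely x + (1 - l x) e
and e. Expanding in one variable at a time reduces everything to the slice. Both the existence and
the uniqueness of Φ rest on this. -/
theorem IsDoubleLinear.eq_of_slice {h h' : X₁ → X₂ → Y → Z} (H : IsDoubleLinear h)
    (H' : IsDoubleLinear h') (l₁ : X₁ →ₗ[ℝ] ℝ) (l₂ : X₂ →ₗ[ℝ] ℝ) {e₁ : X₁} {e₂ : X₂}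
    (h₁ : l₁ e₁ = 1) (h₂ : l₂ e₂ = 1)
    (heq : ∀ x₁ x₂ y, l₁ x₁ = 1 → l₂ x₂ = 1 → h x₁ x₂ y = h' x₁ x₂ y) (x₁ : X₁) (x₂ : X₂) (y : Y) :
    h x₁ x₂ y = h' x₁ x₂ y := by
  have key : ∀ x₁ x₂ y, l₁ x₁ = 1 → h x₁ x₂ y = h' x₁ x₂ y := by
    intro x₁ x₂ y hx
    have e : x₂ = (x₂ + (1 - l₂ x₂) • e₂) + (l₂ x₂ - 1) • e₂ := by module
    rw [e, expand_right (H.right x₁), expand_right (H'.right x₁), heq x₁ _ _ hx (by simp [h₂]),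
      heq x₁ _ _ hx h₂]
  have e : x₁ = (x₁ + (1 - l₁ x₁) • e₁) + (l₁ x₁ - 1) • e₁ := by module
  rw [e, expand_left (H.left x₂), expand_left (H'.left x₂), key _ _ _ (by simp [h₁]), key _ _ _ h₁]

variable {L₁ L₂ : Type*} [AddCommGroup L₁] [Module ℝ L₁] [AddCommGroup L₂] [Module ℝ L₂]

/-- The expansion made explicit for e = (0, 1). The right-hand side contains only values over weight
one on both sides; for a change of charts of the double hull these are values of a transition map of
the double affine bundle, which yields smoothness. -/
theorem slice_expand {h : L₁ × ℝ → L₂ × ℝ → Y → Z}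
    (hl : ∀ b, IsLinearMap ℝ fun p : (L₁ × ℝ) × Y => h p.1 b p.2)
    (hr : ∀ k, IsLinearMap ℝ fun p : (L₂ × ℝ) × Y => h (k, 1) p.1 p.2)
    (a : L₁ × ℝ) (b : L₂ × ℝ) (c : Y) : h a b c = h (a.1, 1) (b.1, 1) c +
      (b.2 - 1) • h (a.1, 1) (0, 1) 0 + (a.2 - 1) • (h (0, 1) (b.1, 1) 0 +
      (b.2 - 1) • h (0, 1) (0, 1) 0) := by
  have ea : a = (a.1, 1) + (a.2 - 1) • ((0 : L₁), (1 : ℝ)) := by ext <;> simp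
  have eb : b = (b.1, 1) + (b.2 - 1) • ((0 : L₂), (1 : ℝ)) := by ext <;> simp
  conv_lhs => rw [ea, expand_left (hl b), eb, expand_right (hr _), expand_right (hr _)]

/-- In the second direction linearity is given over the points (k, 1) only. Linearity in the first
direction expresses the value at a through the values at (a.1, 1) and at (0, 1), the latter with
core 0, and both terms are linear in (b, c). -/
theorem isDoubleLinear_of_slice {h : L₁ × ℝ → L₂ × ℝ → Y → Z}
    (hl : ∀ b, IsLinearMap ℝ fun p : (L₁ × ℝ) × Y => h p.1 b p.2)
    (hr : ∀ k, IsLinearMap ℝ fun p : (L₂ × ℝ) × Y => h (k, 1) p.1 p.2) : IsDoubleLinear h := by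
  refine ⟨hl, fun a => ?_⟩
  have e : ∀ b c, h a b c = h (a.1, 1) b c + (a.2 - 1) • h (0, 1) b 0 := by
    intro b c
    have ea : a = (a.1, 1) + (a.2 - 1) • ((0 : L₁), (1 : ℝ)) := by ext <;> simp
    conv_lhs => rw [ea, expand_left (hl b)]
  constructor
  · intro p q
    have h₁ := (hr a.1).map_add p q
    have h₂ := (hr 0).map_add (p.1, 0) (q.1, 0)
    simp only [Prod.fst_add, Prod.snd_add, add_zero] at h₁ h₂ ⊢
    rw [e, e, e, h₁, h₂]
    module
  · intro t p
    have h₁ := (hr a.1).map_smul t p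
    have h₂ := (hr 0).map_smul t (p.1, 0)
    simp only [Prod.smul_fst, Prod.smul_snd, smul_zero] at h₁ h₂ ⊢
    rw [e, e, h₁, h₂]
    module

end Slice

/-! ### Transition maps and operations of the double vector hull -/

namespace DoubleAffineBundle

section Algebra

variable {M : Type*} [TopologicalSpace M] {B : Type*} [NormedAddCommGroup B] [NormedSpace ℝ B]
  [ChartedSpace B M]
  {K₁ K₂ K : Type*} [NormedAddCommGroup K₁] [NormedSpace ℝ K₁] [NormedAddCommGroup K₂]
  [NormedSpace ℝ K₂] [NormedAddCommGroup K] [NormedSpace ℝ K]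
  {D D₁ D₂ : M → Type*} (𝒜 : DoubleAffineBundle B K₁ K₂ K D D₁ D₂)

section
variable {χ : DoubleChart K₁ K₂ K D D₁ D₂} (hχ : χ ∈ 𝒜.charts) {m : M} (hm : m ∈ χ.dom)
  {χ' : DoubleChart K₁ K₂ K D D₁ D₂} (hχ' : χ' ∈ 𝒜.charts) (hm' : m ∈ χ'.dom)

/-- The point of the double vector hull with given coordinates. -/
def dblMk (a : K₁ × ℝ) (b : K₂ × ℝ) (c : K) : 𝒜.DoubleHull m :=
  ⟨(𝒜.hullSnd hχ hm).symm b, (𝒜.dblEquiv hχ hm _).symm ((a.1, c), a.2)⟩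

@[simp] theorem doubleHullProj_dblMk (a : K₁ × ℝ) (b : K₂ × ℝ) (c : K) :
    𝒜.doubleHullProj m (𝒜.dblMk hχ hm a b c) = (𝒜.hullFst hχ hm).symm a := by
  apply (𝒜.hullFst hχ hm).injective
  rw [hullFst_doubleHullProj, dblMk]
  simp

@[simp] theorem dblMk_fst (a : K₁ × ℝ) (b : K₂ × ℝ) (c : K) :
    (𝒜.dblMk hχ hm a b c).1 = (𝒜.hullSnd hχ hm).symm b := rfl

@[simp] theorem dblCore_dblMk (a : K₁ × ℝ) (b : K₂ × ℝ) (c : K) :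
    𝒜.dblCore hχ hm (𝒜.dblMk hχ hm a b c) = c :=
  congrArg (fun p => p.1.2) ((𝒜.dblEquiv hχ hm _).apply_symm_apply ((a.1, c), a.2))

theorem dblMk_coord (Ξ : 𝒜.DoubleHull m) :
    𝒜.dblMk hχ hm (𝒜.hullFst hχ hm (𝒜.doubleHullProj m Ξ)) (𝒜.hullSnd hχ hm Ξ.1)
      (𝒜.dblCore hχ hm Ξ) = Ξ := by
  apply 𝒜.doubleHull_ext hχ hm <;> simp

/-- Over an actual point of `D₁` the elements of the double hull are generators coming from the
vertical hull. This is where the linear structure over the hull of `D₁` is given in advance. -/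
theorem dblMk_one (a : D₁ m) (b : K₂ × ℝ) (c : K) : 𝒜.dblMk hχ hm (χ.fst m a, 1) b c =
    𝒜.ofVert m ⟨a, (𝒜.vertEquiv hχ hm a).symm ((b.1, c), b.2)⟩ := by
  apply 𝒜.doubleHull_ext hχ hm
  · simp [doubleHullProj_ofVert, LinearEquiv.symm_apply_eq]
  · simp [ofVert, LinearEquiv.symm_apply_eq, hullSnd_vertProj]
  · simp [dblCore_ofVert, vertCore]

theorem dblMk_one_one (d : D m) : 𝒜.dblMk hχ hm (χ.fst m (𝒜.pr₁ m d), 1)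
    (χ.snd m (𝒜.pr₂ m d), 1) (χ.core m d) = 𝒜.ofPoint m d := by
  apply 𝒜.doubleHull_ext hχ hm
  · simp [doubleHullProj_ofPoint, LinearEquiv.symm_apply_eq]
  · simp [ofPoint_fst, LinearEquiv.symm_apply_eq]
  · simp [dblCore_ofPoint]

/-- The change of the core coordinate. -/
def coreChange (a : K₁ × ℝ) (b : K₂ × ℝ) (c : K) : K :=
  𝒜.dblCore hχ' hm' (𝒜.dblMk hχ hm a b c)

/-- For fixed b both charts are linear isomorphisms defined on the same vector space, the fibre of
the double hull over b. -/
theorem coreChange_left (b : K₂ × ℝ) :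
    IsLinearMap ℝ fun p : (K₁ × ℝ) × K => 𝒜.coreChange hχ hm hχ' hm' p.1 b p.2 where
  map_add p q := congrArg (fun x => x.1.2) (((𝒜.dblEquiv hχ hm _).symm.trans
    (𝒜.dblEquiv hχ' hm' ((𝒜.hullSnd hχ hm).symm b))).map_add ((p.1.1, p.2), p.1.2)
      ((q.1.1, q.2), q.1.2))
  map_smul t p := congrArg (fun x => x.1.2) (((𝒜.dblEquiv hχ hm _).symm.trans
    (𝒜.dblEquiv hχ' hm' ((𝒜.hullSnd hχ hm).symm b))).map_smul t ((p.1.1, p.2), p.1.2))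

/-- By construction the double hull is a vector space only over the hull of `D₂`. In the other
direction a linear structure is available only over points of `D₁`, from the vertical hull; hence
the restriction to weight 1. -/
theorem coreChange_right (k : K₁) :
    IsLinearMap ℝ fun p : (K₂ × ℝ) × K => 𝒜.coreChange hχ hm hχ' hm' (k, 1) p.1 p.2 := by
  obtain ⟨a, rfl⟩ := (𝒜.fst_bijective χ hχ m hm).2 k
  have e : ∀ p : (K₂ × ℝ) × K, 𝒜.coreChange hχ hm hχ' hm' (χ.fst m a, 1) p.1 p.2 =
      (𝒜.vertEquiv hχ' hm' a ((𝒜.vertEquiv hχ hm a).symm ((p.1.1, p.2), p.1.2))).1.2 := by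
    intro p
    rw [coreChange, dblMk_one, dblCore_ofVert]; rfl
  let L := LinearMap.fst ℝ (K₂ × K) ℝ ∘ₗ
    ((𝒜.vertEquiv hχ hm a).symm.trans (𝒜.vertEquiv hχ' hm' a)).toLinearMap
  constructor
  · intro p q
    rw [e, e, e]
    exact congrArg Prod.snd (L.map_add ((p.1.1, p.2), p.1.2) ((q.1.1, q.2), q.1.2))
  · intro t p
    rw [e, e]
    exact congrArg Prod.snd (L.map_smul t ((p.1.1, p.2), p.1.2))

theorem coreChange_isDoubleLinear : IsDoubleLinear (𝒜.coreChange hχ hm hχ' hm') :=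
  isDoubleLinear_of_slice (𝒜.coreChange_left hχ hm hχ' hm') (𝒜.coreChange_right hχ hm hχ' hm')

theorem dblCore_eq_coreChange (Ξ : 𝒜.DoubleHull m) : 𝒜.dblCore hχ' hm' Ξ =
    𝒜.coreChange hχ hm hχ' hm' (𝒜.hullFst hχ hm (𝒜.doubleHullProj m Ξ)) (𝒜.hullSnd hχ hm Ξ.1)
      (𝒜.dblCore hχ hm Ξ) := by
  rw [coreChange, dblMk_coord]

end

/-- A chart around `m`. -/
def chartNear (m : M) : DoubleChart K₁ K₂ K D D₁ D₂ := (𝒜.cover m).choose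

theorem chartNear_mem (m : M) : 𝒜.chartNear m ∈ 𝒜.charts := (𝒜.cover m).choose_spec.1
theorem mem_chartNear (m : M) : m ∈ (𝒜.chartNear m).dom := (𝒜.cover m).choose_spec.2

/-- Addition in the fibres of `doubleHullProj`. -/
def dblAdd₁ (m : M) (Ξ Ξ' : 𝒜.DoubleHull m) : 𝒜.DoubleHull m :=
  𝒜.dblMk (𝒜.chartNear_mem m) (𝒜.mem_chartNear m)
    (𝒜.hullFst (𝒜.chartNear_mem m) (𝒜.mem_chartNear m) (𝒜.doubleHullProj m Ξ))
    (𝒜.hullSnd (𝒜.chartNear_mem m) (𝒜.mem_chartNear m) (Ξ.1 + Ξ'.1))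
    (𝒜.dblCore (𝒜.chartNear_mem m) (𝒜.mem_chartNear m) Ξ +
      𝒜.dblCore (𝒜.chartNear_mem m) (𝒜.mem_chartNear m) Ξ')

/-- Multiplication by scalars in the fibres of `doubleHullProj`. -/
def dblSmul₁ (m : M) (t : ℝ) (Ξ : 𝒜.DoubleHull m) : 𝒜.DoubleHull m :=
  𝒜.dblMk (𝒜.chartNear_mem m) (𝒜.mem_chartNear m)
    (𝒜.hullFst (𝒜.chartNear_mem m) (𝒜.mem_chartNear m) (𝒜.doubleHullProj m Ξ))
    (𝒜.hullSnd (𝒜.chartNear_mem m) (𝒜.mem_chartNear m) (t • Ξ.1))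
    (t • 𝒜.dblCore (𝒜.chartNear_mem m) (𝒜.mem_chartNear m) Ξ)

open Classical in
/-- Addition in the fibres of the projection to the hull of `D₂`. -/
def dblAdd₂ (m : M) (Ξ Ξ' : 𝒜.DoubleHull m) : 𝒜.DoubleHull m :=
  if h : Ξ'.1 = Ξ.1 then ⟨Ξ.1, Ξ.2 + h ▸ Ξ'.2⟩ else Ξ

theorem dblAdd₂_mk (m : M) (b : 𝒜.Hull₂ m) (x y : 𝒜.DoubleHullFiber m b) :
    𝒜.dblAdd₂ m ⟨b, x⟩ ⟨b, y⟩ = ⟨b, x + y⟩ := by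
  rw [dblAdd₂, dif_pos rfl]

/-- Multiplication by scalars in the fibres of the projection to the hull of `D₂`. -/
def dblSmul₂ (m : M) (t : ℝ) (Ξ : 𝒜.DoubleHull m) : 𝒜.DoubleHull m := ⟨Ξ.1, t • Ξ.2⟩

@[simp] theorem doubleHullProj_dblAdd₁ (m : M) (Ξ Ξ' : 𝒜.DoubleHull m) :
    𝒜.doubleHullProj m (𝒜.dblAdd₁ m Ξ Ξ') = 𝒜.doubleHullProj m Ξ := by
  simp [dblAdd₁]

@[simp] theorem doubleHullProj_dblSmul₁ (m : M) (t : ℝ) (Ξ : 𝒜.DoubleHull m) :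
    𝒜.doubleHullProj m (𝒜.dblSmul₁ m t Ξ) = 𝒜.doubleHullProj m Ξ := by
  simp [dblSmul₁]

@[simp] theorem dblAdd₁_fst (m : M) (Ξ Ξ' : 𝒜.DoubleHull m) :
    (𝒜.dblAdd₁ m Ξ Ξ').1 = Ξ.1 + Ξ'.1 := LinearEquiv.symm_apply_apply _ _

@[simp] theorem dblSmul₁_fst (m : M) (t : ℝ) (Ξ : 𝒜.DoubleHull m) :
    (𝒜.dblSmul₁ m t Ξ).1 = t • Ξ.1 := LinearEquiv.symm_apply_apply _ _

section
variable {χ : DoubleChart K₁ K₂ K D D₁ D₂} (hχ : χ ∈ 𝒜.charts) {m : M} (hm : m ∈ χ.dom)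

/-- `dblAdd₁` is defined in one chosen chart. Since the change of the core is linear in the second
side coordinate and the core, the sum is componentwise in every chart and the choice does not
matter. -/
theorem dblCore_dblAdd₁ (Ξ Ξ' : 𝒜.DoubleHull m)
    (h : 𝒜.doubleHullProj m Ξ = 𝒜.doubleHullProj m Ξ') :
    𝒜.dblCore hχ hm (𝒜.dblAdd₁ m Ξ Ξ') = 𝒜.dblCore hχ hm Ξ + 𝒜.dblCore hχ hm Ξ' := by
  have H := 𝒜.coreChange_isDoubleLinear (𝒜.chartNear_mem m) (𝒜.mem_chartNear m) hχ hm
  rw [𝒜.dblCore_eq_coreChange (𝒜.chartNear_mem m) (𝒜.mem_chartNear m) hχ hm Ξ,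
    𝒜.dblCore_eq_coreChange (𝒜.chartNear_mem m) (𝒜.mem_chartNear m) hχ hm Ξ', ← h]
  refine Eq.trans ?_ ((H.right _).map_add (_, _) (_, _))
  rw [dblAdd₁, map_add]
  rfl

theorem dblCore_dblSmul₁ (t : ℝ) (Ξ : 𝒜.DoubleHull m) :
    𝒜.dblCore hχ hm (𝒜.dblSmul₁ m t Ξ) = t • 𝒜.dblCore hχ hm Ξ := by
  have H := 𝒜.coreChange_isDoubleLinear (𝒜.chartNear_mem m) (𝒜.mem_chartNear m) hχ hm
  rw [𝒜.dblCore_eq_coreChange (𝒜.chartNear_mem m) (𝒜.mem_chartNear m) hχ hm Ξ]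
  refine Eq.trans ?_ ((H.right _).map_smul t (_, _))
  rw [dblSmul₁, map_smul]
  rfl

end

/-- The linear extension of a chart. -/
def hullChart (χ : 𝒜.charts) : DoubleChart (K₁ × ℝ) (K₂ × ℝ) K 𝒜.DoubleHull 𝒜.Hull₁ 𝒜.Hull₂ :=
  open Classical in
  { dom := χ.1.dom
    fst := fun m a => if hm : m ∈ χ.1.dom then 𝒜.hullFst χ.2 hm a else 0
    snd := fun m b => if hm : m ∈ χ.1.dom then 𝒜.hullSnd χ.2 hm b else 0
    core := fun m Ξ => if hm : m ∈ χ.1.dom then 𝒜.dblCore χ.2 hm Ξ else 0 }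

variable (χ χ' : 𝒜.charts) {m : M}

theorem hullChart_fst (hm : m ∈ χ.1.dom) : (𝒜.hullChart χ).fst m = 𝒜.hullFst χ.2 hm :=
  funext fun _ => dif_pos hm
theorem hullChart_snd (hm : m ∈ χ.1.dom) : (𝒜.hullChart χ).snd m = 𝒜.hullSnd χ.2 hm :=
  funext fun _ => dif_pos hm
theorem hullChart_core (hm : m ∈ χ.1.dom) : (𝒜.hullChart χ).core m = 𝒜.dblCore χ.2 hm :=
  funext fun _ => dif_pos hm

/-- A linear map with (k, 1) ↦ (τ k, 1) is determined by writing (k, s) = (k, 1) + (s - 1) (0, 1).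
No formula for τ is needed, so the transition map of the hull inherits its smoothness from τ. -/
theorem hullFst_eq {χ χ' : DoubleChart K₁ K₂ K D D₁ D₂} (hχ : χ ∈ 𝒜.charts) (hχ' : χ' ∈ 𝒜.charts)
    (hm : m ∈ χ.dom) (hm' : m ∈ χ'.dom) {τ : K₁ → K₁} (hτ : ∀ a, χ'.fst m a = τ (χ.fst m a))
    (x : 𝒜.Hull₁ m) : 𝒜.hullFst hχ' hm' x =
      (τ (𝒜.hullFst hχ hm x).1 + ((𝒜.hullFst hχ hm x).2 - 1) • τ 0, (𝒜.hullFst hχ hm x).2) := by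
  let L : K₁ × ℝ →ₗ[ℝ] K₁ × ℝ := (𝒜.hullFst hχ' hm').toLinearMap ∘ₗ (𝒜.hullFst hχ hm).symm
  have h1 : ∀ k, L (k, 1) = (τ k, 1) := by
    intro k
    obtain ⟨a, rfl⟩ := (𝒜.fst_bijective χ hχ m hm).2 k
    rw [← hτ, ← 𝒜.hullFst_of hχ hm]
    change 𝒜.hullFst hχ' hm' ((𝒜.hullFst hχ hm).symm (𝒜.hullFst hχ hm _)) = _
    rw [LinearEquiv.symm_apply_apply, hullFst_of]
  have h2 : 𝒜.hullFst hχ' hm' x = L (𝒜.hullFst hχ hm x) := by simp [L]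
  have h3 : 𝒜.hullFst hχ hm x = ((𝒜.hullFst hχ hm x).1, 1) +
      ((𝒜.hullFst hχ hm x).2 - 1) • ((0 : K₁), (1 : ℝ)) := by ext <;> simp
  conv_lhs => rw [h2, h3, map_add, map_smul, h1, h1]
  ext <;> simp

theorem hullSnd_eq {χ χ' : DoubleChart K₁ K₂ K D D₁ D₂} (hχ : χ ∈ 𝒜.charts) (hχ' : χ' ∈ 𝒜.charts)
    (hm : m ∈ χ.dom) (hm' : m ∈ χ'.dom) {τ : K₂ → K₂} (hτ : ∀ a, χ'.snd m a = τ (χ.snd m a))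
    (x : 𝒜.Hull₂ m) : 𝒜.hullSnd hχ' hm' x =
      (τ (𝒜.hullSnd hχ hm x).1 + ((𝒜.hullSnd hχ hm x).2 - 1) • τ 0, (𝒜.hullSnd hχ hm x).2) := by
  let L : K₂ × ℝ →ₗ[ℝ] K₂ × ℝ := (𝒜.hullSnd hχ' hm').toLinearMap ∘ₗ (𝒜.hullSnd hχ hm).symm
  have h1 : ∀ k, L (k, 1) = (τ k, 1) := by
    intro k
    obtain ⟨a, rfl⟩ := (𝒜.snd_bijective χ hχ m hm).2 k
    rw [← hτ, ← 𝒜.hullSnd_of hχ hm]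
    change 𝒜.hullSnd hχ' hm' ((𝒜.hullSnd hχ hm).symm (𝒜.hullSnd hχ hm _)) = _
    rw [LinearEquiv.symm_apply_apply, hullSnd_of]
  have h2 : 𝒜.hullSnd hχ' hm' x = L (𝒜.hullSnd hχ hm x) := by simp [L]
  have h3 : 𝒜.hullSnd hχ hm x = ((𝒜.hullSnd hχ hm x).1, 1) +
      ((𝒜.hullSnd hχ hm x).2 - 1) • ((0 : K₂), (1 : ℝ)) := by ext <;> simp
  conv_lhs => rw [h2, h3, map_add, map_smul, h1, h1]
  ext <;> simp

/-- The extension to the double hull of a map of coordinates. -/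
def extendChange (τ : M × (K₁ × K₂ × K) → K₁ × K₂ × K)
    (p : M × ((K₁ × ℝ) × (K₂ × ℝ) × K)) : (K₁ × ℝ) × (K₂ × ℝ) × K :=
  (((τ (p.1, p.2.1.1, 0, 0)).1 + (p.2.1.2 - 1) • (τ (p.1, 0, 0, 0)).1, p.2.1.2),
   ((τ (p.1, 0, p.2.2.1.1, 0)).2.1 + (p.2.2.1.2 - 1) • (τ (p.1, 0, 0, 0)).2.1, p.2.2.1.2),
    (τ (p.1, p.2.1.1, p.2.2.1.1, p.2.2.2)).2.2 +
      (p.2.2.1.2 - 1) • (τ (p.1, p.2.1.1, 0, 0)).2.2 +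
      (p.2.1.2 - 1) • ((τ (p.1, 0, p.2.2.1.1, 0)).2.2 +
        (p.2.2.1.2 - 1) • (τ (p.1, 0, 0, 0)).2.2))

theorem contMDiffOn_extendChange {τ : M × (K₁ × K₂ × K) → K₁ × K₂ × K} {U : Set M}
    (hτ : ContMDiffOn (𝓘(ℝ, B).prod 𝓘(ℝ, K₁ × K₂ × K)) 𝓘(ℝ, K₁ × K₂ × K) ∞ τ (U ×ˢ univ)) :
    ContMDiffOn (𝓘(ℝ, B).prod 𝓘(ℝ, (K₁ × ℝ) × (K₂ × ℝ) × K)) 𝓘(ℝ, (K₁ × ℝ) × (K₂ × ℝ) × K) ∞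
      (extendChange τ) (U ×ˢ univ) := by
  have key : ∀ L : ((K₁ × ℝ) × (K₂ × ℝ) × K) →L[ℝ] K₁ × K₂ × K,
      ContMDiffOn (𝓘(ℝ, B).prod 𝓘(ℝ, (K₁ × ℝ) × (K₂ × ℝ) × K)) 𝓘(ℝ, K₁ × K₂ × K) ∞
        (fun p : M × ((K₁ × ℝ) × (K₂ × ℝ) × K) => τ (p.1, L p.2)) (U ×ˢ univ) := by
    intro L
    refine hτ.comp (f := fun p : M × ((K₁ × ℝ) × (K₂ × ℝ) × K) => (p.1, L p.2)) ?_
      (fun p hp => ⟨hp.1, mem_univ _⟩)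
    exact (contMDiff_fst.prodMk (L.contMDiff.comp contMDiff_snd)).contMDiffOn
  let a : ((K₁ × ℝ) × (K₂ × ℝ) × K) →L[ℝ] K₁ :=
    (ContinuousLinearMap.fst ℝ _ _).comp (ContinuousLinearMap.fst ℝ _ _)
  let b : ((K₁ × ℝ) × (K₂ × ℝ) × K) →L[ℝ] K₂ := (ContinuousLinearMap.fst ℝ _ _).comp
    ((ContinuousLinearMap.fst ℝ _ _).comp (ContinuousLinearMap.snd ℝ _ _))
  let c : ((K₁ × ℝ) × (K₂ × ℝ) × K) →L[ℝ] K :=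
    (ContinuousLinearMap.snd ℝ _ _).comp (ContinuousLinearMap.snd ℝ _ _)
  -- The family of four collects the values of τ at the degenerate points; its last slot is padding.
  -- The value at the full point is passed separately.
  let G : (K₁ × ℝ) × (K₂ × ℝ) × K → (Fin 4 → K₁ × K₂ × K) → (K₁ × K₂ × K) →
      (K₁ × ℝ) × (K₂ × ℝ) × K := fun p q r =>
    (((q 0).1 + (p.1.2 - 1) • (q 1).1, p.1.2),
      ((q 2).2.1 + (p.2.1.2 - 1) • (q 1).2.1, p.2.1.2),
      r.2.2 + (p.2.1.2 - 1) • (q 0).2.2 + (p.1.2 - 1) • ((q 2).2.2 + (p.2.1.2 - 1) • (q 1).2.2))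
  have hG : ContDiff ℝ ∞ fun x : ((K₁ × ℝ) × (K₂ × ℝ) × K) × (Fin 4 → K₁ × K₂ × K) ×
      (K₁ × K₂ × K) => G x.1 x.2.1 x.2.2 := by
    simp only [G]; fun_prop
  refine (hG.contMDiff.comp_contMDiffOn (f := fun p : M × ((K₁ × ℝ) × (K₂ × ℝ) × K) =>
    (p.2, (![τ (p.1, p.2.1.1, 0, 0), τ (p.1, 0, 0, 0), τ (p.1, 0, p.2.2.1.1, 0), 0],
      τ (p.1, p.2.1.1, p.2.2.1.1, p.2.2.2)))) ?_).congr fun p hp => ?_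
  · refine contMDiff_snd.contMDiffOn.prodMk_space (ContMDiffOn.prodMk_space ?_ ?_)
    · rw [contMDiffOn_pi_space]
      intro i
      fin_cases i
      · exact key (a.prod (0 : _ →L[ℝ] K₂ × K))
      · exact key 0
      · exact key ((0 : _ →L[ℝ] K₁).prod (b.prod 0))
      · exact contMDiffOn_const
    · exact key (a.prod (b.prod c))
  · rfl

theorem coord_hullChart {χ χ' : 𝒜.charts} (hm : m ∈ χ.1.dom) (hm' : m ∈ χ'.1.dom)
    {τ : M × (K₁ × K₂ × K) → K₁ × K₂ × K}
    (hτ : ∀ d, χ'.1.coord 𝒜.pr₁ 𝒜.pr₂ m d = τ (m, χ.1.coord 𝒜.pr₁ 𝒜.pr₂ m d))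
    (Ξ : 𝒜.DoubleHull m) :
    (𝒜.hullChart χ').coord 𝒜.doubleHullProj (fun _ Ξ => Ξ.1) m Ξ = extendChange τ
      (m, (𝒜.hullChart χ).coord 𝒜.doubleHullProj (fun _ Ξ => Ξ.1) m Ξ) := by
  have h₀ : ∀ a b c, ∃ d, χ.1.fst m (𝒜.pr₁ m d) = a ∧ χ.1.snd m (𝒜.pr₂ m d) = b ∧
      χ.1.core m d = c := by
    intro a b c
    obtain ⟨d, hd⟩ := (𝒜.coord_bijective _ χ.2 m hm).2 (a, b, c)
    simp only [DoubleChart.coord, Prod.mk.injEq] at hd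
    exact ⟨d, hd⟩
  have h₁ : ∀ a, χ'.1.fst m a = (τ (m, χ.1.fst m a, 0, 0)).1 := by
    intro a
    obtain ⟨d, hd₁, hd₂, hd₃⟩ := h₀ (χ.1.fst m a) 0 0
    have := hτ d
    rw [DoubleChart.coord, DoubleChart.coord, hd₂, hd₃,
      (𝒜.fst_bijective _ χ.2 m hm).1 hd₁] at this
    rw [← this]
  have h₂ : ∀ b, χ'.1.snd m b = (τ (m, 0, χ.1.snd m b, 0)).2.1 := by
    intro b
    obtain ⟨d, hd₁, hd₂, hd₃⟩ := h₀ 0 (χ.1.snd m b) 0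
    have := hτ d
    rw [DoubleChart.coord, DoubleChart.coord, hd₁, hd₃,
      (𝒜.snd_bijective _ χ.2 m hm).1 hd₂] at this
    rw [← this]
  have h₃ : ∀ a b c, 𝒜.coreChange χ.2 hm χ'.2 hm' (a, 1) (b, 1) c = (τ (m, a, b, c)).2.2 := by
    intro a b c
    obtain ⟨d, rfl, rfl, rfl⟩ := h₀ a b c
    rw [coreChange, dblMk_one_one, dblCore_ofPoint]
    exact congrArg (fun p => p.2.2) (hτ d)
  simp only [DoubleChart.coord, hullChart_fst 𝒜 _ hm, hullChart_fst 𝒜 _ hm',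
    hullChart_snd 𝒜 _ hm, hullChart_snd 𝒜 _ hm', hullChart_core 𝒜 _ hm, hullChart_core 𝒜 _ hm']
  refine Prod.ext
    (𝒜.hullFst_eq χ.2 χ'.2 hm hm' (τ := fun a => (τ (m, a, 0, 0)).1) h₁ _)
    (Prod.ext (𝒜.hullSnd_eq χ.2 χ'.2 hm hm' (τ := fun b => (τ (m, 0, b, 0)).2.1) h₂ _) ?_)
  refine (𝒜.dblCore_eq_coreChange χ.2 hm χ'.2 hm' Ξ).trans ?_
  rw [slice_expand (𝒜.coreChange_left χ.2 hm χ'.2 hm') (𝒜.coreChange_right χ.2 hm χ'.2 hm')]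
  simp only [h₃]
  rfl

/-- The double vector hull. -/
def doubleHullBundle :
    DoubleVectorBundle B (K₁ × ℝ) (K₂ × ℝ) K 𝒜.DoubleHull 𝒜.Hull₁ 𝒜.Hull₂ where
  pr₁ := 𝒜.doubleHullProj
  pr₂ _ Ξ := Ξ.1
  add₁ := 𝒜.dblAdd₁
  smul₁ := 𝒜.dblSmul₁
  add₂ := 𝒜.dblAdd₂
  smul₂ := 𝒜.dblSmul₂
  pr₁_add₁ m d d' _ := 𝒜.doubleHullProj_dblAdd₁ m d d'
  pr₂_add₁ m d d' _ := 𝒜.dblAdd₁_fst m d d'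
  pr₁_smul₁ := 𝒜.doubleHullProj_dblSmul₁
  pr₂_smul₁ := 𝒜.dblSmul₁_fst
  pr₂_add₂ m d d' h := by rw [dblAdd₂, dif_pos h.symm]
  pr₁_add₂ m d d' h := by
    obtain ⟨b, x⟩ := d
    obtain ⟨b', y⟩ := d'
    obtain rfl : b = b' := h
    rw [dblAdd₂_mk]
    exact map_add (𝒜.doubleHullProjLin b) x y
  pr₂_smul₂ _ _ _ := rfl
  pr₁_smul₂ m t d := map_smul (𝒜.doubleHullProjLin d.1) t d.2
  charts := range 𝒜.hullChart
  cover m := ⟨_, ⟨⟨_, 𝒜.chartNear_mem m⟩, rfl⟩, 𝒜.mem_chartNear m⟩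
  fst_bijective := by
    rintro _ ⟨χ, rfl⟩ m hm
    rw [hullChart_fst 𝒜 χ hm]
    exact LinearEquiv.bijective _
  snd_bijective := by
    rintro _ ⟨χ, rfl⟩ m hm
    rw [hullChart_snd 𝒜 χ hm]
    exact LinearEquiv.bijective _
  coord_bijective := by
    rintro _ ⟨χ, rfl⟩ m (hm : m ∈ χ.1.dom)
    unfold DoubleChart.coord
    rw [hullChart_fst 𝒜 χ hm, hullChart_snd 𝒜 χ hm, hullChart_core 𝒜 χ hm]
    constructor
    · intro X Y h
      simp only [Prod.mk.injEq, EmbeddingLike.apply_eq_iff_eq] at h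
      exact 𝒜.doubleHull_ext χ.2 hm h.1 h.2.1 h.2.2
    · rintro ⟨a, b, c⟩
      exact ⟨𝒜.dblMk χ.2 hm a b c, by simp⟩
  fst_linear := by
    rintro _ ⟨χ, rfl⟩ m hm
    rw [hullChart_fst 𝒜 χ hm]
    exact (𝒜.hullFst χ.2 hm).toLinearMap.isLinear
  snd_linear := by
    rintro _ ⟨χ, rfl⟩ m hm
    rw [hullChart_snd 𝒜 χ hm]
    exact (𝒜.hullSnd χ.2 hm).toLinearMap.isLinear
  core_add₁ := by
    rintro _ ⟨χ, rfl⟩ m hm d d' h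
    rw [hullChart_core 𝒜 χ hm]
    exact 𝒜.dblCore_dblAdd₁ χ.2 hm d d' h
  core_smul₁ := by
    rintro _ ⟨χ, rfl⟩ m hm t d
    rw [hullChart_core 𝒜 χ hm]
    exact 𝒜.dblCore_dblSmul₁ χ.2 hm t d
  core_add₂ := by
    rintro _ ⟨χ, rfl⟩ m hm d d' h
    obtain ⟨b, x⟩ := d
    obtain ⟨b', y⟩ := d'
    obtain rfl : b = b' := h
    rw [hullChart_core 𝒜 χ hm, dblAdd₂_mk]
    simp [dblCore]
  core_smul₂ := by
    rintro _ ⟨χ, rfl⟩ m hm t d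
    rw [hullChart_core 𝒜 χ hm]
    exact congrArg (fun x => x.1.2) (map_smul (𝒜.dblEquiv χ.2 hm d.1) t d.2)
  smooth := by
    rintro _ ⟨χ, rfl⟩ _ ⟨χ', rfl⟩
    obtain ⟨τ, hτ, h⟩ := 𝒜.smooth _ χ.2 _ χ'.2
    exact ⟨extendChange τ, contMDiffOn_extendChange hτ,
      fun m hm Ξ => 𝒜.coord_hullChart hm.1 hm.2 (h m hm) Ξ⟩

theorem isDoubleHull_doubleHullBundle : 𝒜.IsDoubleHull 𝒜.doubleHullBundle where
  pr₁_eq _ _ := rfl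
  pr₂_eq _ _ := rfl
  add₂_eq := 𝒜.dblAdd₂_mk
  smul₂_eq _ _ _ _ := rfl
  add₁_eq m a x y := by
    have hχ := 𝒜.chartNear_mem m
    have hm := 𝒜.mem_chartNear m
    apply 𝒜.doubleHull_ext hχ hm
    · exact (𝒜.doubleHullProj_dblAdd₁ m _ _).trans
        ((𝒜.doubleHullProj_ofVert _).trans (𝒜.doubleHullProj_ofVert ⟨a, x + y⟩).symm)
    · exact (𝒜.dblAdd₁_fst m _ _).trans (map_add (𝒜.vertProjLin a) x y).symm
    · refine (𝒜.dblCore_dblAdd₁ hχ hm _ _ ?_).trans ?_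
      · rw [doubleHullProj_ofVert, doubleHullProj_ofVert]
      · simp [dblCore_ofVert, vertCore]
  smul₁_eq m t a x := by
    have hχ := 𝒜.chartNear_mem m
    have hm := 𝒜.mem_chartNear m
    apply 𝒜.doubleHull_ext hχ hm
    · exact (𝒜.doubleHullProj_dblSmul₁ m _ _).trans
        ((𝒜.doubleHullProj_ofVert _).trans (𝒜.doubleHullProj_ofVert ⟨a, t • x⟩).symm)
    · exact (𝒜.dblSmul₁_fst m _ _).trans (map_smul (𝒜.vertProjLin a) t x).symm
    · refine (𝒜.dblCore_dblSmul₁ hχ hm _ _).trans ?_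
      simp [dblCore_ofVert, vertCore]
  chart := by
    rintro _ ⟨χ, rfl⟩
    refine ⟨χ.1, χ.2, rfl, fun m hm => ⟨fun a => ?_, fun b => ?_, fun d => ?_⟩⟩
    · rw [hullChart_fst 𝒜 χ hm, hullFst_of]
    · rw [hullChart_snd 𝒜 χ hm, hullSnd_of]
    · rw [hullChart_core 𝒜 χ hm, dblCore_ofPoint]

end Algebra

end DoubleAffineBundle

/-! ### Existence of adapted charts of a special affine bundle -/

section AffineBundleSmooth

variable {F : Type*} [NormedAddCommGroup F] [NormedSpace ℝ F] {M : Type*} [TopologicalSpace M]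
  {V : M → Type*} [∀ m, AddCommGroup (V m)] [∀ m, Module ℝ (V m)]
  {A : M → Type*} [∀ m, AddTorsor (V m) (A m)]
  [∀ m, TopologicalSpace (A m)] [TopologicalSpace (TotalSpace F A)] [FiberBundle F A]
  {B : Type*} [NormedAddCommGroup B] [NormedSpace ℝ B] [ChartedSpace B M]

theorem fiberEquiv_linear [AffineBundle F V A] (e : Trivialization F (π F A)) [MemTrivializationAtlas e] {m : M}
    (hm : m ∈ e.baseSet) (w : V m) (a : A m) :
    (fiberEquiv F V A e hm).linear w = (e ⟨m, w +ᵥ a⟩).2 - (e ⟨m, a⟩).2 := by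
  rw [← fiberEquiv_apply F V A e hm, ← fiberEquiv_apply F V A e hm, AffineEquiv.map_vadd]
  simp

section
variable [SmoothAffineBundle F V A B]
  (e : Trivialization F (π F A)) [MemTrivializationAtlas e]

include V

/-- The manifold structure of the total space refers to the preferred trivializations only; any
other one in the atlas differs from a preferred one by a smooth change of coordinates. -/
theorem contMDiffAt_trivialization {x : TotalSpace F A} (hx : x.1 ∈ e.baseSet) :
    ContMDiffAt (𝓘(ℝ, B).prod 𝓘(ℝ, F)) 𝓘(ℝ, F) ∞ (fun y : TotalSpace F A => (e y).2) x := by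
  let t := trivializationAt F A x.1
  have hxt : x.1 ∈ t.baseSet := mem_baseSet_trivializationAt F A x.1
  have h1 : ContMDiffAt (𝓘(ℝ, B).prod 𝓘(ℝ, F)) 𝓘(ℝ, F) ∞ (fun y : TotalSpace F A => (t y).2) x :=
    ((contMDiffAt_totalSpace (IB := 𝓘(ℝ, B))).1 (contMDiffAt_id (x := x))).2
  have h2 : ContMDiffAt (𝓘(ℝ, B).prod 𝓘(ℝ, F)) 𝓘(ℝ, F) ∞
      (fun p : M × F => t.coordChange e p.1 p.2) (x.1, (t x).2) :=
    (SmoothAffineBundle.contMDiffOn_coordChange (V := V) (B := B) t e).contMDiffAt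
      (((t.open_baseSet.inter e.open_baseSet).prod isOpen_univ).mem_nhds ⟨⟨hxt, hx⟩, mem_univ _⟩)
  have h3 := h2.comp (f := fun y : TotalSpace F A => (y.1, (t y).2)) x
    ((contMDiffAt_proj A).prodMk h1)
  refine h3.congr_of_eventuallyEq ?_
  filter_upwards [t.open_source.mem_nhds (t.mem_source.2 hxt)] with y hy
  exact (t.coordChange_apply_snd e (t.mem_source.1 hy)).symm

theorem contMDiffAt_totalSpace_of_trivialization {E' : Type*} [NormedAddCommGroup E']
    [NormedSpace ℝ E'] {H' : Type*} [TopologicalSpace H'] {I' : ModelWithCorners ℝ E' H'}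
    {N : Type*} [TopologicalSpace N] [ChartedSpace H' N] {f : N → TotalSpace F A} {x : N}
    (hx : (f x).1 ∈ e.baseSet) (h₁ : ContMDiffAt I' 𝓘(ℝ, B) ∞ (fun y => (f y).1) x)
    (h₂ : ContMDiffAt I' 𝓘(ℝ, F) ∞ (fun y => (e (f y)).2) x) :
    ContMDiffAt I' (𝓘(ℝ, B).prod 𝓘(ℝ, F)) ∞ f x := by
  rw [contMDiffAt_totalSpace]
  refine ⟨h₁, ?_⟩
  let t := trivializationAt F A (f x).1
  have hxt : (f x).1 ∈ t.baseSet := mem_baseSet_trivializationAt F A (f x).1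
  have h2 : ContMDiffAt (𝓘(ℝ, B).prod 𝓘(ℝ, F)) 𝓘(ℝ, F) ∞
      (fun p : M × F => e.coordChange t p.1 p.2) ((f x).1, (e (f x)).2) :=
    (SmoothAffineBundle.contMDiffOn_coordChange (V := V) (B := B) e t).contMDiffAt
      (((e.open_baseSet.inter t.open_baseSet).prod isOpen_univ).mem_nhds ⟨⟨hx, hxt⟩, mem_univ _⟩)
  have h3 := h2.comp (f := fun y => ((f y).1, (e (f y)).2)) x (h₁.prodMk h₂)
  refine h3.congr_of_eventuallyEq ?_
  filter_upwards [h₁.continuousAt.preimage_mem_nhds (e.open_baseSet.mem_nhds hx)] with y hy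
  exact (e.coordChange_apply_snd t hy).symm

end

section Shear
variable {K : Type*} [AddCommGroup K] [Module ℝ K]

/-- The linear automorphism of `K × ℝ` that fixes `K` and maps `(w, ρ)` to `(0, 1)`. -/
def shear (u : K × ℝ) (h : u.2 ≠ 0) : (K × ℝ) ≃ₗ[ℝ] K × ℝ where
  toFun p := (p.1 - (p.2 / u.2) • u.1, p.2 / u.2)
  invFun p := (p.1 + p.2 • u.1, p.2 * u.2)
  map_add' p q := by ext <;> simp [add_div, add_smul]; abel
  map_smul' t p := by ext <;> simp [smul_sub, mul_div_assoc, smul_smul]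
  left_inv p := by ext <;> simp [h]
  right_inv p := by ext <;> simp [h]

theorem shear_self (u : K × ℝ) (h : u.2 ≠ 0) : shear u h u = (0, 1) := by
  simp [shear, h]

end Shear

/-- Smoothness of v is known only through the translation a ↦ v + a of the total space. Its fibre
coordinate is therefore computed as a difference along the local section that is 0 in the
trivialization. -/
theorem contMDiffAt_trivialization_section [SmoothAffineBundle F V A B] {v : ∀ m, V m}
    (hv : IsSpecialSection F A B v)
    (e : Trivialization F (π F A)) [MemTrivializationAtlas e] {m : M} (hm : m ∈ e.baseSet) :
    ContMDiffAt 𝓘(ℝ, B) 𝓘(ℝ, F) ∞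
      (fun x => (e ⟨x, v x +ᵥ e.symm x 0⟩).2 - (e ⟨x, e.symm x 0⟩).2) m := by
  have h₁ : ContMDiffAt 𝓘(ℝ, B) (𝓘(ℝ, B).prod 𝓘(ℝ, F)) ∞
      (fun x => (⟨x, e.symm x 0⟩ : TotalSpace F A)) m := by
    refine contMDiffAt_totalSpace_of_trivialization (V := V) e hm contMDiffAt_id ?_
    refine (contMDiffAt_const (c := (0 : F))).congr_of_eventuallyEq ?_
    filter_upwards [e.open_baseSet.mem_nhds hm] with x hx
    rw [e.apply_mk_symm hx]
  have h₂ := (hv.smooth.contMDiffAt).comp m h₁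
  exact ((contMDiffAt_trivialization (V := V) (B := B) e (x := ⟨m, v m +ᵥ e.symm m 0⟩) hm).comp
    m h₂).sub ((contMDiffAt_trivialization (V := V) (B := B) e
      (x := ⟨m, e.symm m 0⟩) hm).comp m h₁)

section Existence
variable [FiniteDimensional ℝ F] [IsManifold 𝓘(ℝ, B) ∞ M] [SmoothAffineBundle F V A B]
  {v : ∀ m, V m}

/-- The dimensions match because w ≠ 0 makes `finrank F - 1` an honest subtraction. Any isomorphism
is then corrected by an automorphism moving the image of w to (0, 1). -/
theorem exists_quotModel_equiv {w : F} (hw : w ≠ 0) : ∃ L : F ≃L[ℝ] QuotModel F × ℝ, L w = (0, 1) := by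
  have : Nontrivial F := ⟨w, 0, hw⟩
  have hd : Module.finrank ℝ F = Module.finrank ℝ (QuotModel F × ℝ) := by
    have := Module.finrank_pos (R := ℝ) (M := F)
    simp
    omega
  let L₀ : F ≃L[ℝ] QuotModel F × ℝ := ContinuousLinearEquiv.ofFinrankEq hd
  obtain ⟨L₁, h₁⟩ := SeparatingDual.exists_continuousLinearEquiv_apply_eq (R := ℝ)
    (V := QuotModel F × ℝ) (x := L₀ w) (y := (0, 1)) (by simpa using hw) (by simp)
  exact ⟨L₀.trans L₁, h₁⟩

/-- A constant linear change of fibre coordinates makes v equal to (0, 1) at m₀. Nearby its last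
component stays nonzero, and `shear` straightens v there, smoothly in the base point. -/
theorem exists_adaptedChart (hv : IsSpecialSection F A B v) (m₀ : M) :
    ∃ κ : AdaptedChart F A B v (QuotModel F), m₀ ∈ κ.dom := by
  classical
  let e := trivializationAt F A m₀
  have hm₀ : m₀ ∈ e.baseSet := mem_baseSet_trivializationAt F A m₀
  have hne : (fiberEquiv F V A e hm₀).linear (v m₀) ≠ 0 := by
    simpa using hv.ne_zero m₀
  obtain ⟨L, hL⟩ := exists_quotModel_equiv hne
  let u : M → QuotModel F × ℝ :=
    fun x => L ((e ⟨x, v x +ᵥ e.symm x 0⟩).2 - (e ⟨x, e.symm x 0⟩).2)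
  have hu : ∀ m ∈ e.baseSet, ContMDiffAt 𝓘(ℝ, B) 𝓘(ℝ, QuotModel F × ℝ) ∞ u m := fun m hm =>
    L.contDiff.contMDiff.contMDiffAt.comp m (contMDiffAt_trivialization_section hv e hm)
  have hul : ∀ m (hm : m ∈ e.baseSet), L ((fiberEquiv F V A e hm).linear (v m)) = u m :=
    fun m hm => by rw [fiberEquiv_linear e hm _ (e.symm m 0)]
  have ho : IsOpen ((e.baseSet ∩ u ⁻¹' {p | p.2 ≠ 0}) ∩ (chartAt B m₀).source) := by
    refine IsOpen.inter ?_ (chartAt B m₀).open_source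
    exact ContinuousOn.isOpen_inter_preimage
      (fun m hm => (hu m hm).continuousAt.continuousWithinAt) e.open_baseSet
      (isOpen_ne_fun continuous_snd continuous_const)
  let e₀ := fun m => fiberEquiv F V A (trivializationAt F A m) (mem_baseSet_trivializationAt F A m)
  -- A chart has to name an affine isomorphism at every point of `M`; where the straightened one is
  -- not available the preferred trivialization followed by `L` serves as a default.
  let T : ∀ m, A m ≃ᵃ[ℝ] QuotModel F × ℝ := fun m =>
    if h : m ∈ e.baseSet ∧ (u m).2 ≠ 0 then
      (fiberEquiv F V A e h.1).trans ((L.toLinearEquiv.trans (shear (u m) h.2)).toAffineEquiv)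
    else (e₀ m).trans L.toLinearEquiv.toAffineEquiv
  have hT : ∀ m (h₁ : m ∈ e.baseSet) (h₂ : (u m).2 ≠ 0) (a : A m),
      T m a = shear (u m) h₂ (L (e ⟨m, a⟩).2) := by
    intro m h₁ h₂ a
    simp only [T, dif_pos (And.intro h₁ h₂)]
    rw [← fiberEquiv_apply F V A e h₁]; rfl
  have hTs : ∀ m (h₁ : m ∈ e.baseSet) (h₂ : (u m).2 ≠ 0) (p : QuotModel F × ℝ),
      (e ⟨m, (T m).symm p⟩).2 = L.symm ((shear (u m) h₂).symm p) := by
    intro m h₁ h₂ p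
    have := hT m h₁ h₂ ((T m).symm p)
    rw [AffineEquiv.apply_symm_apply] at this
    rw [eq_comm, ContinuousLinearEquiv.symm_apply_eq, LinearEquiv.symm_apply_eq]
    exact this
  refine ⟨⟨⟨_, ho⟩, chartAt B m₀, IsManifold.chart_mem_maximalAtlas m₀, fun m hm => hm.2, T, ?_,
    ?_, ?_⟩, ⟨⟨hm₀, ?_⟩, mem_chart_source B m₀⟩⟩
  · rintro m ⟨⟨h₁, h₂⟩, -⟩
    have e₁ : T m = (fiberEquiv F V A e h₁).trans
      ((L.toLinearEquiv.trans (shear (u m) h₂)).toAffineEquiv) := dif_pos (And.intro h₁ h₂)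
    rw [e₁]
    change shear (u m) h₂ (L ((fiberEquiv F V A e h₁).linear (v m))) = _
    rw [hul, shear_self]
  · rintro x ⟨⟨h₁, h₂⟩, h₃⟩
    refine ContMDiffAt.contMDiffWithinAt ?_
    have g₁ : ContMDiffAt (𝓘(ℝ, B).prod 𝓘(ℝ, F)) 𝓘(ℝ, (QuotModel F × ℝ) × (QuotModel F × ℝ)) ∞
        (fun y : TotalSpace F A => (L (e y).2, u y.1)) x :=
      (L.contDiff.contMDiff.contMDiffAt.comp x
        (contMDiffAt_trivialization (V := V) e h₁)).prodMk_space
        ((hu x.1 h₁).comp x (contMDiffAt_proj A))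
    have g₂ : ContDiffAt ℝ ∞ (fun p : (QuotModel F × ℝ) × (QuotModel F × ℝ) =>
        (p.1.1 - (p.1.2 / p.2.2) • p.2.1, p.1.2 / p.2.2)) (L (e x).2, u x.1) := by
      fun_prop (disch := exact h₂)
    refine (g₂.contMDiffAt.comp x g₁).congr_of_eventuallyEq ?_
    filter_upwards [(contMDiffAt_proj (n := ∞) (IB := 𝓘(ℝ, B)) A
      (p := x)).continuousAt.preimage_mem_nhds (ho.mem_nhds ⟨⟨h₁, h₂⟩, h₃⟩)] with y hy
    exact hT y.1 hy.1.1 hy.1.2 y.2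
  · rintro x ⟨⟨⟨h₁, h₂⟩, h₃⟩, -⟩
    refine ContMDiffAt.contMDiffWithinAt ?_
    refine contMDiffAt_totalSpace_of_trivialization (V := V) e h₁ contMDiffAt_fst ?_
    have g₁ : ContMDiffAt (𝓘(ℝ, B).prod 𝓘(ℝ, QuotModel F × ℝ))
        𝓘(ℝ, (QuotModel F × ℝ) × (QuotModel F × ℝ)) ∞
        (fun y : M × (QuotModel F × ℝ) => (y.2, u y.1)) x :=
      contMDiffAt_snd.prodMk_space ((hu x.1 h₁).comp x contMDiffAt_fst)
    have g₂ : ContDiff ℝ ∞ (fun p : (QuotModel F × ℝ) × (QuotModel F × ℝ) =>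
        L.symm (p.1.1 + p.1.2 • p.2.1, p.1.2 * p.2.2)) := by
      fun_prop
    refine (g₂.contMDiff.contMDiffAt.comp x g₁).congr_of_eventuallyEq ?_
    filter_upwards [continuous_fst.continuousAt.preimage_mem_nhds
      (ho.mem_nhds ⟨⟨h₁, h₂⟩, h₃⟩)] with y hy
    exact hTs y.1 hy.1.1 hy.1.2 y.2
  · change (u m₀).2 ≠ 0
    rw [← hul m₀ hm₀, hL]
    simp

end Existence

end AffineBundleSmooth

theorem ratio_smul {W : Type*} [AddCommGroup W] [Module ℝ W] {w : W} (hw : w ≠ 0) (t : ℝ) :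
    ratio (t • w) w = t :=
  (smul_left_injective ℝ hw (Classical.epsilon_spec (p := fun s : ℝ => t • w = s • w)
    ⟨t, rfl⟩)).symm

/-! ### Sections of ζ, the functions f_σ, and adapted coordinates -/

section SectionsOfQuotient

variable {F : Type*} [NormedAddCommGroup F] [NormedSpace ℝ F] {M : Type*} [TopologicalSpace M]
  {V : M → Type*} [∀ m, AddCommGroup (V m)] [∀ m, Module ℝ (V m)]
  {A : M → Type*} [∀ m, AddTorsor (V m) (A m)]
  [∀ m, TopologicalSpace (A m)] [TopologicalSpace (TotalSpace F A)] [FiberBundle F A]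
  {B : Type*} [NormedAddCommGroup B] [NormedSpace ℝ B] [ChartedSpace B M]
  {v : ∀ m, V m} {K : Type*} [NormedAddCommGroup K] [NormedSpace ℝ K]

theorem AffQuot.mk_eq_iff {M : Type*} {V : M → Type*} [∀ m, AddCommGroup (V m)]
    [∀ m, Module ℝ (V m)] {A : M → Type*} [∀ m, AddTorsor (V m) (A m)] {v : ∀ m, V m} {m : M}
    {a b : A m} : AffQuot.mk v a = AffQuot.mk v b ↔ ∃ t : ℝ, b = t • v m +ᵥ a := by
  have he : Equivalence fun a b : A m => ∃ t : ℝ, b = t • v m +ᵥ a :=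
    ⟨fun a => ⟨0, by simp⟩, fun {a b} ⟨t, h⟩ => ⟨-t, by simp [h, vadd_vadd]⟩,
      fun {a b c} ⟨t, h⟩ ⟨s, h'⟩ => ⟨s + t, by rw [h', h, vadd_vadd, add_smul]⟩⟩
  exact ⟨fun h => he.eqvGen_iff.1 (Quot.eqvGen_exact h), fun h => Quot.sound h⟩

theorem AffQuot.exists_rep {M : Type*} {V : M → Type*} [∀ m, AddCommGroup (V m)]
    [∀ m, Module ℝ (V m)] {A : M → Type*} [∀ m, AddTorsor (V m) (A m)] {v : ∀ m, V m} {m : M}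
    (y : AffQuot A v m) : ∃ a, AffQuot.mk v a = y := Quot.exists_rep y

namespace AVSection

variable (σ σ' : AVSection F A B v) {m : M}

theorem fn_smul_vadd (a : A m) : σ.fn ⟨m, a⟩ • v m +ᵥ σ.toFun m (AffQuot.mk v a) = a := by
  obtain ⟨t, ht⟩ := AffQuot.mk_eq_iff.1 (σ.mk_toFun m (AffQuot.mk v a))
  have h : ∃ s : ℝ, a -ᵥ σ.toFun m (AffQuot.mk v a) = s • v m := ⟨t, (eq_vadd_iff_vsub_eq _ _ _).1 ht⟩
  exact ((eq_vadd_iff_vsub_eq _ _ _).2 (Classical.epsilon_spec h)).symm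

theorem fn_eq (hv : v m ≠ 0) {a : A m} {t : ℝ}
    (h : t • v m +ᵥ σ.toFun m (AffQuot.mk v a) = a) : σ.fn ⟨m, a⟩ = t := by
  have := (σ.fn_smul_vadd a).trans h.symm
  exact smul_left_injective ℝ hv (vadd_right_cancel _ this)

theorem mk_smul_vadd {M : Type*} {V : M → Type*} [∀ m, AddCommGroup (V m)]
    [∀ m, Module ℝ (V m)] {A : M → Type*} [∀ m, AddTorsor (V m) (A m)] {v : ∀ m, V m} {m : M}
    (t : ℝ) (a : A m) : AffQuot.mk v (t • v m +ᵥ a) = AffQuot.mk v a :=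
  (AffQuot.mk_eq_iff.2 ⟨t, rfl⟩).symm

theorem fn_vadd (hv : v m ≠ 0) (t : ℝ) (a : A m) :
    σ.fn ⟨m, t • v m +ᵥ a⟩ = t + σ.fn ⟨m, a⟩ := by
  apply σ.fn_eq hv
  rw [mk_smul_vadd, add_smul, add_vadd, fn_smul_vadd]

theorem toFun_mk (a : A m) : σ.toFun m (AffQuot.mk v a) = -σ.fn ⟨m, a⟩ • v m +ᵥ a := by
  conv_rhs => enter [2]; rw [← σ.fn_smul_vadd a]
  rw [vadd_vadd]
  simp

/-- By `toFun_mk` the vector from σ' to σ over ζ(a) is (f_σ'(a) - f_σ(a)) v; measuring it against -v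
reverses the sign. -/
theorem diff_eq (hv : v m ≠ 0) (a : A m) :
    σ.diff σ' ⟨m, a⟩ = σ.fn ⟨m, a⟩ - σ'.fn ⟨m, a⟩ := by
  have : σ.toFun m (AffQuot.mk v a) -ᵥ σ'.toFun m (AffQuot.mk v a) =
      (σ.fn ⟨m, a⟩ - σ'.fn ⟨m, a⟩) • (-v m) := by
    rw [toFun_mk, toFun_mk, vadd_vsub_vadd_cancel_right]
    module
  rw [diff, this, ratio_smul (neg_ne_zero.2 hv)]

end AVSection

namespace AdaptedChart

variable (κ : AdaptedChart F A B v K) {m : M}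

theorem ne_zero (hm : m ∈ κ.dom) : v m ≠ 0 := by
  intro h
  have := κ.triv_special m hm
  rw [h, map_zero] at this
  exact zero_ne_one (congrArg Prod.snd this)

theorem triv_vadd (hm : m ∈ κ.dom) (t : ℝ) (a : A m) :
    κ.triv m (t • v m +ᵥ a) = κ.triv m a + (0, t) := by
  rw [AffineEquiv.map_vadd, map_smul, κ.triv_special m hm]
  simp [add_comm]

theorem mk_eq_iff (hm : m ∈ κ.dom) {a b : A m} :
    AffQuot.mk v a = AffQuot.mk v b ↔ (κ.triv m a).1 = (κ.triv m b).1 := by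
  rw [AffQuot.mk_eq_iff]
  constructor
  · rintro ⟨t, rfl⟩
    simp [κ.triv_vadd hm]
  · intro h
    refine ⟨(κ.triv m b).2 - (κ.triv m a).2, (κ.triv m).injective ?_⟩
    rw [κ.triv_vadd hm]
    ext <;> simp [h]

theorem exists_fst (k : K) : ∃ a : A m, (κ.triv m a).1 = k :=
  ⟨(κ.triv m).symm (k, 0), by simp⟩

/-- Translation along v changes r only. This exhibits f_σ as a difference of smooth functions, which
its definition through `ratio` does not show. -/
theorem fn_eq_sub (hm : m ∈ κ.dom) (σ : AVSection F A B v) (a : A m) :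
    σ.fn ⟨m, a⟩ = (κ.triv m a).2 - (κ.triv m (σ.toFun m (AffQuot.mk v a))).2 := by
  have := congrArg (κ.triv m) (σ.fn_smul_vadd a)
  rw [κ.triv_vadd hm] at this
  have h := congrArg Prod.snd this
  simp only [Prod.snd_add] at h
  linarith

/-- The image of the domain in the model space. -/
def region : Set B := κ.base.target ∩ κ.base.symm ⁻¹' κ.dom

theorem isOpen_region : IsOpen κ.region :=
  κ.base.symm.isOpen_inter_preimage κ.dom.isOpen

theorem base_mem_region (hm : m ∈ κ.dom) : κ.base m ∈ κ.region :=
  ⟨κ.base.map_source (κ.dom_subset hm), by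
    simpa [κ.base.left_inv (κ.dom_subset hm)] using hm⟩

/-- The parametrization of `A` by adapted coordinates. -/
def param (p : B × (K × ℝ)) : TotalSpace F A :=
  ⟨κ.base.symm p.1, (κ.triv (κ.base.symm p.1)).symm p.2⟩

/-- The adapted coordinates on `A`. -/
def coords (x : TotalSpace F A) : B × (K × ℝ) := (κ.base x.1, κ.triv x.1 x.2)

theorem base_symm_base (hm : m ∈ κ.dom) : κ.base.symm (κ.base m) = m :=
  κ.base.left_inv (κ.dom_subset hm)

theorem param_base (hm : m ∈ κ.dom) (z : K × ℝ) :
    κ.param (κ.base m, z) = ⟨m, (κ.triv m).symm z⟩ := by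
  -- The fibre type depends on the base point, so the equality of base points is substituted in a
  -- statement about a general `m'`.
  have : ∀ m', m' = m → (⟨m', (κ.triv m').symm z⟩ : TotalSpace F A) = ⟨m, (κ.triv m).symm z⟩ := by
    rintro _ rfl; rfl
  exact this _ (κ.base_symm_base hm)

theorem param_coords {x : TotalSpace F A} (hx : x.1 ∈ κ.dom) : κ.param (κ.coords x) = x := by
  rw [coords, param_base κ hx, AffineEquiv.symm_apply_apply]

theorem coords_param {p : B × (K × ℝ)} (hp : p.1 ∈ κ.region) : κ.coords (κ.param p) = p := by
  change (κ.base (κ.base.symm p.1), κ.triv (κ.base.symm p.1) ((κ.triv _).symm p.2)) = p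
  rw [κ.base.right_inv hp.1, AffineEquiv.apply_symm_apply]

theorem contMDiffAt_base (hm : m ∈ κ.dom) : ContMDiffAt 𝓘(ℝ, B) 𝓘(ℝ, B) ∞ κ.base m :=
  (contMDiffOn_of_mem_maximalAtlas κ.base_mem).contMDiffAt
    (κ.base.open_source.mem_nhds (κ.dom_subset hm))

theorem contMDiffAt_base_symm {b : B} (hb : b ∈ κ.region) :
    ContMDiffAt 𝓘(ℝ, B) 𝓘(ℝ, B) ∞ κ.base.symm b :=
  (contMDiffOn_symm_of_mem_maximalAtlas κ.base_mem).contMDiffAt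
    (κ.base.open_target.mem_nhds hb.1)

theorem preimage_dom_mem_nhds {x : TotalSpace F A} (hx : x.1 ∈ κ.dom) :
    {y : TotalSpace F A | y.1 ∈ κ.dom} ∈ 𝓝 x :=
  (FiberBundle.continuous_proj F A).continuousAt.preimage_mem_nhds (κ.dom.isOpen.mem_nhds hx)

theorem contMDiffAt_coords {x : TotalSpace F A} (hx : x.1 ∈ κ.dom) :
    ContMDiffAt (𝓘(ℝ, B).prod 𝓘(ℝ, F)) 𝓘(ℝ, B × (K × ℝ)) ∞ κ.coords x :=
  ((κ.contMDiffAt_base hx).comp x (contMDiffAt_proj A)).prodMk_space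
    (κ.smooth.contMDiffAt (κ.preimage_dom_mem_nhds hx))

theorem contMDiffAt_param {p : B × (K × ℝ)} (hp : p.1 ∈ κ.region) :
    ContMDiffAt 𝓘(ℝ, B × (K × ℝ)) (𝓘(ℝ, B).prod 𝓘(ℝ, F)) ∞ κ.param p := by
  have h₁ : ContMDiffAt 𝓘(ℝ, B × (K × ℝ)) 𝓘(ℝ, B) ∞ (fun p : B × (K × ℝ) => κ.base.symm p.1) p :=
    (κ.contMDiffAt_base_symm hp).comp p contDiff_fst.contMDiff.contMDiffAt
  exact (κ.smooth_symm.contMDiffAt (x := (κ.base.symm p.1, p.2))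
    ((κ.dom.isOpen.prod isOpen_univ).mem_nhds ⟨hp.2, mem_univ _⟩)).comp p (h₁.prodMk contDiff_snd.contMDiff.contMDiffAt)

variable (σ : AVSection F A B v)

theorem contMDiffAt_fn {x : TotalSpace F A} (hx : x.1 ∈ κ.dom) :
    ContMDiffAt (𝓘(ℝ, B).prod 𝓘(ℝ, F)) 𝓘(ℝ, ℝ) ∞ σ.fn x := by
  have h₁ := κ.contMDiffAt_coords hx
  have h₂ := (κ.contMDiffAt_coords (x := ⟨x.1, σ.toFun x.1 (AffQuot.mk v x.2)⟩) hx).comp x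
    σ.smooth.contMDiffAt
  have h₃ : ContDiff ℝ ∞ (fun p : B × (K × ℝ) => p.2.2) := by fun_prop
  refine ((h₃.contMDiff.contMDiffAt.comp x h₁).sub
    (h₃.contMDiff.contMDiffAt.comp x h₂)).congr_of_eventuallyEq ?_
  filter_upwards [κ.preimage_dom_mem_nhds hx] with y hy
  exact κ.fn_eq_sub hy σ y.2

theorem localRep_eq (p : B × K) : κ.localRep σ p = σ.fn (κ.param (p.1, (p.2, 0))) := rfl

/-- Every point is obtained from one with r = 0 by translation along v, and f_σ grows by the
parameter of the translation. -/
theorem fn_eq_localRep (hm : m ∈ κ.dom) (a : A m) :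
    σ.fn ⟨m, a⟩ = (κ.triv m a).2 + κ.localRep σ (κ.base m, (κ.triv m a).1) := by
  rw [localRep_eq, param_base κ hm, ← σ.fn_vadd (κ.ne_zero hm)]
  congr 2
  apply (κ.triv m).injective
  rw [κ.triv_vadd hm]
  ext <;> simp

theorem contDiffAt_localRep {p : B × K} (hp : p.1 ∈ κ.region) :
    ContDiffAt ℝ ∞ (κ.localRep σ) p := by
  rw [← contMDiffAt_iff_contDiffAt]
  have h₁ : ContDiff ℝ ∞ (fun p : B × K => (p.1, (p.2, (0 : ℝ)))) := by fun_prop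
  exact (κ.contMDiffAt_fn σ (x := κ.param (p.1, (p.2, 0))) hp.2).comp p
    ((κ.contMDiffAt_param (p := (p.1, (p.2, 0))) hp).comp p h₁.contMDiff.contMDiffAt)

theorem differentiableAt_localRep {p : B × K} (hp : p.1 ∈ κ.region) :
    DifferentiableAt ℝ (κ.localRep σ) p :=
  (κ.contDiffAt_localRep σ hp).differentiableAt (by simp)

end AdaptedChart

/-- Sections of `ζ` correspond to functions `f` on `A` with `f (a + t v) = f a + t`. -/
def AVSection.ofFun (f : TotalSpace F A → ℝ)
    (hf : ContMDiff (𝓘(ℝ, B).prod 𝓘(ℝ, F)) 𝓘(ℝ, ℝ) ∞ f)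
    (h : ∀ m (t : ℝ) (a : A m), f ⟨m, t • v m +ᵥ a⟩ = t + f ⟨m, a⟩)
    (hκ : ∀ m, ∃ κ : AdaptedChart F A B v K, m ∈ κ.dom) : AVSection F A B v where
  toFun m := Quot.lift (fun a => -f ⟨m, a⟩ • v m +ᵥ a) (by
    rintro a _ ⟨t, rfl⟩
    rw [h, vadd_vadd, ← add_smul]
    congr 2
    ring)
  mk_toFun m y := by
    obtain ⟨a, rfl⟩ := AffQuot.exists_rep y
    exact AVSection.mk_smul_vadd _ _
  smooth x := by
    obtain ⟨κ, hκ⟩ := hκ x.1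
    have h₁ := κ.contMDiffAt_coords hκ
    -- In adapted coordinates σ(ζ(a)) is (x, k, r - f(a)).
    have h₂ : ContDiff ℝ ∞ (fun p : (B × (K × ℝ)) × ℝ => (p.1.1, (p.1.2.1, p.1.2.2 - p.2))) := by
      fun_prop
    have h₃ := h₂.contMDiff.contMDiffAt.comp x (h₁.prodMk_space hf.contMDiffAt)
    refine ((κ.contMDiffAt_param (p := _) ?_).comp x h₃).congr_of_eventuallyEq ?_
    · exact κ.base_mem_region hκ
    · filter_upwards [κ.preimage_dom_mem_nhds hκ] with y hy
      change _ = κ.param (κ.base y.1, _)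
      rw [κ.param_base hy]
      congr 1
      apply (κ.triv y.1).injective
      rw [AffineEquiv.apply_symm_apply]
      refine (κ.triv_vadd hy _ _).trans ?_
      ext <;> simp [AdaptedChart.coords, sub_eq_add_neg]

theorem AVSection.fn_ofFun {f : TotalSpace F A → ℝ}
    (hf : ContMDiff (𝓘(ℝ, B).prod 𝓘(ℝ, F)) 𝓘(ℝ, ℝ) ∞ f)
    (h : ∀ m (t : ℝ) (a : A m), f ⟨m, t • v m +ᵥ a⟩ = t + f ⟨m, a⟩)
    (hκ : ∀ m, ∃ κ : AdaptedChart F A B v K, m ∈ κ.dom) (x : TotalSpace F A) :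
    (AVSection.ofFun f hf h hκ).fn x = f x := by
  obtain ⟨κ, hm⟩ := hκ x.1
  apply (AVSection.ofFun f hf h hκ).fn_eq (κ.ne_zero hm)
  change f x • v x.1 +ᵥ (-f x • v x.1 +ᵥ x.2) = x.2
  rw [vadd_vadd]
  simp

theorem AVSection.IsAffine.fn_lineMap {σ : AVSection F A B v} (h : σ.IsAffine) {m : M}
    (hv : v m ≠ 0) (a b : A m) (t : ℝ) : σ.fn ⟨m, AffineMap.lineMap b a t⟩ =
      t * σ.fn ⟨m, a⟩ + (1 - t) * σ.fn ⟨m, b⟩ := by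
  apply σ.fn_eq hv
  rw [h]
  rw [σ.toFun_mk, σ.toFun_mk, AffineMap.lineMap_apply, AffineMap.lineMap_apply,
    vadd_vsub_vadd_comm, vadd_vadd, vadd_vadd]
  congr 1
  module

/-! ### Global sections with prescribed jets -/

section Global

variable [FiniteDimensional ℝ B] [IsManifold 𝓘(ℝ, B) ∞ M] [T2Space M] [SecondCountableTopology M]

/-- Each coordinate r is a special affine function over its chart. Combinations with coefficients
that add up to 1 preserve the condition that the linear part is 1 on v, so a partition of unity
glues them. -/
theorem exists_global_special (hκ : ∀ m, ∃ κ : AdaptedChart F A B v K, m ∈ κ.dom) :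
    ∃ f : TotalSpace F A → ℝ, ContMDiff (𝓘(ℝ, B).prod 𝓘(ℝ, F)) 𝓘(ℝ, ℝ) ∞ f ∧
      ∀ m, ∃ φ : SpecialDual A v m, ∀ a, f ⟨m, a⟩ = φ.1 a := by
  have : LocallyCompactSpace M := ChartedSpace.locallyCompactSpace B M
  choose κ hκ using hκ
  obtain ⟨ρ, hρ⟩ := SmoothPartitionOfUnity.exists_isSubordinate 𝓘(ℝ, B) (s := (univ : Set M))
    isClosed_univ (fun i => ((κ i).dom : Set M)) (fun i => (κ i).dom.isOpen)
    (fun m _ => mem_iUnion.2 ⟨m, hκ m⟩)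
  refine ⟨fun x => ∑ᶠ i, ρ i x.1 * ((κ i).triv x.1 x.2).2, ?_, fun m => ?_⟩
  · refine contMDiff_finsum (fun i x => ?_) ?_
    · by_cases hx : x.1 ∈ tsupport (ρ i)
      · have h₁ := (κ i).contMDiffAt_coords (hρ i hx)
        have h₃ : ContDiff ℝ ∞ (fun p : B × (K × ℝ) => p.2.2) := by fun_prop
        exact ((ρ i).contMDiff.contMDiffAt.comp x (contMDiffAt_proj A)).mul
          (h₃.contMDiff.contMDiffAt.comp x h₁)
      · refine (contMDiffAt_const (c := (0 : ℝ))).congr_of_eventuallyEq ?_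
        filter_upwards [(FiberBundle.continuous_proj F A).continuousAt.preimage_mem_nhds
          ((isClosed_tsupport (ρ i)).isOpen_compl.mem_nhds hx)] with y hy
        rw [image_eq_zero_of_notMem_tsupport hy, zero_mul]
    · refine ((ρ.locallyFinite).preimage_continuous
        (FiberBundle.continuous_proj F A)).subset fun i x hx => ?_
      simp only [Function.mem_support, mem_preimage] at hx ⊢
      exact left_ne_zero_of_mul hx
  · let φ : A m →ᵃ[ℝ] ℝ := ∑ i ∈ ρ.finsupport m,
      ρ i m • ((LinearMap.snd ℝ K ℝ).toAffineMap.comp ((κ i).triv m).toAffineMap)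
    refine ⟨⟨φ, ?_⟩, fun a => ?_⟩
    · have e : φ.linear (v m) = ∑ i ∈ ρ.finsupport m, ρ i m * (((κ i).triv m).linear (v m)).2 := by
        have : φ.linear = ∑ i ∈ ρ.finsupport m, ρ i m • ((LinearMap.snd ℝ K ℝ) ∘ₗ
            ((κ i).triv m).linear.toLinearMap) :=
          map_sum (AddMonoidHom.mk' (fun g : A m →ᵃ[ℝ] ℝ => g.linear) fun _ _ => rfl) _ _
        rw [this]
        simp
      rw [e, ← ρ.sum_finsupport m (mem_univ m)]
      refine Finset.sum_congr rfl fun i hi => ?_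
      rw [ρ.mem_finsupport] at hi
      rw [(κ i).triv_special m (hρ i (subset_tsupport _ hi))]
      simp
    · have : ∀ (s : Finset M), (∑ i ∈ s,
          ρ i m • ((LinearMap.snd ℝ K ℝ).toAffineMap.comp ((κ i).triv m).toAffineMap)) a =
          ∑ i ∈ s, ρ i m * ((κ i).triv m a).2 := by
        intro s
        induction s using Finset.cons_induction with
        | empty => simp
        | cons i s hi ih => rw [Finset.sum_cons, Finset.sum_cons, AffineMap.coe_add, Pi.add_apply, ih]; simp
      rw [this]
      exact (ρ.sum_finsupport_smul_eq_finsum (x₀ := m)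
        (fun i x => ((κ i).triv m a).2)).symm

/-- The function r + q(k) + c(x) has the required derivative at every k. A bump function on the base
interpolates between it and a global special function; as the bump is constant on the fibres, the
result is still special affine on each of them. The lemma supplies surjectivity of the jet
coordinates, fibrewise affine representatives of affine differentials, and sections for the
comparison with covectors. -/
theorem exists_section_with_jet (hκ : ∀ m, ∃ κ : AdaptedChart F A B v K, m ∈ κ.dom)
    (κ : AdaptedChart F A B v K) {m : M} (hm : m ∈ κ.dom) (q : K →L[ℝ] ℝ) (c : B →L[ℝ] ℝ) :
    ∃ σ : AVSection F A B v, (∀ x, ∃ φ : SpecialDual A v x, ∀ a, σ.fn ⟨x, a⟩ = φ.1 a) ∧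
      ∀ k, fderiv ℝ (κ.localRep σ) (κ.base m, k) = c.coprod q := by
  have : LocallyCompactSpace M := ChartedSpace.locallyCompactSpace B M
  obtain ⟨f₀, hf₀, hφ₀⟩ := exists_global_special hκ
  -- The neighbourhood is closed so that χ vanishes on an open set containing the complement of the
  -- domain, where `g` is not known to be smooth.
  obtain ⟨t, ht, htc, htd⟩ := exists_mem_nhds_isClosed_subset (κ.dom.isOpen.mem_nhds hm)
  obtain ⟨χ, hχ₁, hχ₀, -⟩ := exists_contMDiffMap_one_nhds_of_subset_interior 𝓘(ℝ, B) (n := ⊤)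
    (isClosed_singleton (x := m)) (singleton_subset_iff.2 (mem_interior_iff_mem_nhds.2 ht))
  rw [nhdsSet_singleton] at hχ₁
  let g : TotalSpace F A → ℝ := fun x => (κ.triv x.1 x.2).2 + q (κ.triv x.1 x.2).1 + c (κ.base x.1)
  let f : TotalSpace F A → ℝ := fun x => χ x.1 * (g x - f₀ x) + f₀ x
  have hχs : ContMDiff (𝓘(ℝ, B).prod 𝓘(ℝ, F)) 𝓘(ℝ, ℝ) ∞ fun x : TotalSpace F A => χ x.1 :=
    χ.contMDiff.comp (contMDiff_proj A)
  have hf : ContMDiff (𝓘(ℝ, B).prod 𝓘(ℝ, F)) 𝓘(ℝ, ℝ) ∞ f := by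
    intro x
    by_cases hx : x.1 ∈ κ.dom
    · have h₁ := κ.contMDiffAt_coords hx
      have h₃ : ContDiff ℝ ∞ (fun p : B × (K × ℝ) => p.2.2 + q p.2.1 + c p.1) := by fun_prop
      exact (hχs.contMDiffAt.mul ((h₃.contMDiff.contMDiffAt.comp x h₁).sub hf₀.contMDiffAt)).add
        hf₀.contMDiffAt
    · refine hf₀.contMDiffAt.congr_of_eventuallyEq ?_
      filter_upwards [(FiberBundle.continuous_proj F A).continuousAt.preimage_mem_nhds
        (htc.isOpen_compl.mem_nhds fun h => hx (htd h))] with y hy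
      simp [f, hχ₀ y.1 hy]
  have hfφ : ∀ m, ∃ φ : SpecialDual A v m, ∀ a, f ⟨m, a⟩ = φ.1 a := by
    intro x
    obtain ⟨φ₀, hφ₀⟩ := hφ₀ x
    by_cases hx : x ∈ κ.dom
    · let φ₁ : A x →ᵃ[ℝ] ℝ := ((LinearMap.snd ℝ K ℝ) +
        q.toLinearMap ∘ₗ LinearMap.fst ℝ K ℝ).toAffineMap.comp (κ.triv x).toAffineMap +
        AffineMap.const ℝ (A x) (c (κ.base x))
      have h₁ : φ₁.linear (v x) = 1 := by
        have := κ.triv_special x hx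
        simp [φ₁, this]
      refine ⟨⟨χ x • (φ₁ - φ₀.1) + φ₀.1, ?_⟩, fun a => ?_⟩
      · simp [h₁, φ₀.2]
      · simp [f, g, φ₁, hφ₀]
    · exact ⟨φ₀, fun a => by simp [f, hχ₀ x fun h => hx (htd h), hφ₀]⟩
  have hft : ∀ m (t : ℝ) (a : A m), f ⟨m, t • v m +ᵥ a⟩ = t + f ⟨m, a⟩ := by
    intro x t a
    obtain ⟨φ, hφ⟩ := hfφ x
    rw [hφ, hφ, AffineMap.map_vadd, map_smul, φ.2]
    simp
  have hfn := AVSection.fn_ofFun hf hft hκ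
  refine ⟨AVSection.ofFun f hf hft hκ, fun x => ?_, fun k => ?_⟩
  · obtain ⟨φ, hφ⟩ := hfφ x
    exact ⟨φ, fun a => (hfn _).trans (hφ a)⟩
  · have h₁ : κ.localRep (AVSection.ofFun f hf hft hκ) =ᶠ[𝓝 (κ.base m, k)]
        fun p => (c.coprod q) p := by
      have h₂ : ∀ᶠ p : B × K in 𝓝 (κ.base m, k), χ (κ.base.symm p.1) = 1 := by
        have h₃ : Filter.Tendsto (fun p : B × K => κ.base.symm p.1) (𝓝 (κ.base m, k)) (𝓝 m) := by
          have := (κ.contMDiffAt_base_symm (κ.base_mem_region hm)).continuousAt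
          rw [ContinuousAt, κ.base_symm_base hm] at this
          exact this.comp continuous_fst.continuousAt
        exact h₃.eventually hχ₁
      filter_upwards [h₂, (κ.isOpen_region.preimage continuous_fst).mem_nhds
        (κ.base_mem_region hm)] with p hp hp'
      rw [κ.localRep_eq, hfn]
      have hp'' : κ.base (κ.base.symm p.1) = p.1 := κ.base.right_inv hp'.1
      simp [f, g, AdaptedChart.param, hp, hp'', add_comm]
    rw [h₁.fderiv_eq]
    exact (c.coprod q).fderiv

end Global

end SectionsOfQuotient

/-! ### Jets as coordinates on the affine phase bundle -/

section PhaseBundle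

variable {F : Type*} [NormedAddCommGroup F] [NormedSpace ℝ F] {M : Type*} [TopologicalSpace M]
  {V : M → Type*} [∀ m, AddCommGroup (V m)] [∀ m, Module ℝ (V m)]
  {A : M → Type*} [∀ m, AddTorsor (V m) (A m)]
  [∀ m, TopologicalSpace (A m)] [TopologicalSpace (TotalSpace F A)] [FiberBundle F A]
  {B : Type*} [NormedAddCommGroup B] [NormedSpace ℝ B] [ChartedSpace B M]
  {v : ∀ m, V m} {K : Type*} [NormedAddCommGroup K] [NormedSpace ℝ K]

namespace AdaptedChart

variable (κ κ' : AdaptedChart F A B v K) {m : M} (hm : m ∈ κ.dom) (hm' : m ∈ κ'.dom)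

/-- The coordinate on `A / ⟨v⟩`. -/
def quotFst : AffQuot A v m → K :=
  Quot.lift (fun a => (κ.triv m a).1) fun _ _ h =>
    (κ.mk_eq_iff hm).1 (AffQuot.mk_eq_iff.2 h)

@[simp] theorem quotFst_mk (a : A m) : κ.quotFst hm (AffQuot.mk v a) = (κ.triv m a).1 := rfl

theorem quotFst_bijective : Function.Bijective (κ.quotFst hm) := by
  constructor
  · intro y y' h
    obtain ⟨a, rfl⟩ := AffQuot.exists_rep y
    obtain ⟨b, rfl⟩ := AffQuot.exists_rep y'
    exact (κ.mk_eq_iff hm).2 h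
  · intro k
    exact ⟨AffQuot.mk v ((κ.triv m).symm (k, 0)), by simp⟩

section SpecialDual
variable [FiniteDimensional ℝ K]

/-- The coordinate on the special affine dual. -/
def dualCoord (f : SpecialDual A v m) : K →L[ℝ] ℝ :=
  LinearMap.toContinuousLinearMap (f.1.linear ∘ₗ (κ.triv m).symm.linear.toLinearMap ∘ₗ
    LinearMap.inl ℝ K ℝ)

theorem dualCoord_apply (f : SpecialDual A v m) (k : K) : κ.dualCoord f k =
    f.1 ((κ.triv m).symm (k, 0)) - f.1 ((κ.triv m).symm (0, 0)) := by
  have : κ.dualCoord f k = f.1.linear ((κ.triv m).symm.linear (k, 0)) := rfl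
  rw [this, ← vsub_eq_sub, ← AffineMap.linearMap_vsub]
  congr 1
  have := (κ.triv m).symm.toAffineMap.linearMap_vsub (k, 0) (0, 0)
  simpa using this

include hm in
theorem special_eq (f : SpecialDual A v m) (a : A m) : f.1 a = (κ.triv m a).2 +
    κ.dualCoord f (κ.triv m a).1 + f.1 ((κ.triv m).symm (0, 0)) := by
  have h : a = (κ.triv m a).2 • v m +ᵥ (κ.triv m).symm ((κ.triv m a).1, 0) := by
    apply (κ.triv m).injective
    rw [κ.triv_vadd hm]
    ext <;> simp
  rw [dualCoord_apply]
  conv_lhs => rw [h, AffineMap.map_vadd, map_smul, f.2]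
  simp only [smul_eq_mul, mul_one, vadd_eq_add]
  ring

include hm in
theorem exists_special (q : K →L[ℝ] ℝ) : ∃ f : SpecialDual A v m, κ.dualCoord f = q := by
  let φ : A m →ᵃ[ℝ] ℝ := (LinearMap.snd ℝ K ℝ +
    q.toLinearMap ∘ₗ LinearMap.fst ℝ K ℝ).toAffineMap.comp (κ.triv m).toAffineMap
  have h : φ.linear (v m) = 1 := by
    have := κ.triv_special m hm
    simp [φ, this]
  refine ⟨⟨φ, h⟩, ?_⟩
  ext k
  rw [dualCoord_apply]
  simp [φ]

/-- The coordinate on the quotient of the special affine dual. -/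
def quotSnd : SpecialDualQuot A v m → K →L[ℝ] ℝ :=
  Quot.lift (fun f => κ.dualCoord f) (by
    rintro f g ⟨c, hc⟩
    ext k
    simp only [dualCoord_apply, hc]
    ring)

@[simp] theorem quotSnd_mk (f : SpecialDual A v m) :
    κ.quotSnd (SpecialDualQuot.mk f) = κ.dualCoord f := rfl

include hm in
theorem quotSnd_bijective :
    Function.Bijective (κ.quotSnd : SpecialDualQuot A v m → K →L[ℝ] ℝ) := by
  constructor
  · intro y y' h
    obtain ⟨f, rfl⟩ := Quot.exists_rep y
    obtain ⟨g, rfl⟩ := Quot.exists_rep y'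
    change κ.dualCoord f = κ.dualCoord g at h
    refine Quot.sound ⟨g.1 ((κ.triv m).symm (0, 0)) - f.1 ((κ.triv m).symm (0, 0)), fun a => ?_⟩
    rw [κ.special_eq hm f, κ.special_eq hm g, h]
    ring
  · intro q
    obtain ⟨f, hf⟩ := κ.exists_special hm q
    exact ⟨SpecialDualQuot.mk f, hf⟩

end SpecialDual

/-! Jets of sections -/

theorem diff_eventuallyEq (σ σ' : AVSection F A B v) {x : TotalSpace F A} (hx : x.1 ∈ κ.dom) :
    σ.diff σ' =ᶠ[𝓝 x] (fun p : B × (K × ℝ) => κ.localRep σ (p.1, p.2.1) -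
      κ.localRep σ' (p.1, p.2.1)) ∘ κ.coords := by
  filter_upwards [κ.preimage_dom_mem_nhds hx] with y hy
  have := σ.diff_eq σ' (κ.ne_zero hy) y.2
  rw [κ.fn_eq_localRep σ hy, κ.fn_eq_localRep σ' hy, add_sub_add_left_eq_sub] at this
  exact this

/-- In adapted coordinates the difference of two sections is the difference of their functions ψ(x,
k), without r. Its differential can thus be tested on the hypersurface r = 0. In particular the
relation defining the phase bundle is an equality of jets. -/
theorem rel_iff (σ σ' : AVSection F A B v) (y : AffQuot A v m) :
    (∀ a : A m, AffQuot.mk v a = y →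
      mfderiv (𝓘(ℝ, B).prod 𝓘(ℝ, F)) 𝓘(ℝ, ℝ) (σ.diff σ') ⟨m, a⟩ = 0) ↔
    fderiv ℝ (κ.localRep σ) (κ.base m, κ.quotFst hm y) =
      fderiv ℝ (κ.localRep σ') (κ.base m, κ.quotFst hm y) := by
  have hr := κ.base_mem_region hm
  constructor
  · intro h
    set k := κ.quotFst hm y with hk
    have h₁ := h ((κ.triv m).symm (k, 0)) ((κ.quotFst_bijective hm).1 (by simp [hk]))
    have h₂ : (fun p : B × K => κ.localRep σ p - κ.localRep σ' p) =ᶠ[𝓝 (κ.base m, k)]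
        (σ.diff σ') ∘ fun p : B × K => κ.param (p.1, (p.2, 0)) := by
      filter_upwards [(κ.isOpen_region.preimage continuous_fst).mem_nhds hr] with p hp
      exact (σ.diff_eq σ' (κ.ne_zero hp.2) _).symm
    have h₃ : MDifferentiableAt 𝓘(ℝ, B × K) (𝓘(ℝ, B).prod 𝓘(ℝ, F))
        (fun p : B × K => κ.param (p.1, (p.2, 0))) (κ.base m, k) := by
      have h₁ : ContDiff ℝ ∞ (fun p : B × K => (p.1, (p.2, (0 : ℝ)))) := by fun_prop
      exact ((κ.contMDiffAt_param (p := (κ.base m, (k, 0))) hr).comp (κ.base m, k)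
        h₁.contMDiff.contMDiffAt).mdifferentiableAt (by simp)
    -- Differentiability is needed separately: `mfderiv` is 0 by default at a point of
    -- nondifferentiability, and the hypothesis would then carry no information.
    have h₄ : MDifferentiableAt (𝓘(ℝ, B).prod 𝓘(ℝ, F)) 𝓘(ℝ, ℝ) (σ.diff σ')
        (κ.param (κ.base m, (k, 0))) := by
      have hx : (κ.param (κ.base m, (k, 0))).1 ∈ κ.dom := hr.2
      refine MDifferentiableAt.congr_of_eventuallyEq ?_ (κ.diff_eventuallyEq σ σ' hx)
      have e := ((κ.contMDiffAt_fn σ hx).sub (κ.contMDiffAt_fn σ' hx)).mdifferentiableAt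
        (n := ∞) (by simp)
      refine e.congr_of_eventuallyEq ((κ.diff_eventuallyEq σ σ' hx).symm.trans ?_)
      filter_upwards [κ.preimage_dom_mem_nhds hx] with z hz
      exact σ.diff_eq σ' (κ.ne_zero hz) z.2
    have h₅ : fderiv ℝ (fun p : B × K => κ.localRep σ p - κ.localRep σ' p) (κ.base m, k) = 0 := by
      have h₆ := h₄.hasMFDerivAt
      rw [show mfderiv (𝓘(ℝ, B).prod 𝓘(ℝ, F)) 𝓘(ℝ, ℝ) (σ.diff σ') (κ.param (κ.base m, (k, 0))) = 0
        by rw [param_base κ hm, h₁]] at h₆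
      rw [h₂.fderiv_eq]
      have h₇ : HasMFDerivAt 𝓘(ℝ, B × K) 𝓘(ℝ, ℝ)
          (σ.diff σ' ∘ fun p : B × K => κ.param (p.1, (p.2, 0))) (κ.base m, k)
          (0 : B × K →L[ℝ] ℝ) := h₆.comp (κ.base m, k) h₃.hasMFDerivAt
      have h₈ : HasFDerivAt (σ.diff σ' ∘ fun p : B × K => κ.param (p.1, (p.2, 0)))
        (0 : B × K →L[ℝ] ℝ) (κ.base m, k) := h₇.hasFDerivAt
      exact h₈.fderiv
    rw [fderiv_fun_sub (κ.differentiableAt_localRep σ hr)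
      (κ.differentiableAt_localRep σ' hr)] at h₅
    exact sub_eq_zero.1 h₅
  · rintro h a rfl
    have hx : (⟨m, a⟩ : TotalSpace F A).1 ∈ κ.dom := hm
    rw [(κ.diff_eventuallyEq σ σ' hx).mfderiv_eq]
    have h₁ : HasFDerivAt (fun p : B × K => κ.localRep σ p - κ.localRep σ' p) (0 : B × K →L[ℝ] ℝ)
        (κ.base m, (κ.triv m a).1) := by
      have := (κ.differentiableAt_localRep σ (p := (κ.base m, (κ.triv m a).1)) hr).hasFDerivAt.sub
        (κ.differentiableAt_localRep σ' (p := (κ.base m, (κ.triv m a).1)) hr).hasFDerivAt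
      rw [show fderiv ℝ (κ.localRep σ) (κ.base m, (κ.triv m a).1) -
        fderiv ℝ (κ.localRep σ') (κ.base m, (κ.triv m a).1) = 0 from sub_eq_zero.2 h] at this
      exact this
    have h₂ : HasFDerivAt (fun p : B × (K × ℝ) => κ.localRep σ (p.1, p.2.1) -
        κ.localRep σ' (p.1, p.2.1)) (0 : B × (K × ℝ) →L[ℝ] ℝ) (κ.coords ⟨m, a⟩) := by
      have h₀ := (show DifferentiableAt ℝ (fun p : B × (K × ℝ) => (p.1, p.2.1))
        (κ.coords ⟨m, a⟩) by fun_prop).hasFDerivAt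
      exact (HasFDerivAt.comp (κ.coords ⟨m, a⟩) (f := fun p : B × (K × ℝ) => (p.1, p.2.1))
        h₁ h₀).congr_fderiv (ContinuousLinearMap.zero_comp _)
    have h₃ := h₂.hasMFDerivAt.comp (⟨m, a⟩ : TotalSpace F A)
      ((κ.contMDiffAt_coords hx).mdifferentiableAt (by simp)).hasMFDerivAt
    rw [h₃.mfderiv]
    exact ContinuousLinearMap.zero_comp _

/-- The differential at `y` of the local representative of a section, as a function on the affine
phase bundle. -/
def jet (η : Phase F A B v m) : B × K →L[ℝ] ℝ :=
  Quot.lift (fun σ : AVSection F A B v => fderiv ℝ (κ.localRep σ) (κ.base m, κ.quotFst hm η.1))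
    (fun σ σ' h => (κ.rel_iff hm σ σ' η.1).1 h) η.2

@[simp] theorem jet_affDiff (σ : AVSection F A B v) (y : AffQuot A v m) :
    κ.jet hm (σ.affDiff m y) = fderiv ℝ (κ.localRep σ) (κ.base m, κ.quotFst hm y) := rfl

theorem exists_affDiff (η : Phase F A B v m) : ∃ σ : AVSection F A B v, σ.affDiff m η.1 = η := by
  obtain ⟨y, q⟩ := η
  obtain ⟨σ, rfl⟩ := Quot.exists_rep q
  exact ⟨σ, rfl⟩

theorem phase_ext {η η' : Phase F A B v m} (h₁ : η.1 = η'.1) (h₂ : κ.jet hm η = κ.jet hm η') :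
    η = η' := by
  obtain ⟨σ, hσ⟩ := exists_affDiff η
  obtain ⟨σ', hσ'⟩ := exists_affDiff η'
  rw [← hσ, ← hσ', ← h₁] at h₂ ⊢
  exact congrArg (Sigma.mk η.1) (Quot.sound ((κ.rel_iff hm σ σ' η.1).2 h₂))

/-! Change of adapted coordinates -/

/-- The image in the coordinates `κ` of the point of the hyperplane `r' = 0` with coordinates
`(x', k')` for `κ'`. -/
def trans (p : B × K) : B × (K × ℝ) := κ.coords (κ'.param (p.1, (p.2, 0)))

theorem contDiffAt_trans {p : B × K} (hp : p.1 ∈ κ'.region) (hp' : κ'.base.symm p.1 ∈ κ.dom) :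
    ContDiffAt ℝ ∞ (κ.trans κ') p := by
  rw [← contMDiffAt_iff_contDiffAt]
  have h₁ : ContDiff ℝ ∞ (fun p : B × K => (p.1, (p.2, (0 : ℝ)))) := by fun_prop
  exact (κ.contMDiffAt_coords (x := κ'.param (p.1, (p.2, 0))) hp').comp p
    ((κ'.contMDiffAt_param (p := (p.1, (p.2, 0))) hp).comp p h₁.contMDiff.contMDiffAt)

/-- The local representative for κ' is f_σ on the hypersurface r' = 0, and f_σ itself does not refer
to a chart; so it can be evaluated with κ at the image of that hypersurface. -/
theorem localRep_trans (σ : AVSection F A B v) {p : B × K}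
    (hp' : κ'.base.symm p.1 ∈ κ.dom) : κ'.localRep σ p =
      (κ.trans κ' p).2.2 + κ.localRep σ ((κ.trans κ' p).1, (κ.trans κ' p).2.1) :=
  κ.fn_eq_localRep σ hp' _

include hm' in
theorem trans_base (k : K) : κ.trans κ' (κ'.base m, k) =
    (κ.base m, κ.triv m ((κ'.triv m).symm (k, 0))) := by
  rw [trans, param_base κ' hm']; rfl

/-- The change of the base coordinate and of the first fibre coordinate. -/
theorem trans_quotFst (y : AffQuot A v m) :
    ((κ.trans κ' (κ'.base m, κ'.quotFst hm' y)).1, (κ.trans κ' (κ'.base m, κ'.quotFst hm' y)).2.1) =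
      (κ.base m, κ.quotFst hm y) := by
  obtain ⟨a, rfl⟩ := AffQuot.exists_rep y
  rw [trans_base κ κ' hm']
  refine Prod.ext rfl ?_
  exact (κ.mk_eq_iff hm).1 ((κ'.mk_eq_iff hm').2 (by simp))

/-- The linear function `J(x, k) + r` of `(x, k, r)`. -/
def jetExtend (J : B × K →L[ℝ] ℝ) : B × (K × ℝ) →L[ℝ] ℝ :=
  J.comp ((ContinuousLinearMap.fst ℝ B (K × ℝ)).prod
      ((ContinuousLinearMap.fst ℝ K ℝ).comp (ContinuousLinearMap.snd ℝ B (K × ℝ)))) +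
    (ContinuousLinearMap.snd ℝ K ℝ).comp (ContinuousLinearMap.snd ℝ B (K × ℝ))

theorem jetExtend_apply (J : B × K →L[ℝ] ℝ) (w : B × (K × ℝ)) :
    jetExtend J w = J (w.1, 0) + J (0, w.2.1) + w.2.2 := by
  rw [← map_add]
  simp [jetExtend]

/-- This is the derivative of `localRep_trans`. The new jet depends on the old one by J ↦ (J + dr) ∘
DT, with T = `κ.trans κ'`; both affine structures and the smoothness of the transition maps are read
off from this formula. -/
theorem jet_trans (η : Phase F A B v m) : κ'.jet hm' η =
    (jetExtend (κ.jet hm η)).comp (fderiv ℝ (κ.trans κ') (κ'.base m, κ'.quotFst hm' η.1)) := by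
  obtain ⟨σ, hσ⟩ := exists_affDiff η
  have hr' := κ'.base_mem_region hm'
  have hs : κ'.base.symm (κ'.base m) ∈ κ.dom := by rwa [κ'.base_symm_base hm']
  set p := (κ'.base m, κ'.quotFst hm' η.1) with hp
  have hT := (κ.contDiffAt_trans κ' (p := p) hr' hs).differentiableAt (by simp)
  have h₁ : κ'.localRep σ =ᶠ[𝓝 p] fun p =>
      (κ.trans κ' p).2.2 + κ.localRep σ ((κ.trans κ' p).1, (κ.trans κ' p).2.1) := by
    have hc : ContinuousAt (fun p : B × K => κ'.base.symm p.1) p :=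
      (κ'.contMDiffAt_base_symm hr').continuousAt.comp (f := fun p : B × K => p.1)
        continuous_fst.continuousAt
    filter_upwards [hc.preimage_mem_nhds (κ.dom.isOpen.mem_nhds hs)] with q hq
    exact κ.localRep_trans κ' σ hq
  have hq : ((κ.trans κ' p).1, (κ.trans κ' p).2.1) = (κ.base m, κ.quotFst hm η.1) :=
    κ.trans_quotFst κ' hm hm' η.1
  have h₂ : HasFDerivAt (κ.localRep σ) (κ.jet hm η) ((κ.trans κ' p).1, (κ.trans κ' p).2.1) := by
    rw [hq]
    nth_rewrite 1 [← hσ]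
    rw [jet_affDiff]
    exact (κ.differentiableAt_localRep σ (κ.base_mem_region hm)).hasFDerivAt
  have h₃ := (hT.hasFDerivAt.snd.snd).add
    (h₂.comp p (hT.hasFDerivAt.fst.prodMk hT.hasFDerivAt.snd.fst))
  have h₄ : κ'.jet hm' η = fderiv ℝ (κ'.localRep σ) p := by
    nth_rewrite 1 [← hσ]; rfl
  rw [h₄, h₁.fderiv_eq]
  refine HasFDerivAt.fderiv (h₃.congr_fderiv ?_)
  ext u <;> simp [jetExtend, add_comm]

end AdaptedChart
end PhaseBundle

/-! ### Partial derivatives of functions affine in one variable -/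

section PartialDerivative

variable {E K W : Type*} [NormedAddCommGroup E] [NormedSpace ℝ E] [NormedAddCommGroup K]
  [NormedSpace ℝ K] [NormedAddCommGroup W] [NormedSpace ℝ W]

theorem fderiv_comp_inl {G : E × K → W} {b : E} {k : K} (hG : DifferentiableAt ℝ G (b, k)) :
    (fderiv ℝ G (b, k)).comp (ContinuousLinearMap.inl ℝ E K) = fderiv ℝ (fun x => G (x, k)) b :=
  (hG.hasFDerivAt.comp b (hasFDerivAt_prodMk_left b k)).fderiv.symm

theorem fderiv_comp_inr {G : E × K → W} {b : E} {k : K} (hG : DifferentiableAt ℝ G (b, k)) :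
    (fderiv ℝ G (b, k)).comp (ContinuousLinearMap.inr ℝ E K) = fderiv ℝ (fun x => G (b, x)) k :=
  (hG.hasFDerivAt.comp k (hasFDerivAt_prodMk_right b k)).fderiv.symm

/-- The affine relation holds for all x near b with fixed k, k' and t, so it may be differentiated
in x. -/
theorem fderiv_comp_inl_affine {G : E × K → W} {b : E} (hG : ∀ k, DifferentiableAt ℝ G (b, k))
    (k k' : K) (t : ℝ) (h : ∀ᶠ x in 𝓝 b,
      G (x, t • k + (1 - t) • k') = t • G (x, k) + (1 - t) • G (x, k')) :
    (fderiv ℝ G (b, t • k + (1 - t) • k')).comp (ContinuousLinearMap.inl ℝ E K) =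
      t • (fderiv ℝ G (b, k)).comp (ContinuousLinearMap.inl ℝ E K) +
      (1 - t) • (fderiv ℝ G (b, k')).comp (ContinuousLinearMap.inl ℝ E K) := by
  have hd : ∀ k, DifferentiableAt ℝ (fun x => G (x, k)) b := fun k =>
    ((hG k).hasFDerivAt.comp b (hasFDerivAt_prodMk_left b k)).differentiableAt
  rw [fderiv_comp_inl (hG _), fderiv_comp_inl (hG _), fderiv_comp_inl (hG _),
    Filter.EventuallyEq.fderiv_eq h]
  exact (((hd k).hasFDerivAt.const_smul t).add ((hd k').hasFDerivAt.const_smul (1 - t))).fderiv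

end PartialDerivative

/-! ### Affine combinations and projections of the affine phase bundle -/

section PhaseBundle

variable {F : Type*} [NormedAddCommGroup F] [NormedSpace ℝ F] {M : Type*} [TopologicalSpace M]
  {V : M → Type*} [∀ m, AddCommGroup (V m)] [∀ m, Module ℝ (V m)]
  {A : M → Type*} [∀ m, AddTorsor (V m) (A m)]
  [∀ m, TopologicalSpace (A m)] [TopologicalSpace (TotalSpace F A)] [FiberBundle F A]
  {B : Type*} [NormedAddCommGroup B] [NormedSpace ℝ B] [ChartedSpace B M]
  {v : ∀ m, V m} {K : Type*} [NormedAddCommGroup K] [NormedSpace ℝ K]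

theorem AffQuot.mk_out {m : M} (y : AffQuot A v m) : AffQuot.mk v (Quot.out y) = y := Quot.out_eq y

/-- Affine combinations in `A / ⟨v⟩`. -/
def affQuotComb (m : M) (y y' : AffQuot A v m) (t : ℝ) : AffQuot A v m :=
  AffQuot.mk v (AffineMap.lineMap (Quot.out y') (Quot.out y) t)

/-- Affine combinations of special affine functions. -/
def specialComb {m : M} (f g : SpecialDual A v m) (t : ℝ) : SpecialDual A v m :=
  ⟨t • f.1 + (1 - t) • g.1, by simp [f.2, g.2]⟩

/-- Affine combinations in the quotient of the special affine dual. -/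
def specialQuotComb (m : M) (y y' : SpecialDualQuot A v m) (t : ℝ) : SpecialDualQuot A v m :=
  SpecialDualQuot.mk (specialComb (Quot.out y) (Quot.out y') t)

namespace AdaptedChart

variable (κ κ' : AdaptedChart F A B v K) {m : M} (hm : m ∈ κ.dom) (hm' : m ∈ κ'.dom)

theorem quotFst_lineMap (a b : A m) (t : ℝ) :
    κ.quotFst hm (AffQuot.mk v (AffineMap.lineMap b a t)) =
      t • κ.quotFst hm (AffQuot.mk v a) + (1 - t) • κ.quotFst hm (AffQuot.mk v b) := by
  simp only [quotFst_mk]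
  rw [AffineEquiv.apply_lineMap, AffineMap.lineMap_apply_module]
  simp [add_comm]

theorem quotFst_comb (y y' : AffQuot A v m) (t : ℝ) : κ.quotFst hm (affQuotComb m y y' t) =
    t • κ.quotFst hm y + (1 - t) • κ.quotFst hm y' := by
  rw [affQuotComb, quotFst_lineMap, AffQuot.mk_out, AffQuot.mk_out]

section
variable [FiniteDimensional ℝ K]

theorem quotSnd_comb (y y' : SpecialDualQuot A v m) (t : ℝ) :
    κ.quotSnd (specialQuotComb m y y' t) = t • κ.quotSnd y + (1 - t) • κ.quotSnd y' := by
  have h : ∀ f g : SpecialDual A v m, κ.dualCoord (specialComb f g t) =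
      t • κ.dualCoord f + (1 - t) • κ.dualCoord g := by
    intro f g
    ext k
    rfl
  rw [specialQuotComb, quotSnd_mk, h, ← quotSnd_mk, ← quotSnd_mk]
  congr <;> exact Quot.out_eq _

/-- Where f_σ is affine on the fibre, ψ is affine in k with linear part `dualCoord f`, hence has the
same k-derivative at all k. Affinity over the single point m is enough. -/
theorem fderiv_localRep_comp_inr (σ : AVSection F A B v) (f : SpecialDual A v m)
    (h : ∀ a, f.1 a = σ.fn ⟨m, a⟩) (hm : m ∈ κ.dom) (k : K) :
    (fderiv ℝ (κ.localRep σ) (κ.base m, k)).comp (ContinuousLinearMap.inr ℝ B K) =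
      κ.dualCoord f := by
  refine (fderiv_comp_inr (κ.differentiableAt_localRep σ (p := (κ.base m, k))
    (κ.base_mem_region hm))).trans ?_
  have : (fun x => κ.localRep σ (κ.base m, x)) =
      fun x => κ.dualCoord f x + f.1 ((κ.triv m).symm (0, 0)) := by
    funext x
    rw [κ.localRep_eq, κ.param_base hm, dualCoord_apply, ← h]
    ring
  rw [this, fderiv_add_const, ContinuousLinearMap.fderiv]

end

theorem trans_comb (b : B) (k k' : K) (t : ℝ) : κ.trans κ' (b, t • k + (1 - t) • k') =
    t • κ.trans κ' (b, k) + (1 - t) • κ.trans κ' (b, k') := by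
  refine Prod.ext ?_ ?_
  · change κ.base (κ'.base.symm b) = t • κ.base (κ'.base.symm b) + (1 - t) • κ.base (κ'.base.symm b)
    module
  · let φ : K × ℝ →ᵃ[ℝ] K × ℝ := (κ.triv (κ'.base.symm b)).toAffineMap.comp
      (κ'.triv (κ'.base.symm b)).symm.toAffineMap
    change φ (t • k + (1 - t) • k', 0) = t • φ (k, 0) + (1 - t) • φ (k', 0)
    have e : (t • k + (1 - t) • k', (0 : ℝ)) = AffineMap.lineMap (k', (0 : ℝ)) (k, (0 : ℝ)) t := by
      rw [AffineMap.lineMap_apply_module]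
      ext <;> simp [add_comm]
    rw [e, AffineMap.apply_lineMap, AffineMap.lineMap_apply_module]
    exact add_comm _ _

section Change
include hm hm'

theorem differentiableAt_trans (k : K) : DifferentiableAt ℝ (κ.trans κ') (κ'.base m, k) :=
  (κ.contDiffAt_trans κ' (p := (κ'.base m, k)) (κ'.base_mem_region hm')
    (by simpa only [κ'.base_symm_base hm'] using hm)).differentiableAt (by simp)

/-- The base component of the change of coordinates is a coordinate change of `M` and does not
involve k. -/
theorem fderiv_trans_fst (k k' : K) (u : B) : (fderiv ℝ (κ.trans κ') (κ'.base m, k) (u, 0)).1 =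
    (fderiv ℝ (κ.trans κ') (κ'.base m, k') (u, 0)).1 := by
  have h : ∀ k, (fderiv ℝ (κ.trans κ') (κ'.base m, k) (u, 0)).1 =
      fderiv ℝ (fun b => κ.base (κ'.base.symm b)) (κ'.base m) u := by
    intro k
    have hd := κ.differentiableAt_trans κ' hm hm' k
    have h₁ := fderiv_comp_inl (G := fun p => (κ.trans κ' p).1) hd.fst
    have h₂ : fderiv ℝ (fun p => (κ.trans κ' p).1) (κ'.base m, k) = _ := fderiv.fst hd
    rw [h₂] at h₁
    exact congrArg (fun L => L u) h₁
  rw [h, h]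

/-- Over one point y the derivative DT is fixed, and J ↦ (J + dr) ∘ DT is an affine map: the weights
t and 1 - t add up to 1, so the term dr is reproduced. -/
theorem jet_comp_inl_of_fst_eq {η η' ζ : Phase F A B v m} {t : ℝ} (h₀ : η.1 = η'.1) (h₁ : ζ.1 = η.1)
    (h₂ : κ.jet hm ζ = t • κ.jet hm η + (1 - t) • κ.jet hm η') :
    κ'.jet hm' ζ = t • κ'.jet hm' η + (1 - t) • κ'.jet hm' η' := by
  rw [κ.jet_trans κ' hm hm' ζ, κ.jet_trans κ' hm hm' η, κ.jet_trans κ' hm hm' η', h₁, ← h₀, h₂]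
  ext u <;> simp [jetExtend] <;> ring

/-- Let q be the common k-part of the jets and p the x-part. In the direction u the new x-part is
p(DT_x u) + q(DT_k u) + DT_r u. Here DT_x u does not depend on k, while DT_k u and DT_r u are affine
in k by `trans_comb`; so the expression is affine when k and p move together along a line. -/
theorem jet_comp_inl_of_snd_eq {η η' ζ : Phase F A B v m} {t : ℝ}
    (h₀ : κ'.quotFst hm' ζ.1 = t • κ'.quotFst hm' η.1 + (1 - t) • κ'.quotFst hm' η'.1)
    (h₁ : (κ.jet hm ζ).comp (ContinuousLinearMap.inr ℝ B K) =
      (κ.jet hm η).comp (ContinuousLinearMap.inr ℝ B K))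
    (h₁' : (κ.jet hm η').comp (ContinuousLinearMap.inr ℝ B K) =
      (κ.jet hm η).comp (ContinuousLinearMap.inr ℝ B K))
    (h₂ : (κ.jet hm ζ).comp (ContinuousLinearMap.inl ℝ B K) =
      t • (κ.jet hm η).comp (ContinuousLinearMap.inl ℝ B K) +
        (1 - t) • (κ.jet hm η').comp (ContinuousLinearMap.inl ℝ B K)) :
    (κ'.jet hm' ζ).comp (ContinuousLinearMap.inl ℝ B K) =
      t • (κ'.jet hm' η).comp (ContinuousLinearMap.inl ℝ B K) +
        (1 - t) • (κ'.jet hm' η').comp (ContinuousLinearMap.inl ℝ B K) := by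
  have hD := fderiv_comp_inl_affine (G := κ.trans κ') (κ.differentiableAt_trans κ' hm hm')
    (κ'.quotFst hm' η.1) (κ'.quotFst hm' η'.1) t
    (Filter.Eventually.of_forall fun b => κ.trans_comb κ' b _ _ t)
  rw [← h₀] at hD
  ext u
  have hDu := congrArg (fun L => L u) hD
  simp only [ContinuousLinearMap.comp_apply, ContinuousLinearMap.inl_apply,
    add_apply, smul_apply] at hDu
  have e₁ := κ.fderiv_trans_fst κ' hm hm' (κ'.quotFst hm' η.1) (κ'.quotFst hm' ζ.1) u
  have e₂ := κ.fderiv_trans_fst κ' hm hm' (κ'.quotFst hm' η'.1) (κ'.quotFst hm' ζ.1) u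
  have g₁ : ∀ w, κ.jet hm ζ (0, w) = κ.jet hm η (0, w) := fun w => congrArg (fun L => L w) h₁
  have g₂ : ∀ w, κ.jet hm η' (0, w) = κ.jet hm η (0, w) := fun w => congrArg (fun L => L w) h₁'
  have g₃ : ∀ w, κ.jet hm ζ (w, 0) = t * κ.jet hm η (w, 0) + (1 - t) * κ.jet hm η' (w, 0) :=
    fun w => congrArg (fun L => L w) h₂
  simp only [ContinuousLinearMap.comp_apply, ContinuousLinearMap.inl_apply,
    add_apply, smul_apply]
  rw [κ.jet_trans κ' hm hm' ζ, κ.jet_trans κ' hm hm' η, κ.jet_trans κ' hm hm' η']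
  simp only [ContinuousLinearMap.comp_apply, jetExtend_apply, g₁, g₂, g₃, e₁, e₂, smul_eq_mul]
  rw [show (fderiv ℝ (κ.trans κ') (κ'.base m, κ'.quotFst hm' ζ.1) (u, 0)).2 = _ from
    congrArg Prod.snd hDu]
  have g₄ : ∀ w w', κ.jet hm η (0, t • w + (1 - t) • w') =
      t * κ.jet hm η (0, w) + (1 - t) * κ.jet hm η (0, w') := fun w w' => by
    have e : ((0 : B), t • w + (1 - t) • w') = t • (0, w) + (1 - t) • (0, w') := by ext <;> simp
    rw [e, map_add, map_smul, map_smul]; rfl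
  simp only [Prod.snd_add, Prod.smul_snd, Prod.fst_add, Prod.smul_fst, g₄, smul_eq_mul]
  ring

end Change

end AdaptedChart

section Structure

variable [FiniteDimensional ℝ B] [IsManifold 𝓘(ℝ, B) ∞ M] [T2Space M] [SecondCountableTopology M]
  (hκ : ∀ m, ∃ κ : AdaptedChart F A B v K, m ∈ κ.dom)

include hκ

theorem exists_phase (κ : AdaptedChart F A B v K) {m : M} (hm : m ∈ κ.dom) (y : AffQuot A v m)
    (J : B × K →L[ℝ] ℝ) : ∃ η : Phase F A B v m, η.1 = y ∧ κ.jet hm η = J := by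
  obtain ⟨σ, -, hσ⟩ := exists_section_with_jet hκ κ hm (J.comp (ContinuousLinearMap.inr ℝ B K))
    (J.comp (ContinuousLinearMap.inl ℝ B K))
  refine ⟨σ.affDiff m y, rfl, ?_⟩
  rw [κ.jet_affDiff, hσ]
  ext <;> simp

/-- The point is constructed in one chart and then recognised in all. The condition η.1 = η'.1 sits
inside the existential, so that choosing gives an operation on all pairs. -/
theorem exists_phaseAff₁ {m : M} (η η' : Phase F A B v m) (t : ℝ) : ∃ ζ : Phase F A B v m,
    η.1 = η'.1 → ζ.1 = η.1 ∧ ∀ (κ : AdaptedChart F A B v K) (hm : m ∈ κ.dom),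
      κ.jet hm ζ = t • κ.jet hm η + (1 - t) • κ.jet hm η' := by
  obtain ⟨κ, hm⟩ := hκ m
  obtain ⟨ζ, h₁, h₂⟩ := exists_phase hκ κ hm η.1 (t • κ.jet hm η + (1 - t) • κ.jet hm η')
  exact ⟨ζ, fun h => ⟨h₁, fun κ' hm' => κ.jet_comp_inl_of_fst_eq κ' hm hm' h h₁ h₂⟩⟩

variable [FiniteDimensional ℝ K]

/-- Every affine differential is represented by a section with the same jet for which f_σ is special
affine on every fibre. The class of that function serves all charts at once. -/
theorem exists_phasePr₂ {m : M} (η : Phase F A B v m) : ∃ z : SpecialDualQuot A v m,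
    ∀ (κ : AdaptedChart F A B v K) (hm : m ∈ κ.dom),
      κ.quotSnd z = (κ.jet hm η).comp (ContinuousLinearMap.inr ℝ B K) := by
  obtain ⟨κ, hm⟩ := hκ m
  obtain ⟨σ, hφ, hσ⟩ := exists_section_with_jet hκ κ hm
    ((κ.jet hm η).comp (ContinuousLinearMap.inr ℝ B K))
    ((κ.jet hm η).comp (ContinuousLinearMap.inl ℝ B K))
  have h : η = σ.affDiff m η.1 := by
    refine κ.phase_ext hm (η := η) (η' := σ.affDiff m η.1) rfl ?_
    rw [κ.jet_affDiff, hσ]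
    ext <;> simp
  obtain ⟨f, hf⟩ := hφ m
  refine ⟨SpecialDualQuot.mk f, fun κ' hm' => ?_⟩
  rw [h, κ'.jet_affDiff, κ'.fderiv_localRep_comp_inr σ f (fun a => (hf a).symm) hm']
  rfl

/-- The projection of the affine phase bundle to the quotient of the special affine dual. -/
def phasePr₂ (m : M) (η : Phase F A B v m) : SpecialDualQuot A v m :=
  (exists_phasePr₂ hκ η).choose

theorem quotSnd_phasePr₂ (κ : AdaptedChart F A B v K) {m : M} (hm : m ∈ κ.dom)
    (η : Phase F A B v m) : κ.quotSnd (phasePr₂ hκ m η) =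
      (κ.jet hm η).comp (ContinuousLinearMap.inr ℝ B K) :=
  (exists_phasePr₂ hκ η).choose_spec κ hm

/-- In one chart the point is prescribed by the combination of the base points, the common k-part of
the jets and the combination of the x-parts; `jet_comp_inl_of_snd_eq` carries this over to every
chart. -/
theorem exists_phaseAff₂ {m : M} (η η' : Phase F A B v m) (t : ℝ) : ∃ ζ : Phase F A B v m,
    phasePr₂ hκ m η = phasePr₂ hκ m η' → ζ.1 = affQuotComb m η.1 η'.1 t ∧
      phasePr₂ hκ m ζ = phasePr₂ hκ m η ∧
      ∀ (κ : AdaptedChart F A B v K) (hm : m ∈ κ.dom),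
      (κ.jet hm ζ).comp (ContinuousLinearMap.inl ℝ B K) =
      t • (κ.jet hm η).comp (ContinuousLinearMap.inl ℝ B K) +
        (1 - t) • (κ.jet hm η').comp (ContinuousLinearMap.inl ℝ B K) := by
  obtain ⟨κ, hm⟩ := hκ m
  obtain ⟨ζ, h₁, h₂⟩ := exists_phase hκ κ hm (affQuotComb m η.1 η'.1 t)
    ((t • (κ.jet hm η).comp (ContinuousLinearMap.inl ℝ B K) +
        (1 - t) • (κ.jet hm η').comp (ContinuousLinearMap.inl ℝ B K)).coprod
      ((κ.jet hm η).comp (ContinuousLinearMap.inr ℝ B K)))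
  refine ⟨ζ, fun h => ⟨h₁, ?_, fun κ' hm' => ?_⟩⟩
  · apply (κ.quotSnd_bijective hm).1
    rw [quotSnd_phasePr₂ hκ κ hm, quotSnd_phasePr₂ hκ κ hm, h₂]
    ext; simp
  · refine κ.jet_comp_inl_of_snd_eq κ' hm hm' ?_ ?_ ?_ ?_
    · rw [h₁, κ'.quotFst_comb]
    · rw [h₂]; ext; simp
    · rw [← quotSnd_phasePr₂ hκ κ hm, ← quotSnd_phasePr₂ hκ κ hm, h]
    · rw [h₂]; ext; simp

/-- Affine combinations in the fibres of `PA → A / ⟨v⟩`. -/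
def phaseAff₁ (m : M) (η η' : Phase F A B v m) (t : ℝ) : Phase F A B v m :=
  (exists_phaseAff₁ hκ η η' t).choose

/-- Affine combinations in the fibres of the projection of `PA` to the quotient of the special
affine dual. -/
def phaseAff₂ (m : M) (η η' : Phase F A B v m) (t : ℝ) : Phase F A B v m :=
  (exists_phaseAff₂ hκ η η' t).choose

theorem phaseAff₁_spec {m : M} {η η' : Phase F A B v m} (h : η.1 = η'.1) (t : ℝ) :
    (phaseAff₁ hκ m η η' t).1 = η.1 ∧ ∀ (κ : AdaptedChart F A B v K) (hm : m ∈ κ.dom),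
      κ.jet hm (phaseAff₁ hκ m η η' t) = t • κ.jet hm η + (1 - t) • κ.jet hm η' :=
  (exists_phaseAff₁ hκ η η' t).choose_spec h

theorem phaseAff₂_spec {m : M} {η η' : Phase F A B v m}
    (h : phasePr₂ hκ m η = phasePr₂ hκ m η') (t : ℝ) :
    (phaseAff₂ hκ m η η' t).1 = affQuotComb m η.1 η'.1 t ∧
      phasePr₂ hκ m (phaseAff₂ hκ m η η' t) = phasePr₂ hκ m η ∧
      ∀ (κ : AdaptedChart F A B v K) (hm : m ∈ κ.dom),
      (κ.jet hm (phaseAff₂ hκ m η η' t)).comp (ContinuousLinearMap.inl ℝ B K) =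
      t • (κ.jet hm η).comp (ContinuousLinearMap.inl ℝ B K) +
        (1 - t) • (κ.jet hm η').comp (ContinuousLinearMap.inl ℝ B K) :=
  (exists_phaseAff₂ hκ η η' t).choose_spec h

end Structure

namespace AdaptedChart
variable [FiniteDimensional ℝ K] (κ : AdaptedChart F A B v K)

open Classical in
/-- The chart of the affine phase bundle induced by adapted coordinates. -/
def chart : DoubleChart K (K →L[ℝ] ℝ) (B →L[ℝ] ℝ) (Phase F A B v) (AffQuot A v)
    (SpecialDualQuot A v) where
  dom := κ.dom
  fst m y := if hm : m ∈ κ.dom then κ.quotFst hm y else 0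
  snd m z := κ.quotSnd z
  core m η := if hm : m ∈ κ.dom then (κ.jet hm η).comp (ContinuousLinearMap.inl ℝ B K) else 0

theorem induces_chart : κ.Induces κ.chart := by
  refine ⟨rfl, fun m hm => ⟨fun a => ?_, fun f k => ?_, fun σ a => ?_⟩⟩
  · simp only [chart, dif_pos hm, quotFst_mk]
  · exact κ.dualCoord_apply f k
  · simp only [chart, dif_pos hm]; rfl

variable {κ} {χ : DoubleChart K (K →L[ℝ] ℝ) (B →L[ℝ] ℝ) (Phase F A B v) (AffQuot A v)
    (SpecialDualQuot A v)} (h : κ.Induces χ) {m : M}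

include h

theorem Induces.fst_eq (hm : m ∈ κ.dom) : χ.fst m = κ.quotFst hm := by
  funext y
  obtain ⟨a, rfl⟩ := AffQuot.exists_rep y
  exact (h.2 m hm).1 a

theorem Induces.snd_eq (hm : m ∈ κ.dom) : χ.snd m = κ.quotSnd := by
  funext z
  obtain ⟨f, rfl⟩ := Quot.exists_rep z
  ext k
  exact ((h.2 m hm).2.1 f k).trans (κ.dualCoord_apply f k).symm

theorem Induces.core_eq (hm : m ∈ κ.dom) (η : Phase F A B v m) :
    χ.core m η = (κ.jet hm η).comp (ContinuousLinearMap.inl ℝ B K) := by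
  obtain ⟨σ, hσ⟩ := exists_affDiff η
  obtain ⟨a, ha⟩ := AffQuot.exists_rep η.1
  rw [← hσ, ← ha]
  exact (h.2 m hm).2.2 σ a

end AdaptedChart

end PhaseBundle

/-! ### The affine phase bundle as a smooth double affine bundle -/

section PhaseBundle

variable {F : Type*} [NormedAddCommGroup F] [NormedSpace ℝ F] {M : Type*} [TopologicalSpace M]
  {V : M → Type*} [∀ m, AddCommGroup (V m)] [∀ m, Module ℝ (V m)]
  {A : M → Type*} [∀ m, AddTorsor (V m) (A m)]
  [∀ m, TopologicalSpace (A m)] [TopologicalSpace (TotalSpace F A)] [FiberBundle F A]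
  {B : Type*} [NormedAddCommGroup B] [NormedSpace ℝ B] [ChartedSpace B M]
  {v : ∀ m, V m} {K : Type*} [NormedAddCommGroup K] [NormedSpace ℝ K]

theorem AVSection.fn_lineMap {σ σ' σ'' : AVSection F A B v} {m : M} (hv : v m ≠ 0) {a : A m}
    {t : ℝ} (h : σ''.toFun m (AffQuot.mk v a) =
      AffineMap.lineMap (σ'.toFun m (AffQuot.mk v a)) (σ.toFun m (AffQuot.mk v a)) t) :
    σ''.fn ⟨m, a⟩ = t * σ.fn ⟨m, a⟩ + (1 - t) * σ'.fn ⟨m, a⟩ := by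
  apply σ''.fn_eq hv
  rw [h, σ.toFun_mk, σ'.toFun_mk, AffineMap.lineMap_apply, vadd_vsub_vadd_cancel_right, vadd_vadd, vadd_vadd]
  exact (congrArg (· +ᵥ a) (by module)).trans (zero_vadd (V m) a)

/-- Adding g moves the section by -g v, so the coordinate of a point relative to the section grows
by g. -/
theorem AVSection.IsAdd.fn_eq {σ σ' : AVSection F A B v} {g : M → ℝ} (h : σ.IsAdd g σ') {m : M}
    (hv : v m ≠ 0) (a : A m) : σ'.fn ⟨m, a⟩ = σ.fn ⟨m, a⟩ + g m := by
  apply σ'.fn_eq hv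
  rw [h, σ.toFun_mk, vadd_vadd, vadd_vadd]
  exact (congrArg (· +ᵥ a) (by module)).trans (zero_vadd (V m) a)

/-- Differentiating G(k/2 + k'/2) = G(k)/2 + G(k')/2 in k shows that the derivative at the midpoint
equals the derivative at k; by symmetry it equals the one at k'. -/
theorem fderiv_eq_of_affine {G : K → ℝ} (hG : Differentiable ℝ G)
    (h : ∀ (k k' : K) (t : ℝ), G (t • k + (1 - t) • k') = t • G k + (1 - t) • G k') (k k' : K) :
    fderiv ℝ G k = fderiv ℝ G k' := by
  have key : ∀ k k' : K, fderiv ℝ G ((1 / 2 : ℝ) • k + (1 - 1 / 2 : ℝ) • k') = fderiv ℝ G k := by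
    intro k k'
    have h₁ := (hG ((1 / 2 : ℝ) • k + (1 - 1 / 2 : ℝ) • k')).hasFDerivAt.comp k
      (((hasFDerivAt_id (𝕜 := ℝ) k).const_smul (1 / 2 : ℝ)).add_const ((1 - 1 / 2 : ℝ) • k'))
    have h₂ := ((hG k).hasFDerivAt.const_smul (1 / 2 : ℝ)).add_const ((1 - 1 / 2 : ℝ) • G k')
    have h₃ := h₁.unique (h₂.congr_of_eventuallyEq
      (Filter.Eventually.of_forall fun x => h x k' (1 / 2)))
    ext u
    have h₄ := congrArg (fun L => (2 : ℝ) * L u) h₃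
    simpa using h₄
  rw [← key k k', ← key k' k]
  congr 1
  module

namespace AdaptedChart

variable (κ κ' : AdaptedChart F A B v K)

theorem fderiv_localRep_of_isAdd {σ σ' : AVSection F A B v} {g : M → ℝ} (h : σ.IsAdd g σ') {m : M}
    (hm : m ∈ κ.dom) (hg : ContMDiff 𝓘(ℝ, B) 𝓘(ℝ, ℝ) ∞ g) (k : K) :
    fderiv ℝ (κ.localRep σ') (κ.base m, k) = fderiv ℝ (κ.localRep σ) (κ.base m, k) +
      (fderiv ℝ (fun b => g (κ.base.symm b)) (κ.base m)).comp (ContinuousLinearMap.fst ℝ B K) := by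
  have hp := κ.base_mem_region hm
  have hd : DifferentiableAt ℝ (fun b => g (κ.base.symm b)) (κ.base m) :=
    (contMDiffAt_iff_contDiffAt.1 (hg.contMDiffAt.comp (κ.base m)
      (κ.contMDiffAt_base_symm hp))).differentiableAt (n := ∞) (by simp)
  have e : κ.localRep σ' =ᶠ[𝓝 (κ.base m, k)]
      κ.localRep σ + fun p => g (κ.base.symm p.1) := by
    filter_upwards [(κ.isOpen_region.preimage continuous_fst).mem_nhds hp] with p hp
    exact h.fn_eq (κ.ne_zero hp.2) _
  rw [e.fderiv_eq]
  exact ((κ.differentiableAt_localRep σ (p := (κ.base m, k)) hp).hasFDerivAt.add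
    (hd.hasFDerivAt.comp (κ.base m, k) hasFDerivAt_fst)).fderiv

theorem localRep_of_isAffine {σ : AVSection F A B v} (h : σ.IsAffine) {b : B} (hb : b ∈ κ.region)
    (k k' : K) (t : ℝ) : κ.localRep σ (b, t • k + (1 - t) • k') =
      t • κ.localRep σ (b, k) + (1 - t) • κ.localRep σ (b, k') := by
  refine Eq.trans ?_ (h.fn_lineMap (κ.ne_zero hb.2) ((κ.triv (κ.base.symm b)).symm (k, 0))
    ((κ.triv (κ.base.symm b)).symm (k', 0)) t)
  have e : (t • k + (1 - t) • k', (0 : ℝ)) = AffineMap.lineMap (k', (0 : ℝ)) (k, (0 : ℝ)) t := by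
    rw [AffineMap.lineMap_apply_module]
    ext <;> simp [add_comm]
  rw [localRep_eq, e, ← AffineEquiv.apply_lineMap]; rfl

/-- The first fibre coordinate for `κ'` in terms of the one for `κ`. -/
def fstChange (x : M × K) : K := (κ'.triv x.1 ((κ.triv x.1).symm (x.2, 0))).1

/-- The change of the fibre coordinates of the affine phase bundle. -/
def phaseChange (x : M × (K × (K →L[ℝ] ℝ) × (B →L[ℝ] ℝ))) :
    K × (K →L[ℝ] ℝ) × (B →L[ℝ] ℝ) :=
  let k := κ.fstChange κ' (x.1, x.2.1)
  let J := (jetExtend (x.2.2.2.coprod x.2.2.1)).comp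
    (fderiv ℝ (κ.trans κ') (κ'.base x.1, k))
  (k, J.comp (ContinuousLinearMap.inr ℝ B K), J.comp (ContinuousLinearMap.inl ℝ B K))

theorem contMDiffAt_fstChange {x : M × K} (hx : x.1 ∈ κ.dom) (hx' : x.1 ∈ κ'.dom) :
    ContMDiffAt (𝓘(ℝ, B).prod 𝓘(ℝ, K)) 𝓘(ℝ, K) ∞ (κ.fstChange κ') x := by
  have h₁ : ContMDiff 𝓘(ℝ, K) 𝓘(ℝ, K × ℝ) ∞ (fun k : K => (k, (0 : ℝ))) :=
    ContDiff.contMDiff (by fun_prop)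
  have h₂ := (κ.smooth_symm.contMDiffAt (x := (x.1, (x.2, 0)))
    ((κ.dom.isOpen.prod isOpen_univ).mem_nhds ⟨hx, mem_univ _⟩)).comp x
    (f := fun x : M × K => (x.1, (x.2, (0 : ℝ))))
    (contMDiffAt_fst.prodMk (h₁.contMDiffAt.comp x contMDiffAt_snd))
  have h₃ := (κ'.smooth.contMDiffAt (x := ⟨x.1, (κ.triv x.1).symm (x.2, 0)⟩)
    (κ'.preimage_dom_mem_nhds hx')).comp x h₂
  exact (contDiff_fst (𝕜 := ℝ) (E := K) (F := ℝ) (n := ∞)).contMDiff.contMDiffAt.comp x h₃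

/-- The new coordinates are built from the new k, from the derivative of the smooth map `κ.trans κ'`
at that point, and from its composition with the extended jet; each depends smoothly on the old
coordinates. -/
theorem contMDiffOn_phaseChange : ContMDiffOn (𝓘(ℝ, B).prod 𝓘(ℝ, K × (K →L[ℝ] ℝ) × (B →L[ℝ] ℝ)))
    𝓘(ℝ, K × (K →L[ℝ] ℝ) × (B →L[ℝ] ℝ)) ∞ (κ.phaseChange κ')
    ((κ.dom ∩ κ'.dom : Set M) ×ˢ univ) := by
  rintro x ⟨⟨hx, hx'⟩, -⟩
  apply ContMDiffAt.contMDiffWithinAt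
  have hk : ContMDiffAt (𝓘(ℝ, B).prod 𝓘(ℝ, K × (K →L[ℝ] ℝ) × (B →L[ℝ] ℝ))) 𝓘(ℝ, K) ∞
      (fun x : M × (K × (K →L[ℝ] ℝ) × (B →L[ℝ] ℝ)) => κ.fstChange κ' (x.1, x.2.1)) x :=
    (κ.contMDiffAt_fstChange κ' (x := (x.1, x.2.1)) hx hx').comp x
      (f := fun x : M × (K × (K →L[ℝ] ℝ) × (B →L[ℝ] ℝ)) => (x.1, x.2.1))
      (contMDiffAt_fst.prodMk ((contDiff_fst (n := ∞)).contMDiff.contMDiffAt.comp x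
        contMDiffAt_snd))
  have hb : ContMDiffAt (𝓘(ℝ, B).prod 𝓘(ℝ, K × (K →L[ℝ] ℝ) × (B →L[ℝ] ℝ))) 𝓘(ℝ, B) ∞
      (fun x : M × (K × (K →L[ℝ] ℝ) × (B →L[ℝ] ℝ)) => κ'.base x.1) x :=
    (κ'.contMDiffAt_base hx').comp x contMDiffAt_fst
  have hd : ContDiffAt ℝ ∞ (fderiv ℝ (κ.trans κ')) (κ'.base x.1, κ.fstChange κ' (x.1, x.2.1)) :=
    (κ.contDiffAt_trans κ' (p := (κ'.base x.1, κ.fstChange κ' (x.1, x.2.1)))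
      (κ'.base_mem_region hx')
      (show κ'.base.symm (κ'.base x.1) ∈ κ.dom by rw [κ'.base_symm_base hx']; exact hx)).fderiv_right (by simp)
  have hD := hd.contMDiffAt.comp x (hb.prodMk_space hk)
  have hJ : ContDiff ℝ ∞ (fun y : (B × K →L[ℝ] B × (K × ℝ)) × (K × (K →L[ℝ] ℝ) × (B →L[ℝ] ℝ)) =>
      (jetExtend (y.2.2.2.coprod y.2.2.1)).comp y.1) := by
    -- Compositions with fixed linear maps replace `coprod`, which makes the smooth dependence on
    -- the components of the jet visible.
    have e : ∀ y : (B × K →L[ℝ] B × (K × ℝ)) × (K × (K →L[ℝ] ℝ) × (B →L[ℝ] ℝ)),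
        (jetExtend (y.2.2.2.coprod y.2.2.1)).comp y.1 =
        (y.2.2.2.comp (ContinuousLinearMap.fst ℝ B (K × ℝ)) +
          y.2.2.1.comp ((ContinuousLinearMap.fst ℝ K ℝ).comp
            (ContinuousLinearMap.snd ℝ B (K × ℝ))) +
          (ContinuousLinearMap.snd ℝ K ℝ).comp (ContinuousLinearMap.snd ℝ B (K × ℝ))).comp y.1 := by
      intro y
      ext u <;> simp [jetExtend]
    simp only [e]
    fun_prop
  have hx₂ : ContMDiffAt (𝓘(ℝ, B).prod 𝓘(ℝ, K × (K →L[ℝ] ℝ) × (B →L[ℝ] ℝ)))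
      𝓘(ℝ, K × (K →L[ℝ] ℝ) × (B →L[ℝ] ℝ)) ∞
      (fun x : M × (K × (K →L[ℝ] ℝ) × (B →L[ℝ] ℝ)) => x.2) x := contMDiffAt_snd
  have hΛ := hJ.contMDiff.contMDiffAt.comp x (hD.prodMk_space hx₂)
  have hs : ContDiff ℝ ∞ (fun y : K × (B × K →L[ℝ] ℝ) =>
      (y.1, y.2.comp (ContinuousLinearMap.inr ℝ B K), y.2.comp (ContinuousLinearMap.inl ℝ B K))) := by
    fun_prop
  exact hs.contMDiff.contMDiffAt.comp x (hk.prodMk_space hΛ)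

theorem fstChange_quotFst {m : M} (hm : m ∈ κ.dom) (hm' : m ∈ κ'.dom) (y : AffQuot A v m) :
    κ.fstChange κ' (m, κ.quotFst hm y) = κ'.quotFst hm' y := by
  obtain ⟨a, rfl⟩ := AffQuot.exists_rep y
  exact (κ'.mk_eq_iff hm').1 ((κ.mk_eq_iff hm).2 (by simp))

theorem phaseChange_jet {m : M} (hm : m ∈ κ.dom) (hm' : m ∈ κ'.dom) (η : Phase F A B v m) :
    κ.phaseChange κ' (m, κ.quotFst hm η.1, (κ.jet hm η).comp (ContinuousLinearMap.inr ℝ B K),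
      (κ.jet hm η).comp (ContinuousLinearMap.inl ℝ B K)) =
      (κ'.quotFst hm' η.1, (κ'.jet hm' η).comp (ContinuousLinearMap.inr ℝ B K),
        (κ'.jet hm' η).comp (ContinuousLinearMap.inl ℝ B K)) := by
  have e : ((κ.jet hm η).comp (ContinuousLinearMap.inl ℝ B K)).coprod
      ((κ.jet hm η).comp (ContinuousLinearMap.inr ℝ B K)) = κ.jet hm η := by
    ext <;> simp
  simp only [phaseChange, e, κ.fstChange_quotFst κ' hm hm', ← κ.jet_trans κ' hm hm']

end AdaptedChart

section Structure

variable [FiniteDimensional ℝ B] [IsManifold 𝓘(ℝ, B) ∞ M] [T2Space M] [SecondCountableTopology M]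
  [FiniteDimensional ℝ K] (hκ : ∀ m, ∃ κ : AdaptedChart F A B v K, m ∈ κ.dom)

theorem AdaptedChart.Induces.coord_eq {κ : AdaptedChart F A B v K}
    {χ : DoubleChart K (K →L[ℝ] ℝ) (B →L[ℝ] ℝ) (Phase F A B v) (AffQuot A v)
    (SpecialDualQuot A v)} (h : κ.Induces χ) {m : M} (hm : m ∈ κ.dom) (η : Phase F A B v m) :
    χ.coord (fun _ η => η.1) (phasePr₂ hκ) m η = (κ.quotFst hm η.1,
      (κ.jet hm η).comp (ContinuousLinearMap.inr ℝ B K),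
      (κ.jet hm η).comp (ContinuousLinearMap.inl ℝ B K)) := by
  rw [DoubleChart.coord, h.fst_eq hm, h.snd_eq hm, h.core_eq hm, quotSnd_phasePr₂ hκ κ hm]

/-- The affine phase bundle as a double affine bundle. -/
def phaseBundle : DoubleAffineBundle B K (K →L[ℝ] ℝ) (B →L[ℝ] ℝ) (Phase F A B v) (AffQuot A v)
    (SpecialDualQuot A v) where
  pr₁ _ η := η.1
  pr₂ := phasePr₂ hκ
  affSide₁ := affQuotComb
  affSide₂ := specialQuotComb
  aff₁ := phaseAff₁ hκ
  aff₂ := phaseAff₂ hκ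
  pr₁_aff₁ _ _ _ t h := (phaseAff₁_spec hκ h t).1
  pr₂_aff₁ m η η' t h := by
    obtain ⟨κ, hm⟩ := hκ m
    apply (κ.quotSnd_bijective hm).1
    rw [κ.quotSnd_comb, quotSnd_phasePr₂ hκ κ hm, quotSnd_phasePr₂ hκ κ hm,
      quotSnd_phasePr₂ hκ κ hm, (phaseAff₁_spec hκ h t).2 κ hm]
    ext; simp
  pr₂_aff₂ _ _ _ t h := (phaseAff₂_spec hκ h t).2.1
  pr₁_aff₂ _ _ _ t h := (phaseAff₂_spec hκ h t).1
  charts := {χ | ∃ κ : AdaptedChart F A B v K, κ.Induces χ}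
  cover m := by
    obtain ⟨κ, hm⟩ := hκ m
    exact ⟨κ.chart, ⟨κ, κ.induces_chart⟩, hm⟩
  fst_bijective := by
    rintro χ ⟨κ, h⟩ m hm
    rw [h.1] at hm
    rw [h.fst_eq hm]
    exact κ.quotFst_bijective hm
  snd_bijective := by
    rintro χ ⟨κ, h⟩ m hm
    rw [h.1] at hm
    rw [h.snd_eq hm]
    exact κ.quotSnd_bijective hm
  coord_bijective := by
    rintro χ ⟨κ, h⟩ m hm
    rw [h.1] at hm
    constructor
    · intro η η' e
      rw [h.coord_eq hκ hm, h.coord_eq hκ hm] at e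
      simp only [Prod.mk.injEq] at e
      refine κ.phase_ext hm ((κ.quotFst_bijective hm).1 e.1) ?_
      ext u
      · exact congrArg (fun L => L u) e.2.2
      · exact congrArg (fun L => L u) e.2.1
    · rintro ⟨k, q, c⟩
      obtain ⟨y, rfl⟩ := (κ.quotFst_bijective hm).2 k
      obtain ⟨η, rfl, hη⟩ := exists_phase hκ κ hm y (c.coprod q)
      refine ⟨η, ?_⟩
      rw [h.coord_eq hκ hm, hη]
      simp only [Prod.mk.injEq, true_and]
      constructor <;> ext <;> simp
  fst_aff := by
    rintro χ ⟨κ, h⟩ m hm a b t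
    rw [h.1] at hm
    rw [h.fst_eq hm, κ.quotFst_comb hm]
  snd_aff := by
    rintro χ ⟨κ, h⟩ m hm a b t
    rw [h.1] at hm
    rw [h.snd_eq hm, κ.quotSnd_comb]
  core_aff₁ := by
    rintro χ ⟨κ, h⟩ m hm η η' t e
    rw [h.1] at hm
    rw [h.core_eq hm, h.core_eq hm, h.core_eq hm, (phaseAff₁_spec hκ e t).2 κ hm]
    ext; simp
  core_aff₂ := by
    rintro χ ⟨κ, h⟩ m hm η η' t e
    rw [h.1] at hm
    rw [h.core_eq hm, h.core_eq hm, h.core_eq hm, (phaseAff₂_spec hκ e t).2.2 κ hm]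
  smooth := by
    rintro χ ⟨κ, h⟩ χ' ⟨κ', h'⟩
    rw [h.1, h'.1]
    refine ⟨κ.phaseChange κ', κ.contMDiffOn_phaseChange κ', fun m hm η => ?_⟩
    rw [h.coord_eq hκ hm.1, h'.coord_eq hκ hm.2, κ.phaseChange_jet κ' hm.1 hm.2]

theorem isPhaseBundle_phaseBundle : IsPhaseBundle (phaseBundle hκ) where
  affSide₁_eq m a b t := by
    obtain ⟨κ, hm⟩ := hκ m
    apply (κ.quotFst_bijective hm).1
    rw [κ.quotFst_lineMap]
    exact κ.quotFst_comb hm _ _ t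
  affSide₂_eq m f g h t e := by
    obtain ⟨κ, hm⟩ := hκ m
    apply (κ.quotSnd_bijective hm).1
    refine (κ.quotSnd_comb _ _ t).trans ?_
    ext k
    simp only [AdaptedChart.quotSnd_mk, AdaptedChart.dualCoord_apply, add_apply, smul_apply,
      smul_eq_mul, e]
    ring
  pr₁_eq _ _ := rfl
  pr₂_eq m σ y f _ hf := by
    obtain ⟨κ, hm⟩ := hκ m
    apply (κ.quotSnd_bijective hm).1
    refine (quotSnd_phasePr₂ hκ κ hm _).trans ?_
    rw [κ.jet_affDiff, κ.fderiv_localRep_comp_inr σ f hf hm, κ.quotSnd_mk]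
  aff₁_eq m y σ σ' σ'' t h := by
    obtain ⟨κ, hm⟩ := hκ m
    refine κ.phase_ext hm (phaseAff₁_spec hκ (η := σ.affDiff m y) (η' := σ'.affDiff m y) rfl t).1 ?_
    refine ((phaseAff₁_spec hκ (η := σ.affDiff m y) (η' := σ'.affDiff m y) rfl t).2 κ hm).trans ?_
    rw [κ.jet_affDiff, κ.jet_affDiff, κ.jet_affDiff]
    have hp := κ.base_mem_region hm
    have e : κ.localRep σ'' =ᶠ[𝓝 (κ.base m, κ.quotFst hm y)]
        t • κ.localRep σ + (1 - t) • κ.localRep σ' := by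
      filter_upwards [(κ.isOpen_region.preimage continuous_fst).mem_nhds hp] with p hp
      exact AVSection.fn_lineMap (κ.ne_zero hp.2) (h _ _)
    rw [e.fderiv_eq]
    exact ((((κ.differentiableAt_localRep σ hp).hasFDerivAt.const_smul t).add
      ((κ.differentiableAt_localRep σ' hp).hasFDerivAt.const_smul (1 - t))).fderiv).symm
  aff₂_eq m y y' σ σ₁ σ₂ σ₃ g g' t hσ hg hg' h₁ h₂ h₃ := by
    obtain ⟨κ, hm⟩ := hκ m
    have hp := κ.base_mem_region hm
    have hd : ∀ k, DifferentiableAt ℝ (κ.localRep σ) (κ.base m, k) := fun k =>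
      κ.differentiableAt_localRep σ (p := (κ.base m, k)) hp
    -- Since σ is affine on the fibres, the k-derivative of its local representative is the same at
    -- all k. Functions on `M` do not contribute to it, so σ + g and σ + g' have affine
    -- differentials over the same point of the second side.
    have hc : ∀ k k', (fderiv ℝ (κ.localRep σ) (κ.base m, k)).comp
        (ContinuousLinearMap.inr ℝ B K) =
        (fderiv ℝ (κ.localRep σ) (κ.base m, k')).comp (ContinuousLinearMap.inr ℝ B K) := by
      intro k k'
      rw [fderiv_comp_inr (hd k), fderiv_comp_inr (hd k')]
      exact fderiv_eq_of_affine (fun k =>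
        ((hd k).hasFDerivAt.comp k (hasFDerivAt_prodMk_right _ k)).differentiableAt)
        (fun k k' t => κ.localRep_of_isAffine hσ hp k k' t) k k'
    -- The x-derivative, in contrast, varies affinely with k; this accounts for the moving base
    -- point.
    have hx := fderiv_comp_inl_affine hd (κ.quotFst hm y) (κ.quotFst hm y') t (by
      filter_upwards [κ.isOpen_region.mem_nhds hp] with b hb
      exact κ.localRep_of_isAffine hσ hb _ _ t)
    rw [← κ.quotFst_comb hm] at hx
    have hz : ∀ L : B →L[ℝ] ℝ, (L.comp (ContinuousLinearMap.fst ℝ B K)).comp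
        (ContinuousLinearMap.inr ℝ B K) = 0 := fun L => by ext; simp
    have hz' : ∀ L : B →L[ℝ] ℝ, (L.comp (ContinuousLinearMap.fst ℝ B K)).comp
        (ContinuousLinearMap.inl ℝ B K) = L := fun L => by ext; simp
    have hg₃ : ContMDiff 𝓘(ℝ, B) 𝓘(ℝ, ℝ) ∞ (fun x => t * g x + (1 - t) * g' x) :=
      (contMDiff_const.mul hg).add (contMDiff_const.mul hg')
    have hq : phasePr₂ hκ m (σ₁.affDiff m y) = phasePr₂ hκ m (σ₂.affDiff m y') := by
      apply (κ.quotSnd_bijective hm).1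
      rw [quotSnd_phasePr₂ hκ κ hm, quotSnd_phasePr₂ hκ κ hm, κ.jet_affDiff, κ.jet_affDiff,
        κ.fderiv_localRep_of_isAdd h₁ hm hg, κ.fderiv_localRep_of_isAdd h₂ hm hg',
        ContinuousLinearMap.add_comp, ContinuousLinearMap.add_comp, hz, hz]
      simpa using hc _ _
    obtain ⟨s₁, s₂, s₃⟩ := phaseAff₂_spec hκ hq t
    -- `hr` and `hl` describe the k-part and the x-part of the jet of the affine combination, in
    -- terms of σ, g and g'. Both are matched with the jet of σ₃ at the end.
    have hr := quotSnd_phasePr₂ hκ κ hm (phaseAff₂ hκ m (σ₁.affDiff m y) (σ₂.affDiff m y') t)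
    rw [s₂, quotSnd_phasePr₂ hκ κ hm, κ.jet_affDiff, κ.fderiv_localRep_of_isAdd h₁ hm hg,
      ContinuousLinearMap.add_comp, hz, add_zero, hc _ (κ.quotFst hm (affQuotComb m y y' t))] at hr
    have hl := s₃ κ hm
    rw [κ.jet_affDiff, κ.jet_affDiff, κ.fderiv_localRep_of_isAdd h₁ hm hg,
      κ.fderiv_localRep_of_isAdd h₂ hm hg', ContinuousLinearMap.add_comp,
      ContinuousLinearMap.add_comp, hz', hz'] at hl
    have hd₃ : fderiv ℝ (fun b => t * g (κ.base.symm b) + (1 - t) * g' (κ.base.symm b))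
        (κ.base m) = t • fderiv ℝ (fun b => g (κ.base.symm b)) (κ.base m) +
          (1 - t) • fderiv ℝ (fun b => g' (κ.base.symm b)) (κ.base m) := by
      have hd : ∀ g : M → ℝ, ContMDiff 𝓘(ℝ, B) 𝓘(ℝ, ℝ) ∞ g →
          DifferentiableAt ℝ (fun b => g (κ.base.symm b)) (κ.base m) := fun g hg =>
        (contMDiffAt_iff_contDiffAt.1 (hg.contMDiffAt.comp (κ.base m)
          (κ.contMDiffAt_base_symm hp))).differentiableAt (n := ∞) (by simp)
      exact (((hd g hg).hasFDerivAt.const_mul t).add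
        ((hd g' hg').hasFDerivAt.const_mul (1 - t))).fderiv
    have hj : κ.jet hm (σ₃.affDiff m (affQuotComb m y y' t)) = _ :=
      κ.fderiv_localRep_of_isAdd h₃ hm hg₃ _
    change phaseAff₂ hκ m (σ₁.affDiff m y) (σ₂.affDiff m y') t =
      σ₃.affDiff m (affQuotComb m y y' t)
    refine κ.phase_ext hm s₁ ?_
    refine ContinuousLinearMap.prod_ext (hl.trans ?_) (hr.symm.trans ?_)
    · rw [hj, ContinuousLinearMap.add_comp, hz', hd₃]
      change _ = (fderiv ℝ (κ.localRep σ) (κ.base m, κ.quotFst hm (affQuotComb m y y' t))).comp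
        (ContinuousLinearMap.inl ℝ B K) + _
      rw [hx]
      module
    · rw [hj, ContinuousLinearMap.add_comp, hz, add_zero]; rfl
  charts_eq := rfl

end Structure
end PhaseBundle

/-- Points of the affine space have weight 1, and (y, s) = (y, 1) - (0, 1) + s (0, 1); linearity
does the rest. -/
theorem hullEquiv_change {V : Type*} [AddCommGroup V] [Module ℝ V] {A : Type*} [AddTorsor V A]
    {W W' : Type*} [AddCommGroup W] [Module ℝ W] [AddCommGroup W'] [Module ℝ W']
    (φ : A ≃ᵃ[ℝ] W) (ψ : A ≃ᵃ[ℝ] W') (p : W × ℝ) : hullEquiv ψ ((hullEquiv φ).symm p) =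
      (ψ (φ.symm p.1) - ψ (φ.symm 0) + p.2 • ψ (φ.symm 0), p.2) := by
  have h₁ : ∀ z : W, hullEquiv ψ ((hullEquiv φ).symm (z, 1)) = (ψ (φ.symm z), 1) := by
    intro z
    have : (hullEquiv φ).symm (z, 1) = VectorHull.of _ (φ.symm z) := by
      rw [LinearEquiv.symm_apply_eq, hullEquiv_of, AffineEquiv.apply_symm_apply]
    rw [this, hullEquiv_of]
  have h₂ : p = (p.1, 1) - (0, 1) + p.2 • ((0 : W), (1 : ℝ)) := by ext <;> simp
  conv_lhs => rw [h₂, map_add, map_add, map_sub, map_sub, map_smul, map_smul, h₁, h₁]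
  ext <;> simp

/-! ### Smooth adapted coordinates on the hull -/

section HullSmooth

variable {F : Type*} [NormedAddCommGroup F] [NormedSpace ℝ F] {M : Type*} [TopologicalSpace M]
  {V : M → Type*} [∀ m, AddCommGroup (V m)] [∀ m, Module ℝ (V m)]
  {A : M → Type*} [∀ m, AddTorsor (V m) (A m)]
  [∀ m, TopologicalSpace (A m)] [TopologicalSpace (TotalSpace F A)] [FiberBundle F A]
  {B : Type*} [NormedAddCommGroup B] [NormedSpace ℝ B] [ChartedSpace B M] {v : ∀ m, V m}
  {K : Type*} [NormedAddCommGroup K] [NormedSpace ℝ K]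

/-! The preferred trivializations of the hull -/

section Preferred

variable [FiniteDimensional ℝ F] [AffineBundle F V A]

variable (F V A) in
/-- The preferred trivialization of the hull. -/
abbrev hullTriv (m : M) : Trivialization (F × ℝ) (π (F × ℝ) (Hull V A)) :=
  trivializationAt (F × ℝ) (Hull V A) m

theorem hullTriv_apply (m₀ : M) {m : M} (hm : m ∈ (trivializationAt F A m₀).baseSet)
    (w : Hull V A m) : hullTriv F V A m₀ ⟨m, w⟩ =
      (m, hullFiberEquiv F V A (trivializationAt F A m₀) hm w) :=
  hullPretrivialization_apply F V A _ hm w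

theorem mem_hullTriv (m : M) : m ∈ (hullTriv F V A m).baseSet :=
  mem_baseSet_trivializationAt (F × ℝ) (Hull V A) m

end Preferred

section PreferredSmooth

variable [FiniteDimensional ℝ F] [SmoothAffineBundle F V A B]

theorem contMDiffAt_hullTriv (x : HullTotal F V A) :
    ContMDiffAt (hullModel F B) 𝓘(ℝ, F × ℝ) ∞ (fun y => (hullTriv F V A x.1 y).2) x :=
  ((contMDiffAt_totalSpace (IB := 𝓘(ℝ, B))).1 (contMDiffAt_id (x := x))).2

theorem contMDiffAt_hullTriv_symm (m : M) (k : F × ℝ) :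
    ContMDiffAt (𝓘(ℝ, B).prod 𝓘(ℝ, F × ℝ)) (hullModel F B) ∞
      (fun p : M × (F × ℝ) => (⟨p.1, (hullTriv F V A m).symm p.1 p.2⟩ : HullTotal F V A))
      (m, k) := by
  rw [contMDiffAt_totalSpace]
  refine ⟨contMDiffAt_fst, contMDiffAt_snd.congr_of_eventuallyEq ?_⟩
  filter_upwards [continuous_fst.continuousAt.preimage_mem_nhds
    ((hullTriv F V A m).open_baseSet.mem_nhds (mem_hullTriv m))] with p hp
  exact congrArg Prod.snd ((hullTriv F V A m).apply_mk_symm hp p.2)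

end PreferredSmooth

namespace AdaptedChart

variable (κ : AdaptedChart F A B v K) {m : M}

/-- The linear extension to the hull of the adapted fibre coordinates. -/
def hullCoord (m : M) : Hull V A m ≃ₗ[ℝ] (K × ℝ) × ℝ := hullEquiv (κ.triv m)

theorem hullCoord_of (a : A m) : κ.hullCoord m (Hull.of V a) = (κ.triv m a, 1) :=
  hullEquiv_of _ a

theorem hullCoord_ofVec (hm : m ∈ κ.dom) : κ.hullCoord m (Hull.ofVec (v m)) = ((0, 1), 0) := by
  rw [Hull.ofVec, map_sub, hullCoord_of, hullCoord_of]
  have := κ.triv_vadd hm 1 (Classical.arbitrary (A m))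
  rw [one_smul] at this
  rw [this]
  ext <;> simp

/-- Both sides are linear on the hull, and they agree on A, where the weight is 1. -/
theorem extend_eq (f : A m →ᵃ[ℝ] ℝ) (w : Hull V A m) :
    Hull.extend f w = f ((κ.triv m).symm (κ.hullCoord m w).1) - f ((κ.triv m).symm 0) +
      (κ.hullCoord m w).2 * f ((κ.triv m).symm 0) := by
  let g : A m →ᵃ[ℝ] ℝ := f
  let L : (K × ℝ) × ℝ →ₗ[ℝ] ℝ := (f.linear ∘ₗ (κ.triv m).symm.linear.toLinearMap) ∘ₗ
      LinearMap.fst ℝ (K × ℝ) ℝ +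
    f ((κ.triv m).symm 0) • LinearMap.snd ℝ (K × ℝ) ℝ
  have hL : ∀ p : (K × ℝ) × ℝ, L p = f ((κ.triv m).symm p.1) - f ((κ.triv m).symm 0) +
      p.2 * f ((κ.triv m).symm 0) := by
    intro p
    have h₁ : f.linear ((κ.triv m).symm.linear p.1) =
        f ((κ.triv m).symm p.1) - f ((κ.triv m).symm 0) := by
      rw [← vsub_eq_sub, ← AffineMap.linearMap_vsub]
      congr 1
      have := (κ.triv m).symm.toAffineMap.linearMap_vsub p.1 0
      simpa using this
    change f.linear ((κ.triv m).symm.linear p.1) + f ((κ.triv m).symm 0) * p.2 = _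
    rw [h₁, mul_comm]
  rw [← hL]
  have : Hull.extend f = L ∘ₗ (κ.hullCoord m).toLinearMap := by
    apply VectorHull.hom_ext
    intro a
    change _ = L (κ.hullCoord m (Hull.of V a))
    rw [hL, κ.hullCoord_of, AffineEquiv.symm_apply_apply, one_mul, sub_add_cancel]
    exact VectorHull.lift_of _ _ a
  rw [this]; rfl

theorem alpha_eq (w : Hull V A m) : Hull.alpha V A m w = (κ.hullCoord m w).2 := by
  rw [Hull.alpha, κ.extend_eq]
  simp

variable (F) in
/-- Adapted coordinates on the hull. -/
def hullCoords (x : HullTotal F V A) : B × ((K × ℝ) × ℝ) := (κ.base x.1, κ.hullCoord x.1 x.2)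

/-- The parametrization of the hull by adapted coordinates. -/
def hullParam (p : B × ((K × ℝ) × ℝ)) : HullTotal F V A :=
  ⟨κ.base.symm p.1, (κ.hullCoord (κ.base.symm p.1)).symm p.2⟩

theorem hullParam_base (hm : m ∈ κ.dom) (z : (K × ℝ) × ℝ) :
    κ.hullParam (κ.base m, z) = ⟨m, (κ.hullCoord m).symm z⟩ := by
  have : ∀ m', m' = m → (⟨m', (κ.hullCoord m').symm z⟩ : HullTotal F V A) =
    ⟨m, (κ.hullCoord m).symm z⟩ := by
    rintro _ rfl; rfl
  exact this _ (κ.base_symm_base hm)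

theorem hullParam_hullCoords {x : HullTotal F V A} (hx : x.1 ∈ κ.dom) :
    κ.hullParam (κ.hullCoords F x) = x := by
  rw [hullCoords, hullParam_base κ hx, LinearEquiv.symm_apply_apply]

theorem hullCoords_hullParam {p : B × ((K × ℝ) × ℝ)} (hp : p.1 ∈ κ.region) :
    κ.hullCoords F (κ.hullParam p) = p := by
  change (κ.base (κ.base.symm p.1), κ.hullCoord (κ.base.symm p.1) ((κ.hullCoord _).symm p.2)) = p
  rw [κ.base.right_inv hp.1, LinearEquiv.apply_symm_apply]

variable [FiniteDimensional ℝ F] [SmoothAffineBundle F V A B]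

theorem preimage_dom_mem_nhds_hull {x : HullTotal F V A} (hx : x.1 ∈ κ.dom) :
    {y : HullTotal F V A | y.1 ∈ κ.dom} ∈ 𝓝 x :=
  (FiberBundle.continuous_proj (F × ℝ) (Hull V A)).continuousAt.preimage_mem_nhds
    (κ.dom.isOpen.mem_nhds hx)

/-- By `hullEquiv_change` the adapted coordinates arise from the preferred ones (y, s) as (φ(y) -
φ(0) + s φ(0), s), where φ is the change of fibre coordinates of A itself. So smoothness of φ
suffices. -/
theorem contMDiffAt_hullCoords {x : HullTotal F V A} (hx : x.1 ∈ κ.dom) :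
    ContMDiffAt (hullModel F B) 𝓘(ℝ, B × ((K × ℝ) × ℝ)) ∞ (κ.hullCoords F) x := by
  let e := trivializationAt F A x.1
  have he : x.1 ∈ e.baseSet := mem_baseSet_trivializationAt F A x.1
  have h₀ : ContMDiffAt (hullModel F B) 𝓘(ℝ, B) ∞ (fun y : HullTotal F V A => y.1) x :=
    contMDiffAt_proj _
  have hφ : ∀ y₀ : F, ContMDiffAt (𝓘(ℝ, B).prod 𝓘(ℝ, F)) 𝓘(ℝ, K × ℝ) ∞
      (fun p : M × F => κ.triv p.1 (e.symm p.1 p.2)) (x.1, y₀) := by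
    intro y₀
    have h₁ : ContMDiffAt (𝓘(ℝ, B).prod 𝓘(ℝ, F)) (𝓘(ℝ, B).prod 𝓘(ℝ, F)) ∞
        (fun p : M × F => (⟨p.1, e.symm p.1 p.2⟩ : TotalSpace F A)) (x.1, y₀) := by
      refine contMDiffAt_totalSpace_of_trivialization (V := V) e he contMDiffAt_fst ?_
      refine contMDiffAt_snd.congr_of_eventuallyEq ?_
      filter_upwards [continuous_fst.continuousAt.preimage_mem_nhds
        (e.open_baseSet.mem_nhds he)] with p hp
      exact congrArg Prod.snd (e.apply_mk_symm hp p.2)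
    exact (κ.smooth.contMDiffAt (x := ⟨x.1, e.symm x.1 y₀⟩)
      (κ.preimage_dom_mem_nhds hx)).comp (x.1, y₀) h₁
  have ht := contMDiffAt_hullTriv (B := B) x
  have ht₁ : ContMDiffAt (hullModel F B) 𝓘(ℝ, F) ∞ (fun y => (hullTriv F V A x.1 y).2.1) x :=
    (contDiff_fst (n := ∞)).contMDiff.contMDiffAt.comp x ht
  have ht₂ : ContMDiffAt (hullModel F B) 𝓘(ℝ, ℝ) ∞ (fun y => (hullTriv F V A x.1 y).2.2) x :=
    (contDiff_snd (n := ∞)).contMDiff.contMDiffAt.comp x ht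
  have h₁ := (hφ _).comp x (h₀.prodMk ht₁)
  have h₂ := (hφ 0).comp x (h₀.prodMk (contMDiffAt_const (c := (0 : F))))
  refine (((κ.contMDiffAt_base hx).comp x h₀).prodMk_space
    (((h₁.sub h₂).add (ht₂.smul h₂)).prodMk_space ht₂)).congr_of_eventuallyEq ?_
  filter_upwards [(FiberBundle.continuous_proj (F × ℝ) (Hull V A)).continuousAt.preimage_mem_nhds
    (e.open_baseSet.mem_nhds he)] with y hy
  refine Prod.ext rfl ?_
  have hs : ∀ z : F, e.symm y.1 z = (fiberEquiv F V A e hy).symm z := by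
    intro z
    rw [AffineEquiv.eq_symm_apply, fiberEquiv_apply]
    exact congrArg Prod.snd (e.apply_mk_symm hy z)
  have ha : (hullTriv F V A x.1 y).2 = hullFiberEquiv F V A e hy y.2 :=
    congrArg Prod.snd (hullTriv_apply x.1 hy y.2)
  have := hullEquiv_change (fiberEquiv F V A e hy) (κ.triv y.1) (hullFiberEquiv F V A e hy y.2)
  change κ.hullCoord y.1 _ = _ at this
  rw [show (hullEquiv (fiberEquiv F V A e hy)).symm (hullFiberEquiv F V A e hy y.2) = y.2 from
    LinearEquiv.symm_apply_apply _ _, ← ha, ← hs, ← hs] at this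
  exact this

theorem contMDiffAt_hullParam {p : B × ((K × ℝ) × ℝ)} (hp : p.1 ∈ κ.region) :
    ContMDiffAt 𝓘(ℝ, B × ((K × ℝ) × ℝ)) (hullModel F B) ∞ κ.hullParam p := by
  let m := κ.base.symm p.1
  let e := trivializationAt F A m
  have he : m ∈ e.baseSet := mem_baseSet_trivializationAt F A m
  have h₀ : ContMDiffAt 𝓘(ℝ, B × ((K × ℝ) × ℝ)) 𝓘(ℝ, B) ∞
      (fun p : B × ((K × ℝ) × ℝ) => κ.base.symm p.1) p :=
    (κ.contMDiffAt_base_symm hp).comp p contDiff_fst.contMDiff.contMDiffAt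
  have hψ : ∀ z : B × ((K × ℝ) × ℝ) → K × ℝ, ContDiff ℝ ∞ z →
      ContMDiffAt 𝓘(ℝ, B × ((K × ℝ) × ℝ)) 𝓘(ℝ, F) ∞
      (fun p => (e (κ.param (p.1, z p))).2) p := by
    intro z hz
    have h₁ : ContDiff ℝ ∞ fun p : B × ((K × ℝ) × ℝ) => (p.1, z p) := contDiff_fst.prodMk hz
    exact (contMDiffAt_trivialization (V := V) e (x := κ.param (p.1, z p)) he).comp p
      (f := fun p : B × ((K × ℝ) × ℝ) => κ.param (p.1, z p))
      ((κ.contMDiffAt_param (p := (p.1, z p)) hp).comp p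
        (f := fun p : B × ((K × ℝ) × ℝ) => (p.1, z p)) h₁.contMDiff.contMDiffAt)
  have h₁ := hψ (fun p => p.2.1) (by fun_prop)
  have h₂ := hψ (fun _ => 0) (by fun_prop)
  have h₃ : ContMDiffAt 𝓘(ℝ, B × ((K × ℝ) × ℝ)) 𝓘(ℝ, ℝ) ∞
      (fun p : B × ((K × ℝ) × ℝ) => p.2.2) p :=
    ContMDiff.contMDiffAt (ContDiff.contMDiff (by fun_prop))
  rw [contMDiffAt_totalSpace]
  refine ⟨h₀, ?_⟩
  refine (((h₁.sub h₂).add (h₃.smul h₂)).prodMk_space h₃).congr_of_eventuallyEq ?_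
  filter_upwards [h₀.continuousAt.preimage_mem_nhds (e.open_baseSet.mem_nhds he)] with q hq
  have ha : (hullTriv F V A m (κ.hullParam q)).2 = hullFiberEquiv F V A e hq _ :=
    congrArg Prod.snd (hullTriv_apply m hq _)
  refine ha.trans ((hullEquiv_change (κ.triv (κ.base.symm q.1)) (fiberEquiv F V A e hq)
    q.2).trans ?_)
  rw [fiberEquiv_apply, fiberEquiv_apply]; rfl

end AdaptedChart

end HullSmooth

/-- All tangent spaces are by definition the model space. A derivative at one point can thus be used
in the chain rule at another that is only propositionally equal to it. -/
theorem HasMFDerivAt.congr_point {E E' H H' N N' : Type*} [NormedAddCommGroup E] [NormedSpace ℝ E]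
    [NormedAddCommGroup E'] [NormedSpace ℝ E'] [TopologicalSpace H] [TopologicalSpace H']
    {I : ModelWithCorners ℝ E H} {I' : ModelWithCorners ℝ E' H'} [TopologicalSpace N]
    [ChartedSpace H N] [TopologicalSpace N'] [ChartedSpace H' N'] {f : N → N'} {x y : N}
    {L : E →L[ℝ] E'} (h : HasMFDerivAt I I' f x L) (e : x = y) : HasMFDerivAt I I' f y L := by
  subst e
  exact h

/-! ### Horizontal and vertical lifts to the hull -/

section HullSmooth

variable {F : Type*} [NormedAddCommGroup F] [NormedSpace ℝ F] {M : Type*} [TopologicalSpace M]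
  {V : M → Type*} [∀ m, AddCommGroup (V m)] [∀ m, Module ℝ (V m)]
  {A : M → Type*} [∀ m, AddTorsor (V m) (A m)]
  [∀ m, TopologicalSpace (A m)] [TopologicalSpace (TotalSpace F A)] [FiberBundle F A]
  {B : Type*} [NormedAddCommGroup B] [NormedSpace ℝ B] [ChartedSpace B M] {v : ∀ m, V m}
  {K : Type*} [NormedAddCommGroup K] [NormedSpace ℝ K]
  [FiniteDimensional ℝ F]

section Preferred
variable [AffineBundle F V A]

theorem hullTriv_symm_apply_snd {m : M} (w : Hull V A m) :
    (hullTriv F V A m).symm m (hullTriv F V A m ⟨m, w⟩).2 = w :=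
  (hullTriv F V A m).symm_apply_apply_mk (mem_hullTriv m) w

theorem hullTriv_snd_symm {m x : M} (hx : x ∈ (hullTriv F V A m).baseSet) (k : F × ℝ) :
    (hullTriv F V A m ⟨x, (hullTriv F V A m).symm x k⟩).2 = k :=
  congrArg Prod.snd ((hullTriv F V A m).apply_mk_symm hx k)

theorem hullTriv_snd_add {m : M} (w w' : Hull V A m) : (hullTriv F V A m ⟨m, w + w'⟩).2 =
    (hullTriv F V A m ⟨m, w⟩).2 + (hullTriv F V A m ⟨m, w'⟩).2 :=
  ((hullTriv F V A m).linear ℝ (mem_hullTriv m)).map_add w w'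

theorem hullTriv_snd_smul {m : M} (t : ℝ) (w : Hull V A m) : (hullTriv F V A m ⟨m, t • w⟩).2 =
    t • (hullTriv F V A m ⟨m, w⟩).2 :=
  ((hullTriv F V A m).linear ℝ (mem_hullTriv m)).map_smul t w

theorem hullTriv_linearMapAt {m : M} (w : Hull V A m) :
    (hullTriv F V A m).linearMapAt ℝ m w = (hullTriv F V A m ⟨m, w⟩).2 := by
  rw [Trivialization.linearMapAt_apply, if_pos (mem_hullTriv m)]

/-- The section of the hull through `w` that is constant in the preferred trivialization. -/
def constSection (m : M) (w : Hull V A m) (x : M) : HullTotal F V A :=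
  ⟨x, (hullTriv F V A m).symm x (hullTriv F V A m ⟨m, w⟩).2⟩

theorem constSection_self (m : M) (w : Hull V A m) :
    constSection (F := F) m w m = ⟨m, w⟩ := by
  rw [constSection, hullTriv_symm_apply_snd]

/-- The parametrization of the fibre of the hull by the preferred trivialization, with origin
`w`. -/
def fiberParam (m : M) (w : Hull V A m) (k : F × ℝ) : HullTotal F V A :=
  ⟨m, w + (hullTriv F V A m).symm m k⟩

theorem hullTriv_fiberParam (m : M) (w : Hull V A m) (k : F × ℝ) :
    (hullTriv F V A m (fiberParam m w k)).2 = (hullTriv F V A m ⟨m, w⟩).2 + k := by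
  rw [fiberParam, hullTriv_snd_add, hullTriv_snd_symm (mem_hullTriv m)]

theorem hullTriv_symm_zero (m : M) : (hullTriv F V A m).symm m 0 = 0 :=
  (congrFun ((hullTriv F V A m).coe_symmₗ (R := ℝ) (mem_hullTriv m)) 0).symm.trans (map_zero _)

theorem fiberParam_zero (m : M) (w : Hull V A m) : fiberParam m w (0 : F × ℝ) = ⟨m, w⟩ := by
  rw [fiberParam, hullTriv_symm_zero, add_zero]

end Preferred

section Lifts
variable [SmoothAffineBundle F V A B]

theorem contMDiffAt_constSection (m : M) (w : Hull V A m) :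
    ContMDiffAt 𝓘(ℝ, B) (hullModel F B) ∞ (constSection (F := F) m w) m :=
  (contMDiffAt_hullTriv_symm m (hullTriv F V A m ⟨m, w⟩).2).comp m
    (contMDiffAt_id.prodMk contMDiffAt_const)

theorem hasMFDerivAt_constSection (m : M) (w : Hull V A m) :
    HasMFDerivAt 𝓘(ℝ, B) (hullModel F B) (constSection (F := F) m w) m (hlift F V A B m w) :=
  ((contMDiffAt_constSection m w).mdifferentiableAt (by simp)).hasMFDerivAt

theorem contMDiffAt_fiberParam (m : M) (w : Hull V A m) :
    ContMDiffAt 𝓘(ℝ, F × ℝ) (hullModel F B) ∞ (fiberParam (F := F) m w) 0 := by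
  rw [contMDiffAt_totalSpace]
  refine ⟨contMDiffAt_const, ?_⟩
  have : ContDiff ℝ ∞ fun k : F × ℝ => (hullTriv F V A m ⟨m, w⟩).2 + k := by fun_prop
  exact this.contMDiff.contMDiffAt.congr_of_eventuallyEq
    (Filter.Eventually.of_forall fun k => hullTriv_fiberParam m w k)

variable (B) in
/-- The differential of the parametrization of a fibre. -/
def dFiber (m : M) (w : Hull V A m) : F × ℝ →L[ℝ] HullTangent F V A B m w :=
  mfderiv 𝓘(ℝ, F × ℝ) (hullModel F B) (fiberParam (F := F) m w) 0

theorem hasMFDerivAt_fiberParam (m : M) (w : Hull V A m) :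
    HasMFDerivAt 𝓘(ℝ, F × ℝ) (hullModel F B) (fiberParam (F := F) m w) 0 (dFiber B m w) :=
  ((contMDiffAt_fiberParam m w).mdifferentiableAt (by simp)).hasMFDerivAt

theorem vlift_apply (m : M) (w u : Hull V A m) :
    vlift F V A B m w u = dFiber B m w (hullTriv F V A m ⟨m, u⟩).2 := by
  rw [← hullTriv_linearMapAt]; rfl

theorem hasMFDerivAt_proj (m : M) (w : Hull V A m) :
    HasMFDerivAt (hullModel F B) 𝓘(ℝ, B) (fun x : HullTotal F V A => x.1) ⟨m, w⟩
      (mfderiv (hullModel F B) 𝓘(ℝ, B) (fun x : HullTotal F V A => x.1) ⟨m, w⟩) :=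
  ((contMDiffAt_proj (n := ∞) (Hull V A)).mdifferentiableAt (by simp)).hasMFDerivAt

theorem hasMFDerivAt_hullTriv (m : M) (w : Hull V A m) :
    HasMFDerivAt (hullModel F B) 𝓘(ℝ, F × ℝ) (fun x : HullTotal F V A => (hullTriv F V A m x).2)
      ⟨m, w⟩ (mfderiv (hullModel F B) 𝓘(ℝ, F × ℝ)
        (fun x : HullTotal F V A => (hullTriv F V A m x).2) ⟨m, w⟩) :=
  ((contMDiffAt_hullTriv (⟨m, w⟩ : HullTotal F V A)).mdifferentiableAt (by simp)).hasMFDerivAt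

/-- This and the next three lemmas say that the differentials of the projection and of the preferred
fibre coordinate are dual to `hlift` and `dFiber`. Each is the derivative of an identity along
`constSection` or `fiberParam`; together they show that `covec` has the components from which it is
built. -/
theorem mfderiv_proj_hlift (m : M) (w : Hull V A m) (u : TangentSpace 𝓘(ℝ, B) m) :
    mfderiv (hullModel F B) 𝓘(ℝ, B) (fun x : HullTotal F V A => x.1) ⟨m, w⟩
      (hlift F V A B m w u) = u := by
  have h := (HasMFDerivAt.congr_point (hasMFDerivAt_proj (F := F) (B := B) m w)
    (constSection_self m w).symm).comp m (hasMFDerivAt_constSection m w)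
  have := hasMFDerivAt_unique h (hasMFDerivAt_id m)
  exact congrArg (fun L : B →L[ℝ] B => L u) this

theorem mfderiv_hullTriv_hlift (m : M) (w : Hull V A m) (u : TangentSpace 𝓘(ℝ, B) m) :
    mfderiv (hullModel F B) 𝓘(ℝ, F × ℝ) (fun x : HullTotal F V A => (hullTriv F V A m x).2) ⟨m, w⟩
      (hlift F V A B m w u) = (0 : F × ℝ) := by
  have h := (HasMFDerivAt.congr_point (hasMFDerivAt_hullTriv (F := F) (B := B) m w)
    (constSection_self m w).symm).comp m (hasMFDerivAt_constSection m w)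
  have h₂ : HasMFDerivAt 𝓘(ℝ, B) 𝓘(ℝ, F × ℝ)
      ((fun x : HullTotal F V A => (hullTriv F V A m x).2) ∘ constSection (F := F) m w) m
      (0 : B →L[ℝ] F × ℝ) := by
    refine (hasMFDerivAt_const (hullTriv F V A m ⟨m, w⟩).2 m).congr_of_eventuallyEq ?_
    filter_upwards [(hullTriv F V A m).open_baseSet.mem_nhds (mem_hullTriv m)] with x hx
    exact hullTriv_snd_symm hx _
  exact congrArg (fun L : B →L[ℝ] F × ℝ => L u) (hasMFDerivAt_unique h h₂)

theorem mfderiv_proj_dFiber (m : M) (w : Hull V A m) (k : F × ℝ) :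
    mfderiv (hullModel F B) 𝓘(ℝ, B) (fun x : HullTotal F V A => x.1) ⟨m, w⟩
      (dFiber B m w k) = (0 : B) := by
  have h := (HasMFDerivAt.congr_point (hasMFDerivAt_proj (F := F) (B := B) m w)
    (fiberParam_zero m w).symm).comp (0 : F × ℝ) (hasMFDerivAt_fiberParam m w)
  have h₂ := hasMFDerivAt_const (I := 𝓘(ℝ, F × ℝ)) (I' := 𝓘(ℝ, B)) m (0 : F × ℝ)
  exact congrArg (fun L : F × ℝ →L[ℝ] B => L k) (hasMFDerivAt_unique h h₂)

theorem mfderiv_hullTriv_dFiber (m : M) (w : Hull V A m) (k : F × ℝ) :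
    mfderiv (hullModel F B) 𝓘(ℝ, F × ℝ) (fun x : HullTotal F V A => (hullTriv F V A m x).2) ⟨m, w⟩
      (dFiber B m w k) = k := by
  have h₀ : HasMFDerivAt (hullModel F B) 𝓘(ℝ, F × ℝ)
      (fun x : HullTotal F V A => (hullTriv F V A m x).2) (fiberParam m w (0 : F × ℝ))
      (mfderiv (hullModel F B) 𝓘(ℝ, F × ℝ)
        (fun x : HullTotal F V A => (hullTriv F V A m x).2) ⟨m, w⟩) :=
    HasMFDerivAt.congr_point (hasMFDerivAt_hullTriv (F := F) (B := B) m w)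
      (fiberParam_zero m w).symm
  have h := h₀.comp (0 : F × ℝ) (hasMFDerivAt_fiberParam m w)
  have h₁ : HasFDerivAt (fun k : F × ℝ => (hullTriv F V A m ⟨m, w⟩).2 + k)
    (ContinuousLinearMap.id ℝ (F × ℝ)) 0 := (hasFDerivAt_id _).const_add _
  have h₂ : HasMFDerivAt 𝓘(ℝ, F × ℝ) 𝓘(ℝ, F × ℝ)
      ((fun x : HullTotal F V A => (hullTriv F V A m x).2) ∘ fiberParam (F := F) m w) 0
      (ContinuousLinearMap.id ℝ (F × ℝ)) :=
    h₁.hasMFDerivAt.congr_of_eventuallyEq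
      (Filter.Eventually.of_forall fun k => hullTriv_fiberParam m w k)
  exact congrArg (fun L : F × ℝ →L[ℝ] F × ℝ => L k) (hasMFDerivAt_unique h h₂)

theorem horiz_covec (m : M) (w : Hull V A m) (p : TangentSpace 𝓘(ℝ, B) m →L[ℝ] ℝ)
    (ξ : Module.Dual ℝ (Hull V A m)) : horiz F V B m w (covec F V B m w p ξ) = p := by
  ext u
  change p (mfderiv (hullModel F B) 𝓘(ℝ, B) (fun x : HullTotal F V A => x.1) ⟨m, w⟩
      (hlift F V A B m w u)) + ξ ((hullTriv F V A m).symmₗ ℝ m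
      (mfderiv (hullModel F B) 𝓘(ℝ, F × ℝ) (fun x : HullTotal F V A => (hullTriv F V A m x).2) ⟨m, w⟩
      (hlift F V A B m w u))) = p u
  rw [mfderiv_proj_hlift, mfderiv_hullTriv_hlift, map_zero, map_zero, add_zero]

theorem vert_covec (m : M) (w : Hull V A m) (p : TangentSpace 𝓘(ℝ, B) m →L[ℝ] ℝ)
    (ξ : Module.Dual ℝ (Hull V A m)) : vert F V B m w (covec F V B m w p ξ) = ξ := by
  ext u
  change covec F V B m w p ξ (vlift F V A B m w u) = ξ u
  rw [vlift_apply]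
  change p (mfderiv (hullModel F B) 𝓘(ℝ, B) (fun x : HullTotal F V A => x.1) ⟨m, w⟩
      (dFiber B m w (hullTriv F V A m ⟨m, u⟩).2)) + ξ ((hullTriv F V A m).symmₗ ℝ m
      (mfderiv (hullModel F B) 𝓘(ℝ, F × ℝ) (fun x : HullTotal F V A => (hullTriv F V A m x).2) ⟨m, w⟩
      (dFiber B m w (hullTriv F V A m ⟨m, u⟩).2))) = ξ u
  rw [mfderiv_proj_dFiber, mfderiv_hullTriv_dFiber, Trivialization.symmₗ_apply _ (mem_hullTriv m),
    hullTriv_symm_apply_snd]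
  erw [map_zero]
  rw [zero_add]

end Lifts

namespace AdaptedChart

variable [SmoothAffineBundle F V A B] (κ : AdaptedChart F A B v K) {m : M}

/-- The differential of the parametrization of the hull by adapted coordinates. -/
def dParam (m : M) (w : Hull V A m) : B × ((K × ℝ) × ℝ) →L[ℝ] HullTangent F V A B m w :=
  mfderiv 𝓘(ℝ, B × ((K × ℝ) × ℝ)) (hullModel F B) κ.hullParam (κ.base m, κ.hullCoord m w)

/-- The differential of the adapted coordinates on the hull. -/
def dCoords (m : M) (w : Hull V A m) : HullTangent F V A B m w →L[ℝ] B × ((K × ℝ) × ℝ) :=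
  mfderiv (hullModel F B) 𝓘(ℝ, B × ((K × ℝ) × ℝ)) (κ.hullCoords F) ⟨m, w⟩

section
variable (hm : m ∈ κ.dom) (w : Hull V A m)
include hm

theorem hullParam_hullCoord :
    κ.hullParam (κ.base m, κ.hullCoord m w) = (⟨m, w⟩ : HullTotal F V A) :=
  κ.hullParam_hullCoords (x := ⟨m, w⟩) hm

theorem hasMFDerivAt_hullParam : HasMFDerivAt 𝓘(ℝ, B × ((K × ℝ) × ℝ)) (hullModel F B)
    κ.hullParam (κ.base m, κ.hullCoord m w) (κ.dParam m w) :=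
  ((κ.contMDiffAt_hullParam (p := (κ.base m, κ.hullCoord m w))
    (κ.base_mem_region hm)).mdifferentiableAt (by simp)).hasMFDerivAt

theorem hasMFDerivAt_hullCoords : HasMFDerivAt (hullModel F B) 𝓘(ℝ, B × ((K × ℝ) × ℝ))
    (κ.hullCoords F) ⟨m, w⟩ (κ.dCoords m w) :=
  ((κ.contMDiffAt_hullCoords (x := (⟨m, w⟩ : HullTotal F V A)) hm).mdifferentiableAt
    (by simp)).hasMFDerivAt

theorem dCoords_dParam (z : B × ((K × ℝ) × ℝ)) : κ.dCoords m w (κ.dParam m w z) = z := by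
  have h := (HasMFDerivAt.congr_point (κ.hasMFDerivAt_hullCoords hm w)
    (κ.hullParam_hullCoord hm w).symm).comp (κ.base m, κ.hullCoord m w)
      (κ.hasMFDerivAt_hullParam hm w)
  have h₂ := (hasMFDerivAt_id (I := 𝓘(ℝ, B × ((K × ℝ) × ℝ)))
    (κ.base m, κ.hullCoord m w)).congr_of_eventuallyEq
    (f₁ := κ.hullCoords F ∘ κ.hullParam) (by
      filter_upwards [(κ.isOpen_region.preimage continuous_fst).mem_nhds
        (κ.base_mem_region hm)] with p hp
      exact κ.hullCoords_hullParam hp)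
  exact congrArg (fun L : B × ((K × ℝ) × ℝ) →L[ℝ] B × ((K × ℝ) × ℝ) => L z)
    (hasMFDerivAt_unique h h₂)

theorem dParam_dCoords (X : HullTangent F V A B m w) : κ.dParam m w (κ.dCoords m w X) = X := by
  have h := (κ.hasMFDerivAt_hullParam hm w).comp (⟨m, w⟩ : HullTotal F V A)
    (κ.hasMFDerivAt_hullCoords hm w)
  have h₂ := (hasMFDerivAt_id (I := hullModel F B)
    (⟨m, w⟩ : HullTotal F V A)).congr_of_eventuallyEq
    (f₁ := κ.hullParam ∘ κ.hullCoords F) (by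
      filter_upwards [κ.preimage_dom_mem_nhds_hull (x := (⟨m, w⟩ : HullTotal F V A)) hm] with x hx
      exact κ.hullParam_hullCoords hx)
  exact congrArg (fun L : B × (F × ℝ) →L[ℝ] B × (F × ℝ) => L X) (hasMFDerivAt_unique h h₂)

/-- Along a fibre of the hull the adapted coordinates are affine in the parameter, with linear part
`hullCoord`. -/
theorem dCoords_vlift (u : Hull V A m) :
    κ.dCoords m w (vlift F V A B m w u) = (0, κ.hullCoord m u) := by
  rw [vlift_apply]
  have h := (HasMFDerivAt.congr_point (κ.hasMFDerivAt_hullCoords hm w)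
    (fiberParam_zero m w).symm).comp (0 : F × ℝ) (hasMFDerivAt_fiberParam m w)
  let L : F × ℝ →L[ℝ] B × ((K × ℝ) × ℝ) := (LinearMap.inr ℝ B ((K × ℝ) × ℝ) ∘ₗ
    (κ.hullCoord m).toLinearMap ∘ₗ (hullTriv F V A m).symmₗ ℝ m).toContinuousLinearMap
  have h₁ : HasFDerivAt (fun k : F × ℝ => κ.hullCoords F ⟨m, w⟩ + L k) L 0 :=
    L.hasFDerivAt.const_add _
  have h₂ : HasMFDerivAt 𝓘(ℝ, F × ℝ) 𝓘(ℝ, B × ((K × ℝ) × ℝ))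
      (κ.hullCoords F ∘ fiberParam (F := F) m w) 0 L := by
    refine h₁.hasMFDerivAt.congr_of_eventuallyEq (Filter.Eventually.of_forall fun k => ?_)
    refine Prod.ext (add_zero _).symm ?_
    change κ.hullCoord m (w + (hullTriv F V A m).symm m k) =
      κ.hullCoord m w + κ.hullCoord m ((hullTriv F V A m).symmₗ ℝ m k)
    rw [map_add, Trivialization.symmₗ_apply _ (mem_hullTriv m)]
  refine (congrArg (fun L : F × ℝ →L[ℝ] B × ((K × ℝ) × ℝ) => L (hullTriv F V A m ⟨m, u⟩).2)
    (hasMFDerivAt_unique h h₂)).trans ?_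
  change (0, κ.hullCoord m ((hullTriv F V A m).symmₗ ℝ m (hullTriv F V A m ⟨m, u⟩).2)) = _
  rw [Trivialization.symmₗ_apply _ (mem_hullTriv m), hullTriv_symm_apply_snd]

end

end AdaptedChart

end HullSmooth

/-! ### Covectors on the hull in adapted coordinates -/

section Covectors

variable {F : Type*} [NormedAddCommGroup F] [NormedSpace ℝ F] {M : Type*} [TopologicalSpace M]
  {V : M → Type*} [∀ m, AddCommGroup (V m)] [∀ m, Module ℝ (V m)]
  {A : M → Type*} [∀ m, AddTorsor (V m) (A m)]
  [∀ m, TopologicalSpace (A m)] [TopologicalSpace (TotalSpace F A)] [FiberBundle F A]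
  {B : Type*} [NormedAddCommGroup B] [NormedSpace ℝ B] [ChartedSpace B M] {v : ∀ m, V m}
  {K : Type*} [NormedAddCommGroup K] [NormedSpace ℝ K]
  [FiniteDimensional ℝ F] [SmoothAffineBundle F V A B]

namespace AdaptedChart

variable (κ : AdaptedChart F A B v K) {m : M}

variable (m) in
/-- The differential of the chart of the base. -/
def dBase : TangentSpace 𝓘(ℝ, B) m →L[ℝ] B := mfderiv 𝓘(ℝ, B) 𝓘(ℝ, B) κ.base m

section
variable (hm : m ∈ κ.dom)
include hm

theorem hasMFDerivAt_base : HasMFDerivAt 𝓘(ℝ, B) 𝓘(ℝ, B) κ.base m (κ.dBase m) :=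
  ((κ.contMDiffAt_base hm).mdifferentiableAt (by simp)).hasMFDerivAt

theorem exists_dBase (u : B) : ∃ X : TangentSpace 𝓘(ℝ, B) m, κ.dBase m X = u := by
  have h := (κ.hasMFDerivAt_base hm).congr_point (κ.base_symm_base hm).symm
  have h₁ := h.comp (κ.base m) ((κ.contMDiffAt_base_symm
    (κ.base_mem_region hm)).mdifferentiableAt (by simp)).hasMFDerivAt
  have h₂ := (hasMFDerivAt_id (I := 𝓘(ℝ, B)) (κ.base m)).congr_of_eventuallyEq
    (f₁ := κ.base ∘ κ.base.symm) (by
      filter_upwards [κ.isOpen_region.mem_nhds (κ.base_mem_region hm)] with p hp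
      exact κ.base.right_inv hp.1)
  exact ⟨_, congrArg (fun L : B →L[ℝ] B => L u) (hasMFDerivAt_unique h₁ h₂)⟩

/-- The derivative of the adapted coordinate of a section that is constant in the preferred
trivialization. -/
theorem hasMFDerivAt_hullCoord_constSection (w : Hull V A m) :
    HasMFDerivAt 𝓘(ℝ, B) 𝓘(ℝ, B × ((K × ℝ) × ℝ)) (κ.hullCoords F ∘ constSection (F := F) m w) m
      ((κ.dCoords m w).comp (hlift F V A B m w)) :=
  ((κ.hasMFDerivAt_hullCoords hm w).congr_point (constSection_self m w).symm).comp m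
    (hasMFDerivAt_constSection m w)

theorem dCoords_hlift_fst (w : Hull V A m) (u : TangentSpace 𝓘(ℝ, B) m) :
    (κ.dCoords m w (hlift F V A B m w u)).1 = κ.dBase m u := by
  have h₀ : HasFDerivAt (Prod.fst : B × ((K × ℝ) × ℝ) → B)
    (ContinuousLinearMap.fst ℝ B ((K × ℝ) × ℝ)) (κ.hullCoords F (constSection (F := F) m w m)) :=
    hasFDerivAt_fst
  have h₁ := h₀.hasMFDerivAt.comp m (κ.hasMFDerivAt_hullCoord_constSection hm w)
  exact congrArg (fun L : B →L[ℝ] B => L u) (hasMFDerivAt_unique h₁ (κ.hasMFDerivAt_base hm))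

theorem hasMFDerivAt_hullCoord_constSection_snd (w : Hull V A m) :
    HasMFDerivAt 𝓘(ℝ, B) 𝓘(ℝ, (K × ℝ) × ℝ)
      (fun x => κ.hullCoord x (constSection (F := F) m w x).2) m
      ((ContinuousLinearMap.snd ℝ B ((K × ℝ) × ℝ)).comp
        ((κ.dCoords m w).comp (hlift F V A B m w))) := by
  have h₀ : HasFDerivAt (Prod.snd : B × ((K × ℝ) × ℝ) → (K × ℝ) × ℝ)
    (ContinuousLinearMap.snd ℝ B ((K × ℝ) × ℝ)) (κ.hullCoords F (constSection (F := F) m w m)) :=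
    hasFDerivAt_snd
  exact h₀.hasMFDerivAt.comp m (κ.hasMFDerivAt_hullCoord_constSection hm w)

/-- Near m the constant sections through w and w' add up to the one through w + w', and `hullCoord`
is linear on each fibre. -/
theorem dCoords_hlift_snd_add (w w' : Hull V A m) (u : TangentSpace 𝓘(ℝ, B) m) :
    (κ.dCoords m (w + w') (hlift F V A B m (w + w') u)).2 =
      (κ.dCoords m w (hlift F V A B m w u)).2 + (κ.dCoords m w' (hlift F V A B m w' u)).2 := by
  have h := (κ.hasMFDerivAt_hullCoord_constSection_snd hm w).add
    (κ.hasMFDerivAt_hullCoord_constSection_snd hm w')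
  have h₁ := (κ.hasMFDerivAt_hullCoord_constSection_snd hm (w + w')).congr_of_eventuallyEq
    (f₁ := (fun x => κ.hullCoord x (constSection (F := F) m w x).2) +
      fun x => κ.hullCoord x (constSection (F := F) m w' x).2) (by
      filter_upwards [(hullTriv F V A m).open_baseSet.mem_nhds (mem_hullTriv m)] with x hx
      change κ.hullCoord x ((hullTriv F V A m).symm x _) +
        κ.hullCoord x ((hullTriv F V A m).symm x _) = κ.hullCoord x ((hullTriv F V A m).symm x _)
      rw [hullTriv_snd_add, ← map_add, ← Trivialization.symmₗ_apply (R := ℝ) _ hx, ←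
        Trivialization.symmₗ_apply (R := ℝ) _ hx, ← Trivialization.symmₗ_apply (R := ℝ) _ hx,
        ← map_add])
  exact congrArg (fun L : B →L[ℝ] (K × ℝ) × ℝ => L u) (hasMFDerivAt_unique h₁ h)

theorem dCoords_hlift_snd_smul (t : ℝ) (w : Hull V A m) (u : TangentSpace 𝓘(ℝ, B) m) :
    (κ.dCoords m (t • w) (hlift F V A B m (t • w) u)).2 =
      t • (κ.dCoords m w (hlift F V A B m w u)).2 := by
  have h := (κ.hasMFDerivAt_hullCoord_constSection_snd hm w).const_smul t
  have h₁ := (κ.hasMFDerivAt_hullCoord_constSection_snd hm (t • w)).congr_of_eventuallyEq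
    (f₁ := t • (fun x => κ.hullCoord x (constSection (F := F) m w x).2)) (by
      filter_upwards [(hullTriv F V A m).open_baseSet.mem_nhds (mem_hullTriv m)] with x hx
      change t • κ.hullCoord x ((hullTriv F V A m).symm x _) =
        κ.hullCoord x ((hullTriv F V A m).symm x _)
      rw [hullTriv_snd_smul, ← map_smul, ← Trivialization.symmₗ_apply (R := ℝ) _ hx, ←
        Trivialization.symmₗ_apply (R := ℝ) _ hx, ← map_smul])
  exact congrArg (fun L : B →L[ℝ] (K × ℝ) × ℝ => L u) (hasMFDerivAt_unique h₁ h)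

end

/-- The components of a covector on the hull in adapted coordinates. -/
def covCoord (m : M) (w : Hull V A m) (η : HullTangent F V A B m w →L[ℝ] ℝ) :
    B × ((K × ℝ) × ℝ) →L[ℝ] ℝ := η.comp (κ.dParam m w)

/-- The covector with given components in adapted coordinates. -/
def covOf (m : M) (w : Hull V A m) (Λ : B × ((K × ℝ) × ℝ) →L[ℝ] ℝ) :
    HullTangent F V A B m w →L[ℝ] ℝ := Λ.comp (κ.dCoords m w)

section
variable (hm : m ∈ κ.dom)
include hm

theorem covCoord_covOf (w : Hull V A m) (Λ : B × ((K × ℝ) × ℝ) →L[ℝ] ℝ) :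
    κ.covCoord m w (κ.covOf m w Λ) = Λ :=
  ContinuousLinearMap.ext fun z => congrArg Λ (κ.dCoords_dParam hm w z)

theorem covOf_covCoord (w : Hull V A m) (η : HullTangent F V A B m w →L[ℝ] ℝ) :
    κ.covOf m w (κ.covCoord m w η) = η :=
  ContinuousLinearMap.ext fun X => congrArg η (κ.dParam_dCoords hm w X)

theorem apply_eq_covCoord (w : Hull V A m) (η : HullTangent F V A B m w →L[ℝ] ℝ)
    (X : HullTangent F V A B m w) : η X = κ.covCoord m w η (κ.dCoords m w X) :=
  congrArg η (κ.dParam_dCoords hm w X).symm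

theorem vert_eq (w : Hull V A m) (η : HullTangent F V A B m w →L[ℝ] ℝ) (u : Hull V A m) :
    vert F V B m w η u = κ.covCoord m w η (0, κ.hullCoord m u) := by
  rw [← κ.dCoords_vlift hm w u, ← κ.apply_eq_covCoord hm w]; rfl

/-- `horiz` refers to the preferred trivialization and `covCoord` to the adapted one. They differ by
the adapted fibre derivative of a section constant in the preferred trivialization, paired with the
vertical part of the covector. -/
theorem horiz_eq (w : Hull V A m) (η : HullTangent F V A B m w →L[ℝ] ℝ)
    (u : TangentSpace 𝓘(ℝ, B) m) : horiz F V B m w η u = κ.covCoord m w η (κ.dBase m u, 0) +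
      vert F V B m w η ((κ.hullCoord m).symm (κ.dCoords m w (hlift F V A B m w u)).2) := by
  rw [κ.vert_eq hm, LinearEquiv.apply_symm_apply, ← κ.dCoords_hlift_fst hm w u, ← map_add,
    Prod.mk_add_mk, add_zero, zero_add, Prod.mk.eta, ← κ.apply_eq_covCoord hm w]; rfl

/-- When the vertical parts agree, the correction term in `horiz_eq` is additive in w and cancels.
So `cotAdd`, defined by the preferred trivialization, also adds the base components in every adapted
chart. -/
theorem covCoord_cotAdd {w w' : Hull V A m} {η : HullTangent F V A B m w →L[ℝ] ℝ}
    {η' : HullTangent F V A B m w' →L[ℝ] ℝ} (h : vert F V B m w η = vert F V B m w' η') (u : B) :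
    κ.covCoord m (w + w') (cotAdd F V B m w w' η η') (u, 0) =
      κ.covCoord m w η (u, 0) + κ.covCoord m w' η' (u, 0) := by
  obtain ⟨X, rfl⟩ := κ.exists_dBase hm u
  have h₁ := κ.horiz_eq hm (w + w') (cotAdd F V B m w w' η η') X
  have h₂ := κ.horiz_eq hm w η X
  have h₃ := κ.horiz_eq hm w' η' X
  rw [cotAdd, horiz_covec, vert_covec, κ.dCoords_hlift_snd_add hm, map_add, map_add] at h₁
  rw [← h] at h₃
  change horiz F V B m w η X + horiz F V B m w' η' X = _ at h₁
  rw [cotAdd]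
  linarith

theorem covCoord_cotSmul (t : ℝ) (w : Hull V A m) (η : HullTangent F V A B m w →L[ℝ] ℝ) (u : B) :
    κ.covCoord m (t • w) (cotSmul F V B m t w η) (u, 0) = t * κ.covCoord m w η (u, 0) := by
  obtain ⟨X, rfl⟩ := κ.exists_dBase hm u
  have h₁ := κ.horiz_eq hm (t • w) (cotSmul F V B m t w η) X
  have h₂ := κ.horiz_eq hm w η X
  rw [cotSmul, horiz_covec, vert_covec, κ.dCoords_hlift_snd_smul hm, map_smul, map_smul] at h₁
  change t * horiz F V B m w η X = _ at h₁
  rw [cotSmul]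
  simp only [smul_eq_mul] at h₁
  rw [h₂] at h₁
  linarith

/-! The action in adapted coordinates -/

theorem dalpha_eq (w : Hull V A m) : dalpha F A B m w = ((ContinuousLinearMap.snd ℝ (K × ℝ) ℝ).comp
    (ContinuousLinearMap.snd ℝ B ((K × ℝ) × ℝ))).comp (κ.dCoords m w) := by
  let L := (ContinuousLinearMap.snd ℝ (K × ℝ) ℝ).comp (ContinuousLinearMap.snd ℝ B ((K × ℝ) × ℝ))
  have h : HasMFDerivAt (hullModel F B) 𝓘(ℝ, ℝ) (L ∘ κ.hullCoords F) ⟨m, w⟩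
      (L.comp (κ.dCoords m w)) :=
    L.hasFDerivAt.hasMFDerivAt.comp (⟨m, w⟩ : HullTotal F V A) (κ.hasMFDerivAt_hullCoords hm w)
  have h₁ := h.congr_of_eventuallyEq
    (f₁ := fun y : HullTotal F V A => Hull.alpha V A y.1 y.2)
    (Filter.Eventually.of_forall fun y => κ.alpha_eq y.2)
  exact h₁.mfderiv

/-- In adapted coordinates the translation subtracts the constant s from r, so its differential is
the identity there. -/
theorem hasMFDerivAt_translate (s : ℝ) (w : Hull V A m) :
    HasMFDerivAt (hullModel F B) (hullModel F B) (translate F A v (-s))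
      ⟨m, w + s • Hull.ofVec (v m)⟩ ((κ.dParam m w).comp (κ.dCoords m (w + s • Hull.ofVec (v m))))
      := by
  have h₀ : ∀ y : HullTotal F V A, y.1 ∈ κ.dom → κ.hullCoords F (translate F A v (-s) y) =
      κ.hullCoords F y + (0, ((0, -s), 0)) := by
    intro y hy
    refine Prod.ext (add_zero _).symm ?_
    change κ.hullCoord y.1 (y.2 + -s • Hull.ofVec (v y.1)) = _
    rw [map_add, map_smul, κ.hullCoord_ofVec hy]
    change _ = κ.hullCoord y.1 y.2 + ((0, -s), 0)
    simp
  have h₁ := ((ContinuousLinearMap.id ℝ (B × ((K × ℝ) × ℝ))).hasFDerivAt.add_const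
    ((0, ((0, -s), 0)) : B × ((K × ℝ) × ℝ))
    (x := κ.hullCoords F ⟨m, w + s • Hull.ofVec (v m)⟩)).hasMFDerivAt.comp
    (⟨m, w + s • Hull.ofVec (v m)⟩ : HullTotal F V A) (κ.hasMFDerivAt_hullCoords hm _)
  have e : (κ.base m, κ.hullCoord m w) =
      κ.hullCoords F ⟨m, w + s • Hull.ofVec (v m)⟩ + (0, ((0, -s), 0)) := by
    rw [← h₀ _ hm]
    refine Prod.ext rfl ?_
    change κ.hullCoord m w = κ.hullCoord m (w + s • Hull.ofVec (v m) + -s • Hull.ofVec (v m))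
    congr 1
    module
  have h₂ := ((κ.hasMFDerivAt_hullParam hm w).congr_point e).comp
    (⟨m, w + s • Hull.ofVec (v m)⟩ : HullTotal F V A) h₁
  refine h₂.congr_of_eventuallyEq ?_
  filter_upwards [κ.preimage_dom_mem_nhds_hull
    (x := (⟨m, w + s • Hull.ofVec (v m)⟩ : HullTotal F V A)) hm] with y hy
  change _ = κ.hullParam (κ.hullCoords F y + (0, ((0, -s), 0)))
  rw [← h₀ y hy, κ.hullParam_hullCoords (x := translate F A v (-s) y) hy]

/-- Pull-back along the translation leaves the components unchanged, and dα_A is the differential of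
the last fibre coordinate. So the action moves one component of a covector only; this component and
r are what an orbit forgets. -/
theorem covCoord_orbitAction (s t : ℝ) (x : CotangentFiber F V A B m) :
    κ.covCoord m _ (orbitAction F A B v m s t x).2 = κ.covCoord m x.1 x.2 +
      t • ((ContinuousLinearMap.snd ℝ (K × ℝ) ℝ).comp
        (ContinuousLinearMap.snd ℝ B ((K × ℝ) × ℝ))) := by
  refine ContinuousLinearMap.ext fun z => ?_
  have h₁ := (κ.hasMFDerivAt_translate hm s x.1).mfderiv
  have h₂ := κ.dalpha_eq hm (x.1 + s • Hull.ofVec (v m))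
  have h₃ := κ.dCoords_dParam hm (x.1 + s • Hull.ofVec (v m)) z
  change x.2 (mfderiv (hullModel F B) (hullModel F B) (translate F A v (-s))
      ⟨m, x.1 + s • Hull.ofVec (v m)⟩ (κ.dParam m (x.1 + s • Hull.ofVec (v m)) z)) +
    t * dalpha F A B m (x.1 + s • Hull.ofVec (v m)) (κ.dParam m (x.1 + s • Hull.ofVec (v m)) z) = _
  rw [h₁, h₂]
  change x.2 (κ.dParam m x.1 (κ.dCoords m (x.1 + s • Hull.ofVec (v m))
    (κ.dParam m (x.1 + s • Hull.ofVec (v m)) z))) +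
    t * (κ.dCoords m (x.1 + s • Hull.ofVec (v m))
      (κ.dParam m (x.1 + s • Hull.ofVec (v m)) z)).2.2 = _
  rw [h₃]; rfl

theorem hullCoord_orbitAction (s t : ℝ) (x : CotangentFiber F V A B m) :
    κ.hullCoord m (orbitAction F A B v m s t x).1 = κ.hullCoord m x.1 + ((0, s), 0) := by
  change κ.hullCoord m (x.1 + s • Hull.ofVec (v m)) = _
  rw [map_add, map_smul, κ.hullCoord_ofVec hm]
  simp

end

end AdaptedChart

end Covectors

/-! ### Coordinates on the orbit space -/

section Orbits

variable {F : Type*} [NormedAddCommGroup F] [NormedSpace ℝ F] {M : Type*} [TopologicalSpace M]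
  {V : M → Type*} [∀ m, AddCommGroup (V m)] [∀ m, Module ℝ (V m)]
  {A : M → Type*} [∀ m, AddTorsor (V m) (A m)]
  [∀ m, TopologicalSpace (A m)] [TopologicalSpace (TotalSpace F A)] [FiberBundle F A]
  {B : Type*} [NormedAddCommGroup B] [NormedSpace ℝ B] [ChartedSpace B M] {v : ∀ m, V m}
  {K : Type*} [NormedAddCommGroup K] [NormedSpace ℝ K]

namespace AdaptedChart

variable (κ κ' : AdaptedChart F A B v K) {m : M}

/-- The adapted coordinates on `E / ⟨v⟩`, on representatives. -/
def sideFstLin (m : M) : Hull V A m →ₗ[ℝ] K × ℝ :=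
  (LinearMap.fst ℝ K ℝ).prodMap LinearMap.id ∘ₗ (κ.hullCoord m).toLinearMap

theorem sideFstLin_apply (w : Hull V A m) :
    κ.sideFstLin m w = ((κ.hullCoord m w).1.1, (κ.hullCoord m w).2) := rfl

theorem sideFstLin_symm (a : K × ℝ) (r : ℝ) :
    κ.sideFstLin m ((κ.hullCoord m).symm ((a.1, r), a.2)) = a := by
  rw [sideFstLin_apply, LinearEquiv.apply_symm_apply]

/-- In coordinates v_A is the unit vector of r, the one coordinate that `sideFstLin` drops. -/
theorem ker_sideFstLin (hm : m ∈ κ.dom) :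
    Submodule.span ℝ {Hull.ofVec (A := A) (v m)} = LinearMap.ker (κ.sideFstLin m) := by
  ext w
  rw [Submodule.mem_span_singleton, LinearMap.mem_ker, sideFstLin_apply]
  constructor
  · rintro ⟨t, rfl⟩
    rw [map_smul, κ.hullCoord_ofVec hm]
    simp
  · intro h
    refine ⟨(κ.hullCoord m w).1.2, (κ.hullCoord m).injective ?_⟩
    rw [map_smul, κ.hullCoord_ofVec hm]
    have h₁ := congrArg Prod.fst h
    have h₂ := congrArg Prod.snd h
    simp only [Prod.fst_zero, Prod.snd_zero] at h₁ h₂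
    refine Prod.ext (Prod.ext ?_ ?_) ?_ <;> simp [h₁, h₂]

/-- The adapted coordinates on `E / ⟨v⟩`. -/
def sideFst (hm : m ∈ κ.dom) : HullQuot V A v m ≃ₗ[ℝ] K × ℝ :=
  (Submodule.quotEquivOfEq _ _ (κ.ker_sideFstLin hm)).trans
    ((κ.sideFstLin m).quotKerEquivOfSurjective fun a => ⟨_, κ.sideFstLin_symm a 0⟩)

theorem sideFst_mk (hm : m ∈ κ.dom) (w : Hull V A m) :
    κ.sideFst hm (Submodule.Quotient.mk w) = ((κ.hullCoord m w).1.1, (κ.hullCoord m w).2) := rfl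

section
variable [FiniteDimensional ℝ K]

/-- The adapted coordinates on `E* / ⟨α⟩`, on representatives. -/
def sideSndLin (m : M) : Module.Dual ℝ (Hull V A m) →ₗ[ℝ] (K →L[ℝ] ℝ) × ℝ :=
  (LinearMap.toContinuousLinearMap.toLinearMap ∘ₗ LinearMap.lcomp ℝ ℝ
    ((κ.hullCoord m).symm.toLinearMap ∘ₗ LinearMap.inl ℝ (K × ℝ) ℝ ∘ₗ LinearMap.inl ℝ K ℝ)).prod
    (LinearMap.applyₗ ((κ.hullCoord m).symm ((0, 1), 0)))

theorem sideSndLin_fst (ξ : Module.Dual ℝ (Hull V A m)) (k : K) :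
    (κ.sideSndLin m ξ).1 k = ξ ((κ.hullCoord m).symm ((k, 0), 0)) := rfl

theorem sideSndLin_snd (ξ : Module.Dual ℝ (Hull V A m)) :
    (κ.sideSndLin m ξ).2 = ξ ((κ.hullCoord m).symm ((0, 1), 0)) := rfl

theorem dual_apply (ξ : Module.Dual ℝ (Hull V A m)) (z : (K × ℝ) × ℝ) :
    ξ ((κ.hullCoord m).symm z) = (κ.sideSndLin m ξ).1 z.1.1 + z.1.2 * (κ.sideSndLin m ξ).2 +
      z.2 * ξ ((κ.hullCoord m).symm ((0, 0), 1)) := by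
  rw [sideSndLin_fst, sideSndLin_snd, ← smul_eq_mul, ← smul_eq_mul, ← map_smul, ← map_smul,
    ← map_smul, ← map_smul, ← map_add, ← map_add, ← map_add, ← map_add]
  refine congrArg (fun z => ξ ((κ.hullCoord m).symm z)) (Prod.ext (Prod.ext ?_ ?_) ?_) <;> simp

theorem sideSndLin_comp (q : (K →L[ℝ] ℝ) × ℝ) (l : ℝ) : ∃ ξ : Module.Dual ℝ (Hull V A m),
    κ.sideSndLin m ξ = q ∧ ξ ((κ.hullCoord m).symm ((0, 0), 1)) = l := by
  refine ⟨(((q.1.toLinearMap ∘ₗ LinearMap.fst ℝ K ℝ + q.2 • LinearMap.snd ℝ K ℝ) ∘ₗ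
    LinearMap.fst ℝ (K × ℝ) ℝ) + l • LinearMap.snd ℝ (K × ℝ) ℝ) ∘ₗ
      (κ.hullCoord m).toLinearMap, ?_, ?_⟩
  · refine Prod.ext (ContinuousLinearMap.ext fun k => ?_) ?_
    · rw [sideSndLin_fst]; simp
    · rw [sideSndLin_snd]; simp
  · simp

/-- α_A is the last fibre coordinate, and `sideSndLin` drops exactly the coefficient along it. -/
theorem ker_sideSndLin :
    Submodule.span ℝ {Hull.alpha V A m} = LinearMap.ker (κ.sideSndLin m) := by
  ext ξ
  rw [Submodule.mem_span_singleton, LinearMap.mem_ker]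
  constructor
  · rintro ⟨t, rfl⟩
    refine Prod.ext (ContinuousLinearMap.ext fun k => ?_) ?_
    · rw [sideSndLin_fst, LinearMap.smul_apply, κ.alpha_eq]; simp
    · rw [sideSndLin_snd, LinearMap.smul_apply, κ.alpha_eq]; simp
  · intro h
    refine ⟨ξ ((κ.hullCoord m).symm ((0, 0), 1)), LinearMap.ext fun w => ?_⟩
    have e := κ.dual_apply ξ (κ.hullCoord m w)
    rw [LinearEquiv.symm_apply_apply, h] at e
    rw [e, LinearMap.smul_apply, κ.alpha_eq]
    simp [mul_comm]

variable (m) in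
/-- The adapted coordinates on `E* / ⟨α⟩`. -/
def sideSnd : DualQuot V A m ≃ₗ[ℝ] (K →L[ℝ] ℝ) × ℝ :=
  (Submodule.quotEquivOfEq _ _ κ.ker_sideSndLin).trans
    ((κ.sideSndLin m).quotKerEquivOfSurjective fun q =>
      ⟨_, (κ.sideSndLin_comp q 0).choose_spec.1⟩)

theorem sideSnd_mk (ξ : Module.Dual ℝ (Hull V A m)) :
    κ.sideSnd m (Submodule.Quotient.mk ξ) = κ.sideSndLin m ξ := rfl

/-- The second component is the value on v_A, which is 1 for a special function. The special affine
functions modulo constants are thereby placed in the hyperplane of weight 1. -/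
theorem sideSnd_extend (hm : m ∈ κ.dom) (f : SpecialDual A v m) :
    κ.sideSnd m (Submodule.Quotient.mk (Hull.extend f.1)) = (κ.dualCoord f, 1) := by
  rw [sideSnd_mk]
  refine Prod.ext (ContinuousLinearMap.ext fun k => ?_) ?_
  · rw [sideSndLin_fst, κ.extend_eq, LinearEquiv.apply_symm_apply, dualCoord_apply]
    simp
    rfl
  · rw [sideSndLin_snd, κ.extend_eq, LinearEquiv.apply_symm_apply, zero_mul, add_zero]
    have e : (κ.triv m).symm (0, 1) = (1 : ℝ) • v m +ᵥ (κ.triv m).symm 0 := by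
      apply (κ.triv m).injective
      rw [κ.triv_vadd hm]
      simp
    change f.1 ((κ.triv m).symm (0, 1)) - _ = 1
    rw [e, AffineMap.map_vadd, map_smul, f.2]
    simp

end

variable [FiniteDimensional ℝ F] [SmoothAffineBundle F V A B]

section
variable (hm : m ∈ κ.dom)
include hm

/-- A covector modulo the action is projected to `E / ⟨v⟩`. -/
def orbitPr₁ : OrbitSpace F A B v m → HullQuot V A v m :=
  Quot.lift (fun x => Submodule.Quotient.mk x.1) (by
    rintro x _ ⟨s, t, rfl⟩
    apply (κ.sideFst hm).injective
    rw [sideFst_mk, sideFst_mk, κ.hullCoord_orbitAction hm]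
    simp)

@[simp] theorem orbitPr₁_orbit (w : Hull V A m) (η : HullTangent F V A B m w →L[ℝ] ℝ) :
    κ.orbitPr₁ hm (orbit F A B v m w η) = Submodule.Quotient.mk w := rfl

/-- The core coordinate of a covector modulo the action. -/
def orbitCore : OrbitSpace F A B v m → B →L[ℝ] ℝ :=
  Quot.lift (fun x => (κ.covCoord m x.1 x.2).comp (ContinuousLinearMap.inl ℝ B ((K × ℝ) × ℝ))) (by
    rintro x _ ⟨s, t, rfl⟩
    rw [κ.covCoord_orbitAction hm]
    ext u
    simp)

@[simp] theorem orbitCore_orbit (w : Hull V A m) (η : HullTangent F V A B m w →L[ℝ] ℝ) :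
    κ.orbitCore hm (orbit F A B v m w η) =
      (κ.covCoord m w η).comp (ContinuousLinearMap.inl ℝ B ((K × ℝ) × ℝ)) := rfl

end

variable [FiniteDimensional ℝ K]

section
variable (hm : m ∈ κ.dom) (hm' : m ∈ κ'.dom)
include hm

/-- A covector modulo the action is projected to `E* / ⟨α⟩`. -/
def orbitPr₂ : OrbitSpace F A B v m → DualQuot V A m :=
  Quot.lift (fun x => Submodule.Quotient.mk (vert F V B m x.1 x.2)) (by
    rintro x _ ⟨s, t, rfl⟩
    apply (κ.sideSnd m).injective
    rw [sideSnd_mk, sideSnd_mk]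
    refine Prod.ext (ContinuousLinearMap.ext fun k => ?_) ?_
    · rw [sideSndLin_fst, sideSndLin_fst, κ.vert_eq hm, κ.vert_eq hm, κ.covCoord_orbitAction hm]
      simp
    · rw [sideSndLin_snd, sideSndLin_snd, κ.vert_eq hm, κ.vert_eq hm, κ.covCoord_orbitAction hm]
      simp)

@[simp] theorem orbitPr₂_orbit (w : Hull V A m) (η : HullTangent F V A B m w →L[ℝ] ℝ) :
    κ.orbitPr₂ hm (orbit F A B v m w η) = Submodule.Quotient.mk (vert F V B m w η) := rfl

theorem covCoord_apply (w : Hull V A m) (η : HullTangent F V A B m w →L[ℝ] ℝ) (u : B)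
    (z : (K × ℝ) × ℝ) : κ.covCoord m w η (u, z) =
      κ.covCoord m w η (u, 0) + vert F V B m w η ((κ.hullCoord m).symm z) := by
  rw [κ.vert_eq hm, LinearEquiv.apply_symm_apply, ← map_add]
  simp

/-- Equality on the two sides gives s with w' = w + s v and t with vert η' = vert η + t α. As the
base components agree as well, the single group element (s, t) carries one representative to the
other. -/
theorem orbit_ext {d d' : OrbitSpace F A B v m} (h₁ : κ.orbitPr₁ hm d = κ.orbitPr₁ hm d')
    (h₂ : κ.orbitPr₂ hm d = κ.orbitPr₂ hm d') (h₃ : κ.orbitCore hm d = κ.orbitCore hm d') :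
    d = d' := by
  obtain ⟨⟨w, η⟩, rfl⟩ := Quot.exists_rep d
  obtain ⟨⟨w', η'⟩, rfl⟩ := Quot.exists_rep d'
  apply Quot.sound
  have h₁ : (Submodule.Quotient.mk w' : HullQuot V A v m) = Submodule.Quotient.mk w := h₁.symm
  have h₂ : (Submodule.Quotient.mk (vert F V B m w' η') : DualQuot V A m) =
    Submodule.Quotient.mk (vert F V B m w η) := h₂.symm
  rw [Submodule.Quotient.eq, Submodule.mem_span_singleton] at h₁ h₂
  obtain ⟨s, hs⟩ := h₁
  obtain ⟨t, ht⟩ := h₂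
  refine ⟨s, t, ?_⟩
  obtain rfl : w' = w + s • Hull.ofVec (v m) := by rw [hs]; abel
  refine congrArg (Sigma.mk _) ?_
  refine (κ.covOf_covCoord hm _ η').symm.trans ((congrArg (κ.covOf m _) ?_).trans
    (κ.covOf_covCoord hm _ (orbitAction F A B v m s t ⟨w, η⟩).2))
  refine Eq.trans (ContinuousLinearMap.ext fun z => ?_)
    (κ.covCoord_orbitAction hm s t ⟨w, η⟩).symm
  obtain ⟨u, z⟩ := z
  have e : vert F V B m (w + s • Hull.ofVec (v m)) η' = vert F V B m w η + t • Hull.alpha V A m := by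
    rw [ht]; abel
  have e₃ : κ.covCoord m w η (u, 0) = κ.covCoord m (w + s • Hull.ofVec (v m)) η' (u, 0) :=
    congrArg (fun L : B →L[ℝ] ℝ => L u) h₃
  rw [κ.covCoord_apply hm, e, LinearMap.add_apply, LinearMap.smul_apply, κ.alpha_eq,
    LinearEquiv.apply_symm_apply, ← e₃, ← add_assoc]
  exact congrArg (· + t • z.2) (κ.covCoord_apply hm w η u z).symm

/-- The components of a covector with given coordinates. -/
def covRep (b : (K →L[ℝ] ℝ) × ℝ) (c : B →L[ℝ] ℝ) : B × ((K × ℝ) × ℝ) →L[ℝ] ℝ :=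
  c.coprod ((b.1.coprod (b.2 • ContinuousLinearMap.id ℝ ℝ)).coprod 0)

omit hm in
theorem covRep_apply (b : (K →L[ℝ] ℝ) × ℝ) (c : B →L[ℝ] ℝ) (z : B × ((K × ℝ) × ℝ)) :
    covRep b c z = c z.1 + (b.1 z.2.1.1 + b.2 * z.2.1.2) := by
  simp [covRep]

omit hm in
variable (m) in
/-- The orbit with given coordinates. -/
def orbitMk (a : K × ℝ) (b : (K →L[ℝ] ℝ) × ℝ) (c : B →L[ℝ] ℝ) : OrbitSpace F A B v m :=
  orbit F A B v m ((κ.hullCoord m).symm ((a.1, 0), a.2)) (κ.covOf m _ (covRep b c))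

theorem vert_covOf (w : Hull V A m) (b : (K →L[ℝ] ℝ) × ℝ) (c : B →L[ℝ] ℝ) (z : (K × ℝ) × ℝ) :
    vert F V B m w (κ.covOf m w (covRep b c)) ((κ.hullCoord m).symm z) =
      b.1 z.1.1 + b.2 * z.1.2 := by
  rw [κ.vert_eq hm, κ.covCoord_covOf hm, covRep_apply, LinearEquiv.apply_symm_apply, map_zero,
    zero_add]

theorem sideFst_orbitMk (a : K × ℝ) (b : (K →L[ℝ] ℝ) × ℝ) (c : B →L[ℝ] ℝ) :
    κ.sideFst hm (κ.orbitPr₁ hm (κ.orbitMk m a b c)) = a := κ.sideFstLin_symm a 0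

theorem sideSnd_orbitMk (a : K × ℝ) (b : (K →L[ℝ] ℝ) × ℝ) (c : B →L[ℝ] ℝ) :
    κ.sideSnd m (κ.orbitPr₂ hm (κ.orbitMk m a b c)) = b := by
  rw [orbitMk, orbitPr₂_orbit, sideSnd_mk]
  refine Prod.ext (ContinuousLinearMap.ext fun k => ?_) ?_
  · rw [sideSndLin_fst, κ.vert_covOf hm]; simp
  · rw [sideSndLin_snd, κ.vert_covOf hm]; simp

theorem orbitCore_orbitMk (a : K × ℝ) (b : (K →L[ℝ] ℝ) × ℝ) (c : B →L[ℝ] ℝ) :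
    κ.orbitCore hm (κ.orbitMk m a b c) = c := by
  rw [orbitMk, orbitCore_orbit, κ.covCoord_covOf hm]
  ext u
  simp [covRep_apply]

theorem orbitMk_coord (d : OrbitSpace F A B v m) :
    κ.orbitMk m (κ.sideFst hm (κ.orbitPr₁ hm d)) (κ.sideSnd m (κ.orbitPr₂ hm d))
      (κ.orbitCore hm d) = d := by
  refine κ.orbit_ext hm ((κ.sideFst hm).injective ?_) ((κ.sideSnd m).injective ?_) ?_
  · rw [sideFst_orbitMk]
  · rw [sideSnd_orbitMk]
  · rw [orbitCore_orbitMk]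

theorem orbitCore_cotAdd {w w' : Hull V A m} {η : HullTangent F V A B m w →L[ℝ] ℝ}
    {η' : HullTangent F V A B m w' →L[ℝ] ℝ} (h : vert F V B m w η = vert F V B m w' η') :
    κ.orbitCore hm (orbit F A B v m (w + w') (cotAdd F V B m w w' η η')) =
      κ.orbitCore hm (orbit F A B v m w η) + κ.orbitCore hm (orbit F A B v m w' η') :=
  ContinuousLinearMap.ext fun u => κ.covCoord_cotAdd hm h u

theorem orbitCore_cotSmul (t : ℝ) (w : Hull V A m) (η : HullTangent F V A B m w →L[ℝ] ℝ) :
    κ.orbitCore hm (orbit F A B v m (t • w) (cotSmul F V B m t w η)) =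
      t • κ.orbitCore hm (orbit F A B v m w η) :=
  ContinuousLinearMap.ext fun u => κ.covCoord_cotSmul hm t w η u

/-- Adding over E* by `cotAdd` needs representatives with equal vertical parts. Expressing sums of
coordinates through such representatives makes them computable in a second chart. -/
theorem orbitMk_add_left (a a' : K × ℝ) (b : (K →L[ℝ] ℝ) × ℝ) (c c' : B →L[ℝ] ℝ) :
    ∃ (w w' : Hull V A m) (η : HullTangent F V A B m w →L[ℝ] ℝ)
      (η' : HullTangent F V A B m w' →L[ℝ] ℝ), vert F V B m w η = vert F V B m w' η' ∧
      κ.orbitMk m a b c = orbit F A B v m w η ∧ κ.orbitMk m a' b c' = orbit F A B v m w' η' ∧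
      κ.orbitMk m (a + a') b (c + c') =
        orbit F A B v m (w + w') (cotAdd F V B m w w' η η') := by
  have h : vert F V B m ((κ.hullCoord m).symm ((a.1, 0), a.2)) (κ.covOf m _ (covRep b c)) =
      vert F V B m ((κ.hullCoord m).symm ((a'.1, 0), a'.2)) (κ.covOf m _ (covRep b c')) := by
    refine LinearMap.ext fun u => ?_
    rw [← (κ.hullCoord m).symm_apply_apply u, κ.vert_covOf hm, κ.vert_covOf hm]
  refine ⟨_, _, κ.covOf m _ (covRep b c), κ.covOf m _ (covRep b c'), h, rfl, rfl, ?_⟩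
  refine κ.orbit_ext hm ((κ.sideFst hm).injective ?_) ((κ.sideSnd m).injective ?_) ?_
  · rw [sideFst_orbitMk, orbitPr₁_orbit, sideFst_mk, map_add, LinearEquiv.apply_symm_apply,
      LinearEquiv.apply_symm_apply]; rfl
  · rw [sideSnd_orbitMk, orbitPr₂_orbit, cotAdd, vert_covec]
    exact (κ.sideSnd_orbitMk hm a b c).symm
  · rw [orbitCore_orbitMk, κ.orbitCore_cotAdd hm h]
    exact (congrArg₂ (· + ·) (κ.orbitCore_orbitMk hm a b c) (κ.orbitCore_orbitMk hm a' b c')).symm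

theorem orbitMk_smul_left (t : ℝ) (a : K × ℝ) (b : (K →L[ℝ] ℝ) × ℝ) (c : B →L[ℝ] ℝ) :
    ∃ (w : Hull V A m) (η : HullTangent F V A B m w →L[ℝ] ℝ),
      κ.orbitMk m a b c = orbit F A B v m w η ∧
      κ.orbitMk m (t • a) b (t • c) = orbit F A B v m (t • w) (cotSmul F V B m t w η) := by
  refine ⟨_, κ.covOf m _ (covRep b c), rfl, ?_⟩
  refine κ.orbit_ext hm ((κ.sideFst hm).injective ?_) ((κ.sideSnd m).injective ?_) ?_
  · rw [sideFst_orbitMk, orbitPr₁_orbit, sideFst_mk, map_smul, LinearEquiv.apply_symm_apply]; rfl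
  · rw [sideSnd_orbitMk, orbitPr₂_orbit, cotSmul, vert_covec]
    exact (κ.sideSnd_orbitMk hm a b c).symm
  · rw [orbitCore_orbitMk, κ.orbitCore_cotSmul hm]
    exact (congrArg (t • ·) (κ.orbitCore_orbitMk hm a b c)).symm

include hm' in
/-- The change of the core coordinate is linear in each of the two directions. -/
theorem isDoubleLinear_orbitCore :
    IsDoubleLinear fun a b c => κ'.orbitCore hm' (κ.orbitMk m a b c) where
  left b := by
    constructor
    · intro p q
      obtain ⟨w, w', η, η', h, h₁, h₂, h₃⟩ := κ.orbitMk_add_left hm p.1 q.1 b p.2 q.2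
      change κ'.orbitCore hm' (κ.orbitMk m (p.1 + q.1) b (p.2 + q.2)) = _
      rw [h₃, κ'.orbitCore_cotAdd hm' h, h₁, h₂]
    · intro t p
      obtain ⟨w, η, h₁, h₂⟩ := κ.orbitMk_smul_left hm t p.1 b p.2
      change κ'.orbitCore hm' (κ.orbitMk m (t • p.1) b (t • p.2)) = _
      rw [h₂, κ'.orbitCore_cotSmul hm', h₁]
  right a := by
    have h₁ : ∀ (b b' : (K →L[ℝ] ℝ) × ℝ) (c c' : B →L[ℝ] ℝ),
        covRep (b + b') (c + c') = covRep b c + covRep b' c' := by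
      intro b b' c c'
      refine ContinuousLinearMap.ext fun z => ?_
      rw [add_apply, covRep_apply, covRep_apply, covRep_apply]
      simp only [Prod.fst_add, Prod.snd_add, add_apply]
      ring
    have h₂ : ∀ (t : ℝ) (b : (K →L[ℝ] ℝ) × ℝ) (c : B →L[ℝ] ℝ),
        covRep (t • b) (t • c) = t • covRep b c := by
      intro t b c
      refine ContinuousLinearMap.ext fun z => ?_
      rw [smul_apply, covRep_apply, covRep_apply]
      simp only [Prod.smul_fst, Prod.smul_snd, smul_apply, smul_eq_mul]
      ring
    constructor
    · intro p q
      change κ'.orbitCore hm' (κ.orbitMk m a (p.1 + q.1) (p.2 + q.2)) = _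
      rw [orbitMk, h₁]; rfl
    · intro t p
      change κ'.orbitCore hm' (κ.orbitMk m a (t • p.1) (t • p.2)) = _
      rw [orbitMk, h₂]; rfl

end

end AdaptedChart

end Orbits

/-! ### Restriction of covectors to A and the differentials of f_σ -/

section Restriction

variable {F : Type*} [NormedAddCommGroup F] [NormedSpace ℝ F] {M : Type*} [TopologicalSpace M]
  {V : M → Type*} [∀ m, AddCommGroup (V m)] [∀ m, Module ℝ (V m)]
  {A : M → Type*} [∀ m, AddTorsor (V m) (A m)]
  [∀ m, TopologicalSpace (A m)] [TopologicalSpace (TotalSpace F A)] [FiberBundle F A]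
  {B : Type*} [NormedAddCommGroup B] [NormedSpace ℝ B] [ChartedSpace B M] {v : ∀ m, V m}
  {K : Type*} [NormedAddCommGroup K] [NormedSpace ℝ K]

namespace AdaptedChart

variable (κ κ' : AdaptedChart F A B v K) {m : M}

/-- The differential of the adapted coordinates on `A`. -/
def dAff (m : M) (a : A m) : B × F →L[ℝ] B × (K × ℝ) :=
  mfderiv (𝓘(ℝ, B).prod 𝓘(ℝ, F)) 𝓘(ℝ, B × (K × ℝ)) κ.coords ⟨m, a⟩

/-- The differential of the inclusion of `A` in the hull, in adapted coordinates. -/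
def affInl : B × (K × ℝ) →L[ℝ] B × ((K × ℝ) × ℝ) :=
  (ContinuousLinearMap.id ℝ B).prodMap (ContinuousLinearMap.inl ℝ (K × ℝ) ℝ)

section
variable (hm : m ∈ κ.dom)
include hm

theorem hasMFDerivAt_coords (a : A m) :
    HasMFDerivAt (𝓘(ℝ, B).prod 𝓘(ℝ, F)) 𝓘(ℝ, B × (K × ℝ)) κ.coords ⟨m, a⟩ (κ.dAff m a) :=
  ((κ.contMDiffAt_coords (x := ⟨m, a⟩) hm).mdifferentiableAt (by simp)).hasMFDerivAt

theorem exists_dAff (a : A m) (z : B × (K × ℝ)) : ∃ X, κ.dAff m a X = z := by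
  have hp : (κ.base m, κ.triv m a).1 ∈ κ.region := κ.base_mem_region hm
  have h := (κ.hasMFDerivAt_coords hm a).congr_point (y := κ.param (κ.base m, κ.triv m a))
    (κ.param_coords (x := ⟨m, a⟩) hm).symm
  have h₁ := h.comp (κ.base m, κ.triv m a)
    ((κ.contMDiffAt_param hp).mdifferentiableAt (by simp)).hasMFDerivAt
  have h₂ := (hasMFDerivAt_id (I := 𝓘(ℝ, B × (K × ℝ)))
    (κ.base m, κ.triv m a)).congr_of_eventuallyEq (f₁ := κ.coords ∘ κ.param) (by
      filter_upwards [(κ.isOpen_region.preimage continuous_fst).mem_nhds hp] with p hp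
      exact κ.coords_param hp)
  exact ⟨_, congrArg (fun L : B × (K × ℝ) →L[ℝ] B × (K × ℝ) => L z) (hasMFDerivAt_unique h₁ h₂)⟩

/-- In adapted coordinates f_σ is r plus its local representative in (x, k); the jet supplies the
derivatives along (x, k), and the derivative along r is 1. -/
theorem mfderiv_fn (σ : AVSection F A B v) (a : A m) :
    mfderiv (𝓘(ℝ, B).prod 𝓘(ℝ, F)) 𝓘(ℝ, ℝ) σ.fn ⟨m, a⟩ =
      (jetExtend (κ.jet hm (σ.affDiff m (AffQuot.mk v a)))).comp (κ.dAff m a) := by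
  have hp := κ.base_mem_region hm
  have hd : HasFDerivAt (κ.localRep σ) (κ.jet hm (σ.affDiff m (AffQuot.mk v a)))
      (κ.base m, (κ.triv m a).1) :=
    (κ.differentiableAt_localRep σ (p := (κ.base m, (κ.triv m a).1)) hp).hasFDerivAt
  let L := (ContinuousLinearMap.fst ℝ B (K × ℝ)).prod
      ((ContinuousLinearMap.fst ℝ K ℝ).comp (ContinuousLinearMap.snd ℝ B (K × ℝ)))
  let L' := (ContinuousLinearMap.snd ℝ K ℝ).comp (ContinuousLinearMap.snd ℝ B (K × ℝ))
  have h₁ : HasFDerivAt (fun p : B × (K × ℝ) => κ.localRep σ (L p) + L' p)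
      (jetExtend (κ.jet hm (σ.affDiff m (AffQuot.mk v a)))) (κ.coords ⟨m, a⟩) := by
    have h₀ : HasFDerivAt (fun p : B × (K × ℝ) => κ.localRep σ (L p))
      ((κ.jet hm (σ.affDiff m (AffQuot.mk v a))).comp L) (κ.coords ⟨m, a⟩) :=
      HasFDerivAt.comp (f := L) (κ.coords ⟨m, a⟩) hd L.hasFDerivAt
    exact h₀.add L'.hasFDerivAt
  refine ((h₁.hasMFDerivAt.comp (⟨m, a⟩ : TotalSpace F A)
    (κ.hasMFDerivAt_coords hm a)).congr_of_eventuallyEq ?_).mfderiv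
  filter_upwards [κ.preimage_dom_mem_nhds (x := ⟨m, a⟩) hm] with y hy
  exact (κ.fn_eq_localRep σ hy y.2).trans (add_comm _ _)

end

variable [FiniteDimensional ℝ F] [SmoothAffineBundle F V A B]

section
variable (hm : m ∈ κ.dom)
include hm

/-- In adapted coordinates the inclusion of A is the affine map that appends the weight 1. -/
theorem mfderiv_of (a : A m) : mfderiv (𝓘(ℝ, B).prod 𝓘(ℝ, F)) (hullModel F B)
      (fun x : TotalSpace F A => (⟨x.1, Hull.of V x.2⟩ : HullTotal F V A)) ⟨m, a⟩ =
    (κ.dParam m (Hull.of V a)).comp (affInl.comp (κ.dAff m a)) := by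
  have h₀ : HasFDerivAt (fun p : B × (K × ℝ) => affInl p + (0, (0, 1))) affInl
      (κ.coords ⟨m, a⟩) := (affInl (B := B) (K := K)).hasFDerivAt.add_const _
  have e : ∀ y : TotalSpace F A, affInl (κ.coords y) + (0, (0, 1)) =
      κ.hullCoords F (⟨y.1, Hull.of V y.2⟩ : HullTotal F V A) := by
    intro y
    refine Prod.ext (add_zero _) ?_
    change ((κ.triv y.1 y.2, (0 : ℝ)) : (K × ℝ) × ℝ) + (0, 1) = κ.hullCoord y.1 (Hull.of V y.2)
    rw [κ.hullCoord_of]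
    simp
  have h₁ := (κ.hasMFDerivAt_hullParam hm (Hull.of V a)).congr_point (e ⟨m, a⟩).symm
  have h₂ := h₁.comp (⟨m, a⟩ : TotalSpace F A)
    (h₀.hasMFDerivAt.comp (⟨m, a⟩ : TotalSpace F A) (κ.hasMFDerivAt_coords hm a))
  refine (h₂.congr_of_eventuallyEq ?_).mfderiv
  filter_upwards [κ.preimage_dom_mem_nhds (x := ⟨m, a⟩) hm] with y hy
  refine Eq.trans ?_ (congrArg κ.hullParam (e y)).symm
  exact (κ.hullParam_hullCoords (x := ⟨y.1, Hull.of V y.2⟩) hy).symm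

/-- A covector at a point of `A` restricts to `d f_σ` if and only if its components are those of
the affine differential of `σ`. -/
theorem restrict_iff (a : A m) (η : HullTangent F V A B m (Hull.of V a) →L[ℝ] ℝ)
    (σ : AVSection F A B v) :
    η.comp (mfderiv (𝓘(ℝ, B).prod 𝓘(ℝ, F)) (hullModel F B)
      (fun x : TotalSpace F A => (⟨x.1, Hull.of V x.2⟩ : HullTotal F V A)) ⟨m, a⟩) =
      mfderiv (𝓘(ℝ, B).prod 𝓘(ℝ, F)) 𝓘(ℝ, ℝ) σ.fn ⟨m, a⟩ ↔
    (κ.covCoord m (Hull.of V a) η).comp affInl =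
      jetExtend (κ.jet hm (σ.affDiff m (AffQuot.mk v a))) := by
  rw [κ.mfderiv_of hm, κ.mfderiv_fn hm]
  constructor
  · intro h
    refine ContinuousLinearMap.ext fun z => ?_
    obtain ⟨X, rfl⟩ := κ.exists_dAff hm a z
    exact congrArg (fun L : B × F →L[ℝ] ℝ => L X) h
  · intro h
    exact ContinuousLinearMap.ext fun X =>
      congrArg (fun L : B × (K × ℝ) →L[ℝ] ℝ => L (κ.dAff m a X)) h

variable [FiniteDimensional ℝ K]

/-- Restriction to A leaves the component along dα_A undetermined, and the action removes it. The
first side has weight 1 because a lies in A, the second because f_σ has derivative 1 along v_A. -/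
theorem orbit_of_restrict {a : A m} {η : HullTangent F V A B m (Hull.of V a) →L[ℝ] ℝ}
    {σ : AVSection F A B v} (h : (κ.covCoord m (Hull.of V a) η).comp affInl =
      jetExtend (κ.jet hm (σ.affDiff m (AffQuot.mk v a)))) :
    orbit F A B v m (Hull.of V a) η = κ.orbitMk m ((κ.triv m a).1, 1)
      ((κ.jet hm (σ.affDiff m (AffQuot.mk v a))).comp (ContinuousLinearMap.inr ℝ B K), 1)
      ((κ.jet hm (σ.affDiff m (AffQuot.mk v a))).comp (ContinuousLinearMap.inl ℝ B K)) := by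
  have h' : ∀ u k r, κ.covCoord m (Hull.of V a) η (u, ((k, r), 0)) =
      κ.jet hm (σ.affDiff m (AffQuot.mk v a)) (u, 0) +
        κ.jet hm (σ.affDiff m (AffQuot.mk v a)) (0, k) + r := fun u k r =>
    (congrArg (fun L : B × (K × ℝ) →L[ℝ] ℝ => L (u, (k, r))) h).trans (jetExtend_apply _ _)
  refine κ.orbit_ext hm ((κ.sideFst hm).injective ?_) ((κ.sideSnd m).injective ?_) ?_
  · rw [sideFst_orbitMk, orbitPr₁_orbit, sideFst_mk, κ.hullCoord_of]
  · rw [sideSnd_orbitMk, orbitPr₂_orbit, sideSnd_mk]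
    refine Prod.ext (ContinuousLinearMap.ext fun k => ?_) ?_
    · rw [sideSndLin_fst, κ.vert_eq hm, LinearEquiv.apply_symm_apply, h' 0 k 0]
      simp
      exact map_zero _
    · rw [sideSndLin_snd, κ.vert_eq hm, LinearEquiv.apply_symm_apply, h' 0 0 1]
      simp
      exact map_zero _
  · rw [orbitCore_orbitMk, orbitCore_orbit]
    refine ContinuousLinearMap.ext fun u => (h' u 0 0).trans ?_
    simp
    exact map_zero _

/-- The component along dα_A is free; `covRep` sets it to 0. -/
theorem exists_restrict (a : A m) (σ : AVSection F A B v) :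
    ∃ η : HullTangent F V A B m (Hull.of V a) →L[ℝ] ℝ,
      (κ.covCoord m (Hull.of V a) η).comp affInl =
        jetExtend (κ.jet hm (σ.affDiff m (AffQuot.mk v a))) := by
  refine ⟨κ.covOf m _ (covRep ((κ.jet hm (σ.affDiff m (AffQuot.mk v a))).comp
    (ContinuousLinearMap.inr ℝ B K), 1) ((κ.jet hm (σ.affDiff m (AffQuot.mk v a))).comp
      (ContinuousLinearMap.inl ℝ B K))), ?_⟩
  rw [κ.covCoord_covOf hm]
  refine ContinuousLinearMap.ext fun z => ?_
  rw [jetExtend_apply]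
  refine (covRep_apply _ _ _).trans ?_
  simp [affInl]
  ring

end

end AdaptedChart

end Restriction

/-! ### Comparison of the orbit space with the double vector hull -/

section Comparison

variable {F : Type*} [NormedAddCommGroup F] [NormedSpace ℝ F] {M : Type*} [TopologicalSpace M]
  {V : M → Type*} [∀ m, AddCommGroup (V m)] [∀ m, Module ℝ (V m)]
  {A : M → Type*} [∀ m, AddTorsor (V m) (A m)]
  [∀ m, TopologicalSpace (A m)] [TopologicalSpace (TotalSpace F A)] [FiberBundle F A]
  {B : Type*} [NormedAddCommGroup B] [NormedSpace ℝ B] [ChartedSpace B M] {v : ∀ m, V m}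
  {K : Type*} [NormedAddCommGroup K] [NormedSpace ℝ K]
  [FiniteDimensional ℝ B] [IsManifold 𝓘(ℝ, B) ∞ M] [T2Space M] [SecondCountableTopology M]
  [FiniteDimensional ℝ K] (hκ : ∀ m, ∃ κ : AdaptedChart F A B v K, m ∈ κ.dom)

namespace AdaptedChart

variable {κ κ' : AdaptedChart F A B v K}
  {χ χ' : DoubleChart K (K →L[ℝ] ℝ) (B →L[ℝ] ℝ) (Phase F A B v) (AffQuot A v)
    (SpecialDualQuot A v)} (h : κ.Induces χ) (h' : κ'.Induces χ')

include h in
theorem Induces.mem_charts : χ ∈ (phaseBundle hκ).charts := ⟨κ, h⟩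

variable {m : M}

include h in
theorem Induces.mem_dom (hm : m ∈ κ.dom) : m ∈ χ.dom := by rwa [h.1]

section
variable (hm : m ∈ κ.dom) (hm' : m ∈ κ'.dom)

/-- The point of the double hull determined by a point of the affine phase bundle. -/
theorem ofPoint_eq_dblMk (η : Phase F A B v m) : (phaseBundle hκ).ofPoint m η =
    (phaseBundle hκ).dblMk (h.mem_charts hκ) (h.mem_dom hm) (κ.quotFst hm η.1, 1)
      ((κ.jet hm η).comp (ContinuousLinearMap.inr ℝ B K), 1)
      ((κ.jet hm η).comp (ContinuousLinearMap.inl ℝ B K)) := by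
  rw [← (phaseBundle hκ).dblMk_one_one (h.mem_charts hκ) (h.mem_dom hm) η, h.fst_eq hm,
    h.snd_eq hm, h.core_eq hm]
  refine congrArg (fun q => (phaseBundle hκ).dblMk (h.mem_charts hκ) (h.mem_dom hm)
    (κ.quotFst hm η.1, 1) (q, 1) _) ?_
  exact quotSnd_phasePr₂ hκ κ hm η

/-- The canonical map of the side bundles `E / ⟨v⟩`, in adapted coordinates. -/
def sideEquiv₁ : HullQuot V A v m ≃ₗ[ℝ] (phaseBundle hκ).Hull₁ m :=
  (κ.sideFst hm).trans ((phaseBundle hκ).hullFst (h.mem_charts hκ) (h.mem_dom hm)).symm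

/-- The canonical map of the side bundles `E* / ⟨α⟩`, in adapted coordinates. -/
def sideEquiv₂ : DualQuot V A m ≃ₗ[ℝ] (phaseBundle hκ).Hull₂ m :=
  (κ.sideSnd m).trans ((phaseBundle hκ).hullSnd (h.mem_charts hκ) (h.mem_dom hm)).symm

theorem sideEquiv₁_of (a : A m) : sideEquiv₁ hκ h hm (Submodule.Quotient.mk (Hull.of V a)) =
    VectorHull.of _ (AffQuot.mk v a) := by
  rw [sideEquiv₁, LinearEquiv.trans_apply, LinearEquiv.symm_apply_eq, κ.sideFst_mk,
    κ.hullCoord_of]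
  refine Eq.trans ?_ ((phaseBundle hκ).hullFst_of (h.mem_charts hκ) (h.mem_dom hm) _).symm
  rw [h.fst_eq hm]; rfl

theorem sideEquiv₂_extend (f : SpecialDual A v m) :
    sideEquiv₂ hκ h hm (Submodule.Quotient.mk (Hull.extend f.1)) =
    VectorHull.of _ (SpecialDualQuot.mk f) := by
  rw [sideEquiv₂, LinearEquiv.trans_apply, LinearEquiv.symm_apply_eq, κ.sideSnd_extend hm]
  refine Eq.trans ?_ ((phaseBundle hκ).hullSnd_of (h.mem_charts hκ) (h.mem_dom hm) _).symm
  rw [h.snd_eq hm]; rfl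

omit [FiniteDimensional ℝ B] [IsManifold 𝓘(ℝ, B) ∞ M] [T2Space M] [SecondCountableTopology M]
  [FiniteDimensional ℝ K] in
theorem hullQuot_hom_ext {W : Type*} [AddCommGroup W] [Module ℝ W] {f g : HullQuot V A v m →ₗ[ℝ] W}
    (h : ∀ a : A m, f (Submodule.Quotient.mk (Hull.of V a)) =
      g (Submodule.Quotient.mk (Hull.of V a))) : f = g :=
  Submodule.linearMap_qext _ (VectorHull.hom_ext h)

omit [FiniteDimensional ℝ B] [IsManifold 𝓘(ℝ, B) ∞ M] [T2Space M] [SecondCountableTopology M] in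
-- The classes of special affine functions fill the hyperplane of weight 1 in E* / ⟨α_A⟩, and this
-- hyperplane spans.
theorem dualQuot_hom_ext {κ : AdaptedChart F A B v K} (hm : m ∈ κ.dom) {W : Type*}
    [AddCommGroup W] [Module ℝ W] {f g : DualQuot V A m →ₗ[ℝ] W}
    (h : ∀ φ : SpecialDual A v m, f (Submodule.Quotient.mk (Hull.extend φ.1)) =
      g (Submodule.Quotient.mk (Hull.extend φ.1))) : f = g := by
  have key : f ∘ₗ (κ.sideSnd m).symm.toLinearMap = g ∘ₗ (κ.sideSnd m).symm.toLinearMap := by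
    have h₁ : ∀ q : K →L[ℝ] ℝ, f ((κ.sideSnd m).symm (q, 1)) = g ((κ.sideSnd m).symm (q, 1)) := by
      intro q
      obtain ⟨φ, rfl⟩ := κ.exists_special hm q
      rw [← κ.sideSnd_extend hm, LinearEquiv.symm_apply_apply, h]
    refine LinearMap.ext fun q => ?_
    have e : q = (q.1, 1) + (q.2 - 1) • ((0 : K →L[ℝ] ℝ), (1 : ℝ)) := by ext <;> simp
    change f ((κ.sideSnd m).symm q) = g ((κ.sideSnd m).symm q)
    rw [e]
    simp only [map_add, map_smul, h₁]
  refine LinearMap.ext fun x => ?_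
  have := congrArg (fun L => L (κ.sideSnd m x)) key
  simpa using this

/-- Both maps have the same prescribed values on the classes of points of A, which span; so the
construction does not depend on the chart. -/
theorem sideEquiv₁_eq : sideEquiv₁ hκ h hm = sideEquiv₁ hκ h' hm' :=
  LinearEquiv.toLinearMap_injective (hullQuot_hom_ext fun a =>
    (sideEquiv₁_of hκ h hm a).trans (sideEquiv₁_of hκ h' hm' a).symm)

theorem sideEquiv₂_eq : sideEquiv₂ hκ h hm = sideEquiv₂ hκ h' hm' :=
  LinearEquiv.toLinearMap_injective (dualQuot_hom_ext hm fun a =>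
    (sideEquiv₂_extend hκ h hm a).trans (sideEquiv₂_extend hκ h' hm' a).symm)

variable [FiniteDimensional ℝ F] [SmoothAffineBundle F V A B]

/-- The changes of the core coordinates of the orbit space and of the double vector hull agree. -/
theorem orbitCore_orbitMk_eq (a : K × ℝ) (b : (K →L[ℝ] ℝ) × ℝ) (c : B →L[ℝ] ℝ) :
    κ'.orbitCore hm' (κ.orbitMk m a b c) = (phaseBundle hκ).coreChange (h.mem_charts hκ)
      (h.mem_dom hm) (h'.mem_charts hκ) (h'.mem_dom hm') a b c := by
  refine (κ.isDoubleLinear_orbitCore κ' hm hm').eq_of_slice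
    ((phaseBundle hκ).coreChange_isDoubleLinear _ _ _ _) (LinearMap.snd ℝ K ℝ)
    (LinearMap.snd ℝ (K →L[ℝ] ℝ) ℝ) (e₁ := (0, 1)) (e₂ := (0, 1)) rfl rfl ?_ a b c
  rintro ⟨k, _⟩ ⟨q, _⟩ c rfl rfl
  -- On the slice, (k, q, c) are the coordinates of the affine differential of a section with jet
  -- (c, q). The condition that η restricts to d f_σ is free of charts, so the same η and σ compute
  -- the coordinates for κ' on both sides.
  obtain ⟨σ, -, hσ⟩ := exists_section_with_jet hκ κ hm q c
  obtain ⟨x, rfl⟩ := κ.exists_fst (m := m) k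
  obtain ⟨η, hη⟩ := κ.exists_restrict hm x σ
  have hj : κ.jet hm (σ.affDiff m (AffQuot.mk v x)) = c.coprod q := hσ _
  have h₁ := κ.orbit_of_restrict hm hη
  have h₂ := κ'.orbit_of_restrict hm'
    ((κ'.restrict_iff hm' x η σ).1 ((κ.restrict_iff hm x η σ).2 hη))
  have h₃ := ofPoint_eq_dblMk hκ h hm (σ.affDiff m (AffQuot.mk v x))
  rw [hj] at h₁ h₃
  have e₁ : (c.coprod q).comp (ContinuousLinearMap.inr ℝ B K) = q := by ext; simp
  have e₂ : (c.coprod q).comp (ContinuousLinearMap.inl ℝ B K) = c := by ext; simp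
  rw [e₁, e₂] at h₁ h₃
  change κ'.orbitCore hm' (κ.orbitMk m ((κ.triv m x).1, 1) (q, 1) c) =
    (phaseBundle hκ).dblCore (h'.mem_charts hκ) (h'.mem_dom hm')
    ((phaseBundle hκ).dblMk (h.mem_charts hκ) (h.mem_dom hm) ((κ.triv m x).1, 1) (q, 1) c)
  refine Eq.trans ?_ (congrArg ((phaseBundle hκ).dblCore (h'.mem_charts hκ) (h'.mem_dom hm')) h₃)
  rw [← h₁, h₂, orbitCore_orbitMk, DoubleAffineBundle.dblCore_ofPoint, h'.core_eq hm']

/-- The canonical map from the orbit space to the double vector hull, in adapted coordinates. -/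
def totalEquiv : OrbitSpace F A B v m ≃ (phaseBundle hκ).DoubleHull m where
  toFun d := (phaseBundle hκ).dblMk (h.mem_charts hκ) (h.mem_dom hm)
    (κ.sideFst hm (κ.orbitPr₁ hm d)) (κ.sideSnd m (κ.orbitPr₂ hm d)) (κ.orbitCore hm d)
  invFun Ξ := κ.orbitMk m ((phaseBundle hκ).hullFst (h.mem_charts hκ) (h.mem_dom hm)
      ((phaseBundle hκ).doubleHullProj m Ξ))
    ((phaseBundle hκ).hullSnd (h.mem_charts hκ) (h.mem_dom hm) Ξ.1)
    ((phaseBundle hκ).dblCore (h.mem_charts hκ) (h.mem_dom hm) Ξ)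
  left_inv d := by
    beta_reduce
    rw [DoubleAffineBundle.doubleHullProj_dblMk, DoubleAffineBundle.dblMk_fst,
      DoubleAffineBundle.dblCore_dblMk, LinearEquiv.apply_symm_apply, LinearEquiv.apply_symm_apply,
      κ.orbitMk_coord hm]
  right_inv Ξ := by
    beta_reduce
    rw [κ.sideFst_orbitMk hm, κ.sideSnd_orbitMk hm, κ.orbitCore_orbitMk hm,
      DoubleAffineBundle.dblMk_coord]

theorem doubleHullProj_totalEquiv (d : OrbitSpace F A B v m) :
    (phaseBundle hκ).doubleHullProj m (totalEquiv hκ h hm d) =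
      sideEquiv₁ hκ h hm (κ.orbitPr₁ hm d) :=
  (phaseBundle hκ).doubleHullProj_dblMk _ _ _ _ _

theorem totalEquiv_fst (d : OrbitSpace F A B v m) :
    (totalEquiv hκ h hm d).1 = sideEquiv₂ hκ h hm (κ.orbitPr₂ hm d) := rfl

/-- The map that is the identity in the coordinates of κ is also the identity in those of κ',
because the two changes of the core coordinate coincide. -/
theorem dblCore_totalEquiv (d : OrbitSpace F A B v m) :
    (phaseBundle hκ).dblCore (h'.mem_charts hκ) (h'.mem_dom hm') (totalEquiv hκ h hm d) =
      κ'.orbitCore hm' d := by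
  refine (orbitCore_orbitMk_eq hκ h h' hm hm' _ _ _).symm.trans ?_
  rw [κ.orbitMk_coord hm]

theorem totalEquiv_orbit {a : A m} {η : HullTangent F V A B m (Hull.of V a) →L[ℝ] ℝ}
    {σ : AVSection F A B v} (hη : (κ.covCoord m (Hull.of V a) η).comp affInl =
      jetExtend (κ.jet hm (σ.affDiff m (AffQuot.mk v a)))) :
    totalEquiv hκ h hm (orbit F A B v m (Hull.of V a) η) =
      (phaseBundle hκ).ofPoint m (σ.affDiff m (AffQuot.mk v a)) := by
  rw [κ.orbit_of_restrict hm hη, ofPoint_eq_dblMk hκ h hm]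
  change (phaseBundle hκ).dblMk _ _ _ _ _ = _
  rw [κ.sideFst_orbitMk hm, κ.sideSnd_orbitMk hm, κ.orbitCore_orbitMk hm]
  rfl

end

end AdaptedChart

end Comparison

/-! ### Transport of structure, and rigidity of isomorphisms -/

section Transport

variable {M : Type*} [TopologicalSpace M] {B : Type*} [NormedAddCommGroup B] [NormedSpace ℝ B]
  [ChartedSpace B M] {K₁ K₂ K : Type*} [NormedAddCommGroup K₁] [NormedSpace ℝ K₁]
  [NormedAddCommGroup K₂] [NormedSpace ℝ K₂] [NormedAddCommGroup K] [NormedSpace ℝ K]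
  {D D₁ D₂ D' D₁' D₂' : M → Type*}
  [∀ m, AddCommGroup (D₁ m)] [∀ m, Module ℝ (D₁ m)]
  [∀ m, AddCommGroup (D₂ m)] [∀ m, Module ℝ (D₂ m)]
  [∀ m, AddCommGroup (D₁' m)] [∀ m, Module ℝ (D₁' m)]
  [∀ m, AddCommGroup (D₂' m)] [∀ m, Module ℝ (D₂' m)]
  (ℋ : DoubleVectorBundle B K₁ K₂ K D' D₁' D₂')
  (t : ∀ m, D m ≃ D' m) (s₁ : ∀ m, D₁ m ≃ₗ[ℝ] D₁' m) (s₂ : ∀ m, D₂ m ≃ₗ[ℝ] D₂' m)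

/-- The pull-back of a chart. -/
def DoubleChart.pull (χ : DoubleChart K₁ K₂ K D' D₁' D₂') : DoubleChart K₁ K₂ K D D₁ D₂ where
  dom := χ.dom
  fst m a := χ.fst m (s₁ m a)
  snd m b := χ.snd m (s₂ m b)
  core m d := χ.core m (t m d)

namespace DoubleVectorBundle

theorem coord_pull (χ : DoubleChart K₁ K₂ K D' D₁' D₂') (m : M) (d : D m) :
    (χ.pull t s₁ s₂).coord (fun m d => (s₁ m).symm (ℋ.pr₁ m (t m d)))
      (fun m d => (s₂ m).symm (ℋ.pr₂ m (t m d))) m d = χ.coord ℋ.pr₁ ℋ.pr₂ m (t m d) := by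
  simp [DoubleChart.coord, DoubleChart.pull]

/-- The transport of the structure of a double vector bundle. -/
def transport : DoubleVectorBundle B K₁ K₂ K D D₁ D₂ where
  pr₁ m d := (s₁ m).symm (ℋ.pr₁ m (t m d))
  pr₂ m d := (s₂ m).symm (ℋ.pr₂ m (t m d))
  add₁ m d d' := (t m).symm (ℋ.add₁ m (t m d) (t m d'))
  smul₁ m c d := (t m).symm (ℋ.smul₁ m c (t m d))
  add₂ m d d' := (t m).symm (ℋ.add₂ m (t m d) (t m d'))
  smul₂ m c d := (t m).symm (ℋ.smul₂ m c (t m d))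
  pr₁_add₁ m d d' h := by
    rw [Equiv.apply_symm_apply, ℋ.pr₁_add₁ m _ _ ((s₁ m).symm.injective h)]
  pr₂_add₁ m d d' h := by
    rw [Equiv.apply_symm_apply, ℋ.pr₂_add₁ m _ _ ((s₁ m).symm.injective h), map_add]
  pr₁_smul₁ m c d := by rw [Equiv.apply_symm_apply, ℋ.pr₁_smul₁]
  pr₂_smul₁ m c d := by rw [Equiv.apply_symm_apply, ℋ.pr₂_smul₁, map_smul]
  pr₂_add₂ m d d' h := by
    rw [Equiv.apply_symm_apply, ℋ.pr₂_add₂ m _ _ ((s₂ m).symm.injective h)]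
  pr₁_add₂ m d d' h := by
    rw [Equiv.apply_symm_apply, ℋ.pr₁_add₂ m _ _ ((s₂ m).symm.injective h), map_add]
  pr₂_smul₂ m c d := by rw [Equiv.apply_symm_apply, ℋ.pr₂_smul₂]
  pr₁_smul₂ m c d := by rw [Equiv.apply_symm_apply, ℋ.pr₁_smul₂, map_smul]
  charts := (DoubleChart.pull t s₁ s₂) '' ℋ.charts
  cover m := by
    obtain ⟨χ, hχ, hm⟩ := ℋ.cover m
    exact ⟨_, ⟨χ, hχ, rfl⟩, hm⟩
  fst_bijective := by
    rintro _ ⟨χ, hχ, rfl⟩ m hm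
    exact (ℋ.fst_bijective χ hχ m hm).comp (s₁ m).bijective
  snd_bijective := by
    rintro _ ⟨χ, hχ, rfl⟩ m hm
    exact (ℋ.snd_bijective χ hχ m hm).comp (s₂ m).bijective
  coord_bijective := by
    rintro _ ⟨χ, hχ, rfl⟩ m hm
    rw [funext (coord_pull ℋ t s₁ s₂ χ m)]
    exact (ℋ.coord_bijective χ hχ m hm).comp (t m).bijective
  fst_linear := by
    rintro _ ⟨χ, hχ, rfl⟩ m hm
    exact (((ℋ.fst_linear χ hχ m hm).mk' _).comp (s₁ m).toLinearMap).isLinear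
  snd_linear := by
    rintro _ ⟨χ, hχ, rfl⟩ m hm
    exact (((ℋ.snd_linear χ hχ m hm).mk' _).comp (s₂ m).toLinearMap).isLinear
  core_add₁ := by
    rintro _ ⟨χ, hχ, rfl⟩ m hm d d' h
    refine (congrArg (χ.core m) (Equiv.apply_symm_apply _ _)).trans ?_
    exact ℋ.core_add₁ χ hχ m hm _ _ ((s₁ m).symm.injective h)
  core_smul₁ := by
    rintro _ ⟨χ, hχ, rfl⟩ m hm c d
    refine (congrArg (χ.core m) (Equiv.apply_symm_apply _ _)).trans ?_
    exact ℋ.core_smul₁ χ hχ m hm _ _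
  core_add₂ := by
    rintro _ ⟨χ, hχ, rfl⟩ m hm d d' h
    refine (congrArg (χ.core m) (Equiv.apply_symm_apply _ _)).trans ?_
    exact ℋ.core_add₂ χ hχ m hm _ _ ((s₂ m).symm.injective h)
  core_smul₂ := by
    rintro _ ⟨χ, hχ, rfl⟩ m hm c d
    refine (congrArg (χ.core m) (Equiv.apply_symm_apply _ _)).trans ?_
    exact ℋ.core_smul₂ χ hχ m hm _ _
  smooth := by
    rintro _ ⟨χ, hχ, rfl⟩ _ ⟨χ', hχ', rfl⟩
    obtain ⟨τ, hτ, h⟩ := ℋ.smooth χ hχ χ' hχ'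
    refine ⟨τ, hτ, fun m hm d => ?_⟩
    rw [coord_pull, coord_pull, h m hm]

/-- The tautological isomorphism. -/
def transportIso : Iso (ℋ.transport t s₁ s₂) ℋ where
  total := t
  side₁ := s₁
  side₂ := s₂
  pr₁_total m d := ((s₁ m).apply_symm_apply _).symm
  pr₂_total m d := ((s₂ m).apply_symm_apply _).symm
  total_add₁ m d d' _ := (t m).apply_symm_apply _
  total_smul₁ m c d := (t m).apply_symm_apply _
  total_add₂ m d d' _ := (t m).apply_symm_apply _
  total_smul₂ m c d := (t m).apply_symm_apply _
  smooth := by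
    rintro _ ⟨χ, hχ, rfl⟩ χ' hχ'
    obtain ⟨τ, hτ, h⟩ := ℋ.smooth χ hχ χ' hχ'
    exact ⟨τ, hτ, fun m hm d => (h m hm _).trans
      (congrArg (fun x => τ (m, x)) (ℋ.coord_pull t s₁ s₂ χ m d).symm)⟩
  smooth_symm := by
    rintro _ ⟨χ, hχ, rfl⟩ χ' hχ'
    obtain ⟨τ, hτ, h⟩ := ℋ.smooth χ' hχ' χ hχ
    refine ⟨τ, by rwa [inter_comm] at hτ, fun m hm d => (ℋ.coord_pull t s₁ s₂ χ m _).trans ?_⟩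
    rw [Equiv.apply_symm_apply, h m hm.symm]

section Uniqueness

variable {ℋ} {K₁' K₂' K' : Type*} [NormedAddCommGroup K₁'] [NormedSpace ℝ K₁']
  [NormedAddCommGroup K₂'] [NormedSpace ℝ K₂'] [NormedAddCommGroup K'] [NormedSpace ℝ K']
  {𝒟 : DoubleVectorBundle B K₁' K₂' K' D D₁ D₂}

theorem exists_coord {χ : DoubleChart K₁ K₂ K D' D₁' D₂'} (hχ : χ ∈ ℋ.charts) {m : M}
    (hm : m ∈ χ.dom) (a : D₁' m) (b : D₂' m) (c : K) :
    ∃ d, ℋ.pr₁ m d = a ∧ ℋ.pr₂ m d = b ∧ χ.core m d = c := by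
  obtain ⟨d, hd⟩ := (ℋ.coord_bijective χ hχ m hm).2 (χ.fst m a, χ.snd m b, c)
  simp only [DoubleChart.coord, Prod.mk.injEq] at hd
  exact ⟨d, (ℋ.fst_bijective χ hχ m hm).1 hd.1, (ℋ.snd_bijective χ hχ m hm).1 hd.2.1, hd.2.2⟩

theorem coord_ext {χ : DoubleChart K₁ K₂ K D' D₁' D₂'} (hχ : χ ∈ ℋ.charts) {m : M}
    (hm : m ∈ χ.dom) {d d' : D' m} (h₁ : ℋ.pr₁ m d = ℋ.pr₁ m d') (h₂ : ℋ.pr₂ m d = ℋ.pr₂ m d')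
    (h₃ : χ.core m d = χ.core m d') : d = d' :=
  (ℋ.coord_bijective χ hχ m hm).1 (by simp only [DoubleChart.coord, h₁, h₂, h₃])

/-- In a chart, an isomorphism is linear in each of the two directions. -/
theorem Iso.isDoubleLinear_core (Φ : Iso 𝒟 ℋ) {χ : DoubleChart K₁' K₂' K' D D₁ D₂}
    (hχ : χ ∈ 𝒟.charts) {m : M} (hm : m ∈ χ.dom) {χ' : DoubleChart K₁ K₂ K D' D₁' D₂'}
    (hχ' : χ' ∈ ℋ.charts) (hm' : m ∈ χ'.dom) {mk : D₁ m → D₂ m → K' → D m}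
    (h₁ : ∀ a b c, 𝒟.pr₁ m (mk a b c) = a) (h₂ : ∀ a b c, 𝒟.pr₂ m (mk a b c) = b)
    (h₃ : ∀ a b c, χ.core m (mk a b c) = c) :
    IsDoubleLinear fun a b c => χ'.core m (Φ.total m (mk a b c)) where
  left b := by
    constructor
    · intro p q
      have hb : 𝒟.pr₂ m (mk p.1 b p.2) = 𝒟.pr₂ m (mk q.1 b q.2) := by rw [h₂, h₂]
      have e : mk (p.1 + q.1) b (p.2 + q.2) = 𝒟.add₂ m (mk p.1 b p.2) (mk q.1 b q.2) := by
        apply 𝒟.coord_ext hχ hm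
        · rw [𝒟.pr₁_add₂ m _ _ hb, h₁, h₁, h₁]
        · rw [𝒟.pr₂_add₂ m _ _ hb, h₂, h₂]
        · rw [𝒟.core_add₂ χ hχ m hm _ _ hb, h₃, h₃, h₃]
      refine (congrArg (fun d => χ'.core m (Φ.total m d)) e).trans ?_
      rw [Φ.total_add₂ m _ _ hb, ℋ.core_add₂ χ' hχ' m hm' _ _
        (by rw [Φ.pr₂_total, Φ.pr₂_total, hb])]
    · intro t p
      have e : mk (t • p.1) b (t • p.2) = 𝒟.smul₂ m t (mk p.1 b p.2) := by
        apply 𝒟.coord_ext hχ hm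
        · rw [𝒟.pr₁_smul₂, h₁, h₁]
        · rw [𝒟.pr₂_smul₂, h₂, h₂]
        · rw [𝒟.core_smul₂ χ hχ m hm, h₃, h₃]
      refine (congrArg (fun d => χ'.core m (Φ.total m d)) e).trans ?_
      rw [Φ.total_smul₂, ℋ.core_smul₂ χ' hχ' m hm']
  right a := by
    constructor
    · intro p q
      have ha : 𝒟.pr₁ m (mk a p.1 p.2) = 𝒟.pr₁ m (mk a q.1 q.2) := by rw [h₁, h₁]
      have e : mk a (p.1 + q.1) (p.2 + q.2) = 𝒟.add₁ m (mk a p.1 p.2) (mk a q.1 q.2) := by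
        apply 𝒟.coord_ext hχ hm
        · rw [𝒟.pr₁_add₁ m _ _ ha, h₁, h₁]
        · rw [𝒟.pr₂_add₁ m _ _ ha, h₂, h₂, h₂]
        · rw [𝒟.core_add₁ χ hχ m hm _ _ ha, h₃, h₃, h₃]
      refine (congrArg (fun d => χ'.core m (Φ.total m d)) e).trans ?_
      rw [Φ.total_add₁ m _ _ ha, ℋ.core_add₁ χ' hχ' m hm' _ _
        (by rw [Φ.pr₁_total, Φ.pr₁_total, ha])]
    · intro t p
      have e : mk a (t • p.1) (t • p.2) = 𝒟.smul₁ m t (mk a p.1 p.2) := by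
        apply 𝒟.coord_ext hχ hm
        · rw [𝒟.pr₁_smul₁, h₁, h₁]
        · rw [𝒟.pr₂_smul₁, h₂, h₂]
        · rw [𝒟.core_smul₁ χ hχ m hm, h₃, h₃]
      refine (congrArg (fun d => χ'.core m (Φ.total m d)) e).trans ?_
      rw [Φ.total_smul₁, ℋ.core_smul₁ χ' hχ' m hm']

/-- Isomorphisms over the same maps of the side bundles agree if they do over affine hyperplanes in
the side bundles. -/
theorem Iso.total_eq (Φ Φ' : Iso 𝒟 ℋ) {m : M} (hs₁ : Φ.side₁ m = Φ'.side₁ m)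
    (hs₂ : Φ.side₂ m = Φ'.side₂ m) (l₁ : D₁ m →ₗ[ℝ] ℝ) (l₂ : D₂ m →ₗ[ℝ] ℝ) {e₁ : D₁ m} {e₂ : D₂ m}
    (h₁ : l₁ e₁ = 1) (h₂ : l₂ e₂ = 1) (h : ∀ d, l₁ (𝒟.pr₁ m d) = 1 → l₂ (𝒟.pr₂ m d) = 1 →
      Φ.total m d = Φ'.total m d) : Φ.total m = Φ'.total m := by
  obtain ⟨χ, hχ, hm⟩ := 𝒟.cover m
  obtain ⟨χ', hχ', hm'⟩ := ℋ.cover m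
  choose mk hmk using 𝒟.exists_coord hχ hm
  refine Equiv.ext fun d => ℋ.coord_ext hχ' hm' ?_ ?_ ?_
  · rw [Φ.pr₁_total, Φ'.pr₁_total, hs₁]
  · rw [Φ.pr₂_total, Φ'.pr₂_total, hs₂]
  · have e : mk (𝒟.pr₁ m d) (𝒟.pr₂ m d) (χ.core m d) = d :=
      𝒟.coord_ext hχ hm (hmk _ _ _).1 (hmk _ _ _).2.1 (hmk _ _ _).2.2
    have key := (Φ.isDoubleLinear_core hχ hm hχ' hm' (fun a b c => (hmk a b c).1)
      (fun a b c => (hmk a b c).2.1) (fun a b c => (hmk a b c).2.2)).eq_of_slice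
      (Φ'.isDoubleLinear_core hχ hm hχ' hm' (fun a b c => (hmk a b c).1)
      (fun a b c => (hmk a b c).2.1) (fun a b c => (hmk a b c).2.2)) l₁ l₂ h₁ h₂
      (fun a b c ha hb => by rw [h _ (by rwa [(hmk a b c).1]) (by rwa [(hmk a b c).2.1])])
      (𝒟.pr₁ m d) (𝒟.pr₂ m d) (χ.core m d)
    simpa only [e] using key

theorem Iso.ext {Φ Φ' : Iso 𝒟 ℋ} (h : ∀ m, Φ.total m = Φ'.total m)
    (h₁ : ∀ m, Φ.side₁ m = Φ'.side₁ m) (h₂ : ∀ m, Φ.side₂ m = Φ'.side₂ m) : Φ = Φ' := by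
  obtain ⟨t, s₁, s₂⟩ := Φ
  obtain ⟨t', s₁', s₂'⟩ := Φ'
  obtain rfl : t = t' := funext h
  obtain rfl : s₁ = s₁' := funext h₁
  obtain rfl : s₂ = s₂' := funext h₂
  rfl

end Uniqueness

end DoubleVectorBundle

end Transport

/-! ### The double vector bundle of orbits and the canonical isomorphism -/

section Reduced

variable {F : Type*} [NormedAddCommGroup F] [NormedSpace ℝ F] {M : Type*} [TopologicalSpace M]
  {V : M → Type*} [∀ m, AddCommGroup (V m)] [∀ m, Module ℝ (V m)]
  {A : M → Type*} [∀ m, AddTorsor (V m) (A m)]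
  [∀ m, TopologicalSpace (A m)] [TopologicalSpace (TotalSpace F A)] [FiberBundle F A]
  {B : Type*} [NormedAddCommGroup B] [NormedSpace ℝ B] [ChartedSpace B M] {v : ∀ m, V m}
  {K : Type*} [NormedAddCommGroup K] [NormedSpace ℝ K]
  [FiniteDimensional ℝ B] [IsManifold 𝓘(ℝ, B) ∞ M] [T2Space M] [SecondCountableTopology M]
  [FiniteDimensional ℝ K] (hκ : ∀ m, ∃ κ : AdaptedChart F A B v K, m ∈ κ.dom)

open AdaptedChart

/-- The canonical map from `E / ⟨v⟩` to the hull of `A / ⟨v⟩`. -/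
def sideIso₁ (m : M) : HullQuot V A v m ≃ₗ[ℝ] (phaseBundle hκ).Hull₁ m :=
  sideEquiv₁ hκ (hκ m).choose.induces_chart (hκ m).choose_spec

/-- The canonical map from `E* / ⟨α⟩` to the hull of the quotient of the special affine dual. -/
def sideIso₂ (m : M) : DualQuot V A m ≃ₗ[ℝ] (phaseBundle hκ).Hull₂ m :=
  sideEquiv₂ hκ (hκ m).choose.induces_chart (hκ m).choose_spec

variable [FiniteDimensional ℝ F] [SmoothAffineBundle F V A B]

/-- The canonical map from the orbit space to the double vector hull. -/
def totalIso (m : M) : OrbitSpace F A B v m ≃ (phaseBundle hκ).DoubleHull m :=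
  totalEquiv hκ (hκ m).choose.induces_chart (hκ m).choose_spec

/-- The double vector bundle structure of the orbit space. -/
def reducedBundle : DoubleVectorBundle B (K × ℝ) ((K →L[ℝ] ℝ) × ℝ) (B →L[ℝ] ℝ)
    (OrbitSpace F A B v) (HullQuot V A v) (DualQuot V A) :=
  (phaseBundle hκ).doubleHullBundle.transport (totalIso hκ) (sideIso₁ hκ) (sideIso₂ hκ)

/-- The canonical isomorphism. -/
def canonicalIso : DoubleVectorBundle.Iso (reducedBundle hκ) (phaseBundle hκ).doubleHullBundle :=
  (DoubleVectorBundle.transportIso (D := OrbitSpace F A B v) (D₁ := HullQuot V A v)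
    (D₂ := DualQuot V A) (phaseBundle hκ).doubleHullBundle (totalIso hκ) (sideIso₁ hκ)
    (sideIso₂ hκ) :)

/-! The structure in adapted coordinates -/

section
variable {m : M}

theorem reducedBundle_pr₁ (w : Hull V A m) (η : HullTangent F V A B m w →L[ℝ] ℝ) :
    (reducedBundle hκ).pr₁ m (orbit F A B v m w η) = Submodule.Quotient.mk w :=
  (LinearEquiv.symm_apply_eq _).2 (doubleHullProj_totalEquiv hκ _ _ _)

theorem reducedBundle_pr₂ (w : Hull V A m) (η : HullTangent F V A B m w →L[ℝ] ℝ) :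
    (reducedBundle hκ).pr₂ m (orbit F A B v m w η) =
      Submodule.Quotient.mk (vert F V B m w η) :=
  (LinearEquiv.symm_apply_eq _).2 (totalEquiv_fst hκ _ _ _)

variable {χ : (phaseBundle hκ).charts} {κ : AdaptedChart F A B v K} (h : κ.Induces χ.1)
  (hm : m ∈ κ.dom)
include h

/-- The chart of the orbit space corresponding to a chart of the affine phase bundle. -/
abbrev reducedChart (χ : (phaseBundle hκ).charts) :
    DoubleChart (K × ℝ) ((K →L[ℝ] ℝ) × ℝ) (B →L[ℝ] ℝ)
    (OrbitSpace F A B v) (HullQuot V A v) (DualQuot V A) :=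
  ((phaseBundle hκ).hullChart χ).pull (totalIso hκ) (sideIso₁ hκ) (sideIso₂ hκ)

/-- `sideIso₁` uses a chart chosen separately at each m. Independence of the chart allows it to be
computed in the given one, and with it the coordinates over a whole domain. -/
theorem reducedChart_fst (x : HullQuot V A v m) :
    (reducedChart hκ χ).fst m x = κ.sideFst hm x := by
  change ((phaseBundle hκ).hullChart χ).fst m (sideIso₁ hκ m x) = _
  rw [(phaseBundle hκ).hullChart_fst χ (h.mem_dom hm), sideIso₁,
    sideEquiv₁_eq hκ _ h _ hm]
  exact LinearEquiv.apply_symm_apply _ _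

include hm in
theorem reducedChart_snd (x : DualQuot V A m) :
    (reducedChart hκ χ).snd m x = κ.sideSnd m x := by
  change ((phaseBundle hκ).hullChart χ).snd m (sideIso₂ hκ m x) = _
  rw [(phaseBundle hκ).hullChart_snd χ (h.mem_dom hm), sideIso₂,
    sideEquiv₂_eq hκ _ h _ hm]
  exact LinearEquiv.apply_symm_apply _ _

theorem reducedChart_core (d : OrbitSpace F A B v m) :
    (reducedChart hκ χ).core m d = κ.orbitCore hm d := by
  change ((phaseBundle hκ).hullChart χ).core m (totalIso hκ m d) = _
  rw [(phaseBundle hκ).hullChart_core χ (h.mem_dom hm)]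
  exact dblCore_totalEquiv hκ _ h _ hm d

/-- The adapted coordinates of an orbit, in terms of those of a representative. -/
def reducedCoord (z : (K × ℝ) × ℝ) (Λ : B × ((K × ℝ) × ℝ) →L[ℝ] ℝ) :
    (K × ℝ) × ((K →L[ℝ] ℝ) × ℝ) × (B →L[ℝ] ℝ) :=
  ((z.1.1, z.2), (Λ.comp ((ContinuousLinearMap.inr ℝ B ((K × ℝ) × ℝ)).comp
    ((ContinuousLinearMap.inl ℝ (K × ℝ) ℝ).comp (ContinuousLinearMap.inl ℝ K ℝ))),
      Λ (0, ((0, 1), 0))), Λ.comp (ContinuousLinearMap.inl ℝ B ((K × ℝ) × ℝ)))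

include hm in
theorem coord_reducedChart (w : Hull V A m) (η : HullTangent F V A B m w →L[ℝ] ℝ) :
    (reducedChart hκ χ).coord (reducedBundle hκ).pr₁ (reducedBundle hκ).pr₂ m
      (orbit F A B v m w η) = reducedCoord (κ.hullCoord m w) (κ.covCoord m w η) := by
  rw [DoubleChart.coord, reducedChart_fst hκ h hm, reducedChart_snd hκ h hm,
    reducedChart_core hκ h hm, reducedBundle_pr₁, reducedBundle_pr₂]
  refine Prod.ext (κ.sideFst_mk hm w) (Prod.ext ?_ rfl)
  refine (κ.sideSnd_mk _).trans (Prod.ext (ContinuousLinearMap.ext fun k => ?_) ?_)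
  · rw [sideSndLin_fst, κ.vert_eq hm, LinearEquiv.apply_symm_apply]; rfl
  · rw [sideSndLin_snd, κ.vert_eq hm, LinearEquiv.apply_symm_apply]; rfl

end

/-- The operations on orbits are defined by transport; this is how they are matched with the
operations on covectors. -/
theorem orbit_eq_of_coord {m : M} {d d' : OrbitSpace F A B v m}
    (h₁ : (reducedBundle hκ).pr₁ m d = (reducedBundle hκ).pr₁ m d')
    (h₂ : (reducedBundle hκ).pr₂ m d = (reducedBundle hκ).pr₂ m d')
    (h₃ : ∀ χ ∈ (reducedBundle hκ).charts, m ∈ χ.dom → χ.core m d = χ.core m d') : d = d' := by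
  obtain ⟨χ, hχ, hm⟩ := (reducedBundle hκ).cover m
  exact (reducedBundle hκ).coord_ext hχ hm h₁ h₂ (h₃ χ hχ hm)

theorem reducedBundle_add₁ (m : M) (w : Hull V A m) (η η' : HullTangent F V A B m w →L[ℝ] ℝ) :
    (reducedBundle hκ).add₁ m (orbit F A B v m w η) (orbit F A B v m w η') =
      orbit F A B v m w (η + η') := by
  have e : (reducedBundle hκ).pr₁ m (orbit F A B v m w η) =
    (reducedBundle hκ).pr₁ m (orbit F A B v m w η') := by
    rw [reducedBundle_pr₁, reducedBundle_pr₁]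
  refine orbit_eq_of_coord hκ ?_ ?_ fun χ hχ hm => ?_
  · rw [(reducedBundle hκ).pr₁_add₁ m _ _ e, reducedBundle_pr₁, reducedBundle_pr₁]
  · rw [(reducedBundle hκ).pr₂_add₁ m _ _ e, reducedBundle_pr₂, reducedBundle_pr₂,
      reducedBundle_pr₂]; rfl
  · rw [(reducedBundle hκ).core_add₁ χ hχ m hm _ _ e]
    obtain ⟨_, ⟨⟨χ, κ, h⟩, rfl⟩, rfl⟩ := hχ
    have hm : m ∈ κ.dom := by rw [← h.1]; exact hm
    rw [reducedChart_core hκ h hm, reducedChart_core hκ h hm, reducedChart_core hκ h hm]; rfl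

theorem reducedBundle_smul₁ (m : M) (t : ℝ) (w : Hull V A m)
    (η : HullTangent F V A B m w →L[ℝ] ℝ) :
    (reducedBundle hκ).smul₁ m t (orbit F A B v m w η) = orbit F A B v m w (t • η) := by
  refine orbit_eq_of_coord hκ ?_ ?_ fun χ hχ hm => ?_
  · rw [(reducedBundle hκ).pr₁_smul₁, reducedBundle_pr₁, reducedBundle_pr₁]
  · rw [(reducedBundle hκ).pr₂_smul₁, reducedBundle_pr₂, reducedBundle_pr₂]; rfl
  · rw [(reducedBundle hκ).core_smul₁ χ hχ m hm]
    obtain ⟨_, ⟨⟨χ, κ, h⟩, rfl⟩, rfl⟩ := hχ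
    have hm : m ∈ κ.dom := by rw [← h.1]; exact hm
    rw [reducedChart_core hκ h hm, reducedChart_core hκ h hm]; rfl

theorem reducedBundle_add₂ (m : M) (w w' : Hull V A m) (η : HullTangent F V A B m w →L[ℝ] ℝ)
    (η' : HullTangent F V A B m w' →L[ℝ] ℝ) (hv : vert F V B m w η = vert F V B m w' η') :
    (reducedBundle hκ).add₂ m (orbit F A B v m w η) (orbit F A B v m w' η') =
      orbit F A B v m (w + w') (cotAdd F V B m w w' η η') := by
  have e : (reducedBundle hκ).pr₂ m (orbit F A B v m w η) =
    (reducedBundle hκ).pr₂ m (orbit F A B v m w' η') := by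
    rw [reducedBundle_pr₂, reducedBundle_pr₂, hv]
  refine orbit_eq_of_coord hκ ?_ ?_ fun χ hχ hm => ?_
  · rw [(reducedBundle hκ).pr₁_add₂ m _ _ e, reducedBundle_pr₁, reducedBundle_pr₁,
      reducedBundle_pr₁]; rfl
  · rw [(reducedBundle hκ).pr₂_add₂ m _ _ e, reducedBundle_pr₂, reducedBundle_pr₂, cotAdd,
      vert_covec]
  · rw [(reducedBundle hκ).core_add₂ χ hχ m hm _ _ e]
    obtain ⟨_, ⟨⟨χ, κ, h⟩, rfl⟩, rfl⟩ := hχ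
    have hm : m ∈ κ.dom := by rw [← h.1]; exact hm
    rw [reducedChart_core hκ h hm, reducedChart_core hκ h hm, reducedChart_core hκ h hm,
      κ.orbitCore_cotAdd hm hv]

theorem reducedBundle_smul₂ (m : M) (t : ℝ) (w : Hull V A m)
    (η : HullTangent F V A B m w →L[ℝ] ℝ) :
    (reducedBundle hκ).smul₂ m t (orbit F A B v m w η) =
      orbit F A B v m (t • w) (cotSmul F V B m t w η) := by
  refine orbit_eq_of_coord hκ ?_ ?_ fun χ hχ hm => ?_
  · rw [(reducedBundle hκ).pr₁_smul₂, reducedBundle_pr₁, reducedBundle_pr₁]; rfl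
  · rw [(reducedBundle hκ).pr₂_smul₂, reducedBundle_pr₂, reducedBundle_pr₂, cotSmul, vert_covec]
  · rw [(reducedBundle hκ).core_smul₂ χ hχ m hm]
    obtain ⟨_, ⟨⟨χ, κ, h⟩, rfl⟩, rfl⟩ := hχ
    have hm : m ∈ κ.dom := by rw [← h.1]; exact hm
    rw [reducedChart_core hκ h hm, reducedChart_core hκ h hm, κ.orbitCore_cotSmul hm]

/-! The canonical isomorphism -/

theorem isCanonical_canonicalIso : IsCanonical (canonicalIso hκ) where
  side₁_of m a := sideEquiv₁_of hκ (hκ m).choose.induces_chart (hκ m).choose_spec a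
  side₂_extend m f := sideEquiv₂_extend hκ (hκ m).choose.induces_chart (hκ m).choose_spec f
  total_orbit m a η σ h := totalEquiv_orbit hκ (hκ m).choose.induces_chart (hκ m).choose_spec
    (((hκ m).choose.restrict_iff (hκ m).choose_spec a η σ).1 h)

include hκ in
/-- An orbit over a point of `A / ⟨v⟩` and a point of the quotient of the special affine dual is the
orbit of a covector restricting to the differential of some `f_σ`. -/
theorem exists_section_of_orbit {κ : AdaptedChart F A B v K} {m : M} (hm : m ∈ κ.dom)
    (d : OrbitSpace F A B v m) (h₁ : (κ.sideFst hm (κ.orbitPr₁ hm d)).2 = 1)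
    (h₂ : (κ.sideSnd m (κ.orbitPr₂ hm d)).2 = 1) :
    ∃ (a : A m) (η : HullTangent F V A B m (Hull.of V a) →L[ℝ] ℝ) (σ : AVSection F A B v),
      d = orbit F A B v m (Hull.of V a) η ∧
      η.comp (mfderiv (𝓘(ℝ, B).prod 𝓘(ℝ, F)) (hullModel F B)
        (fun x : TotalSpace F A => (⟨x.1, Hull.of V x.2⟩ : HullTotal F V A)) ⟨m, a⟩) =
        mfderiv (𝓘(ℝ, B).prod 𝓘(ℝ, F)) 𝓘(ℝ, ℝ) σ.fn ⟨m, a⟩ := by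
  obtain ⟨a, ha⟩ := κ.exists_fst (m := m) (κ.sideFst hm (κ.orbitPr₁ hm d)).1
  obtain ⟨σ, -, hσ⟩ := exists_section_with_jet hκ κ hm (κ.sideSnd m (κ.orbitPr₂ hm d)).1
    (κ.orbitCore hm d)
  obtain ⟨η, hη⟩ := κ.exists_restrict hm a σ
  refine ⟨a, η, σ, ?_, (κ.restrict_iff hm a η σ).2 hη⟩
  rw [κ.orbit_of_restrict hm hη, show κ.jet hm (σ.affDiff m (AffQuot.mk v a)) = _ from hσ _, ha]
  conv_lhs => rw [← κ.orbitMk_coord hm d]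
  have e₁ : κ.sideFst hm (κ.orbitPr₁ hm d) = ((κ.sideFst hm (κ.orbitPr₁ hm d)).1, 1) :=
    Prod.ext rfl h₁
  have e₂ : κ.sideSnd m (κ.orbitPr₂ hm d) = ((κ.sideSnd m (κ.orbitPr₂ hm d)).1, 1) :=
    Prod.ext rfl h₂
  conv_lhs => rw [e₁, e₂]
  congr 1
  · refine Prod.ext ?_ rfl
    ext; simp
  · ext; simp

/-- The side maps are prescribed on spanning sets. On the total space `Iso.total_eq` leaves only the
orbits of weight 1 on both sides; each of these is the orbit of a covector restricting to some d
f_σ, and its image is prescribed. -/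
theorem eq_canonicalIso {Φ : DoubleVectorBundle.Iso (reducedBundle hκ)
    (phaseBundle hκ).doubleHullBundle} (hΦ : IsCanonical Φ) : Φ = canonicalIso hκ := by
  have hΨ := isCanonical_canonicalIso hκ
  have hs₁ : ∀ m, Φ.side₁ m = (canonicalIso hκ).side₁ m := fun m =>
    LinearEquiv.toLinearMap_injective (hullQuot_hom_ext fun a =>
      (hΦ.side₁_of m a).trans (hΨ.side₁_of m a).symm)
  have hs₂ : ∀ m, Φ.side₂ m = (canonicalIso hκ).side₂ m := fun m =>
    LinearEquiv.toLinearMap_injective (dualQuot_hom_ext (hκ m).choose_spec fun f =>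
      (hΦ.side₂_extend m f).trans (hΨ.side₂_extend m f).symm)
  refine DoubleVectorBundle.Iso.ext (fun m => ?_) hs₁ hs₂
  obtain ⟨κ, hm⟩ := hκ m
  refine Φ.total_eq _ (hs₁ m) (hs₂ m) (LinearMap.snd ℝ K ℝ ∘ₗ (κ.sideFst hm).toLinearMap)
    (LinearMap.snd ℝ (K →L[ℝ] ℝ) ℝ ∘ₗ (κ.sideSnd m).toLinearMap)
    (e₁ := (κ.sideFst hm).symm (0, 1)) (e₂ := (κ.sideSnd m).symm (0, 1)) ?_ ?_ fun d h₁ h₂ => ?_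
  · simp
  · simp
  · obtain ⟨⟨w, ξ⟩, rfl⟩ := Quot.exists_rep d
    change (κ.sideFst hm ((reducedBundle hκ).pr₁ m (orbit F A B v m w ξ))).2 = 1 at h₁
    change (κ.sideSnd m ((reducedBundle hκ).pr₂ m (orbit F A B v m w ξ))).2 = 1 at h₂
    rw [reducedBundle_pr₁] at h₁
    rw [reducedBundle_pr₂] at h₂
    obtain ⟨a, η, σ, hd, hη⟩ := exists_section_of_orbit hκ hm (orbit F A B v m w ξ) h₁ h₂
    change Φ.total m (orbit F A B v m w ξ) = (canonicalIso hκ).total m (orbit F A B v m w ξ)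
    rw [hd, hΦ.total_orbit m a η σ hη, hΨ.total_orbit m a η σ hη]

end Reduced

/-! ### Smoothness on T*E and local sections of the orbit projection -/

section CotangentSmooth

variable {F : Type*} [NormedAddCommGroup F] [NormedSpace ℝ F] {M : Type*} [TopologicalSpace M]
  {V : M → Type*} [∀ m, AddCommGroup (V m)] [∀ m, Module ℝ (V m)]
  {A : M → Type*} [∀ m, AddTorsor (V m) (A m)]
  [∀ m, TopologicalSpace (A m)] [TopologicalSpace (TotalSpace F A)] [FiberBundle F A]
  {B : Type*} [NormedAddCommGroup B] [NormedSpace ℝ B] [ChartedSpace B M] {v : ∀ m, V m}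
  {K : Type*} [NormedAddCommGroup K] [NormedSpace ℝ K]
  [FiniteDimensional ℝ B] [IsManifold 𝓘(ℝ, B) ∞ M]
  [FiniteDimensional ℝ K] [FiniteDimensional ℝ F] [SmoothAffineBundle F V A B]

/-- A map to a space of linear forms on a finite dimensional space is smooth if its values on all
vectors are. -/
theorem contMDiffAt_of_apply {E H N : Type*} [NormedAddCommGroup E] [NormedSpace ℝ E]
    [TopologicalSpace H] {I : ModelWithCorners ℝ E H} [TopologicalSpace N] [ChartedSpace H N]
    {P : Type*} [NormedAddCommGroup P] [NormedSpace ℝ P] [FiniteDimensional ℝ P]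
    {f : N → P →L[ℝ] ℝ} {x : N} (h : ∀ z, ContMDiffAt I 𝓘(ℝ, ℝ) ∞ (fun y => f y z) x) :
    ContMDiffAt I 𝓘(ℝ, P →L[ℝ] ℝ) ∞ f x := by
  let ε : (P →L[ℝ] ℝ) ≃L[ℝ] (Fin (Module.finrank ℝ P) → ℝ) :=
    ((ContinuousLinearEquiv.ofFinrankEq (Module.finrank_fin_fun ℝ).symm).arrowCongr
      (1 : ℝ ≃L[ℝ] ℝ)).trans (ContinuousLinearEquiv.piRing _)
  have h₂ : ContMDiffAt I 𝓘(ℝ, Fin (Module.finrank ℝ P) → ℝ) ∞ (fun y => ε (f y)) x :=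
    contMDiffAt_pi_space.2 fun i => h _
  refine (ε.symm.contDiff.contMDiff.contMDiffAt.comp x h₂).congr_of_eventuallyEq
    (Filter.Eventually.of_forall fun y => ?_)
  simp

namespace AdaptedChart

variable (κ : AdaptedChart F A B v K)

/-- The vector field is the tangent map of the smooth map `hullParam`, applied to the constant
vector z at the coordinates of y. -/
theorem contMDiffAt_dParam {x : HullTotal F V A} (hx : x.1 ∈ κ.dom) (z : B × ((K × ℝ) × ℝ)) :
    ContMDiffAt (hullModel F B) (hullModel F B).tangent ∞
      (fun y : HullTotal F V A => (⟨y, κ.dParam y.1 y.2 z⟩ : TangentBundle (hullModel F B) _)) x := by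
  have hs : IsOpen {p : B × ((K × ℝ) × ℝ) | p.1 ∈ κ.region} :=
    κ.isOpen_region.preimage continuous_fst
  have h₁ : ContMDiffOn 𝓘(ℝ, B × ((K × ℝ) × ℝ)) (hullModel F B) ∞ (κ.hullParam (F := F) (V := V))
      {p | p.1 ∈ κ.region} := fun p hp => (κ.contMDiffAt_hullParam hp).contMDiffWithinAt
  have h₂ := h₁.contMDiffOn_tangentMapWithin (m := ∞) (by simp) hs.uniqueMDiffOn
  have h₃ : ContMDiffAt (hullModel F B) 𝓘(ℝ, B × ((K × ℝ) × ℝ)).tangent ∞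
      (fun y : HullTotal F V A => (⟨κ.hullCoords F y, z⟩ : TangentBundle 𝓘(ℝ, B × ((K × ℝ) × ℝ)) _))
      x := by
    rw [contMDiffAt_totalSpace]
    refine ⟨κ.contMDiffAt_hullCoords hx, ?_⟩
    simpa using contMDiffAt_const
  have h₄ := (h₂.contMDiffAt (x := ⟨κ.hullCoords F x, z⟩)
    ((hs.preimage (FiberBundle.continuous_proj _ _)).mem_nhds (κ.base_mem_region hx))).comp x h₃
  refine h₄.congr_of_eventuallyEq ?_
  filter_upwards [κ.preimage_dom_mem_nhds_hull hx] with y hy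
  -- The tangent map lands over `hullParam (hullCoords y)`, which equals y only propositionally.
  have e : ∀ (y' : HullTotal F V A) (X : B × (F × ℝ)), y' = y →
      (⟨y, X⟩ : TangentBundle (hullModel F B) (HullTotal F V A)) = ⟨y', X⟩ := by
    rintro _ _ rfl; rfl
  refine (e _ _ (κ.hullParam_hullCoords hy)).trans ?_
  exact (tangentMapWithin_eq_tangentMap (p := ⟨κ.hullCoords F y, z⟩)
    (hs.uniqueMDiffOn (κ.hullCoords F y) (κ.base_mem_region hy))
    ((κ.contMDiffAt_hullParam (p := κ.hullCoords F y)
      (κ.base_mem_region hy)).mdifferentiableAt (by simp))).symm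

/-- Evaluated on a fixed vector z, the components are the pairing of the covector with the smooth
vector field of `contMDiffAt_dParam`. -/
theorem contMDiffAt_covCoord {x : CotangentBundle F V A B} (hx : x.1.1 ∈ κ.dom) :
    ContMDiffAt (cotangentModel F B) 𝓘(ℝ, B × ((K × ℝ) × ℝ) →L[ℝ] ℝ) ∞
      (fun y : CotangentBundle F V A B => κ.covCoord y.1.1 y.1.2 y.2) x := by
  refine contMDiffAt_of_apply fun z => ?_
  have h₁ : ContMDiffAt (cotangentModel F B) (hullModel F B) ∞
      (fun y : CotangentBundle F V A B => y.1) x := contMDiffAt_proj _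
  have h₂ := (κ.contMDiffAt_dParam hx z).comp x h₁
  have h₃ := ContMDiffAt.clm_bundle_apply (𝕜 := ℝ) (IB := hullModel F B)
    (b := fun y : CotangentBundle F V A B => y.1)
    (E₁ := fun y : HullTotal F V A => TangentSpace (hullModel F B) y)
    (E₂ := Bundle.Trivial (HullTotal F V A) ℝ) (F₁ := B × (F × ℝ)) (F₂ := ℝ)
    (ϕ := fun y => y.2) (v := fun y => κ.dParam y.1.1 y.1.2 z) contMDiffAt_id h₂
  exact (contMDiffAt_totalSpace.1 h₃).2

theorem contMDiffAt_hullCoord {x : HullTotal F V A} (hx : x.1 ∈ κ.dom) :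
    ContMDiffAt (hullModel F B) 𝓘(ℝ, (K × ℝ) × ℝ) ∞
      (fun y : HullTotal F V A => κ.hullCoord y.1 y.2) x :=
  (contDiff_snd (n := ∞)).contMDiff.contMDiffAt.comp x (κ.contMDiffAt_hullCoords hx)

theorem contDiff_reducedCoord : ContDiff ℝ ∞
    fun p : ((K × ℝ) × ℝ) × (B × ((K × ℝ) × ℝ) →L[ℝ] ℝ) => reducedCoord p.1 p.2 := by
  simp only [reducedCoord]
  fun_prop

theorem contMDiffAt_reducedCoord {x : CotangentBundle F V A B} (hx : x.1.1 ∈ κ.dom) :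
    ContMDiffAt (cotangentModel F B) 𝓘(ℝ, (K × ℝ) × ((K →L[ℝ] ℝ) × ℝ) × (B →L[ℝ] ℝ)) ∞
      (fun y : CotangentBundle F V A B =>
        reducedCoord (κ.hullCoord y.1.1 y.1.2) (κ.covCoord y.1.1 y.1.2 y.2)) x := by
  have h₁ : ContMDiffAt (cotangentModel F B) (hullModel F B) ∞
      (fun y : CotangentBundle F V A B => y.1) x := contMDiffAt_proj _
  exact contDiff_reducedCoord.contMDiff.contMDiffAt.comp x
    (((κ.contMDiffAt_hullCoord hx).comp x h₁).prodMk_space (κ.contMDiffAt_covCoord hx))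

/-! A smooth local right inverse of the orbit projection -/

/-- In bundle coordinates the covector is the composition of Λ with the derivative of `hullCoords`,
and both depend smoothly on the point. -/
theorem contMDiffAt_covOf {x : HullTotal F V A} (hx : x.1 ∈ κ.dom)
    (Λ : B × ((K × ℝ) × ℝ) →L[ℝ] ℝ) :
    ContMDiffAt ((hullModel F B).prod 𝓘(ℝ, B × ((K × ℝ) × ℝ) →L[ℝ] ℝ)) (cotangentModel F B) ∞
      (fun y : HullTotal F V A × (B × ((K × ℝ) × ℝ) →L[ℝ] ℝ) =>
        (⟨y.1, κ.covOf y.1.1 y.1.2 y.2⟩ : CotangentBundle F V A B)) (x, Λ) := by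
  rw [contMDiffAt_hom_bundle]
  refine ⟨contMDiffAt_fst, ?_⟩
  have h₀ := ContMDiffAt.mfderiv_const (κ.contMDiffAt_hullCoords hx) (m := ∞) (by simp)
  have h₁ : ContMDiffAt ((hullModel F B).prod 𝓘(ℝ, B × ((K × ℝ) × ℝ) →L[ℝ] ℝ))
      𝓘(ℝ, B × (F × ℝ) →L[ℝ] B × ((K × ℝ) × ℝ)) ∞
      (fun y : HullTotal F V A × (B × ((K × ℝ) × ℝ) →L[ℝ] ℝ) =>
        inTangentCoordinates (hullModel F B) 𝓘(ℝ, B × ((K × ℝ) × ℝ)) id (κ.hullCoords F)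
          (mfderiv (hullModel F B) 𝓘(ℝ, B × ((K × ℝ) × ℝ)) (κ.hullCoords F)) x y.1) (x, Λ) :=
    ContMDiffAt.comp (x, Λ) (f := fun y : HullTotal F V A × (B × ((K × ℝ) × ℝ) →L[ℝ] ℝ) => y.1)
      h₀ contMDiffAt_fst
  have h₂ : ContMDiffAt ((hullModel F B).prod 𝓘(ℝ, B × ((K × ℝ) × ℝ) →L[ℝ] ℝ))
    𝓘(ℝ, B × ((K × ℝ) × ℝ) →L[ℝ] ℝ) ∞
      (fun y : HullTotal F V A × (B × ((K × ℝ) × ℝ) →L[ℝ] ℝ) => y.2) (x, Λ) := contMDiffAt_snd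
  refine (h₂.clm_comp h₁).congr_of_eventuallyEq (Filter.Eventually.of_forall fun y => ?_)
  refine ContinuousLinearMap.ext fun X => ?_
  simp [inTangentCoordinates, ContinuousLinearMap.inCoordinates, covOf, dCoords]
  rfl

/-- The right inverse, with given values of the coordinates along the action. -/
def orbitSection (r l : ℝ) (p : M × ((K × ℝ) × ((K →L[ℝ] ℝ) × ℝ) × (B →L[ℝ] ℝ))) :
    CotangentBundle F V A B :=
  let y : HullTotal F V A := κ.hullParam (κ.base p.1, ((p.2.1.1, r), p.2.1.2))
  ⟨y, κ.covOf y.1 y.2 (covRep p.2.2.1 p.2.2.2 + l • (ContinuousLinearMap.snd ℝ (K × ℝ) ℝ).comp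
    (ContinuousLinearMap.snd ℝ B ((K × ℝ) × ℝ)))⟩

theorem contMDiffAt_orbitSection (r l : ℝ)
    {p : M × ((K × ℝ) × ((K →L[ℝ] ℝ) × ℝ) × (B →L[ℝ] ℝ))} (hp : p.1 ∈ κ.dom) :
    ContMDiffAt (𝓘(ℝ, B).prod 𝓘(ℝ, (K × ℝ) × ((K →L[ℝ] ℝ) × ℝ) × (B →L[ℝ] ℝ)))
      (cotangentModel F B) ∞ (κ.orbitSection (F := F) (V := V) r l) p := by
  have h₁ : ContDiff ℝ ∞ fun c : (K × ℝ) × ((K →L[ℝ] ℝ) × ℝ) × (B →L[ℝ] ℝ) =>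
      ((c.1.1, r), c.1.2) := by fun_prop
  have h₂ : ContDiff ℝ ∞ fun c : (K × ℝ) × ((K →L[ℝ] ℝ) × ℝ) × (B →L[ℝ] ℝ) =>
      covRep c.2.1 c.2.2 + l • (ContinuousLinearMap.snd ℝ (K × ℝ) ℝ).comp
        (ContinuousLinearMap.snd ℝ B ((K × ℝ) × ℝ)) := by
    have e : ∀ c : (K × ℝ) × ((K →L[ℝ] ℝ) × ℝ) × (B →L[ℝ] ℝ), covRep c.2.1 c.2.2 =
        c.2.2.comp (ContinuousLinearMap.fst ℝ B ((K × ℝ) × ℝ)) +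
        c.2.1.1.comp (((ContinuousLinearMap.fst ℝ K ℝ).comp
          (ContinuousLinearMap.fst ℝ (K × ℝ) ℝ)).comp
            (ContinuousLinearMap.snd ℝ B ((K × ℝ) × ℝ))) +
        c.2.1.2 • ((ContinuousLinearMap.snd ℝ K ℝ).comp
          (ContinuousLinearMap.fst ℝ (K × ℝ) ℝ)).comp
            (ContinuousLinearMap.snd ℝ B ((K × ℝ) × ℝ)) := by
      intro c
      refine ContinuousLinearMap.ext fun z => (covRep_apply _ _ _).trans ?_
      simp [add_assoc]
    simp only [e]
    fun_prop
  have h₃ := (κ.contMDiffAt_hullParam (F := F) (V := V)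
    (p := (κ.base p.1, ((p.2.1.1, r), p.2.1.2))) (κ.base_mem_region hp)).comp p
    (f := fun p : M × ((K × ℝ) × ((K →L[ℝ] ℝ) × ℝ) × (B →L[ℝ] ℝ)) =>
      (κ.base p.1, ((p.2.1.1, r), p.2.1.2)))
    (((κ.contMDiffAt_base hp).comp p contMDiffAt_fst).prodMk_space
      (h₁.contMDiff.contMDiffAt.comp p contMDiffAt_snd))
  have h₄ := h₂.contMDiff.contMDiffAt.comp p (f := Prod.snd) (contMDiffAt_snd (I := 𝓘(ℝ, B)))
  have hx : (κ.hullParam (κ.base p.1, ((p.2.1.1, r), p.2.1.2)) : HullTotal F V A).1 ∈ κ.dom :=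
    (κ.base_mem_region hp).2
  exact (κ.contMDiffAt_covOf hx _).comp p (h₃.prodMk h₄)

theorem orbitSection_eq (r l : ℝ) {m : M} (hm : m ∈ κ.dom)
    (c : (K × ℝ) × ((K →L[ℝ] ℝ) × ℝ) × (B →L[ℝ] ℝ)) :
    κ.orbitSection (F := F) (V := V) r l (m, c) =
      ⟨⟨m, (κ.hullCoord m).symm ((c.1.1, r), c.1.2)⟩, κ.covOf m _ (covRep c.2.1 c.2.2 +
        l • (ContinuousLinearMap.snd ℝ (K × ℝ) ℝ).comp
          (ContinuousLinearMap.snd ℝ B ((K × ℝ) × ℝ)))⟩ := by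
  rw [orbitSection, κ.hullParam_base hm]

theorem reducedCoord_orbitSection (r l : ℝ) {m : M} (hm : m ∈ κ.dom)
    (c : (K × ℝ) × ((K →L[ℝ] ℝ) × ℝ) × (B →L[ℝ] ℝ)) {y : CotangentBundle F V A B}
    (hy : κ.orbitSection (F := F) (V := V) r l (m, c) = y) :
    (y.1.1, reducedCoord (κ.hullCoord y.1.1 y.1.2) (κ.covCoord y.1.1 y.1.2 y.2)) = (m, c) := by
  rw [κ.orbitSection_eq r l hm] at hy
  subst hy
  refine Prod.ext rfl ?_
  change reducedCoord (κ.hullCoord m ((κ.hullCoord m).symm ((c.1.1, r), c.1.2)))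
    (κ.covCoord m ((κ.hullCoord m).symm ((c.1.1, r), c.1.2)) (κ.covOf m _ _)) = c
  rw [κ.covCoord_covOf hm, LinearEquiv.apply_symm_apply]
  refine Prod.ext rfl (Prod.ext (Prod.ext (ContinuousLinearMap.ext fun k => ?_) ?_)
    (ContinuousLinearMap.ext fun u => ?_)) <;> simp [reducedCoord, covRep_apply]

/-- With r and l taken to be the two coordinates of x that its orbit forgets, the local section
passes through x itself and not merely through its orbit. -/
theorem orbitSection_reducedCoord {x : CotangentBundle F V A B} (hx : x.1.1 ∈ κ.dom) :
    κ.orbitSection (κ.hullCoord x.1.1 x.1.2).1.2 (κ.covCoord x.1.1 x.1.2 x.2 (0, ((0, 0), 1)))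
      (x.1.1, reducedCoord (κ.hullCoord x.1.1 x.1.2) (κ.covCoord x.1.1 x.1.2 x.2)) = x := by
  have e₁ : covRep (reducedCoord (κ.hullCoord x.1.1 x.1.2) (κ.covCoord x.1.1 x.1.2 x.2)).2.1
      (reducedCoord (κ.hullCoord x.1.1 x.1.2) (κ.covCoord x.1.1 x.1.2 x.2)).2.2 +
      κ.covCoord x.1.1 x.1.2 x.2 (0, ((0, 0), 1)) • (ContinuousLinearMap.snd ℝ (K × ℝ) ℝ).comp
        (ContinuousLinearMap.snd ℝ B ((K × ℝ) × ℝ)) = κ.covCoord x.1.1 x.1.2 x.2 := by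
    generalize κ.covCoord x.1.1 x.1.2 x.2 = Λ
    refine ContinuousLinearMap.ext fun z => ?_
    rw [add_apply, covRep_apply]
    have h₁ : Λ (0, ((0, z.2.1.2), 0)) = z.2.1.2 * Λ (0, ((0, 1), 0)) := by
      rw [← smul_eq_mul, ← map_smul]; simp
    have h₂ : Λ (0, ((0, 0), z.2.2)) = z.2.2 * Λ (0, ((0, 0), 1)) := by
      rw [← smul_eq_mul, ← map_smul]; simp
    have h₃ : z = (z.1, 0) + (0, ((z.2.1.1, 0), 0)) + (0, ((0, z.2.1.2), 0)) +
      (0, ((0, 0), z.2.2)) := by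
      refine Prod.ext ?_ (Prod.ext (Prod.ext ?_ ?_) ?_) <;> simp
    conv_rhs => rw [h₃, map_add, map_add, map_add, h₁, h₂]
    change Λ (z.1, 0) + (Λ (0, ((z.2.1.1, 0), 0)) + Λ (0, ((0, 1), 0)) * z.2.1.2) +
      Λ (0, ((0, 0), 1)) * z.2.2 = _
    ring
  have e₂ : κ.hullParam (κ.base x.1.1, ((((κ.hullCoord x.1.1 x.1.2).1.1,
      (κ.hullCoord x.1.1 x.1.2).1.2)), (κ.hullCoord x.1.1 x.1.2).2)) = x.1 :=
    κ.hullParam_hullCoords hx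
  have e₃ : ∀ (y : HullTotal F V A) (Λ : B × ((K × ℝ) × ℝ) →L[ℝ] ℝ), y = x.1 →
      Λ = κ.covCoord x.1.1 x.1.2 x.2 →
      (⟨y, κ.covOf y.1 y.2 Λ⟩ : CotangentBundle F V A B) = x := by
    rintro _ _ rfl rfl
    rw [κ.covOf_covCoord hx]
  exact e₃ _ _ e₂ e₁

/-- The map has a smooth local right inverse through x, so the chain rule gives a right inverse of
its differential at x. -/
theorem surjective_mfderiv_reducedCoord {x : CotangentBundle F V A B} (hx : x.1.1 ∈ κ.dom)
    {f : CotangentBundle F V A B → M × ((K × ℝ) × ((K →L[ℝ] ℝ) × ℝ) × (B →L[ℝ] ℝ))}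
    (hf : ∀ y, y.1.1 ∈ κ.dom → f y =
      (y.1.1, reducedCoord (κ.hullCoord y.1.1 y.1.2) (κ.covCoord y.1.1 y.1.2 y.2))) :
    Function.Surjective (mfderiv (cotangentModel F B)
      (𝓘(ℝ, B).prod 𝓘(ℝ, (K × ℝ) × ((K →L[ℝ] ℝ) × ℝ) × (B →L[ℝ] ℝ))) f x) := by
  set r := (κ.hullCoord x.1.1 x.1.2).1.2 with hr
  set l := κ.covCoord x.1.1 x.1.2 x.2 (0, ((0, 0), 1)) with hl
  have h₀ : ContMDiffAt (cotangentModel F B) (hullModel F B) ∞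
      (fun y : CotangentBundle F V A B => y.1) x := contMDiffAt_proj _
  have h₁ : ContMDiffAt (cotangentModel F B) 𝓘(ℝ, B) ∞
      (fun y : CotangentBundle F V A B => y.1.1) x :=
    (contMDiffAt_proj (Hull V A)).comp x h₀
  have h₂ : ContMDiffAt (cotangentModel F B)
      (𝓘(ℝ, B).prod 𝓘(ℝ, (K × ℝ) × ((K →L[ℝ] ℝ) × ℝ) × (B →L[ℝ] ℝ))) ∞ f x := by
    refine (h₁.prodMk (κ.contMDiffAt_reducedCoord hx)).congr_of_eventuallyEq ?_
    filter_upwards [h₁.continuousAt.preimage_mem_nhds (κ.dom.isOpen.mem_nhds hx)] with y hy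
    exact hf y hy
  have e : κ.orbitSection r l (f x) = x := by
    rw [hf x hx]
    exact κ.orbitSection_reducedCoord hx
  have hfx : (f x).1 ∈ κ.dom := by rw [hf x hx]; exact hx
  have h₃ := ((h₂.mdifferentiableAt (by simp)).hasMFDerivAt.congr_point e.symm).comp (f x)
    ((κ.contMDiffAt_orbitSection r l hfx).mdifferentiableAt (by simp)).hasMFDerivAt
  have h₄ := (hasMFDerivAt_id (I := 𝓘(ℝ, B).prod
    𝓘(ℝ, (K × ℝ) × ((K →L[ℝ] ℝ) × ℝ) × (B →L[ℝ] ℝ))) (f x)).congr_of_eventuallyEq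
    (f₁ := f ∘ κ.orbitSection r l) (by
      filter_upwards [continuous_fst.continuousAt.preimage_mem_nhds
        (κ.dom.isOpen.mem_nhds hfx)] with p hp
      exact (hf (κ.orbitSection r l p) (κ.base_mem_region hp).2).trans
        (κ.reducedCoord_orbitSection r l hp p.2 rfl))
  intro u
  exact ⟨_, congrArg (fun L : B × ((K × ℝ) × ((K →L[ℝ] ℝ) × ℝ) × (B →L[ℝ] ℝ)) →L[ℝ]
    B × ((K × ℝ) × ((K →L[ℝ] ℝ) × ℝ) × (B →L[ℝ] ℝ)) => L u) (hasMFDerivAt_unique h₃ h₄)⟩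

end AdaptedChart

end CotangentSmooth

/-! ### The orbit projection as a submersive morphism -/

section Inherited

variable {F : Type*} [NormedAddCommGroup F] [NormedSpace ℝ F] {M : Type*} [TopologicalSpace M]
  {V : M → Type*} [∀ m, AddCommGroup (V m)] [∀ m, Module ℝ (V m)]
  {A : M → Type*} [∀ m, AddTorsor (V m) (A m)]
  [∀ m, TopologicalSpace (A m)] [TopologicalSpace (TotalSpace F A)] [FiberBundle F A]
  {B : Type*} [NormedAddCommGroup B] [NormedSpace ℝ B] [ChartedSpace B M] {v : ∀ m, V m}
  {K : Type*} [NormedAddCommGroup K] [NormedSpace ℝ K]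
  [FiniteDimensional ℝ B] [IsManifold 𝓘(ℝ, B) ∞ M] [T2Space M] [SecondCountableTopology M]
  [FiniteDimensional ℝ K] [FiniteDimensional ℝ F] [SmoothAffineBundle F V A B]

theorem isInherited_reducedBundle (hκ : ∀ m, ∃ κ : AdaptedChart F A B v K, m ∈ κ.dom) :
    IsInherited (reducedBundle hκ) where
  pr₁_orbit _ := reducedBundle_pr₁ hκ
  pr₂_orbit _ := reducedBundle_pr₂ hκ
  add₁_orbit := reducedBundle_add₁ hκ
  smul₁_orbit := reducedBundle_smul₁ hκ
  add₂_orbit := reducedBundle_add₂ hκ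
  smul₂_orbit := reducedBundle_smul₂ hκ
  smooth χ hχ := by
    obtain ⟨_, ⟨⟨χ, κ, h⟩, rfl⟩, rfl⟩ := hχ
    have hd : ∀ x : CotangentBundle F V A B, x.1.1 ∈ χ.dom → x.1.1 ∈ κ.dom := by
      intro x hx
      rw [← h.1]; exact hx
    exact ContMDiffOn.congr
      (fun x hx => (κ.contMDiffAt_reducedCoord (hd x hx)).contMDiffWithinAt)
      fun x hx => coord_reducedChart hκ h (hd x hx) _ _
  submersion χ hχ x hx := by
    obtain ⟨_, ⟨⟨χ, κ, h⟩, rfl⟩, rfl⟩ := hχ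
    have hx : x.1.1 ∈ κ.dom := by rw [← h.1]; exact hx
    exact κ.surjective_mfderiv_reducedCoord hx
      fun y hy => Prod.ext rfl (coord_reducedChart hκ h hy _ _)

end Inherited

end DoubleAffine

end

theorem mainTheorem6 {B : Type*} [NormedAddCommGroup B] [NormedSpace ℝ B] [FiniteDimensional ℝ B]
    {M : Type*} [TopologicalSpace M] [T2Space M] [SecondCountableTopology M] [ConnectedSpace M]
    [ChartedSpace B M] [IsManifold 𝓘(ℝ, B) ∞ M]
    {F : Type*} [NormedAddCommGroup F] [NormedSpace ℝ F] [FiniteDimensional ℝ F]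
    {V : M → Type*} [∀ m, AddCommGroup (V m)] [∀ m, Module ℝ (V m)]
    {A : M → Type*} [∀ m, AddTorsor (V m) (A m)]
    [∀ m, TopologicalSpace (A m)] [TopologicalSpace (TotalSpace F A)] [FiberBundle F A]
    [SmoothAffineBundle F V A B] (v : ∀ m, V m) (hv : IsSpecialSection F A B v) :
    ∃ (𝒬 : DoubleVectorBundle B (QuotModel F × ℝ) ((QuotModel F →L[ℝ] ℝ) × ℝ) (B →L[ℝ] ℝ)
        (OrbitSpace F A B v) (HullQuot V A v) (DualQuot V A))
      (𝔓 : DoubleAffineBundle B (QuotModel F) (QuotModel F →L[ℝ] ℝ) (B →L[ℝ] ℝ)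
        (Phase F A B v) (AffQuot A v) (SpecialDualQuot A v))
      (ℋ : DoubleVectorBundle B (QuotModel F × ℝ) ((QuotModel F →L[ℝ] ℝ) × ℝ) (B →L[ℝ] ℝ)
        𝔓.DoubleHull 𝔓.Hull₁ 𝔓.Hull₂),
      IsInherited 𝒬 ∧ IsPhaseBundle 𝔓 ∧ 𝔓.IsDoubleHull ℋ ∧
        ∃! Φ : DoubleVectorBundle.Iso 𝒬 ℋ, IsCanonical Φ := by
  -- The special section enters only through the adapted charts that it provides; every structure
  -- below is built from a cover by such charts.
  have hκ : ∀ m, ∃ κ : AdaptedChart F A B v (QuotModel F), m ∈ κ.dom := exists_adaptedChart hv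
  exact ⟨reducedBundle hκ, phaseBundle hκ, (phaseBundle hκ).doubleHullBundle,
    isInherited_reducedBundle hκ, isPhaseBundle_phaseBundle hκ,
    (phaseBundle hκ).isDoubleHull_doubleHullBundle, canonicalIso hκ, isCanonical_canonicalIso hκ,
    fun _ hΦ => eq_canonicalIso hκ hΦ⟩
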